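/- Let $k$ be a field of characteristic $0$ and $\mathfrak g$ a finite-dimensional Lie algebra over $k$ with a non-degenerate symmetric invariant bilinear form $\langle\,,\rangle$ (invariance: $\langle [x,y],z\rangle=\langle x,[y,z]\rangle$). Fix a basis $e_i$ of $\mathfrak g$, let $e^i$ be the dual basis with respect to $\langle\,,\rangle$, and let $\xi^i\in\mathfrak g^\vee$ be the coordinates of the basis $e_i$. *The Chevalley–Eilenberg algebra.* Let $A=\mathrm{Ch}^\bullet(\mathfrak g)=\Lambda^\bullet\mathfrak g^\vee$, with $\mathfrak g^\vee$ in degree $1$ and with the derivation $d$ of degree $1$ given by $(d\xi)(x,y)=-\xi([x,y])$ for $\xi\in\mathfrak g^\vee$. For $x\in\mathfrak g$ let $\partial_x$ be the odd left derivation of $A$ with $\partial_x\xi=\xi(x)$. Let $\{\,,\}$ be the Poisson bracket of degree $-2$ on $A$, the graded biderivation with $\{\xi,\eta\}=\langle\xi,\eta\rangle$ (induced form on $\mathfrak g^\vee$); explicitly $\{a,a'\}=\sum_i(-1)^{\deg a-1}\,\partial_{e_i}a\;\partial_{e^i}a'$ for homogeneous $a$. *The Hochschild complex.* Let $C_*(A)=\prod_{i\ge0}A\otimes(A/k)^{\otimes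 i}$ be the unbounded normalized Hochschild complex. A chain is of total degree $m$ if its component in $A\otimes (A/k)^{\otimes i}$ has internal degree $m+i$. The differential is $D=b+(-1)^i d$ on $A\otimes(A/k)^{\otimes i}$, where $d$ acts on tensors with Koszul signs and $$b(a_0\otimes\cdots\otimes a_i)=\sum_{j<i}(-1)^j a_0\otimes\cdots\otimes a_ja_{j+1}\otimes\cdots\otimes a_i+(-1)^{i+\deg a_i(\deg a_0+\cdots+\deg a_{i-1})}a_ia_0\otimes a_1\otimes\cdots\otimes a_{i-1}.$$ The deformed product $aa'+\tfrac12\varepsilon\{a,a'\}$ ($\varepsilon^2=0$, $\deg\varepsilon=2$) changes $D$ to $D+\varepsilon d_0$. Thus $d_0$ is the operator of degree $-1$ given by the formula for $b$ with every product $aa'$ replaced by $\tfrac12\{a,a'\}$. *Differential forms.* Let $\Omega=\mathrm{Ch}^\bullet(\mathfrak g,k[[\mathfrak g^\vee]]^{ad})$ be the algebra of power series with coefficients in $A$ in central variables $y_i=d_{dR}\xi^i$ of degree $0$, with the Chevalley–Eilenberg differential $d_{CE}=d+\sum_i\xi^i\,\rho(e_i)$, where $d$ acts on coefficients and $\rho(x)$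 is the derivation in the $y$-variables with $\rho(x)y_i=-\sum_j\xi^i([x,e_j])\,y_j$. Let $d_{dR}a=\sum_i(\partial_{e_i}a)\,y_i$ for $a\in A$. The Hochschild–Kostant–Rosenberg map $\Phi\colon C_*(A)\to\Omega$ is $$\Phi(a_0\otimes\cdots\otimes a_i)=\frac{(-1)^{i+\sum_{j}(i-j)\deg a_j}}{i!}\;a_0\,d_{dR}a_1\cdots d_{dR}a_i .$$ *The Brylinski operator and the Duflo character.* Let $d_{Br}=\sum_i\partial_{e_i}\circ\partial/\partial y^{(e^i)}$ on $\Omega$, where $\partial_{e_i}$ acts on coefficients and $\partial/\partial y^{(v)}=\sum_k\xi^k(v)\,\partial/\partial y_k$. Let $\mathrm{Ad}=\sum_i y_i\,\mathrm{ad}(e_i)$, a matrix over $k[[y]]$, let $B_n$ be the Bernoulli numbers, $\sum_n B_nz^n/n!=z/(e^z-1)$, and let $$j^{1/2}=\exp\sum_{n\ge1}\frac{B_{2n}}{4n\,(2n)!}\operatorname{Tr}(\mathrm{Ad}^{2n})\in k[[y]].$$ Its powers $j^{\pm1/2}$ act on $\Omega$ by multiplication. **Statement.** $\Phi$ is a quasi-isomorphism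 of complexes $(C_*(A),D)\to(\Omega,d_{CE})$; it has a chain homotopy inverse; and for every chain homotopy inverse $\Psi$ of $\Phi$ the transported operator $\Phi\circ d_0\circ\Psi$ on $\Omega$ is chain homotopic, as a chain map of degree $-1$, to $$j^{-1/2}\circ d_{Br}\circ j^{1/2}.$$ -/

import Mathlib

open scoped TensorProduct

noncomputable section

namespace CEHochschild

/-! ### Cochain complexes, given as a graded module with an endomorphism -/

section Complexes

variable {k : Type*} [Field k] {M N : Type*} [AddCommGroup M] [Module k M]
  [AddCommGroup N] [Module k N]

/-- The linear map `f` raises degrees by `p`. -/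
def HasDegree (gM : ℤ → Submodule k M) (gN : ℤ → Submodule k N) (p : ℤ) (f : M →ₗ[k] N) : Prop :=
  ∀ m : ℤ, ∀ x ∈ gM m, f x ∈ gN (m + p)

/-- `d` is a differential of degree `1`. -/
structure IsDifferential (gM : ℤ → Submodule k M) (d : M →ₗ[k] M) : Prop where
  degree : HasDegree gM gM 1 d
  square : d ∘ₗ d = 0

/-- `f` is a chain map of degree `p`, that is `d f = (-1)^p f d`. -/
structure IsChainMap (gM : ℤ → Submodule k M) (dM : M →ₗ[k] M)
    (gN : ℤ → Submodule k N) (dN : N →ₗ[k] N) (p : ℤ) (f : M →ₗ[k] N) : Prop where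
  degree : HasDegree gM gN p f
  comm : dN ∘ₗ f = (p.negOnePow : ℤ) • (f ∘ₗ dM)

/-- The chain maps `f` and `g` of degree `p` are chain homotopic: there is a map `h` of degree
`p - 1` with `f - g = d h - (-1)^(p-1) h d`. -/
structure ChainHomotopic (gM : ℤ → Submodule k M) (dM : M →ₗ[k] M)
    (gN : ℤ → Submodule k N) (dN : N →ₗ[k] N) (p : ℤ) (f g : M →ₗ[k] N) : Prop where
  left : IsChainMap gM dM gN dN p f
  right : IsChainMap gM dM gN dN p g
  homotopy : ∃ h : M →ₗ[k] N, HasDegree gM gN (p - 1) h ∧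
    f - g = dN ∘ₗ h - ((p - 1).negOnePow : ℤ) • (h ∘ₗ dM)

/-- `f` is a quasi-isomorphism: a chain map of degree `0` between complexes which is
injective and surjective on cohomology in every degree. -/
structure IsQuasiIso (gM : ℤ → Submodule k M) (dM : M →ₗ[k] M)
    (gN : ℤ → Submodule k N) (dN : N →ₗ[k] N) (f : M →ₗ[k] N) : Prop where
  source : IsDifferential gM dM
  target : IsDifferential gN dN
  chain : IsChainMap gM dM gN dN 0 f
  inj : ∀ m : ℤ, ∀ x ∈ gM m, dM x = 0 → (∃ y ∈ gN (m - 1), f x = dN y) →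
    ∃ z ∈ gM (m - 1), x = dM z
  surj : ∀ m : ℤ, ∀ y ∈ gN m, dN y = 0 →
    ∃ x ∈ gM m, dM x = 0 ∧ ∃ z ∈ gN (m - 1), y - f x = dN z

/-- `e` is a chain homotopy inverse of `f`. -/
structure IsHomotopyInverse (gM : ℤ → Submodule k M) (dM : M →ₗ[k] M)
    (gN : ℤ → Submodule k N) (dN : N →ₗ[k] N) (f : M →ₗ[k] N) (e : N →ₗ[k] M) : Prop where
  chain : IsChainMap gN dN gM dM 0 e
  left : ChainHomotopic gM dM gM dM 0 (e ∘ₗ f) LinearMap.id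
  right : ChainHomotopic gN dN gN dN 0 (f ∘ₗ e) LinearMap.id

end Complexes

/-! ### The normalized Hochschild complex of a differential super-algebra

`A` is an algebra over `k`, `α` its parity automorphism (`α a = (-1)^(deg a) a`). The Hochschild
operator is written for an arbitrary bilinear product `μ` on `A`, so that it can be
differentiated along a deformation of the product. -/

section Hochschild

variable {k : Type*} [Field k] {A : Type*} [Ring A] [Algebra k A]

variable (k A) in
/-- `A ⊗ A ⊗ ⋯ ⊗ A` with `i + 1` factors `a_0, …, a_i`. -/
abbrev Tens (i : ℕ) : Type _ := ⨂[k] (_ : Fin (i + 1)), A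

variable (k A) in
/-- The span of the tensors with `a_j = 1` for some `j ≥ 1`. -/
def degenerate (i : ℕ) : Submodule k (Tens k A i) :=
  Submodule.span k {t | ∃ a : Fin (i + 1) → A, (∃ j, j ≠ 0 ∧ a j = 1) ∧
    t = PiTensorProduct.tprod k a}

variable (k A) in
/-- `A ⊗ (A/k)^{⊗ i}`, as a quotient of `A^{⊗ (i+1)}`. -/
abbrev NTens (i : ℕ) : Type _ := Tens k A i ⧸ degenerate k A i

variable (k A) in
/-- Unbounded normalized Hochschild chains, `∏_i A ⊗ (A/k)^{⊗ i}`. -/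
abbrev Chains : Type _ := (i : ℕ) → NTens k A i

theorem contractNth_update (μ : A →ₗ[k] A →ₗ[k] A) {i : ℕ} (j : Fin (i + 1))
    (a : Fin (i + 2) → A) (l : Fin (i + 2)) :
    ∃ (s : Fin (i + 1)) (f : A →ₗ[k] A), ∀ x : A,
      Fin.contractNth j.castSucc (fun x y => μ x y) (Function.update a l x) =
        Function.update (Fin.contractNth j.castSucc (fun x y => μ x y) a) s (f x) := by
  have key : ∀ (s : Fin (i + 1)) (f : A →ₗ[k] A),
      (∀ x, Fin.contractNth j.castSucc (fun x y => μ x y) (Function.update a l x) s = f x) →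
      (∀ r : Fin (i + 1), r ≠ s → (r : ℕ) ≤ j → r.castSucc ≠ l) →
      (∀ r : Fin (i + 1), r ≠ s → (j : ℕ) ≤ r → r.succ ≠ l) →
      ∀ x : A, Fin.contractNth j.castSucc (fun x y => μ x y) (Function.update a l x) =
        Function.update (Fin.contractNth j.castSucc (fun x y => μ x y) a) s (f x) := by
    intro s f h1 h2 h3 x
    funext r
    by_cases hr : r = s
    · subst hr
      rw [h1, Function.update_self]
    · rw [Function.update_of_ne hr]
      unfold Fin.contractNth
      simp only [Fin.val_castSucc]
      split_ifs with h4 h5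
      · rw [Function.update_of_ne (h2 r hr h4.le)]
      · rw [Function.update_of_ne (h2 r hr h5.le), Function.update_of_ne (h3 r hr h5.ge)]
      · rw [Function.update_of_ne (h3 r hr (by omega))]
  have hj := j.isLt
  have hl := l.isLt
  rcases lt_trichotomy (l : ℕ) j with h | h | h
  · refine ⟨⟨l, by omega⟩, LinearMap.id, key _ _ ?_ ?_ ?_⟩
    · intro x
      rw [Fin.contractNth_apply_of_lt _ _ _ _ (by simpa using h)]
      exact Function.update_self ..
    · intro r hr _ h'
      exact hr (Fin.ext (by simp [← h']))
    · intro r hr h1 h'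
      have := congrArg Fin.val h'
      simp at this
      omega
  · refine ⟨j, μ.flip (a j.succ), key _ _ ?_ ?_ ?_⟩
    · intro x
      rw [Fin.contractNth_apply_of_eq _ _ _ _ (by simp)]
      have h1 : j.castSucc = l := Fin.ext (by simp [h])
      have h2 : j.succ ≠ l := fun h' => by
        have := congrArg Fin.val h'
        simp at this
        omega
      rw [h1, Function.update_self, Function.update_of_ne h2, LinearMap.flip_apply]
    · intro r hr _ h'
      have := congrArg Fin.val h'
      simp at this
      exact hr (Fin.ext (by omega))
    · intro r hr h1 h'
      have := congrArg Fin.val h'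
      simp at this
      omega
  · by_cases h0 : (l : ℕ) = j + 1
    · refine ⟨j, μ (a j.castSucc), key _ _ ?_ ?_ ?_⟩
      · intro x
        rw [Fin.contractNth_apply_of_eq _ _ _ _ (by simp)]
        have h1 : j.succ = l := Fin.ext (by simp [h0])
        have h2 : j.castSucc ≠ l := fun h' => by
          have := congrArg Fin.val h'
          simp at this
          omega
        rw [h1, Function.update_self, Function.update_of_ne h2]
      · intro r hr _ h'
        have := congrArg Fin.val h'
        simp at this
        omega
      · intro r hr h1 h'
        have := congrArg Fin.val h'
        simp at this
        exact hr (Fin.ext (by omega))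
    · refine ⟨⟨l - 1, by omega⟩, LinearMap.id, key _ _ ?_ ?_ ?_⟩
      · intro x
        rw [Fin.contractNth_apply_of_gt _ _ _ _ (by simp; omega)]
        have h1 : Fin.succ ⟨(l : ℕ) - 1, by omega⟩ = l := Fin.ext (by simp; omega)
        rw [h1]
        exact Function.update_self ..
      · intro r hr h2 h'
        have := congrArg Fin.val h'
        simp at this
        omega
      · intro r hr h1 h'
        have := congrArg Fin.val h'
        simp at this
        exact hr (Fin.ext (by simp; omega))

/-- `a_0 ⊗ ⋯ ⊗ a_{i+1} ↦ a_0 ⊗ ⋯ ⊗ μ(a_j, a_{j+1}) ⊗ ⋯ ⊗ a_{i+1}`. -/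
def face (μ : A →ₗ[k] A →ₗ[k] A) {i : ℕ} (j : Fin (i + 1)) :
    Tens k A (i + 1) →ₗ[k] Tens k A i :=
  PiTensorProduct.lift
    { toFun := fun a =>
        PiTensorProduct.tprod k (Fin.contractNth j.castSucc (fun x y => μ x y) a)
      map_update_add' := by
        intro inst a l x y
        rw [Subsingleton.elim inst (instDecidableEqFin _)]
        obtain ⟨s, f, h⟩ := contractNth_update μ j a l
        rw [h, h, h, map_add, MultilinearMap.map_update_add]
      map_update_smul' := by
        intro inst a l c x
        rw [Subsingleton.elim inst (instDecidableEqFin _)]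
        obtain ⟨s, f, h⟩ := contractNth_update μ j a l
        rw [h, h, map_smul, MultilinearMap.map_update_smul] }

/-- The projection onto the even part. -/
def evenPart (α : A →ₐ[k] A) : A →ₗ[k] A := (2⁻¹ : k) • (LinearMap.id + α.toLinearMap)

/-- The projection onto the odd part. -/
def oddPart (α : A →ₐ[k] A) : A →ₗ[k] A := (2⁻¹ : k) • (LinearMap.id - α.toLinearMap)

/-- The cyclic rotation with Koszul sign, on homogeneous elements
`a_0 ⊗ ⋯ ⊗ a_i ↦ (-1)^(deg a_i (deg a_0 + ⋯ + deg a_{i-1})) a_i ⊗ a_0 ⊗ ⋯ ⊗ a_{i-1}`. -/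
def rotate (α : A →ₐ[k] A) (i : ℕ) : Tens k A i →ₗ[k] Tens k A i :=
  (PiTensorProduct.reindex k (fun _ : Fin (i + 1) => A) (finRotate (i + 1))).toLinearMap ∘ₗ
    (PiTensorProduct.map (fun l => if l = Fin.last i then evenPart α else LinearMap.id) +
      PiTensorProduct.map (fun l => if l = Fin.last i then oddPart α else α.toLinearMap))

/-- The Hochschild operator `A^{⊗ (i+2)} → A^{⊗ (i+1)}` of the bilinear product `μ`:
`∑_{j ≤ i} (-1)^j a_0 ⊗ ⋯ ⊗ μ(a_j, a_{j+1}) ⊗ ⋯ ⊗ a_{i+1}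
  + (-1)^(i + 1 + deg a_{i+1} (deg a_0 + ⋯ + deg a_i)) μ(a_{i+1}, a_0) ⊗ a_1 ⊗ ⋯ ⊗ a_i`. -/
def hochB (α : A →ₐ[k] A) (μ : A →ₗ[k] A →ₗ[k] A) (i : ℕ) :
    Tens k A (i + 1) →ₗ[k] Tens k A i :=
  (∑ j : Fin (i + 1), (-1 : k) ^ (j : ℕ) • face μ j) +
    (-1 : k) ^ (i + 1) • (face μ 0 ∘ₗ rotate α (i + 1))

/-- The operator on `A^{⊗ (i+1)}` induced by `d`, with Koszul signs:
`∑_j (-1)^(deg a_0 + ⋯ + deg a_{j-1}) a_0 ⊗ ⋯ ⊗ d a_j ⊗ ⋯ ⊗ a_i`. -/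
def tensD (α : A →ₐ[k] A) (d : A →ₗ[k] A) (i : ℕ) : Tens k A i →ₗ[k] Tens k A i :=
  ∑ j : Fin (i + 1), PiTensorProduct.map
    (fun l => if l < j then α.toLinearMap else if l = j then d else LinearMap.id)

/-- `μ(1, a) = μ(a, 1) = c a` for a scalar `c`, so that `μ` acts on normalized chains. Here `c = 1`
for a product with unit `1`, and `c = 0` for a bracket that kills the constants. -/
def UnitScalar (μ : A →ₗ[k] A →ₗ[k] A) : Prop :=
  ∃ c : k, ∀ a : A, μ 1 a = c • a ∧ μ a 1 = c • a

theorem face_tprod (μ : A →ₗ[k] A →ₗ[k] A) {i : ℕ} (j : Fin (i + 1)) (a : Fin (i + 2) → A) :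
    face μ j (PiTensorProduct.tprod k a) =
      PiTensorProduct.tprod k (Fin.contractNth j.castSucc (fun x y => μ x y) a) :=
  PiTensorProduct.lift.tprod a

theorem rotate_tprod (α : A →ₐ[k] A) (i : ℕ) (a : Fin (i + 1) → A) :
    rotate α i (PiTensorProduct.tprod k a) =
      PiTensorProduct.tprod k (fun r => (if (finRotate (i + 1)).symm r = Fin.last i
        then evenPart α else LinearMap.id) (a ((finRotate (i + 1)).symm r))) +
      PiTensorProduct.tprod k (fun r => (if (finRotate (i + 1)).symm r = Fin.last i
        then oddPart α else α.toLinearMap) (a ((finRotate (i + 1)).symm r))) := by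
  simp only [rotate, LinearMap.comp_apply, LinearMap.add_apply, PiTensorProduct.map_tprod, map_add,
    LinearEquiv.coe_coe]
  rw [PiTensorProduct.reindex_tprod, PiTensorProduct.reindex_tprod]

theorem finRotate_symm_succ' {i : ℕ} (r : Fin (i + 1)) :
    (finRotate (i + 2)).symm r.succ = r.castSucc := by
  rw [Equiv.symm_apply_eq, finRotate_apply]
  exact (Fin.coeSucc_eq_succ).symm

theorem finRotate_symm_zero' {i : ℕ} : (finRotate (i + 2)).symm 0 = Fin.last (i + 1) := by
  rw [Equiv.symm_apply_eq, finRotate_last]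

theorem tprod_mem_degenerate {i : ℕ} {a : Fin (i + 1) → A} (r : Fin (i + 1)) (hr : r ≠ 0)
    (ha : a r = 1) : PiTensorProduct.tprod k a ∈ degenerate k A i :=
  Submodule.subset_span ⟨a, ⟨r, hr, ha⟩, rfl⟩

theorem hochB_degenerate [CharZero k] (α : A →ₐ[k] A) (μ : A →ₗ[k] A →ₗ[k] A) (hμ : UnitScalar μ)
    (i : ℕ) : degenerate k A (i + 1) ≤ (degenerate k A i).comap (hochB α μ i) := by
  obtain ⟨c, hc⟩ := hμ
  refine Submodule.span_le.2 ?_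
  rintro _ ⟨a, ⟨j, hj, ha⟩, rfl⟩
  obtain ⟨p, rfl⟩ := Fin.exists_succ_eq.2 hj
  change hochB α μ i _ ∈ degenerate k A i
  set del : Fin (i + 1) → A := fun r => a (p.succ.succAbove r) with hdel
  have hlt : ∀ f : Fin (i + 1), f < p → face μ f (PiTensorProduct.tprod k a) ∈
      degenerate k A i := by
    intro f hf
    rw [face_tprod]
    refine tprod_mem_degenerate p (Fin.pos_iff_ne_zero.1 (lt_of_le_of_lt (Fin.zero_le _) hf)) ?_
    rw [Fin.contractNth_apply_of_gt _ _ _ _ (by simpa using hf), ha]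
  have hgt : ∀ f : Fin (i + 1), (p : ℕ) + 1 < f → face μ f (PiTensorProduct.tprod k a) ∈
      degenerate k A i := by
    intro f hf
    rw [face_tprod]
    have hf' := f.isLt
    refine tprod_mem_degenerate ⟨p + 1, by omega⟩ (fun h => ?_) ?_
    · simpa using congrArg Fin.val h
    · rw [Fin.contractNth_apply_of_lt _ _ _ _ (by simpa using hf), ← ha]
      rfl
  have heq : face μ p (PiTensorProduct.tprod k a) = c • PiTensorProduct.tprod k del := by
    have : Fin.contractNth p.castSucc (fun x y => μ x y) a =
        Function.update del p (c • del p) := by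
      funext r
      rcases lt_trichotomy r p with h | h | h
      · rw [Function.update_of_ne h.ne, Fin.contractNth_apply_of_lt _ _ _ _ (by simpa using h)]
        simp only [hdel]
        rw [Fin.succAbove_of_castSucc_lt _ _ (by
          rw [Fin.lt_def] at h ⊢; simp; omega)]
      · subst h
        rw [Function.update_self, Fin.contractNth_apply_of_eq _ _ _ _ (by simp), ha, (hc _).2]
        simp only [hdel]
        rw [Fin.succAbove_of_castSucc_lt _ _ (by rw [Fin.lt_def]; simp)]
      · rw [Function.update_of_ne h.ne', Fin.contractNth_apply_of_gt _ _ _ _ (by simpa using h)]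
        simp only [hdel]
        rw [Fin.succAbove_of_le_castSucc _ _ (by
          rw [Fin.lt_def] at h; rw [Fin.le_def]; simp; omega)]
    rw [face_tprod, this, MultilinearMap.map_update_smul, Function.update_eq_self]
  have heq' : ∀ f : Fin (i + 1), (f : ℕ) = p + 1 →
      face μ f (PiTensorProduct.tprod k a) = c • PiTensorProduct.tprod k del := by
    intro f hf
    have : Fin.contractNth f.castSucc (fun x y => μ x y) a =
        Function.update del f (c • del f) := by
      funext r
      rcases lt_trichotomy r f with h | h | h
      · rw [Function.update_of_ne h.ne, Fin.contractNth_apply_of_lt _ _ _ _ (by simpa using h)]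
        simp only [hdel]
        rw [Fin.succAbove_of_castSucc_lt _ _ (by
          rw [Fin.lt_def] at h ⊢; simp; omega)]
      · subst h
        have h1 : r.castSucc = p.succ := Fin.ext (by simp [hf])
        rw [Function.update_self, Fin.contractNth_apply_of_eq _ _ _ _ (by simp), h1, ha, (hc _).1]
        simp only [hdel]
        rw [Fin.succAbove_of_le_castSucc _ _ (by rw [Fin.le_def]; simp [hf])]
      · rw [Function.update_of_ne h.ne', Fin.contractNth_apply_of_gt _ _ _ _ (by simpa using h)]
        simp only [hdel]
        rw [Fin.succAbove_of_le_castSucc _ _ (by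
          rw [Fin.lt_def] at h; rw [Fin.le_def]; simp; omega)]
    rw [face_tprod, this, MultilinearMap.map_update_smul, Function.update_eq_self]
  simp only [hochB, LinearMap.add_apply, LinearMap.sum_apply, LinearMap.smul_apply,
    LinearMap.comp_apply, rotate_tprod, map_add]
  rcases Fin.eq_castSucc_or_eq_last p with ⟨q, hq⟩ | hp
  · refine add_mem ?_ (Submodule.smul_mem _ _ (add_mem ?_ ?_))
    · have hi := q.isLt
      have hpq : (p : ℕ) = q := by simp [hq]
      have hne : q.succ ≠ p := fun h => by
        have := congrArg Fin.val h
        simp at this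
        omega
      rw [← Finset.add_sum_erase _ _ (Finset.mem_univ p),
        ← Finset.add_sum_erase _ _ (Finset.mem_erase.2 ⟨hne, Finset.mem_univ q.succ⟩),
        heq, heq' q.succ (by simp [hpq]), ← add_assoc]
      have hs : (-1 : k) ^ ((q.succ : Fin (i + 1)) : ℕ) = -(-1 : k) ^ (p : ℕ) := by
        rw [Fin.val_succ, hpq, pow_succ]
        ring
      rw [hs, neg_smul, add_neg_cancel, zero_add]
      refine Submodule.sum_mem _ fun f hf => Submodule.smul_mem _ _ ?_
      rw [Finset.mem_erase, Finset.mem_erase] at hf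
      have h1 : (f : ℕ) ≠ q + 1 := fun h => hf.1 (Fin.ext (by simp [h]))
      have h2 : (f : ℕ) ≠ p := fun h => hf.2.1 (Fin.ext h)
      rcases lt_or_gt_of_ne h2 with h | h
      · exact hlt f h
      · exact hgt f (by omega)
    all_goals
      have hi := q.isLt
      rw [face_tprod]
      refine tprod_mem_degenerate q.succ (Fin.succ_ne_zero _) ?_
      rw [Fin.contractNth_apply_of_gt _ _ _ _ (by simp), finRotate_symm_succ',
        if_neg (by
          intro h
          have := congrArg Fin.val h
          simp at this
          omega)]
      have h1 : (q.succ.castSucc : Fin (i + 2)) = p.succ := Fin.ext (by simp [hq])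
      rw [h1, ha]
      simp
  · subst hp
    have h2 : (2 : k) ≠ 0 := two_ne_zero
    have hodd : oddPart α 1 = 0 := by simp [oddPart]
    have heven : evenPart α 1 = 1 := by
      have h3 : (2⁻¹ : k) + 2⁻¹ = 1 := by field_simp; norm_num
      simp [evenPart, ← _root_.add_smul, h3]
    have hlast : a (Fin.last (i + 1)) = 1 := ha
    have e1 : face μ 0 (PiTensorProduct.tprod k (fun r =>
        (if (finRotate (i + 1 + 1)).symm r = Fin.last (i + 1) then oddPart α else α.toLinearMap)
          (a ((finRotate (i + 1 + 1)).symm r)))) = 0 := by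
      rw [face_tprod]
      refine MultilinearMap.map_coord_zero _ 0 ?_
      rw [Fin.contractNth_apply_of_eq _ _ _ _ (by simp), Fin.castSucc_zero, finRotate_symm_zero',
        if_pos rfl, hlast, hodd, map_zero, LinearMap.zero_apply]
    have e2 : face μ 0 (PiTensorProduct.tprod k (fun r =>
        (if (finRotate (i + 1 + 1)).symm r = Fin.last (i + 1) then evenPart α else LinearMap.id)
          (a ((finRotate (i + 1 + 1)).symm r)))) = c • PiTensorProduct.tprod k del := by
      rw [face_tprod]
      have : (Fin.contractNth (Fin.castSucc 0) (fun x y => μ x y) (fun r : Fin (i + 2) =>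
          (if (finRotate (i + 1 + 1)).symm r = Fin.last (i + 1) then evenPart α else LinearMap.id)
          (a ((finRotate (i + 1 + 1)).symm r)))) = Function.update del 0 (c • del 0) := by
        funext r
        have hd : del r = a r.castSucc := by
          simp only [hdel]
          rw [Fin.succAbove_of_castSucc_lt _ _ (by rw [Fin.lt_def]; simp; have := r.isLt; omega)]
        have hr : ((if (finRotate (i + 1 + 1)).symm r.succ = Fin.last (i + 1) then evenPart α
            else LinearMap.id) (a ((finRotate (i + 1 + 1)).symm r.succ))) = del r := by
          rw [finRotate_symm_succ', if_neg (Fin.castSucc_lt_last r).ne, LinearMap.id_apply, hd]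
        by_cases h : r = 0
        · subst h
          rw [Function.update_self, Fin.contractNth_apply_of_eq _ _ _ _ (by simp), hr,
            Fin.castSucc_zero, finRotate_symm_zero', if_pos rfl, hlast, heven, (hc _).1]
        · rw [Function.update_of_ne h, Fin.contractNth_apply_of_gt _ _ _ _ (by
            simpa using Nat.pos_of_ne_zero fun h' => h (Fin.ext h')), hr]
      rw [this, MultilinearMap.map_update_smul, Function.update_eq_self]
    rw [e1, e2, add_zero, Fin.sum_univ_castSucc, heq, add_assoc]
    have hs : (-1 : k) ^ ((Fin.last i : Fin (i + 1)) : ℕ) • c • PiTensorProduct.tprod k del +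
        (-1 : k) ^ (i + 1) • c • PiTensorProduct.tprod k del = 0 := by
      rw [Fin.val_last, pow_succ, mul_neg_one, neg_smul, add_neg_cancel]
    rw [hs, add_zero]
    exact Submodule.sum_mem _ fun f _ => Submodule.smul_mem _ _ (hlt _ (Fin.castSucc_lt_last f))

theorem tensD_degenerate (α : A →ₐ[k] A) (d : A →ₗ[k] A) (hd : d 1 = 0) (i : ℕ) :
    degenerate k A i ≤ (degenerate k A i).comap (tensD α d i) := by
  refine Submodule.span_le.2 ?_
  rintro _ ⟨a, ⟨j, hj, ha⟩, rfl⟩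
  change tensD α d i _ ∈ degenerate k A i
  simp only [tensD, LinearMap.sum_apply, PiTensorProduct.map_tprod]
  refine Submodule.sum_mem _ fun l _ => ?_
  by_cases h : j = l
  · subst h
    rw [MultilinearMap.map_coord_zero _ j (by simp [ha, hd])]
    exact zero_mem _
  · refine tprod_mem_degenerate j hj ?_
    rw [ha, if_neg h]
    split_ifs <;> simp

/-- The Hochschild operator of `μ` on normalized unbounded chains. -/
def chainB [CharZero k] (α : A →ₐ[k] A) (μ : A →ₗ[k] A →ₗ[k] A) (hμ : UnitScalar μ) :
    Chains k A →ₗ[k] Chains k A :=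
  LinearMap.pi fun i =>
    Submodule.mapQ _ _ (hochB α μ i) (hochB_degenerate α μ hμ i) ∘ₗ LinearMap.proj (i + 1)

/-- The differential of the total complex: the Hochschild operator of `μ` plus `(-1)^i` times
the operator induced by `d` on `A ⊗ (A/k)^{⊗ i}`. -/
def chainD [CharZero k] (α : A →ₐ[k] A) (d : A →ₗ[k] A) (hd : d 1 = 0)
    (μ : A →ₗ[k] A →ₗ[k] A) (hμ : UnitScalar μ) : Chains k A →ₗ[k] Chains k A :=
  chainB α μ hμ + LinearMap.pi fun i =>
    (-1 : k) ^ i • (Submodule.mapQ _ _ (tensD α d i) (tensD_degenerate α d hd i) ∘ₗ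
      LinearMap.proj i)

theorem UnitScalar.add_smul {μ ν : A →ₗ[k] A →ₗ[k] A} (hμ : UnitScalar μ) (hν : UnitScalar ν)
    (t : k) : UnitScalar (μ + t • ν) := by
  obtain ⟨c, hc⟩ := hμ
  obtain ⟨c', hc'⟩ := hν
  refine ⟨c + t * c', fun a => ?_⟩
  simp only [LinearMap.add_apply, LinearMap.smul_apply, (hc a).1, (hc a).2, (hc' a).1, (hc' a).2,
    _root_.add_smul, mul_smul, and_self]

theorem face_add_smul (μ ν : A →ₗ[k] A →ₗ[k] A) (t : k) {i : ℕ} (j : Fin (i + 1)) :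
    face (μ + t • ν) j = face μ j + t • face ν j := by
  refine PiTensorProduct.ext (MultilinearMap.ext fun a => ?_)
  have h : ∀ κ : A →ₗ[k] A →ₗ[k] A, Fin.contractNth j.castSucc (fun x y => κ x y) a =
      Function.update (Fin.contractNth j.castSucc (fun _ _ => 0) a) j
        (κ (a j.castSucc) (a j.succ)) := by
    intro κ
    funext r
    by_cases hr : r = j
    · subst hr
      rw [Function.update_self, Fin.contractNth_apply_of_eq _ _ _ _ (by simp)]
    · rw [Function.update_of_ne hr]
      have : (r : ℕ) ≠ j := fun h => hr (Fin.ext h)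
      unfold Fin.contractNth
      simp [this]
  rw [LinearMap.compMultilinearMap_apply, LinearMap.compMultilinearMap_apply,
    LinearMap.add_apply, LinearMap.smul_apply, face_tprod, face_tprod, face_tprod]
  rw [h, h μ, h ν, LinearMap.add_apply, LinearMap.add_apply, LinearMap.smul_apply,
    LinearMap.smul_apply, MultilinearMap.map_update_add, MultilinearMap.map_update_smul]

theorem hochB_add_smul (α : A →ₐ[k] A) (μ ν : A →ₗ[k] A →ₗ[k] A) (t : k) (i : ℕ) :
    hochB α (μ + t • ν) i = hochB α μ i + t • hochB α ν i := by
  simp only [hochB, face_add_smul, smul_add, Finset.sum_add_distrib, LinearMap.add_comp,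
    LinearMap.smul_comp, Finset.smul_sum, smul_comm t]
  abel

/-- The Hochschild differential of `μ + t ν` is that of `μ` plus `t` times the Hochschild
operator of `ν`: the latter is the first-order deformation of the Hochschild differential along
the deformation `ν` of the product. -/
theorem chainD_deformed [CharZero k] (α : A →ₐ[k] A) (d : A →ₗ[k] A) (hd : d 1 = 0)
    {μ ν : A →ₗ[k] A →ₗ[k] A} (hμ : UnitScalar μ) (hν : UnitScalar ν) (t : k) :
    chainD α d hd (μ + t • ν) (hμ.add_smul hν t) = chainD α d hd μ hμ + t • chainB α ν hν := by
  have h : chainB α (μ + t • ν) (hμ.add_smul hν t) = chainB α μ hμ + t • chainB α ν hν := by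
    refine LinearMap.ext fun c => funext fun i => ?_
    obtain ⟨x, hx⟩ := Submodule.Quotient.mk_surjective _ (c (i + 1))
    simp only [chainB, LinearMap.pi_apply, LinearMap.comp_apply, LinearMap.proj_apply, ← hx,
      LinearMap.add_apply, LinearMap.smul_apply, Pi.add_apply, Pi.smul_apply,
      Submodule.mapQ_apply, hochB_add_smul, Submodule.Quotient.mk_add,
      Submodule.Quotient.mk_smul]
  rw [chainD, chainD, h]
  abel

/-- The tensors of total internal degree `n`, for a grading `gr` on `A`. -/
def tensDeg (gr : ℕ → Submodule k A) (i : ℕ) (n : ℤ) : Submodule k (Tens k A i) :=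
  Submodule.span k {t | ∃ (a : Fin (i + 1) → A) (p : Fin (i + 1) → ℕ),
    (∀ j, a j ∈ gr (p j)) ∧ ((∑ j, p j : ℕ) : ℤ) = n ∧ t = PiTensorProduct.tprod k a}

/-- The chains of total degree `m`: the component in `A ⊗ (A/k)^{⊗ i}` has internal
degree `m + i`. -/
def chainDeg (gr : ℕ → Submodule k A) (m : ℤ) : Submodule k (Chains k A) :=
  Submodule.pi Set.univ fun i => (tensDeg gr i (m + i)).map (degenerate k A i).mkQ

end Hochschild

/-! ### The Chevalley–Eilenberg algebra -/

section ChevalleyEilenberg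

variable {k : Type*} [Field k] {g : Type*} [LieRing g] [LieAlgebra k g]
  {ι : Type*} [Fintype ι]

variable (k g) in
/-- The underlying algebra of `Ch(g)`: the exterior algebra of the dual space, with `g^∨` in
degree `1`. -/
abbrev Ch : Type _ := ExteriorAlgebra k (Module.Dual k g)

variable (k g) in
/-- The parity automorphism `a ↦ (-1)^(deg a) a`. -/
def parity : Ch k g →ₐ[k] Ch k g := CliffordAlgebra.involute

/-- The partial derivative `∂_x` for `x ∈ g`: the odd derivation of `Ch(g)`, acting from the
left, with `∂_x ξ = ξ(x)` for `ξ ∈ g^∨`. -/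
def partialXi (x : g) : Ch k g →ₗ[k] Ch k g :=
  CliffordAlgebra.contractLeft (Module.Dual.eval k g x)

/-- The generator of `Ch(g)` dual to `b i`. -/
def xi (b : Module.Basis ι k g) (i : ι) : Ch k g := ExteriorAlgebra.ι k (b.coord i)

/-- The Chevalley–Eilenberg differential: the odd derivation of `Ch(g)` with
`(dξ)(x, y) = -ξ([x, y])`, that is `d = -1/2 ∑_{i,j} ξ^i ξ^j ∂_{[b_i, b_j]}`. -/
def chD (b : Module.Basis ι k g) : Ch k g →ₗ[k] Ch k g :=
  (-2⁻¹ : k) • ∑ i, ∑ j,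
    LinearMap.mulLeft k (xi b i * xi b j) ∘ₗ partialXi ⁅b i, b j⁆

theorem chD_one (b : Module.Basis ι k g) : chD b 1 = 0 := by
  simp [chD, partialXi]

variable (k g) in
/-- The grading of `Ch(g)`. -/
def chDeg (p : ℕ) : Submodule k (Ch k g) := ⋀[k]^p (Module.Dual k g)

variable (k g) in
/-- The product of `Ch(g)`. -/
def chMul : Ch k g →ₗ[k] Ch k g →ₗ[k] Ch k g := LinearMap.mul k (Ch k g)

theorem chMul_unit : UnitScalar (chMul k g) := ⟨1, fun a => by simp [chMul]⟩

variable [DecidableEq ι]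

/-- The Poisson bracket of degree `-2` of a non-degenerate scalar product `B`: the biderivation
of `Ch(g)` with `{ξ, η} = ⟨ξ, η⟩` for `ξ, η ∈ g^∨`, where `⟨ , ⟩` is the scalar product on `g^∨`
induced by `B`. With `b^i` the `B`-dual basis, `{a, a'} = ∑_i (a ∂_{b_i}) (∂_{b^i} a')`; the left
factor is the derivative acting from the right, `a ∂_x = (-1)^(deg a - 1) ∂_x a`. -/
def poisson (b : Module.Basis ι k g) (B : LinearMap.BilinForm k g) (hB : B.Nondegenerate) :
    Ch k g →ₗ[k] Ch k g →ₗ[k] Ch k g :=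
  ∑ i, (LinearMap.mul k (Ch k g)).compl₁₂
    ((parity k g).toLinearMap ∘ₗ partialXi (b i)) (partialXi (B.dualBasis hB b i))

theorem poisson_unit (b : Module.Basis ι k g) (B : LinearMap.BilinForm k g)
    (hB : B.Nondegenerate) : UnitScalar ((2⁻¹ : k) • poisson b B hB) :=
  ⟨0, fun a => by simp [poisson, partialXi, LinearMap.sum_apply]⟩

end ChevalleyEilenberg

/-! ### Differential forms -/

section Forms

variable {k : Type*} [Field k] {g : Type*} [LieRing g] [LieAlgebra k g]
  {ι : Type*} [Fintype ι]

variable (k g ι) in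
/-- The differential forms `Ch(g, k[[g^∨]]^ad)`: power series with coefficients in `Ch(g)` in
commuting even variables `y_i = d_dR ξ^i` indexed by a basis of `g`. -/
abbrev Forms : Type _ := MvPowerSeries ι (Ch k g)

variable (k g ι) in
/-- The forms of degree `m`; the variables `y_i` have degree `0`. -/
def formsDeg (m : ℤ) : Submodule k (Forms k g ι) where
  carrier := {ω | ∀ n, MvPowerSeries.coeff n ω ∈ ⨆ (p : ℕ) (_ : (p : ℤ) = m), chDeg k g p}
  add_mem' := fun h h' n => by rw [map_add]; exact add_mem (h n) (h' n)
  zero_mem' := fun n => by rw [map_zero]; exact zero_mem _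
  smul_mem' := fun c ω h n => Submodule.smul_mem _ c (h n)

/-- The coefficientwise action of an operator on `Ch(g)`. -/
def coeffMap (T : Ch k g →ₗ[k] Ch k g) : Forms k g ι →ₗ[k] Forms k g ι where
  toFun ω := fun n => T (MvPowerSeries.coeff n ω)
  map_add' ω η := by funext n; exact map_add T _ _
  map_smul' c ω := by funext n; exact map_smul T c _

variable (k g) in
/-- The partial derivative `∂/∂y_i`. -/
def partialY (i : ι) : Forms k g ι →ₗ[k] Forms k g ι where
  toFun ω := fun n => ((n i : k) + 1) • MvPowerSeries.coeff (n + Finsupp.single i 1) ω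
  map_add' ω η := by funext n; exact smul_add _ _ _
  map_smul' c ω := by funext n; exact smul_comm _ c _

/-- The derivative in the direction of the vector `v` of `g`, in the coordinates `y` on `g`. -/
def partialYVec (b : Module.Basis ι k g) (v : g) : Forms k g ι →ₗ[k] Forms k g ι :=
  ∑ i, b.coord i v • partialY k g i

/-- The action of `x ∈ g` on power series on `g` by derivations, given on the linear functions
by the coadjoint action: `x · y_i = -∑_j y_i([x, b_j]) y_j`. -/
def coadjoint (b : Module.Basis ι k g) (x : g) : Forms k g ι →ₗ[k] Forms k g ι :=
  -∑ i, ∑ j, b.coord i ⁅x, b j⁆ •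
    (LinearMap.mulLeft k (MvPowerSeries.X j : Forms k g ι) ∘ₗ partialY k g i)

/-- The differential of the Chevalley–Eilenberg complex with coefficients in `k[[g^∨]]`. -/
def formsD (b : Module.Basis ι k g) : Forms k g ι →ₗ[k] Forms k g ι :=
  coeffMap (chD b) +
    ∑ i, LinearMap.mulLeft k (MvPowerSeries.C (xi b i) : Forms k g ι) ∘ₗ coadjoint b (b i)

/-- An element of `Ch(g)`, as a form. -/
def constForm : Ch k g →ₗ[k] Forms k g ι :=
  (MvPowerSeries.monomial (R := Ch k g) (0 : ι →₀ ℕ)).restrictScalars k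

/-- The de Rham differential `Ch(g) → Ch(g, g^∨)`, the odd derivation with `ξ^i ↦ y_i`. -/
def deRham (b : Module.Basis ι k g) : Ch k g →ₗ[k] Forms k g ι :=
  ∑ i, (MvPowerSeries.monomial (R := Ch k g) (Finsupp.single i 1)).restrictScalars k ∘ₗ
    partialXi (b i)

/-- The component of the Hochschild–Kostant–Rosenberg map on `i`-chains, before normalization:
`a_0 ⊗ ⋯ ⊗ a_i ↦ ± (1 / i!) a_0 d_dR a_1 ⋯ d_dR a_i`,
with the sign `(-1)^(i + ∑_j (i - j) deg a_j)`: the Koszul sign of moving the `i` odd operators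
`-d_dR` past the arguments. -/
def hkrTens (b : Module.Basis ι k g) (i : ℕ) : Tens k (Ch k g) i →ₗ[k] Forms k g ι :=
  ((-1 : k) ^ i / (Nat.factorial i : k)) • PiTensorProduct.lift
    ((MultilinearMap.mkPiAlgebraFin k (i + 1) (Forms k g ι)).compLinearMap fun j =>
      (if j = 0 then constForm else deRham b) ∘ₗ (parity k g).toLinearMap ^ (i - (j : ℕ)))

theorem deRham_one (b : Module.Basis ι k g) : deRham b (1 : Ch k g) = 0 := by
  simp [deRham, partialXi]

theorem hkrTens_degenerate (b : Module.Basis ι k g) (i : ℕ) :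
    degenerate k (Ch k g) i ≤ LinearMap.ker (hkrTens b i) := by
  refine Submodule.span_le.2 ?_
  rintro _ ⟨a, ⟨j, hj, ha⟩, rfl⟩
  have hp : ∀ n : ℕ, ((parity k g).toLinearMap ^ n) 1 = 1 := by
    intro n
    induction n with
    | zero => simp
    | succ n ih =>
      rw [pow_succ', Module.End.mul_apply, ih]
      exact map_one (parity k g)
  change hkrTens b i _ = 0
  rw [hkrTens, LinearMap.smul_apply, PiTensorProduct.lift.tprod,
    MultilinearMap.compLinearMap_apply, MultilinearMap.map_coord_zero _ j, smul_zero]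
  rw [if_neg hj, LinearMap.comp_apply, ha, hp, deRham_one]

/-- The Hochschild–Kostant–Rosenberg map. The image of an `i`-chain is homogeneous of degree `i`
in the variables `y`, so only the `i`-chain component of `c` contributes to the coefficients of
the monomials of degree `i`. -/
def hkr (b : Module.Basis ι k g) : Chains k (Ch k g) →ₗ[k] Forms k g ι where
  toFun c := fun n => MvPowerSeries.coeff n
    ((degenerate k (Ch k g) n.degree).liftQ (hkrTens b n.degree)
      (hkrTens_degenerate b n.degree) (c n.degree))
  map_add' c c' := by
    funext n
    simp only [Pi.add_apply, map_add]
    rfl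
  map_smul' r c := by
    funext n
    simp only [Pi.smul_apply, map_smul]
    rfl

/-- The matrix of `Ad`, the linear function `y ↦ [y, ·]` on `g` with values in `End(g)`. -/
def adMatrix (b : Module.Basis ι k g) : Matrix ι ι (MvPowerSeries ι k) :=
  Matrix.of fun r s => ∑ i, MvPowerSeries.C (b.coord r ⁅b i, b s⁆) * MvPowerSeries.X i

variable [DecidableEq ι]

/-- The series `∑_{n ≥ 1} B_{2n} / (4n (2n)!) Tr(Ad^{2n})`. Since `Tr(Ad^{2n})` is homogeneous of
degree `2n`, only terms with `n ≤ deg m` contribute to the coefficient of the monomial `m`. -/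
def logDuflo (b : Module.Basis ι k g) [CharZero k] : MvPowerSeries ι k :=
  fun m => ∑ n ∈ Finset.Icc 1 m.degree,
    ((bernoulli (2 * n) : ℚ) : k) / (4 * n * (Nat.factorial (2 * n) : k)) *
      MvPowerSeries.coeff m (adMatrix b ^ (2 * n)).trace

/-- The Duflo character `j^{1/2}`. -/
def duflo (b : Module.Basis ι k g) [CharZero k] : MvPowerSeries ι k :=
  (PowerSeries.exp k).subst (logDuflo b)

/-- Multiplication of forms by a power series on `g`. -/
def mulSeries (f : MvPowerSeries ι k) : Forms k g ι →ₗ[k] Forms k g ι :=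
  LinearMap.mulLeft k (MvPowerSeries.map (algebraMap k (Ch k g)) f)

/-- The Brylinski operator `∑_i ∂/∂ξ^{b_i} ∂/∂y^{b^i}`, where `b^i` is the `B`-dual basis. -/
def brylinski (b : Module.Basis ι k g) (B : LinearMap.BilinForm k g) (hB : B.Nondegenerate) :
    Forms k g ι →ₗ[k] Forms k g ι :=
  ∑ i, coeffMap (partialXi (b i)) ∘ₗ partialYVec b (B.dualBasis hB b i)

end Forms

/-! ### The Hochschild complex of the Chevalley–Eilenberg algebra -/

section Main

variable {k : Type*} [Field k] [CharZero k] {g : Type*} [LieRing g] [LieAlgebra k g]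
  {ι : Type*} [Fintype ι]

/-- The Hochschild differential of `Ch(g)`. -/
def hochD (b : Module.Basis ι k g) : Chains k (Ch k g) →ₗ[k] Chains k (Ch k g) :=
  chainD (parity k g) (chD b) (chD_one b) (chMul k g) chMul_unit

variable [DecidableEq ι]

/-- The first-order deformation `d_0` of the Hochschild differential of `Ch(g)` along the
deformation `a a' + (1/2) ε {a, a'}` of the product: the coefficient of `ε` in the Hochschild
differential of the deformed product (see `chainD_deformed`). -/
def hochD0 (b : Module.Basis ι k g) (B : LinearMap.BilinForm k g) (hB : B.Nondegenerate) :
    Chains k (Ch k g) →ₗ[k] Chains k (Ch k g) :=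
  chainB (parity k g) ((2⁻¹ : k) • poisson b B hB) (poisson_unit b B hB)

/-- The operator `j^{-1/2} ∘ d_Br ∘ j^{1/2}`. -/
def twistedBrylinski (b : Module.Basis ι k g) (B : LinearMap.BilinForm k g)
    (hB : B.Nondegenerate) : Forms k g ι →ₗ[k] Forms k g ι :=
  mulSeries (duflo b)⁻¹ ∘ₗ brylinski b B hB ∘ₗ mulSeries (duflo b)

end Main

end CEHochschild

end

/-!
Write `A = Ch(g)`, `Φ` for the Hochschild–Kostant–Rosenberg map and `T = j^{-1/2} d_Br j^{1/2}`.
The theorem follows formally (`IsHomotopyInverse.chainHomotopic`) from two facts: `Φ` has a chain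
homotopy inverse, and there is an operator `H : C_*(A) → Ω` of degree `-2` with
`Φ d_0 - T Φ = d_CE H - H D`. For then, if `e` is any homotopy inverse and
`Φ e - 1 = d_CE h + h d_CE`, the operator `H e - T h` is a homotopy between `Φ d_0 e` and `T`.

*Slots.* The tensor power `A^{⊗ (i+1)}` is the exterior algebra on `i + 1` copies of `g^∨`. All tensor
powers are embedded in the one exterior algebra `Slots` on countably many copies, the slots. The faces
of the Hochschild complex and its cyclic rotation then become algebra homomorphisms that relabel
slots (`toSlots_hochB`), the internal differential becomes an odd derivation, and the component of `Φ`
on `i`-chains is, up to a factor, `m ∘ (D_1 ⋯ D_i)`, where `m` multiplies all the slots and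
`D_l = ∑_c y_c ∂_{c,l}` is the tautological derivative in slot `l` (`hkrTens_eq`). All signs are
absorbed in the anticommutation of the `∂_{c,l}`.

*The homotopy `H`.* Let `β` be the bivector of the scalar product and `N_s = Ad^s β`, an invariant
bivector with entries homogeneous of degree `s` in `y`, and with `N_s^T = (-1)^s N_s`. On `i`-chains,
`H` is the sum over `s` of the operators
`± 1/2 m ∑_{j,l ≤ i} g(s+1; i; j, l) ∑_{c,d} (N_s)_{cd} ∂_{c,j} ∂_{d,l} D_1 ⋯ D_i`
with numerical coefficients `g` built from Bernoulli numbers (`gC`). The commutator of this operator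
with the differentials has three kinds of terms. Passing the internal differential through
`D_1 ⋯ D_i` replaces one `D_q` by `Ad` applied to an index of `N_s`, and so gives terms with `N_{s+1}`
(`formsD_homS`). The operator `b` merges neighbouring slots and gives terms with `N_s` and differences
of the coefficients `g` (`mulP_opG_slotB`). These cancel between `s` and `s + 1` by the recursion
`gC_faceIdx`, except for the terms with `N_0 = β`, which are `d_Br Φ` and, because `B_1` is not zero,
`Φ d_0` (`homS_slotB`). Finally, two derivatives in the same slot give the bracket
`∑_{c,d} (N_s)_{cd} [e_c, e_d]`, which is the gradient of `Tr(Ad^{s+1})` up to a factor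
(`bracketVec_pow`). These terms are multiplied by Bernoulli numbers and add up to the derivation along
the gradient of `log j^{1/2}`, which is `T - d_Br` (`twistedBrylinski_apply`). The sum is
`hkr_hochD0_sub`.

*The homotopy inverse.* It is enough to treat the complex `(C_*(A), b)` without the internal
differential: symmetric tensors give a section of `Φ` by cycles (`hkrInv`), and a homological
perturbation with respect to the internal differential (`PerturbationData`) does the rest. Because
chains are infinite products, the recursions of the perturbation lemma need no convergence.
Its input is that `b`-cycles with vanishing image under `Φ` are boundaries (`nB_exact_succ`).
Changing the generators `e_l` of slot `l` to `e_l + e_0` identifies the normalized Hochschild complex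
with the bar complex of `Λ(g^∨)` with trivial coefficients, tensored with `A`. Its exactness
(`modB_exact`) is proved for coefficients in the quotients of the free module by some of the
variables, by induction on the number of variables.

*Degrees.* All the gradings are eigenspace decompositions of the automorphism that multiplies the
generators by `2`, so that the degree of an operator can be read off from its commutation with this
automorphism (`Scales`).
-/

namespace CEHochschild

noncomputable section

/-! ### Operators on exterior algebras -/

section ExteriorOperators

variable {k : Type*} [Field k] {M N : Type*} [AddCommGroup M] [Module k M]
  [AddCommGroup N] [Module k N]

/-- The parity automorphism of an exterior algebra. -/
abbrev sgn : ExteriorAlgebra k M →ₐ[k] ExteriorAlgebra k M := CliffordAlgebra.involute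

/-- Contraction of an exterior algebra with a linear functional. -/
abbrev contr (d : Module.Dual k M) : ExteriorAlgebra k M →ₗ[k] ExteriorAlgebra k M :=
  CliffordAlgebra.contractLeft d

theorem extInduction {C : ExteriorAlgebra k M → Prop} (h1 : C 1)
    (hadd : ∀ x y, C x → C y → C (x + y)) (hsmul : ∀ (c : k) x, C x → C (c • x))
    (hmul : ∀ v x, C x → C (ExteriorAlgebra.ι k v * x)) (x : ExteriorAlgebra k M) : C x := by
  refine CliffordAlgebra.left_induction (Q := (0 : QuadraticForm k M)) (fun r => ?_) hadd
    (fun x v hx => hmul v x hx) x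
  rw [Algebra.algebraMap_eq_smul_one]
  exact hsmul r _ h1

/-- Linear maps on an exterior algebra agree if they agree on `1` and their agreement is
preserved by left multiplication by generators. -/
theorem extHom_ext {P : Type*} [AddCommGroup P] [Module k P] {S T : ExteriorAlgebra k M →ₗ[k] P}
    (h1 : S 1 = T 1)
    (hmul : ∀ v x, S x = T x → S (ExteriorAlgebra.ι k v * x) = T (ExteriorAlgebra.ι k v * x)) :
    S = T := by
  refine LinearMap.ext fun x => extInduction (C := fun x => S x = T x) h1 ?_ ?_ hmul x
  · intro x y hx hy
    rw [map_add, map_add, hx, hy]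
  · intro c x hx
    rw [map_smul, map_smul, hx]

@[simp] theorem sgn_ι (v : M) : sgn (ExteriorAlgebra.ι k v) = -ExteriorAlgebra.ι k v :=
  CliffordAlgebra.involute_ι v

theorem sgn_sgn (x : ExteriorAlgebra k M) : sgn (sgn x) = x :=
  CliffordAlgebra.involute_involute x

theorem sgn_map (f : M →ₗ[k] N) (x : ExteriorAlgebra k M) :
    sgn (ExteriorAlgebra.map f x) = ExteriorAlgebra.map f (sgn x) := by
  have : (sgn (k := k)).comp (ExteriorAlgebra.map f) = (ExteriorAlgebra.map f).comp sgn := by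
    ext v
    simp
  exact DFunLike.congr_fun this x

theorem contr_ι_mul (d : Module.Dual k M) (v : M) (x : ExteriorAlgebra k M) :
    contr d (ExteriorAlgebra.ι k v * x) = d v • x - ExteriorAlgebra.ι k v * contr d x :=
  CliffordAlgebra.contractLeft_ι_mul d v x

@[simp] theorem contr_one (d : Module.Dual k M) : contr d (1 : ExteriorAlgebra k M) = 0 :=
  CliffordAlgebra.contractLeft_one (Q := (0 : QuadraticForm k M)) (d := d)

@[simp] theorem contr_ι (d : Module.Dual k M) (v : M) :
    contr d (ExteriorAlgebra.ι k v) = algebraMap k _ (d v) :=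
  CliffordAlgebra.contractLeft_ι (Q := (0 : QuadraticForm k M)) (d := d) v

theorem contr_map (f : M →ₗ[k] N) (d : Module.Dual k N) (x : ExteriorAlgebra k M) :
    contr d (ExteriorAlgebra.map f x) = ExteriorAlgebra.map f (contr (d ∘ₗ f) x) := by
  refine DFunLike.congr_fun (f := contr d ∘ₗ (ExteriorAlgebra.map f).toLinearMap)
    (g := (ExteriorAlgebra.map f).toLinearMap ∘ₗ contr (d ∘ₗ f)) (extHom_ext ?_ ?_) x
  · simp
  · intro v x hx
    simp only [LinearMap.comp_apply, AlgHom.toLinearMap_apply] at hx ⊢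
    rw [map_mul, ExteriorAlgebra.map_apply_ι, contr_ι_mul, contr_ι_mul, hx, map_sub, map_smul,
      map_mul, ExteriorAlgebra.map_apply_ι, LinearMap.comp_apply]

theorem sgn_contr (d : Module.Dual k M) (x : ExteriorAlgebra k M) :
    sgn (contr d x) = -contr d (sgn x) := by
  refine DFunLike.congr_fun (f := (sgn (k := k)).toLinearMap ∘ₗ contr d)
    (g := -(contr d ∘ₗ (sgn (k := k)).toLinearMap)) (extHom_ext ?_ ?_) x
  · simp
  · intro v x hx
    simp only [LinearMap.comp_apply, AlgHom.toLinearMap_apply, LinearMap.neg_apply] at hx ⊢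
    rw [map_mul sgn, sgn_ι, contr_ι_mul, map_sub, map_smul, map_mul, sgn_ι, hx, neg_mul, neg_mul, map_neg,
      contr_ι_mul]
    simp

theorem contr_mul (d : Module.Dual k M) (x y : ExteriorAlgebra k M) :
    contr d (x * y) = contr d x * y + sgn x * contr d y := by
  refine DFunLike.congr_fun (f := contr d ∘ₗ LinearMap.mulRight k y)
    (g := LinearMap.mulRight k y ∘ₗ contr d +
      LinearMap.mulRight k (contr d y) ∘ₗ (sgn (k := k)).toLinearMap) (extHom_ext ?_ ?_) x
  · simp
  · intro v x hx
    simp only [LinearMap.comp_apply, AlgHom.toLinearMap_apply, LinearMap.add_apply,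
      LinearMap.mulRight_apply] at hx ⊢
    rw [mul_assoc, contr_ι_mul, hx, contr_ι_mul, map_mul, sgn_ι, sub_mul, mul_add, smul_mul_assoc,
      neg_mul, neg_mul, ← mul_assoc, ← mul_assoc]
    abel

theorem contr_contr (d d' : Module.Dual k M) (x : ExteriorAlgebra k M) :
    contr d (contr d' x) = -contr d' (contr d x) :=
  CliffordAlgebra.contractLeft_comm (Q := (0 : QuadraticForm k M)) (d := d) d' x

theorem ι_mul_ι_comm (v w : M) : ExteriorAlgebra.ι k v * ExteriorAlgebra.ι k w =
    -(ExteriorAlgebra.ι k w * ExteriorAlgebra.ι k v) :=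
  eq_neg_of_add_eq_zero_left (ExteriorAlgebra.ι_add_mul_swap v w)

theorem mul_ι (x : ExteriorAlgebra k M) (v : M) :
    x * ExteriorAlgebra.ι k v = ExteriorAlgebra.ι k v * sgn x := by
  refine DFunLike.congr_fun (f := LinearMap.mulRight k (ExteriorAlgebra.ι k v))
    (g := LinearMap.mulLeft k (ExteriorAlgebra.ι k v) ∘ₗ (sgn (k := k)).toLinearMap)
    (extHom_ext ?_ ?_) x
  · simp
  · intro w x hx
    simp only [LinearMap.comp_apply, AlgHom.toLinearMap_apply, LinearMap.mulRight_apply,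
      LinearMap.mulLeft_apply] at hx ⊢
    rw [mul_assoc, hx, map_mul, sgn_ι, ← mul_assoc, ι_mul_ι_comm]
    noncomm_ring

/-- Elements fixed by the parity automorphism are central. -/
theorem even_mul_comm {u : ExteriorAlgebra k M} (hu : sgn u = u) (x : ExteriorAlgebra k M) :
    u * x = x * u := by
  refine DFunLike.congr_fun (f := LinearMap.mulLeft k u) (g := LinearMap.mulRight k u)
    (extHom_ext ?_ ?_) x
  · simp
  · intro v x hx
    simp only [LinearMap.mulRight_apply, LinearMap.mulLeft_apply] at hx ⊢
    rw [← mul_assoc, mul_ι, hu, mul_assoc, hx, mul_assoc]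

/-- Elements on which the parity automorphism is `-1` commute with all others up to the Koszul
sign. -/
theorem odd_mul_comm {u : ExteriorAlgebra k M} (hu : sgn u = -u) (x : ExteriorAlgebra k M) :
    u * x = sgn x * u := by
  refine DFunLike.congr_fun (f := LinearMap.mulLeft k u)
    (g := LinearMap.mulRight k u ∘ₗ (sgn (k := k)).toLinearMap) (extHom_ext ?_ ?_) x
  · simp
  · intro v x hx
    simp only [LinearMap.mulRight_apply, LinearMap.mulLeft_apply, LinearMap.comp_apply,
      AlgHom.toLinearMap_apply] at hx ⊢
    rw [← mul_assoc, mul_ι, hu, mul_assoc, neg_mul, hx, map_mul, sgn_ι, mul_assoc]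
    noncomm_ring

section OddDerivation

variable (f : M →ₗ[k] ExteriorAlgebra k M) (hf : ∀ v, sgn (f v) = f v)

/-- The algebra homomorphism `x ↦ (sgn x, T x; 0, x)` to upper triangular matrices, where `T` is
the odd derivation extending the even-valued map `f` on generators. -/
def oddDerHom : ExteriorAlgebra k M →ₐ[k] Matrix (Fin 2) (Fin 2) (ExteriorAlgebra k M) :=
  ExteriorAlgebra.lift k ⟨
    { toFun := fun v => !![-ExteriorAlgebra.ι k v, f v; 0, ExteriorAlgebra.ι k v]
      map_add' := fun v w => by
        ext i j
        fin_cases i <;> fin_cases j <;> simp [add_comm]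
      map_smul' := fun c v => by
        ext i j
        fin_cases i <;> fin_cases j <;> simp }, fun v => by
      change !![-ExteriorAlgebra.ι k v, f v; 0, ExteriorAlgebra.ι k v] *
        !![-ExteriorAlgebra.ι k v, f v; 0, ExteriorAlgebra.ι k v] = 0
      rw [Matrix.mul_fin_two]
      ext i j
      fin_cases i <;> fin_cases j <;>
        simp [even_mul_comm (hf v)]⟩

/-- The odd derivation of an exterior algebra with prescribed even values on the generators. -/
def oddDer : ExteriorAlgebra k M →ₗ[k] ExteriorAlgebra k M where
  toFun x := oddDerHom f hf x 0 1
  map_add' x y := by simp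
  map_smul' c x := by simp

theorem oddDerHom_apply (x : ExteriorAlgebra k M) :
    oddDerHom f hf x = !![sgn x, oddDer f hf x; 0, x] := by
  refine extInduction (C := fun x => oddDerHom f hf x = !![sgn x, oddDer f hf x; 0, x])
    ?_ ?_ ?_ ?_ x
  · ext i j
    fin_cases i <;> fin_cases j <;> simp [oddDer]
  · intro x y hx hy
    rw [map_add, hx, hy]
    ext i j
    fin_cases i <;> fin_cases j <;> simp
  · intro c x hx
    rw [map_smul, hx]
    ext i j
    fin_cases i <;> fin_cases j <;> simp
  · intro v x hx
    have h : oddDerHom f hf (ExteriorAlgebra.ι k v) =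
        !![-ExteriorAlgebra.ι k v, f v; 0, ExteriorAlgebra.ι k v] :=
      ExteriorAlgebra.lift_ι_apply ..
    have h' : oddDerHom f hf (ExteriorAlgebra.ι k v * x) = !![-ExteriorAlgebra.ι k v * sgn x,
        -ExteriorAlgebra.ι k v * oddDer f hf x + f v * x; 0, ExteriorAlgebra.ι k v * x] := by
      rw [map_mul, h, hx, Matrix.mul_fin_two]
      simp
    have h2 : oddDer f hf (ExteriorAlgebra.ι k v * x) =
        -ExteriorAlgebra.ι k v * oddDer f hf x + f v * x := by
      change oddDerHom f hf (ExteriorAlgebra.ι k v * x) 0 1 = _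
      rw [h']
      simp
    rw [h', h2, map_mul, sgn_ι]

theorem oddDer_mul (x y : ExteriorAlgebra k M) :
    oddDer f hf (x * y) = oddDer f hf x * y + sgn x * oddDer f hf y := by
  change oddDerHom f hf (x * y) 0 1 = _
  rw [map_mul, oddDerHom_apply, oddDerHom_apply, Matrix.mul_fin_two]
  simp [add_comm]

@[simp] theorem oddDer_ι (v : M) : oddDer f hf (ExteriorAlgebra.ι k v) = f v := by
  change oddDerHom f hf (ExteriorAlgebra.ι k v) 0 1 = _
  rw [oddDerHom, ExteriorAlgebra.lift_ι_apply]
  simp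

@[simp] theorem oddDer_one : oddDer f hf 1 = 0 := by
  change oddDerHom f hf 1 0 1 = _
  simp

theorem oddDer_ι_mul (v : M) (x : ExteriorAlgebra k M) :
    oddDer f hf (ExteriorAlgebra.ι k v * x) = f v * x - ExteriorAlgebra.ι k v * oddDer f hf x := by
  rw [oddDer_mul, oddDer_ι, sgn_ι, neg_mul, sub_eq_add_neg]

end OddDerivation

end ExteriorOperators

/-! ### Ordered products -/

section OrderedProducts

theorem prod_ofFn_contractNth {R : Type*} [Monoid R] : ∀ {n : ℕ} (j : Fin n) (f : Fin (n + 1) → R),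
    (List.ofFn (Fin.contractNth j.castSucc (fun x y => x * y) f)).prod = (List.ofFn f).prod
  | n + 1, j, f => by
    rw [List.ofFn_succ, List.prod_cons, List.ofFn_succ (f := f), List.prod_cons]
    refine Fin.cases ?_ (fun j' => ?_) j
    · rw [Fin.contractNth_apply_of_eq _ _ _ _ (by simp), List.ofFn_succ, List.prod_cons, mul_assoc]
      congr 3
    · rw [Fin.contractNth_apply_of_lt _ _ _ _ (by simp),
        ← prod_ofFn_contractNth j' (fun r => f r.succ)]
      congr 3
      funext r
      simp [Fin.contractNth]

variable {k : Type*} [Field k] {M : Type*} [AddCommGroup M] [Module k M]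

/-- An odd derivation applied to an ordered product. -/
theorem oddDerivation_prod_ofFn (T : ExteriorAlgebra k M →ₗ[k] ExteriorAlgebra k M) (h1 : T 1 = 0)
    (hT : ∀ x y, T (x * y) = T x * y + sgn x * T y) : ∀ {n : ℕ} (f : Fin n → ExteriorAlgebra k M),
    T (List.ofFn f).prod = ∑ j : Fin n, (List.ofFn fun l => if l < j then sgn (f l) else
      if l = j then T (f l) else f l).prod
  | 0, f => by simp [h1]
  | n + 1, f => by
    rw [List.ofFn_succ, List.prod_cons, hT, oddDerivation_prod_ofFn T h1 hT, Fin.sum_univ_succ,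
      List.ofFn_succ, List.prod_cons, Finset.mul_sum]
    congr 1
    simp

/-- The parity automorphism applied to an ordered product. -/
theorem algHom_prod_ofFn {A B : Type*} [Semiring A] [Algebra k A] [Semiring B] [Algebra k B]
    (φ : A →ₐ[k] B) {n : ℕ} (f : Fin n → A) :
    φ (List.ofFn f).prod = (List.ofFn fun l => φ (f l)).prod := by
  rw [map_list_prod, List.map_ofFn]
  rfl

end OrderedProducts

/-! ### The exterior algebra with slots -/

section Slots

variable {k : Type*} [Field k] {g : Type*} [AddCommGroup g] [Module k g]

variable (k g) in
/-- The exterior algebra on countably many copies, the *slots*, of the dual space of `g`. The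
tensor power `Ch(g)^{⊗ (i+1)}` is its subalgebra on the slots `0, …, i`, and the operators of
the Hochschild complex become operators on this one algebra. -/
abbrev Slots : Type _ := ExteriorAlgebra k (ℕ →₀ Module.Dual k g)

/-- The generator `v` in slot `l`. -/
def gen (l : ℕ) (v : Module.Dual k g) : Slots k g := ExteriorAlgebra.ι k (Finsupp.single l v)

/-- The inclusion of slot `l`. -/
def slot (l : ℕ) : ExteriorAlgebra k (Module.Dual k g) →ₐ[k] Slots k g :=
  ExteriorAlgebra.map (Finsupp.lsingle l)

/-- Moving slot `l` to slot `θ l`, and multiplying what ends up in the same slot. -/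
def relabel (θ : ℕ → ℕ) : Slots k g →ₐ[k] Slots k g :=
  ExteriorAlgebra.map (Finsupp.lmapDomain _ k θ)

/-- The derivative `∂_x` in slot `l`. -/
def dslot (x : g) (l : ℕ) : Slots k g →ₗ[k] Slots k g :=
  contr (Module.Dual.eval k g x ∘ₗ Finsupp.lapply l)

/-- The product of all slots. -/
def slotProd : Slots k g →ₐ[k] ExteriorAlgebra k (Module.Dual k g) :=
  ExteriorAlgebra.map (Finsupp.lsum k fun _ => LinearMap.id)

theorem slotsInduction {C : Slots k g → Prop} (h1 : C 1) (hadd : ∀ x y, C x → C y → C (x + y))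
    (hsmul : ∀ (c : k) x, C x → C (c • x)) (hmul : ∀ l v x, C x → C (gen l v * x))
    (x : Slots k g) : C x := by
  refine extInduction h1 hadd hsmul (fun w x hx => ?_) x
  induction w using Finsupp.induction_linear with
  | zero => simpa using hsmul 0 x hx
  | add w w' h h' => simpa [map_add, add_mul] using hadd _ _ h h'
  | single l v => exact hmul l v x hx

theorem slotsHom_ext {P : Type*} [AddCommGroup P] [Module k P] {S T : Slots k g →ₗ[k] P}
    (h1 : S 1 = T 1) (hmul : ∀ l v x, S x = T x → S (gen l v * x) = T (gen l v * x)) :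
    S = T := by
  refine LinearMap.ext fun x => slotsInduction (C := fun x => S x = T x) h1 ?_ ?_ hmul x
  · intro x y hx hy
    rw [map_add, map_add, hx, hy]
  · intro c x hx
    rw [map_smul, map_smul, hx]

theorem slotsAlgHom_ext {A : Type*} [Ring A] [Algebra k A] {S T : Slots k g →ₐ[k] A}
    (h : ∀ l v, S (gen l v) = T (gen l v)) : S = T := by
  refine AlgHom.toLinearMap_injective (slotsHom_ext (by simp) fun l v x hx => ?_)
  simp only [AlgHom.toLinearMap_apply] at hx ⊢
  rw [map_mul, map_mul, h, hx]

theorem slot_ι (l : ℕ) (v : Module.Dual k g) : slot l (ExteriorAlgebra.ι k v) = gen l v := by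
  simp [slot, gen]

theorem relabel_gen (θ : ℕ → ℕ) (l : ℕ) (v : Module.Dual k g) :
    relabel θ (gen l v) = gen (θ l) v := by
  simp [relabel, gen]

theorem relabel_relabel (θ η : ℕ → ℕ) (x : Slots k g) :
    relabel θ (relabel η x) = relabel (θ ∘ η) x := by
  refine DFunLike.congr_fun (f := (relabel θ).comp (relabel η)) (g := relabel (θ ∘ η))
    (slotsAlgHom_ext fun l v => ?_) x
  simp [relabel_gen]

theorem relabel_slot (θ : ℕ → ℕ) (l : ℕ) (a : ExteriorAlgebra k (Module.Dual k g)) :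
    relabel θ (slot l a) = slot (θ l) a := by
  refine DFunLike.congr_fun (f := (relabel θ).comp (slot l)) (g := slot (θ l)) ?_ a
  ext v
  simp [slot_ι, relabel_gen]

theorem slotProd_gen (l : ℕ) (v : Module.Dual k g) :
    slotProd (gen l v) = ExteriorAlgebra.ι k v := by
  simp [slotProd, gen]

theorem slotProd_slot (l : ℕ) (a : ExteriorAlgebra k (Module.Dual k g)) :
    slotProd (slot l a) = a := by
  refine DFunLike.congr_fun (f := slotProd.comp (slot l)) (g := AlgHom.id k _) ?_ a
  ext v
  simp [slot_ι, slotProd_gen]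

theorem slotProd_relabel (θ : ℕ → ℕ) (x : Slots k g) : slotProd (relabel θ x) = slotProd x := by
  refine DFunLike.congr_fun (f := slotProd.comp (relabel θ)) (g := slotProd)
    (slotsAlgHom_ext fun l v => ?_) x
  simp [relabel_gen, slotProd_gen]

theorem sgn_slot (l : ℕ) (a : ExteriorAlgebra k (Module.Dual k g)) :
    sgn (slot l a) = slot l (sgn a) := sgn_map _ a

theorem dslot_gen_mul (x : g) (l r : ℕ) (v : Module.Dual k g) (y : Slots k g) :
    dslot x l (gen r v * y) = (if r = l then v x else 0) • y - gen r v * dslot x l y := by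
  rw [dslot, gen, contr_ι_mul]
  congr 2
  simp only [LinearMap.comp_apply, Finsupp.lapply_apply, Finsupp.single_apply]
  split_ifs <;> simp

@[simp] theorem dslot_one (x : g) (l : ℕ) : dslot x l (1 : Slots k g) = 0 := contr_one _

theorem dslot_mul (x : g) (l : ℕ) (y z : Slots k g) :
    dslot x l (y * z) = dslot x l y * z + sgn y * dslot x l z := contr_mul _ y z

theorem dslot_dslot (x x' : g) (l l' : ℕ) (y : Slots k g) :
    dslot x l (dslot x' l' y) = -dslot x' l' (dslot x l y) := contr_contr _ _ y

theorem dslot_slot (x : g) (l r : ℕ) (a : ExteriorAlgebra k (Module.Dual k g)) :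
    dslot x l (slot r a) =
      if r = l then slot r (contr (Module.Dual.eval k g x) a) else 0 := by
  rw [dslot, slot, contr_map]
  split_ifs with h
  · subst h
    congr 3
    refine LinearMap.ext fun v => ?_
    simp
  · have : (Module.Dual.eval k g x ∘ₗ Finsupp.lapply l) ∘ₗ Finsupp.lsingle r = 0 := by
      refine LinearMap.ext fun v => ?_
      simp [h]
    rw [this]
    simp

theorem dslot_add (x x' : g) (l : ℕ) :
    dslot (k := k) (x + x') l = dslot x l + dslot x' l := by
  simp [dslot, LinearMap.add_comp]

theorem dslot_smul (c : k) (x : g) (l : ℕ) :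
    dslot (k := k) (c • x) l = c • dslot x l := by
  simp [dslot, LinearMap.smul_comp]

/-- The derivatives of a relabelled element, slot by slot. -/
theorem dslot_relabel (θ : ℕ → ℕ) (x : g) (l : ℕ) (s : Finset ℕ) (hs : ∀ r, r ∈ s ↔ θ r = l)
    (y : Slots k g) : dslot x l (relabel θ y) = relabel θ (∑ r ∈ s, dslot x r y) := by
  refine DFunLike.congr_fun (f := dslot x l ∘ₗ (relabel θ).toLinearMap)
    (g := (relabel θ).toLinearMap ∘ₗ ∑ r ∈ s, dslot x r) (slotsHom_ext ?_ ?_) y |>.trans ?_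
  · simp
  · intro r v y hy
    simp only [LinearMap.comp_apply, AlgHom.toLinearMap_apply, LinearMap.sum_apply] at hy ⊢
    simp only [map_mul, relabel_gen, dslot_gen_mul, hy, map_sub, map_sum, Finset.sum_sub_distrib,
      ← Finset.mul_sum, map_smul]
    congr 1
    rw [← Finset.sum_smul, Finset.sum_ite_eq]
    simp only [hs]
  · simp

end Slots

/-! ### Tensor powers as slots -/

section TensorSlots

variable {k : Type*} [Field k] {g : Type*} [LieRing g] [LieAlgebra k g]

/-- The embedding of the tensor power `Ch(g)^{⊗ (i+1)}` into the algebra with slots. -/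
def toSlots (i : ℕ) : Tens k (Ch k g) i →ₗ[k] Slots k g :=
  PiTensorProduct.lift ((MultilinearMap.mkPiAlgebraFin k (i + 1) (Slots k g)).compLinearMap
    fun j => (slot (j : ℕ)).toLinearMap)

theorem toSlots_tprod (i : ℕ) (a : Fin (i + 1) → Ch k g) :
    toSlots i (PiTensorProduct.tprod k a) = (List.ofFn fun j : Fin (i + 1) => slot j (a j)).prod :=
  PiTensorProduct.lift.tprod _

/-- Killing the slots outside `s`. -/
def restr (s : ℕ → Prop) [DecidablePred s] : Slots k g →ₐ[k] Slots k g :=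
  ExteriorAlgebra.map (Finsupp.lsum k fun l => if s l then Finsupp.lsingle l else 0)

theorem restr_gen (s : ℕ → Prop) [DecidablePred s] (l : ℕ) (v : Module.Dual k g) :
    restr s (gen l v) = if s l then gen l v else 0 := by
  rw [restr, gen, ExteriorAlgebra.map_apply_ι]
  split_ifs with h <;> simp [h]

theorem restr_slot_of_mem (s : ℕ → Prop) [DecidablePred s] {l : ℕ} (h : s l) (a : Ch k g) :
    restr s (slot l a) = slot l a := by
  refine DFunLike.congr_fun (f := (restr s).comp (slot l)) (g := slot l) ?_ a
  ext v
  simp [slot_ι, restr_gen, h]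

theorem restr_toSlots (i : ℕ) (t : Tens k (Ch k g) i) :
    restr (· ≤ i) (toSlots i t) = toSlots i t := by
  refine DFunLike.congr_fun (f := (restr (· ≤ i)).toLinearMap ∘ₗ toSlots i) (g := toSlots i)
    (PiTensorProduct.ext (MultilinearMap.ext fun a => ?_)) t
  simp only [LinearMap.compMultilinearMap_apply, LinearMap.comp_apply, toSlots_tprod,
    AlgHom.toLinearMap_apply, algHom_prod_ofFn]
  congr 2
  funext l
  exact restr_slot_of_mem (· ≤ i) (Nat.le_of_lt_succ l.isLt) _

/-- Multiplication by the generator `v` in slot `l`, on tensors, with Koszul sign. -/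
def tensMul (i : ℕ) (l : Fin (i + 1)) : Module.Dual k g →ₗ[k] Module.End k (Tens k (Ch k g) i) :=
  (PiTensorProduct.mapMultilinear k (fun _ : Fin (i + 1) => Ch k g) (fun _ => Ch k g)).toLinearMap
    (fun r => if r < l then (parity k g).toLinearMap else LinearMap.id) l ∘ₗ
    (LinearMap.mul k (Ch k g)) ∘ₗ ExteriorAlgebra.ι k

theorem tensMul_tprod (i : ℕ) (l : Fin (i + 1)) (v : Module.Dual k g) (a : Fin (i + 1) → Ch k g) :
    tensMul i l v (PiTensorProduct.tprod k a) = PiTensorProduct.tprod k fun r =>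
      if r < l then parity k g (a r) else if r = l then ExteriorAlgebra.ι k v * a r else a r := by
  simp only [tensMul, LinearMap.comp_apply, MultilinearMap.toLinearMap_apply,
    PiTensorProduct.mapMultilinear_apply, PiTensorProduct.map_tprod]
  congr 1
  funext r
  rcases lt_trichotomy r l with h | h | h
  · simp [h, h.ne]
  · subst h
    simp
  · simp [h.not_gt, h.ne']

theorem tensMul_tensMul_lt (i : ℕ) {l l' : Fin (i + 1)} (h : l < l') (v v' : Module.Dual k g) :
    tensMul i l v * tensMul i l' v' + tensMul i l' v' * tensMul i l v = 0 := by
  refine PiTensorProduct.ext (MultilinearMap.ext fun a => ?_)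
  simp only [LinearMap.compMultilinearMap_apply, LinearMap.add_apply, Module.End.mul_apply,
    tensMul_tprod, LinearMap.zero_apply]
  set a' : Fin (i + 1) → Ch k g := fun r => if r < l then a r else if r = l then
    ExteriorAlgebra.ι k v * parity k g (a r) else if r < l' then parity k g (a r) else
      if r = l' then ExteriorAlgebra.ι k v' * a r else a r with ha'
  have e1 : (fun r => if r < l then parity k g (if r < l' then parity k g (a r) else
      if r = l' then ExteriorAlgebra.ι k v' * a r else a r) else if r = l then
        ExteriorAlgebra.ι k v * (if r < l' then parity k g (a r) else
          if r = l' then ExteriorAlgebra.ι k v' * a r else a r) else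
        if r < l' then parity k g (a r) else
          if r = l' then ExteriorAlgebra.ι k v' * a r else a r) = Function.update a' l (a' l) := by
    funext r
    rw [Function.update_eq_self]
    simp only [ha']
    by_cases h1 : r < l
    · simp only [h1, h1.trans h, if_true]
      exact sgn_sgn _
    · by_cases h2 : r = l
      · subst h2
        simp [h]
      · simp [h1, h2]
  have e2 : (fun r => if r < l' then parity k g (if r < l then parity k g (a r) else
      if r = l then ExteriorAlgebra.ι k v * a r else a r) else if r = l' then
        ExteriorAlgebra.ι k v' * (if r < l then parity k g (a r) else
          if r = l then ExteriorAlgebra.ι k v * a r else a r) else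
        if r < l then parity k g (a r) else
          if r = l then ExteriorAlgebra.ι k v * a r else a r) =
      Function.update a' l ((-1 : k) • a' l) := by
    funext r
    by_cases h2 : r = l
    · subst h2
      simp [h, ha', parity]
    · rw [Function.update_of_ne h2]
      simp only [ha']
      by_cases h1 : r < l
      · simp only [h1, h1.trans h, if_true]
        exact sgn_sgn _
      · simp only [h1, h2, if_false]
  rw [e1, e2, MultilinearMap.map_update_smul]
  simp

theorem tensMul_tensMul_self (i : ℕ) (l : Fin (i + 1)) (v v' : Module.Dual k g) :
    tensMul i l v * tensMul i l v' + tensMul i l v' * tensMul i l v = 0 := by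
  refine PiTensorProduct.ext (MultilinearMap.ext fun a => ?_)
  simp only [LinearMap.compMultilinearMap_apply, LinearMap.add_apply, Module.End.mul_apply,
    tensMul_tprod, LinearMap.zero_apply]
  have e : ∀ v v' : Module.Dual k g, (fun r => if r < l then parity k g (if r < l then
      parity k g (a r) else if r = l then ExteriorAlgebra.ι k v' * a r else a r) else
        if r = l then ExteriorAlgebra.ι k v * (if r < l then
      parity k g (a r) else if r = l then ExteriorAlgebra.ι k v' * a r else a r) else
      if r < l then parity k g (a r) else if r = l then ExteriorAlgebra.ι k v' * a r else a r) =
      Function.update a l (ExteriorAlgebra.ι k v * (ExteriorAlgebra.ι k v' * a l)) := by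
    intro v v'
    funext r
    by_cases h2 : r = l
    · subst h2
      simp
    · rw [Function.update_of_ne h2]
      by_cases h1 : r < l
      · simp only [h1, if_true]
        exact sgn_sgn _
      · simp only [h1, h2, if_false]
  rw [e, e, ← MultilinearMap.map_update_add]
  refine MultilinearMap.map_coord_zero _ l ?_
  rw [Function.update_self, ← mul_assoc, ← mul_assoc, ι_mul_ι_comm]
  simp

theorem tensMul_tensMul (i : ℕ) (l l' : Fin (i + 1)) (v v' : Module.Dual k g) :
    tensMul i l v * tensMul i l' v' + tensMul i l' v' * tensMul i l v = 0 := by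
  rcases lt_trichotomy l l' with h | h | h
  · exact tensMul_tensMul_lt i h v v'
  · subst h
    exact tensMul_tensMul_self i l v v'
  · exact (add_comm _ _).trans (tensMul_tensMul_lt i h v' v)

/-- The action of the generators of the algebra with slots on tensors; the slots that the tensors
do not have act by zero. -/
def slotsActGen (i : ℕ) : (ℕ →₀ Module.Dual k g) →ₗ[k] Module.End k (Tens k (Ch k g) i) :=
  Finsupp.lsum k fun l => if h : l < i + 1 then tensMul i ⟨l, h⟩ else 0

/-- The generators act by anticommuting operators, so that the action extends to the exterior algebra. -/
theorem slotsActGen_anticomm (i : ℕ) (w w' : ℕ →₀ Module.Dual k g) :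
    slotsActGen i w * slotsActGen i w' + slotsActGen i w' * slotsActGen i w = 0 := by
  induction w using Finsupp.induction_linear with
  | zero => simp
  | add w₁ w₂ h₁ h₂ =>
    rw [map_add, add_mul, mul_add, add_add_add_comm, h₁, h₂, add_zero]
  | single l v =>
    induction w' using Finsupp.induction_linear with
    | zero => simp
    | add w₁ w₂ h₁ h₂ =>
      rw [map_add, add_mul, mul_add, add_add_add_comm, h₁, h₂, add_zero]
    | single l' v' =>
      simp only [slotsActGen, Finsupp.lsum_single]
      split_ifs
      · exact tensMul_tensMul i _ _ v v'
      all_goals simp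

variable [CharZero k]

/-- The action of the algebra with slots on tensors by multiplication with Koszul signs. -/
def slotsAct (i : ℕ) : Slots k g →ₐ[k] Module.End k (Tens k (Ch k g) i) :=
  ExteriorAlgebra.lift k ⟨slotsActGen i, fun w => by
    have h := slotsActGen_anticomm i w w
    rw [← two_smul k] at h
    exact (smul_eq_zero.1 h).resolve_left two_ne_zero⟩

theorem slotsAct_gen (i : ℕ) (l : ℕ) (v : Module.Dual k g) :
    slotsAct i (gen l v) = if h : l < i + 1 then tensMul i ⟨l, h⟩ v else 0 := by
  rw [slotsAct, gen, ExteriorAlgebra.lift_ι_apply]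
  simp only [slotsActGen, Finsupp.lsum_single]
  split_ifs <;> rfl

/-- The retraction of the algebra with slots onto tensors. -/
def ofSlots (i : ℕ) : Slots k g →ₗ[k] Tens k (Ch k g) i :=
  LinearMap.applyₗ (PiTensorProduct.tprod k fun _ => 1) ∘ₗ (slotsAct i).toLinearMap

theorem ofSlots_one (i : ℕ) :
    ofSlots i (1 : Slots k g) = PiTensorProduct.tprod k fun _ => (1 : Ch k g) := by
  simp [ofSlots]

theorem ofSlots_mul (i : ℕ) (x y : Slots k g) : ofSlots i (x * y) = slotsAct i x (ofSlots i y) := by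
  simp [ofSlots]

theorem toSlots_tensMul (i : ℕ) (l : Fin (i + 1)) (v : Module.Dual k g) (t : Tens k (Ch k g) i) :
    toSlots i (tensMul i l v t) = gen l v * toSlots i t := by
  refine DFunLike.congr_fun (f := toSlots i ∘ₗ tensMul i l v)
    (g := LinearMap.mulLeft k (gen (l : ℕ) v) ∘ₗ toSlots i)
    (PiTensorProduct.ext (MultilinearMap.ext fun a => ?_)) t
  simp only [LinearMap.compMultilinearMap_apply, LinearMap.comp_apply, toSlots_tprod,
    tensMul_tprod, LinearMap.mulLeft_apply]
  have key : ∀ {n : ℕ} (s : Fin n → ℕ) (l : Fin n) (a : Fin n → Ch k g),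
      (List.ofFn fun j => slot (s j) (if j < l then parity k g (a j) else
        if j = l then ExteriorAlgebra.ι k v * a j else a j)).prod =
      gen (s l) v * (List.ofFn fun j => slot (s j) (a j)).prod := by
    intro n
    induction n with
    | zero => exact fun _ l => l.elim0
    | succ n ih =>
      intro s l a
      rw [List.ofFn_succ, List.prod_cons, List.ofFn_succ, List.prod_cons]
      refine Fin.cases ?_ (fun l' => ?_) l
      · simp [slot_ι, mul_assoc]
      · simp only [Fin.succ_pos, if_true, Fin.succ_lt_succ_iff, Fin.succ_inj]
        rw [ih (fun j => s j.succ) l' (fun j => a j.succ), ← mul_assoc, ← mul_assoc, gen, mul_ι,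
          sgn_slot]
        congr 3
        exact sgn_sgn _
  exact key (fun j => (j : ℕ)) l a

theorem toSlots_slotsAct (i : ℕ) (x : Slots k g) (t : Tens k (Ch k g) i) :
    toSlots i (slotsAct i x t) = restr (· ≤ i) x * toSlots i t := by
  refine slotsInduction (C := fun x => ∀ t, toSlots i (slotsAct i x t) =
    restr (· ≤ i) x * toSlots i t) ?_ ?_ ?_ ?_ x t
  · simp
  · intro x y hx hy t
    simp [hx, hy, add_mul]
  · intro c x hx t
    simp [hx]
  · intro l v x hx t
    rw [map_mul, map_mul, Module.End.mul_apply, slotsAct_gen, restr_gen]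
    by_cases h : l ≤ i
    · rw [dif_pos (Nat.lt_succ_of_le h), if_pos h, toSlots_tensMul, hx, mul_assoc]
    · rw [dif_neg (by omega), if_neg h]
      simp

theorem toSlots_ofSlots (i : ℕ) (x : Slots k g) : toSlots i (ofSlots i x) = restr (· ≤ i) x := by
  have h1 : toSlots i (PiTensorProduct.tprod k fun _ => (1 : Ch k g)) = 1 := by
    rw [toSlots_tprod]
    simp
  have := toSlots_slotsAct i x (PiTensorProduct.tprod k fun _ => (1 : Ch k g))
  rw [h1, mul_one] at this
  exact this

/-- The Koszul signs disappear when everything to the left of the slot is `1`. -/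
theorem slotsAct_slot_tprod (i : ℕ) (l : Fin (i + 1)) (a : Ch k g) (u : Fin (i + 1) → Ch k g)
    (hu : ∀ r, r < l → u r = 1) : slotsAct i (slot l a) (PiTensorProduct.tprod k u) =
      PiTensorProduct.tprod k (Function.update u l (a * u l)) := by
  refine extInduction (C := fun a => slotsAct i (slot l a) (PiTensorProduct.tprod k u) =
      PiTensorProduct.tprod k (Function.update u l (a * u l))) ?_ ?_ ?_ ?_ a
  · simp
  · intro x y hx hy
    rw [map_add, map_add, LinearMap.add_apply, hx, hy, add_mul, MultilinearMap.map_update_add]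
  · intro c x hx
    rw [map_smul, map_smul, LinearMap.smul_apply, hx, smul_mul_assoc,
      MultilinearMap.map_update_smul]
  · intro v x hx
    rw [map_mul, map_mul, Module.End.mul_apply, hx, slot_ι, slotsAct_gen, dif_pos l.isLt,
      tensMul_tprod]
    congr 1
    funext r
    rcases lt_trichotomy r l with h | h | h
    · simp [h, h.ne, hu r h, parity]
    · subst h
      simp [mul_assoc]
    · simp [h.not_gt, h.ne']

theorem ofSlots_surjective (i : ℕ) : Function.Surjective (ofSlots (k := k) (g := g) i) := by
  rw [← LinearMap.range_eq_top, eq_top_iff, ← PiTensorProduct.span_tprod_eq_top,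
    Submodule.span_le]
  rintro _ ⟨a, rfl⟩
  have key : ∀ m ≤ i + 1, PiTensorProduct.tprod k (fun r : Fin (i + 1) =>
      if (r : ℕ) < i + 1 - m then (1 : Ch k g) else a r) ∈
        LinearMap.range (ofSlots (k := k) (g := g) i) := by
    intro m
    induction m with
    | zero =>
      intro _
      refine ⟨1, ?_⟩
      rw [ofSlots_one]
      congr 1
      funext r
      simp [r.isLt]
    | succ m ih =>
      intro hm
      obtain ⟨x, hx⟩ := ih (by omega)
      set l : Fin (i + 1) := ⟨i - m, by omega⟩ with hl
      refine ⟨slot l (a l) * x, ?_⟩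
      rw [ofSlots_mul, hx, slotsAct_slot_tprod]
      · congr 1
        funext r
        by_cases h : r = l
        · subst h
          simp [hl]
          omega
        · rw [Function.update_of_ne h]
          have h' : (r : ℕ) ≠ i - m := fun h' => h (Fin.ext h')
          have : ((r : ℕ) < i + 1 - m) ↔ ((r : ℕ) < i + 1 - (m + 1)) := by omega
          simp only [this]
      · intro r hr
        rw [if_pos]
        have : (r : ℕ) < i - m := hr
        omega
  simpa using key (i + 1) le_rfl

theorem restr_restr (s t : ℕ → Prop) [DecidablePred s] [DecidablePred t] (x : Slots k g) :
    restr s (restr t x) = restr (fun l => s l ∧ t l) x := by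
  refine DFunLike.congr_fun (f := (restr s).comp (restr t)) (g := restr (fun l => s l ∧ t l))
    (slotsAlgHom_ext fun l v => ?_) x
  simp only [AlgHom.comp_apply, restr_gen]
  by_cases h : t l <;> by_cases h' : s l <;> simp [restr_gen, h, h']

theorem ofSlots_restr (i : ℕ) (x : Slots k g) : ofSlots i (restr (· ≤ i) x) = ofSlots i x := by
  refine DFunLike.congr_fun (f := ofSlots i ∘ₗ (restr (· ≤ i)).toLinearMap) (g := ofSlots i)
    (slotsHom_ext ?_ fun l v x hx => ?_) x
  · simp
  · simp only [LinearMap.comp_apply, AlgHom.toLinearMap_apply] at hx ⊢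
    rw [map_mul, ofSlots_mul, hx, ofSlots_mul, restr_gen]
    split_ifs with h
    · rfl
    · rw [slotsAct_gen, dif_neg (by omega)]
      simp

theorem ofSlots_toSlots (i : ℕ) (t : Tens k (Ch k g) i) : ofSlots i (toSlots i t) = t := by
  obtain ⟨x, rfl⟩ := ofSlots_surjective i t
  rw [toSlots_ofSlots, ofSlots_restr]

theorem toSlots_injective (i : ℕ) : Function.Injective (toSlots (k := k) (g := g) i) :=
  Function.LeftInverse.injective (ofSlots_toSlots i)

end TensorSlots

/-! ### The Hochschild and Chevalley–Eilenberg differentials on slots -/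

section Differentials

variable {k : Type*} [Field k] {g : Type*} [LieRing g] [LieAlgebra k g]

/-- The map of slots underlying the `p`-th face: for `p ≤ i` it merges the slots `p` and `p + 1`,
for `p = i + 1` the slots `i + 1` and `0`. -/
def faceIdx (i p : ℕ) (l : ℕ) : ℕ :=
  if p ≤ i then (if l ≤ p then l else l - 1) else
    (if l ≤ i then l else if l = i + 1 then 0 else l - 1)

/-- The map of slots underlying the cyclic rotation of `i + 1` slots. -/
def rotIdx (i : ℕ) (l : ℕ) : ℕ := if l < i then l + 1 else if l = i then 0 else l

/-- The simplicial identities of the faces. -/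
theorem faceIdx_comp (i p q : ℕ) (hpq : p < q) (hq : q ≤ i + 2) :
    faceIdx i p ∘ faceIdx (i + 1) q = faceIdx i (q - 1) ∘ faceIdx (i + 1) p := by
  funext l
  simp only [Function.comp_apply, faceIdx]
  grind

theorem toSlots_face (i : ℕ) (j : Fin (i + 1)) (t : Tens k (Ch k g) (i + 1)) :
    toSlots i (face (chMul k g) j t) = relabel (faceIdx i j) (toSlots (i + 1) t) := by
  refine DFunLike.congr_fun (f := toSlots i ∘ₗ face (chMul k g) j)
    (g := (relabel (faceIdx i j)).toLinearMap ∘ₗ toSlots (i + 1))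
    (PiTensorProduct.ext (MultilinearMap.ext fun a => ?_)) t
  simp only [LinearMap.compMultilinearMap_apply, LinearMap.comp_apply, toSlots_tprod,
    AlgHom.toLinearMap_apply, algHom_prod_ofFn, face_tprod, relabel_slot]
  rw [← prod_ofFn_contractNth j]
  congr 2
  funext r
  have hj : (j : ℕ) ≤ i := Nat.le_of_lt_succ j.isLt
  rcases lt_trichotomy (r : ℕ) j with h | h | h
  · rw [Fin.contractNth_apply_of_lt _ _ _ _ (by simpa using h),
      Fin.contractNth_apply_of_lt _ _ _ _ (by simpa using h)]
    simp [faceIdx, hj, h.le]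
  · have : r = j := Fin.ext h
    subst this
    rw [Fin.contractNth_apply_of_eq _ _ _ _ (by simp),
      Fin.contractNth_apply_of_eq _ _ _ _ (by simp)]
    simp [faceIdx, hj, chMul]
  · rw [Fin.contractNth_apply_of_gt _ _ _ _ (by simpa using h),
      Fin.contractNth_apply_of_gt _ _ _ _ (by simpa using h)]
    have : ¬ (r : ℕ) + 1 ≤ j := by omega
    simp [faceIdx, hj, this]

/-- The Koszul sign of the cyclic rotation, in terms of the parity projections. -/
theorem even_add_odd_mul [CharZero k] {M : Type*} [AddCommGroup M] [Module k M]
    (x y : ExteriorAlgebra k M) :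
    x * y = ((2⁻¹ : k) • (y + sgn y)) * x + ((2⁻¹ : k) • (y - sgn y)) * sgn x := by
  have he : sgn ((2⁻¹ : k) • (y + sgn y)) = (2⁻¹ : k) • (y + sgn y) := by
    rw [map_smul, map_add, sgn_sgn, add_comm]
  have ho : sgn ((2⁻¹ : k) • (y - sgn y)) = -((2⁻¹ : k) • (y - sgn y)) := by
    rw [map_smul, map_sub, sgn_sgn, ← smul_neg, neg_sub]
  rw [even_mul_comm he, odd_mul_comm ho, sgn_sgn, ← mul_add, ← smul_add]
  congr 1
  rw [add_add_sub_cancel, ← two_smul k, smul_smul, inv_mul_cancel₀ two_ne_zero, one_smul]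

/-- On slots, the cyclic rotation is a relabelling without signs. -/
theorem toSlots_rotate [CharZero k] (i : ℕ) (t : Tens k (Ch k g) i) :
    toSlots i (rotate (parity k g) i t) = relabel (rotIdx i) (toSlots i t) := by
  refine DFunLike.congr_fun (f := toSlots i ∘ₗ rotate (parity k g) i)
    (g := (relabel (rotIdx i)).toLinearMap ∘ₗ toSlots i)
    (PiTensorProduct.ext (MultilinearMap.ext fun a => ?_)) t
  simp only [LinearMap.compMultilinearMap_apply, LinearMap.comp_apply, toSlots_tprod,
    AlgHom.toLinearMap_apply, algHom_prod_ofFn, rotate_tprod, relabel_slot, map_add]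
  cases i with
  | zero =>
    have h : (finRotate (0 + 1)).symm (0 : Fin 1) = Fin.last 0 := Subsingleton.elim (α := Fin 1) _ _
    simp only [List.ofFn_succ, List.ofFn_zero, List.prod_cons, List.prod_nil, mul_one]
    rw [← map_add, h, if_pos rfl, if_pos rfl, ← LinearMap.add_apply]
    have h2 : evenPart (parity k g) + oddPart (parity k g) = LinearMap.id := by
      rw [evenPart, oddPart, ← smul_add, add_add_sub_cancel, ← two_smul k, smul_smul,
        inv_mul_cancel₀ two_ne_zero, one_smul]
    rw [h2]
    simp [rotIdx]
  | succ i =>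
    have e1 : (List.ofFn fun r : Fin (i + 1) => slot (r.succ : ℕ)
        ((if (finRotate (i + 1 + 1)).symm r.succ = Fin.last (i + 1) then evenPart (parity k g)
          else LinearMap.id) (a ((finRotate (i + 1 + 1)).symm r.succ)))).prod =
        (List.ofFn fun r : Fin (i + 1) =>
          slot (rotIdx (i + 1) (r.castSucc : ℕ)) (a r.castSucc)).prod := by
      congr 2
      funext r
      rw [finRotate_symm_succ', if_neg (Fin.castSucc_lt_last r).ne]
      simp [rotIdx, Nat.le_of_lt_succ r.isLt]
    have e2 : (List.ofFn fun r : Fin (i + 1) => slot (r.succ : ℕ)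
        ((if (finRotate (i + 1 + 1)).symm r.succ = Fin.last (i + 1) then oddPart (parity k g)
          else (parity k g).toLinearMap) (a ((finRotate (i + 1 + 1)).symm r.succ)))).prod =
        sgn (List.ofFn fun r : Fin (i + 1) =>
          slot (rotIdx (i + 1) (r.castSucc : ℕ)) (a r.castSucc)).prod := by
      rw [algHom_prod_ofFn]
      congr 2
      funext r
      rw [finRotate_symm_succ', if_neg (Fin.castSucc_lt_last r).ne, sgn_slot]
      simp [rotIdx, parity, Nat.le_of_lt_succ r.isLt]
    have hL : ∀ f : Fin (i + 1 + 1) → Slots k g,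
        (List.ofFn f).prod = f 0 * (List.ofFn fun r : Fin (i + 1) => f r.succ).prod := by
      intro f
      rw [List.ofFn_succ, List.prod_cons]
    have hR : ∀ f : Fin (i + 1 + 1) → Slots k g, (List.ofFn f).prod =
        (List.ofFn fun r : Fin (i + 1) => f r.castSucc).prod * f (Fin.last (i + 1)) := by
      intro f
      rw [List.ofFn_succ', List.prod_concat]
    refine (congrArg₂ (· + ·) (hL _) (hL _)).trans (Eq.trans ?_ (hR _).symm)
    rw [e1, e2]
    conv_rhs => rw [even_add_odd_mul]
    rw [finRotate_symm_zero', if_pos rfl, if_pos rfl, sgn_slot, ← map_add, ← map_sub,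
      ← map_smul, ← map_smul]
    simp [rotIdx, evenPart, oddPart, parity]

/-- The Hochschild operator `b` on slots. -/
def slotB (i : ℕ) : Slots k g →ₗ[k] Slots k g :=
  ∑ p ∈ Finset.range (i + 2), (-1 : k) ^ p • (relabel (faceIdx i p)).toLinearMap

theorem slotB_apply (i : ℕ) (x : Slots k g) :
    slotB i x = ∑ p ∈ Finset.range (i + 2), (-1 : k) ^ p • relabel (faceIdx i p) x := by
  simp [slotB, LinearMap.sum_apply]

/-- All faces of the Hochschild operator, the last one included, are relabellings of slots. -/
theorem toSlots_hochB [CharZero k] (i : ℕ) (t : Tens k (Ch k g) (i + 1)) :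
    toSlots i (hochB (parity k g) (chMul k g) i t) = slotB i (toSlots (i + 1) t) := by
  rw [slotB_apply, Finset.sum_range_succ, ← Fin.sum_univ_eq_sum_range
    (fun p => (-1 : k) ^ p • relabel (faceIdx i p) (toSlots (i + 1) t))]
  simp only [hochB, LinearMap.add_apply, LinearMap.sum_apply, LinearMap.smul_apply, map_add,
    map_sum, map_smul, toSlots_face, LinearMap.comp_apply, toSlots_rotate, relabel_relabel]
  congr 4
  funext l
  simp only [Function.comp_apply, faceIdx, rotIdx, Fin.val_zero]
  grind

/-- The cancellation behind `b² = 0`. -/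
theorem sum_faces_eq_zero {P : Type*} [AddCommGroup P] [Module k P] (n : ℕ) (F : ℕ → ℕ → P)
    (hF : ∀ p q, p < q → q ≤ n → F p q = F (q - 1) p) :
    ∑ p ∈ Finset.range n, ∑ q ∈ Finset.range (n + 1), (-1 : k) ^ (p + q) • F p q = 0 := by
  rw [← Finset.sum_product']
  refine Finset.sum_involution
    (fun x _ => if x.1 < x.2 then (x.2 - 1, x.1) else (x.2, x.1 + 1)) ?_ ?_ ?_ ?_
  · rintro ⟨p, q⟩ h
    simp only [Finset.mem_product, Finset.mem_range] at h
    dsimp only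
    split_ifs with hpq
    · dsimp only
      rw [hF p q hpq (by omega)]
      obtain ⟨q, rfl⟩ := Nat.exists_eq_succ_of_ne_zero (by omega : q ≠ 0)
      rw [Nat.succ_sub_one, ← _root_.add_smul, add_comm q p, Nat.add_succ, pow_succ]
      simp
    · dsimp only
      rw [hF q (p + 1) (by omega) (by omega), Nat.add_sub_cancel, ← _root_.add_smul, add_comm p q,
        ← add_assoc, pow_succ]
      simp
  · rintro ⟨p, q⟩ h _ heq
    dsimp only at heq
    split_ifs at heq with hpq
    · simp only [Prod.mk.injEq] at heq
      omega
    · simp only [Prod.mk.injEq] at heq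
      omega
  · rintro ⟨p, q⟩ h
    simp only [Finset.mem_product, Finset.mem_range] at h ⊢
    split_ifs with hpq
    · dsimp only
      omega
    · dsimp only
      omega
  · rintro ⟨p, q⟩ h
    by_cases hpq : p < q
    · simp only [if_pos hpq, if_neg (show ¬ q - 1 < p by omega)]
      exact Prod.ext rfl (by simp only; omega)
    · simp only [if_neg hpq, if_pos (show q < p + 1 by omega)]
      exact Prod.ext (by simp only; omega) rfl

theorem slotB_slotB (i : ℕ) (x : Slots k g) : slotB i (slotB (i + 1) x) = 0 := by
  simp only [slotB_apply, map_sum, map_smul, Finset.smul_sum, smul_smul, ← pow_add,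
    relabel_relabel]
  have h := sum_faces_eq_zero (k := k) (P := Slots k g) (i + 2)
    (fun p q => relabel (faceIdx i p ∘ faceIdx (i + 1) q) x)
    fun p q hpq hq => by
      rw [faceIdx_comp i p q hpq hq]
  rw [Finset.sum_comm]
  refine Eq.trans (Finset.sum_congr rfl fun p _ => Finset.sum_congr rfl fun q _ => ?_) h
  rw [add_comm q p]

variable {ι : Type*} [Fintype ι] (b : Module.Basis ι k g)

theorem chD_mul (x y : Ch k g) : chD b (x * y) = chD b x * y + sgn x * chD b y := by
  simp only [chD, LinearMap.smul_apply, LinearMap.sum_apply, LinearMap.comp_apply,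
    LinearMap.mulLeft_apply, smul_mul_assoc, mul_smul_comm, ← smul_add, Finset.sum_mul,
    Finset.mul_sum, ← Finset.sum_add_distrib]
  congr 1
  refine Finset.sum_congr rfl fun i _ => Finset.sum_congr rfl fun j _ => ?_
  have he : sgn (xi b i * xi b j) = xi b i * xi b j := by
    rw [map_mul, xi, xi, sgn_ι, sgn_ι, neg_mul_neg]
  change xi b i * xi b j * contr _ (x * y) = xi b i * xi b j * contr _ x * y +
    sgn x * (xi b i * xi b j * contr _ y)
  rw [contr_mul, mul_add, ← mul_assoc, ← mul_assoc, even_mul_comm he (sgn x), mul_assoc (sgn x)]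

theorem chD_ι (v : Module.Dual k g) : chD b (ExteriorAlgebra.ι k v) =
    (-2⁻¹ : k) • ∑ i, ∑ j, v ⁅b i, b j⁆ • (xi b i * xi b j) := by
  simp only [chD, LinearMap.smul_apply, LinearMap.sum_apply, LinearMap.comp_apply,
    LinearMap.mulLeft_apply]
  congr 1
  refine Finset.sum_congr rfl fun i _ => Finset.sum_congr rfl fun j _ => ?_
  change _ * contr _ _ = _
  rw [contr_ι, Module.Dual.eval_apply, ← Algebra.commutes, ← Algebra.smul_def]

theorem sgn_chD_ι (v : Module.Dual k g) :
    sgn (chD b (ExteriorAlgebra.ι k v)) = chD b (ExteriorAlgebra.ι k v) := by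
  simp only [chD_ι, map_smul, map_sum, map_mul, xi, sgn_ι, neg_mul_neg]

/-- The Jacobi identity. -/
theorem chD_chD_ι [CharZero k] (v : Module.Dual k g) :
    chD b (chD b (ExteriorAlgebra.ι k v)) = 0 := by
  have h1 : chD b (chD b (ExteriorAlgebra.ι k v)) =
      -∑ i, ∑ j, v ⁅b i, b j⁆ • (chD b (xi b i) * xi b j) := by
    have hswap : ∑ i, ∑ j, v ⁅b i, b j⁆ • (xi b i * chD b (xi b j)) =
        -∑ i, ∑ j, v ⁅b i, b j⁆ • (chD b (xi b i) * xi b j) := by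
      rw [Finset.sum_comm, ← Finset.sum_neg_distrib]
      refine Finset.sum_congr rfl fun i _ => ?_
      rw [← Finset.sum_neg_distrib]
      refine Finset.sum_congr rfl fun j _ => ?_
      rw [← lie_skew, map_neg, neg_smul, xi, xi, even_mul_comm (sgn_chD_ι b _)]
    rw [chD_ι]
    simp only [map_smul, map_sum, chD_mul, smul_add, Finset.sum_add_distrib]
    have hs : ∀ i j, v ⁅b i, b j⁆ • (sgn (xi b i) * chD b (xi b j)) =
        -(v ⁅b i, b j⁆ • (xi b i * chD b (xi b j))) := by
      intro i j
      rw [xi, sgn_ι, neg_mul, smul_neg]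
    simp only [hs, Finset.sum_neg_distrib]
    rw [hswap, neg_neg, ← two_smul k, smul_smul]
    have h2 : (2 : k) * -2⁻¹ = -1 := by
      rw [mul_neg, mul_inv_cancel₀ two_ne_zero]
    rw [h2, neg_one_smul]
  have h2 : ∑ i, ∑ j, v ⁅b i, b j⁆ • (chD b (xi b i) * xi b j) = (-2⁻¹ : k) •
      ∑ p, ∑ q, ∑ j, v ⁅⁅b p, b q⁆, b j⁆ • (xi b p * xi b q * xi b j) := by
    have h3 : ∀ i j, v ⁅b i, b j⁆ • (chD b (xi b i) * xi b j) = (-2⁻¹ : k) • ∑ p, ∑ q,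
        (b.coord i ⁅b p, b q⁆ * v ⁅b i, b j⁆) • (xi b p * xi b q * xi b j) := by
      intro i j
      rw [xi, chD_ι, smul_mul_assoc, smul_comm]
      congr 1
      simp only [Finset.sum_mul, Finset.smul_sum, smul_mul_assoc, smul_smul, mul_comm]
    simp only [h3, ← Finset.smul_sum]
    congr 1
    have h4 : ∀ p q j, v ⁅⁅b p, b q⁆, b j⁆ = ∑ i, b.coord i ⁅b p, b q⁆ * v ⁅b i, b j⁆ := by
      intro p q j
      conv_lhs => rw [← b.sum_repr ⁅b p, b q⁆]
      simp only [sum_lie, smul_lie, map_sum, map_smul, smul_eq_mul,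
        Module.Basis.coord_apply]
    simp only [h4, Finset.sum_smul]
    rw [Finset.sum_comm]
    rw [Finset.sum_congr rfl fun j _ => Finset.sum_comm]
    rw [Finset.sum_comm]
    refine Finset.sum_congr rfl fun p _ => ?_
    rw [Finset.sum_congr rfl fun j _ => Finset.sum_comm]
    rw [Finset.sum_comm]
  have h3 : ∑ p, ∑ q, ∑ j, v ⁅⁅b p, b q⁆, b j⁆ • (xi b p * xi b q * xi b j) = 0 := by
    set S := ∑ p, ∑ q, ∑ j, v ⁅⁅b p, b q⁆, b j⁆ • (xi b p * xi b q * xi b j) with hS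
    have hc : ∀ p q j, xi b p * xi b q * xi b j = xi b q * xi b j * xi b p := by
      intro p q j
      have he : sgn (xi b q * xi b j) = xi b q * xi b j := by
        rw [map_mul, xi, xi, sgn_ι, sgn_ι, neg_mul_neg]
      rw [even_mul_comm he, mul_assoc]
    have e1 : S = ∑ p, ∑ q, ∑ j, v ⁅⁅b j, b p⁆, b q⁆ • (xi b p * xi b q * xi b j) := by
      rw [hS]
      rw [Finset.sum_comm, Finset.sum_congr rfl fun q _ => Finset.sum_comm]
      refine Finset.sum_congr rfl fun q _ => Finset.sum_congr rfl fun j _ =>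
        Finset.sum_congr rfl fun p _ => ?_
      rw [hc]
    have e2 : S = ∑ p, ∑ q, ∑ j, v ⁅⁅b q, b j⁆, b p⁆ • (xi b p * xi b q * xi b j) := by
      rw [e1]
      rw [Finset.sum_comm, Finset.sum_congr rfl fun q _ => Finset.sum_comm]
      refine Finset.sum_congr rfl fun q _ => Finset.sum_congr rfl fun j _ =>
        Finset.sum_congr rfl fun p _ => ?_
      rw [hc]
    have e3 : (3 : k) • S = 0 := by
      have : (3 : k) • S = S + S + S := by
        rw [show (3 : k) = 1 + 1 + 1 by norm_num, _root_.add_smul, _root_.add_smul, one_smul]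
      rw [this]
      nth_rewrite 2 [e1]
      nth_rewrite 2 [e2]
      rw [hS]
      simp only [← Finset.sum_add_distrib, ← _root_.add_smul, ← map_add]
      refine Finset.sum_eq_zero fun p _ => Finset.sum_eq_zero fun q _ =>
        Finset.sum_eq_zero fun j _ => ?_
      have : ⁅⁅b p, b q⁆, b j⁆ + ⁅⁅b j, b p⁆, b q⁆ + ⁅⁅b q, b j⁆, b p⁆ = 0 := by
        have := lie_jacobi (b p) (b q) (b j)
        rw [← lie_skew (b p) ⁅b q, b j⁆, ← lie_skew (b q) ⁅b j, b p⁆,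
          ← lie_skew (b j) ⁅b p, b q⁆, ← neg_add, ← neg_add, neg_eq_zero] at this
        rw [← this]
        abel
      rw [this]
      simp
    exact (smul_eq_zero.1 e3).resolve_left (by norm_num)
  rw [h1, h2, h3]
  simp

/-- The Chevalley–Eilenberg differential of all slots. -/
def slotD : Slots k g →ₗ[k] Slots k g :=
  oddDer (Finsupp.lsum k fun l => (slot l).toLinearMap ∘ₗ chD b ∘ₗ ExteriorAlgebra.ι k) fun w => by
    induction w using Finsupp.induction_linear with
    | zero => simp
    | add w w' h h' => rw [map_add, map_add, h, h']
    | single l v => simp [sgn_slot, sgn_chD_ι]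

theorem slotD_gen_mul (l : ℕ) (v : Module.Dual k g) (x : Slots k g) :
    slotD b (gen l v * x) = slot l (chD b (ExteriorAlgebra.ι k v)) * x - gen l v * slotD b x := by
  rw [slotD, gen, oddDer_ι_mul]
  simp

theorem slotD_mul (x y : Slots k g) : slotD b (x * y) = slotD b x * y + sgn x * slotD b y :=
  oddDer_mul _ _ x y

theorem slotD_one : slotD b 1 = 0 := oddDer_one _ _

theorem slotD_slot (l : ℕ) (a : Ch k g) : slotD b (slot l a) = slot l (chD b a) := by
  refine DFunLike.congr_fun (f := slotD b ∘ₗ (slot l).toLinearMap)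
    (g := (slot l).toLinearMap ∘ₗ chD b) (extHom_ext ?_ ?_) a
  · simp [slotD_one, chD_one]
  · intro v x hx
    simp only [LinearMap.comp_apply, AlgHom.toLinearMap_apply] at hx ⊢
    rw [map_mul, slot_ι, slotD_gen_mul, hx, chD_mul, map_add, map_mul, map_mul, sgn_ι, map_neg,
      slot_ι, neg_mul, sub_eq_add_neg]

theorem slotD_relabel (θ : ℕ → ℕ) (x : Slots k g) :
    slotD b (relabel θ x) = relabel θ (slotD b x) := by
  refine DFunLike.congr_fun (f := slotD b ∘ₗ (relabel θ).toLinearMap)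
    (g := (relabel θ).toLinearMap ∘ₗ slotD b) (slotsHom_ext ?_ ?_) x
  · simp [slotD_one]
  · intro l v x hx
    simp only [LinearMap.comp_apply, AlgHom.toLinearMap_apply] at hx ⊢
    rw [map_mul, relabel_gen, slotD_gen_mul, hx, slotD_gen_mul, map_sub, map_mul, map_mul,
      relabel_gen, relabel_slot]

theorem slotProd_slotD (x : Slots k g) : slotProd (slotD b x) = chD b (slotProd x) := by
  refine DFunLike.congr_fun (f := slotProd.toLinearMap ∘ₗ slotD b)
    (g := chD b ∘ₗ slotProd.toLinearMap) (slotsHom_ext ?_ ?_) x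
  · simp [slotD_one, chD_one]
  · intro l v x hx
    simp only [LinearMap.comp_apply, AlgHom.toLinearMap_apply] at hx ⊢
    rw [map_mul slotProd (gen l v), slotProd_gen, slotD_gen_mul, chD_mul, map_sub, map_mul, map_mul, hx,
      slotProd_gen, slotProd_slot, sgn_ι, neg_mul, sub_eq_add_neg]

theorem slotD_slotD [CharZero k] (x : Slots k g) : slotD b (slotD b x) = 0 := by
  refine DFunLike.congr_fun (f := slotD b ∘ₗ slotD b) (g := 0) (slotsHom_ext ?_ ?_) x
  · simp [slotD_one]
  · intro l v x hx
    simp only [LinearMap.comp_apply, LinearMap.zero_apply] at hx ⊢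
    rw [slotD_gen_mul, map_sub, slotD_mul, slotD_gen_mul, hx, slotD_slot, chD_chD_ι, sgn_slot,
      sgn_chD_ι]
    simp

theorem slotB_slotD (i : ℕ) (x : Slots k g) : slotB i (slotD b x) = slotD b (slotB i x) := by
  simp only [slotB_apply, map_sum, map_smul, slotD_relabel]

theorem toSlots_tensD (i : ℕ) (t : Tens k (Ch k g) i) :
    toSlots i (tensD (parity k g) (chD b) i t) = slotD b (toSlots i t) := by
  refine DFunLike.congr_fun (f := toSlots i ∘ₗ tensD (parity k g) (chD b) i)
    (g := slotD b ∘ₗ toSlots i)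
    (PiTensorProduct.ext (MultilinearMap.ext fun a => ?_)) t
  simp only [LinearMap.compMultilinearMap_apply, LinearMap.comp_apply, toSlots_tprod,
    tensD, LinearMap.sum_apply, PiTensorProduct.map_tprod, map_sum]
  rw [oddDerivation_prod_ofFn (slotD b) (slotD_one b) (slotD_mul b)]
  refine Finset.sum_congr rfl fun j _ => ?_
  congr 2
  funext l
  split_ifs
  · simp [sgn_slot, parity]
  · simp [slotD_slot]
  · simp

variable [CharZero k]

theorem hochB_hochB (i : ℕ) (t : Tens k (Ch k g) (i + 2)) :
    hochB (parity k g) (chMul k g) i (hochB (parity k g) (chMul k g) (i + 1) t) = 0 := by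
  apply toSlots_injective
  rw [toSlots_hochB, toSlots_hochB, slotB_slotB, map_zero]

theorem hochB_tensD (i : ℕ) (t : Tens k (Ch k g) (i + 1)) :
    hochB (parity k g) (chMul k g) i (tensD (parity k g) (chD b) (i + 1) t) =
      tensD (parity k g) (chD b) i (hochB (parity k g) (chMul k g) i t) := by
  apply toSlots_injective
  rw [toSlots_hochB, toSlots_tensD, toSlots_tensD, toSlots_hochB, slotB_slotD]

theorem tensD_tensD (i : ℕ) (t : Tens k (Ch k g) i) :
    tensD (parity k g) (chD b) i (tensD (parity k g) (chD b) i t) = 0 := by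
  apply toSlots_injective
  rw [toSlots_tensD, toSlots_tensD, slotD_slotD, map_zero]

/-- The Hochschild operator on normalized chains. -/
def nB (i : ℕ) : NTens k (Ch k g) (i + 1) →ₗ[k] NTens k (Ch k g) i :=
  Submodule.mapQ _ _ (hochB (parity k g) (chMul k g) i) (hochB_degenerate _ _ chMul_unit i)

/-- The Chevalley–Eilenberg operator on normalized chains, without sign. -/
def nD (i : ℕ) : NTens k (Ch k g) i →ₗ[k] NTens k (Ch k g) i :=
  Submodule.mapQ _ _ (tensD (parity k g) (chD b) i) (tensD_degenerate _ _ (chD_one b) i)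

theorem hochD_apply (c : Chains k (Ch k g)) (i : ℕ) :
    hochD b c i = nB i (c (i + 1)) + (-1 : k) ^ i • nD b i (c i) := rfl

theorem nB_nB (i : ℕ) (x : NTens k (Ch k g) (i + 2)) : nB i (nB (i + 1) x) = 0 := by
  obtain ⟨t, rfl⟩ := Submodule.Quotient.mk_surjective _ x
  simp only [nB, Submodule.mapQ_apply, hochB_hochB, Submodule.Quotient.mk_zero]

theorem nB_nD (i : ℕ) (x : NTens k (Ch k g) (i + 1)) :
    nB i (nD b (i + 1) x) = nD b i (nB i x) := by
  obtain ⟨t, rfl⟩ := Submodule.Quotient.mk_surjective _ x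
  simp only [nB, nD, Submodule.mapQ_apply, hochB_tensD]

theorem nD_nD (i : ℕ) (x : NTens k (Ch k g) i) : nD b i (nD b i x) = 0 := by
  obtain ⟨t, rfl⟩ := Submodule.Quotient.mk_surjective _ x
  simp only [nD, Submodule.mapQ_apply, tensD_tensD, Submodule.Quotient.mk_zero]

theorem hochD_hochD (c : Chains k (Ch k g)) : hochD b (hochD b c) = 0 := by
  funext i
  rw [hochD_apply, hochD_apply, hochD_apply, map_add, map_add, map_smul, map_smul, nB_nB, nB_nD,
    nD_nD, smul_zero, add_zero, zero_add, pow_succ, mul_neg_one, neg_smul]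
  exact neg_add_cancel _

end Differentials

/-! ### Power series with coefficients in a noncommutative algebra -/

section Series

variable {k : Type*} [Field k] {ι : Type*} {R S : Type*} [Ring R] [Algebra k R] [Ring S] [Algebra k S]

/-- The coefficientwise action of a linear map. -/
def cmap (T : R →ₗ[k] S) : MvPowerSeries ι R →ₗ[k] MvPowerSeries ι S where
  toFun ω := fun n => T (MvPowerSeries.coeff n ω)
  map_add' ω η := by funext n; exact map_add T _ _
  map_smul' c ω := by funext n; exact map_smul T c _

theorem coeff_cmap (T : R →ₗ[k] S) (ω : MvPowerSeries ι R) (n : ι →₀ ℕ) :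
    MvPowerSeries.coeff n (cmap T ω) = T (MvPowerSeries.coeff n ω) := rfl

theorem coeff_ksmul (c : k) (ω : MvPowerSeries ι R) (n : ι →₀ ℕ) :
    MvPowerSeries.coeff n (c • ω) = c • MvPowerSeries.coeff n ω := rfl

variable (k) in
/-- The partial derivative in the variable `i`. -/
def pdY (i : ι) : MvPowerSeries ι R →ₗ[k] MvPowerSeries ι R where
  toFun ω := fun n => ((n i : k) + 1) • MvPowerSeries.coeff (n + Finsupp.single i 1) ω
  map_add' ω η := by funext n; exact smul_add _ _ _
  map_smul' c ω := by funext n; exact smul_comm _ c _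

theorem coeff_pdY (i : ι) (ω : MvPowerSeries ι R) (n : ι →₀ ℕ) :
    MvPowerSeries.coeff n (pdY k i ω) =
      ((n i : k) + 1) • MvPowerSeries.coeff (n + Finsupp.single i 1) ω := rfl

/-- Multiplication by power series with central coefficients. -/
def mulS : MvPowerSeries ι k →ₐ[k] Module.End k (MvPowerSeries ι R) :=
  (Algebra.lmul k (MvPowerSeries ι R)).comp (MvPowerSeries.mapAlgHom (Algebra.ofId k R))

theorem mulS_apply (f : MvPowerSeries ι k) (ω : MvPowerSeries ι R) :
    mulS f ω = MvPowerSeries.map (algebraMap k R) f * ω := rfl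

open Classical in
theorem coeff_mulS (f : MvPowerSeries ι k) (ω : MvPowerSeries ι R) (n : ι →₀ ℕ) :
    MvPowerSeries.coeff n (mulS f ω) = ∑ p ∈ Finset.HasAntidiagonal.antidiagonal n,
      MvPowerSeries.coeff p.1 f • MvPowerSeries.coeff p.2 ω := by
  rw [mulS_apply, MvPowerSeries.coeff_mul]
  simp only [MvPowerSeries.coeff_map, Algebra.smul_def]

theorem cmap_mulS (T : R →ₗ[k] S) (f : MvPowerSeries ι k) (ω : MvPowerSeries ι R) :
    cmap T (mulS f ω) = mulS f (cmap T ω) := by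
  classical
  ext n
  simp only [coeff_cmap, coeff_mulS, map_sum, map_smul]

theorem cmap_pdY (T : R →ₗ[k] S) (i : ι) (ω : MvPowerSeries ι R) :
    cmap T (pdY k i ω) = pdY k i (cmap T ω) := by
  ext n
  simp only [coeff_cmap, coeff_pdY, map_smul]

/-- A shift of the summation index in the Cauchy product, for terms that vanish where the exponent of
the variable `i` is `0`. -/
theorem sum_antidiagonal_add_single {P : Type*} [AddCommMonoid P] (n : ι →₀ ℕ) (i : ι)
    [DecidableEq (ι →₀ ℕ)] [DecidableEq ι]
    (F : (ι →₀ ℕ) × (ι →₀ ℕ) → P) (hF : ∀ p, p.1 i = 0 → F p = 0) :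
    ∑ p ∈ Finset.HasAntidiagonal.antidiagonal (n + Finsupp.single i 1), F p =
      ∑ p ∈ Finset.HasAntidiagonal.antidiagonal n, F (p.1 + Finsupp.single i 1, p.2) := by
  symm
  refine Finset.sum_of_injOn (fun p => (p.1 + Finsupp.single i 1, p.2)) ?_ ?_ ?_ ?_
  · rintro ⟨a, b⟩ _ ⟨a', b'⟩ _ h
    simp only [Prod.mk.injEq, add_left_inj] at h
    exact Prod.ext h.1 h.2
  · rintro ⟨a, b⟩ h
    simp only [Finset.mem_coe, Finset.HasAntidiagonal.mem_antidiagonal] at h ⊢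
    rw [← h]
    abel
  · rintro ⟨a, b⟩ h h'
    refine hF _ ?_
    by_contra h0
    refine h' ⟨(a - Finsupp.single i 1, b), ?_, ?_⟩
    · simp only [Finset.mem_coe, Finset.HasAntidiagonal.mem_antidiagonal] at h ⊢
      have hle : Finsupp.single i 1 ≤ a := by
        rw [Finsupp.single_le_iff]
        exact Nat.one_le_iff_ne_zero.2 h0
      have : a - Finsupp.single i 1 + Finsupp.single i 1 = a := tsub_add_cancel_of_le hle
      refine add_right_cancel (b := Finsupp.single i 1) ?_
      rw [← h, add_right_comm, this]
    · have hle : Finsupp.single i 1 ≤ a := by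
        rw [Finsupp.single_le_iff]
        exact Nat.one_le_iff_ne_zero.2 h0
      exact Prod.ext (tsub_add_cancel_of_le hle) rfl
  · intro p _
    rfl

/-- The Leibniz rule. -/
theorem pdY_mulS (i : ι) (f : MvPowerSeries ι k) (ω : MvPowerSeries ι R) :
    pdY k i (mulS f ω) = mulS (pdY k i f) ω + mulS f (pdY k i ω) := by
  classical
  ext n
  rw [map_add, coeff_pdY, coeff_mulS, coeff_mulS, coeff_mulS, Finset.smul_sum]
  have h1 : ∀ p ∈ Finset.HasAntidiagonal.antidiagonal (n + Finsupp.single i 1),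
      ((n i : k) + 1) • MvPowerSeries.coeff p.1 f • MvPowerSeries.coeff p.2 ω =
      ((p.1 i : k) * MvPowerSeries.coeff p.1 f) • MvPowerSeries.coeff p.2 ω +
      ((p.2 i : k) * MvPowerSeries.coeff p.1 f) • MvPowerSeries.coeff p.2 ω := by
    intro p hp
    rw [Finset.HasAntidiagonal.mem_antidiagonal] at hp
    have : ((n i : k) + 1) = p.1 i + p.2 i := by
      have := DFunLike.congr_fun hp i
      simp only [Finsupp.add_apply, Finsupp.single_eq_same] at this
      exact_mod_cast congrArg (Nat.cast (R := k)) this.symm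
    rw [this, smul_smul, add_mul, _root_.add_smul]
  rw [Finset.sum_congr rfl h1, Finset.sum_add_distrib]
  congr 1
  · rw [sum_antidiagonal_add_single n i (fun p => ((p.1 i : k) * MvPowerSeries.coeff p.1 f) •
      MvPowerSeries.coeff p.2 ω) (fun p hp => by simp [hp])]
    refine Finset.sum_congr rfl fun p _ => ?_
    rw [coeff_pdY]
    simp
  · rw [← Finset.HasAntidiagonal.map_swap_antidiagonal, Finset.sum_map]
    simp only [Function.Embedding.coeFn_mk, Prod.fst_swap, Prod.snd_swap]
    rw [sum_antidiagonal_add_single n i (fun p => ((p.1 i : k) * MvPowerSeries.coeff p.2 f) •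
      MvPowerSeries.coeff p.1 ω) (fun p hp => by simp [hp])]
    conv_lhs => rw [← Finset.HasAntidiagonal.map_swap_antidiagonal, Finset.sum_map]
    simp only [Function.Embedding.coeFn_mk, Prod.fst_swap, Prod.snd_swap]
    refine Finset.sum_congr rfl fun p _ => ?_
    rw [coeff_pdY, smul_smul, Finsupp.add_apply, Finsupp.single_eq_same, Nat.cast_add,
      Nat.cast_one, mul_comm]

theorem pdY_pdY (i j : ι) (ω : MvPowerSeries ι R) : pdY k i (pdY k j ω) = pdY k j (pdY k i ω) := by
  classical
  ext n
  simp only [coeff_pdY, smul_smul, Finsupp.add_apply, Finsupp.single_apply]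
  by_cases h : i = j
  · subst h
    rfl
  · rw [if_neg h, if_neg (Ne.symm h), add_right_comm]
    simp [mul_comm]

theorem pdY_X [DecidableEq ι] (i j : ι) : pdY k i (MvPowerSeries.X j : MvPowerSeries ι k) =
    if i = j then 1 else 0 := by
  ext n
  rw [coeff_pdY, MvPowerSeries.coeff_X]
  by_cases h : i = j
  · subst h
    by_cases h0 : n = 0
    · subst h0
      simp
    · rw [if_neg (by simpa using h0), if_pos rfl, MvPowerSeries.coeff_one, if_neg h0, smul_zero]
  · rw [if_neg h, map_zero, if_neg, smul_zero]
    intro hn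
    have := DFunLike.congr_fun hn i
    simp [Ne.symm h] at this

/-- Constant series. -/
def cst : R →ₗ[k] MvPowerSeries ι R :=
  (MvPowerSeries.monomial (R := R) (0 : ι →₀ ℕ)).restrictScalars k

open Classical in
theorem coeff_cst (x : R) (n : ι →₀ ℕ) :
    MvPowerSeries.coeff n (cst (k := k) (ι := ι) x) = if n = 0 then x else 0 := by
  simp only [cst, LinearMap.coe_restrictScalars, MvPowerSeries.coeff_monomial]

theorem cmap_cst (T : R →ₗ[k] S) (x : R) : cmap T (cst (k := k) (ι := ι) x) = cst (k := k) (T x) := by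
  classical
  ext n
  rw [coeff_cmap, coeff_cst, coeff_cst]
  split_ifs <;> simp

theorem pdY_cst (i : ι) (x : R) : pdY k i (cst (k := k) x) = 0 := by
  classical
  ext n
  rw [coeff_pdY, coeff_cst, if_neg, smul_zero, map_zero]
  intro h
  simpa using DFunLike.congr_fun h i

/-- The series `ω` is homogeneous of degree `m` in the variables. -/
def IsHomog (m : ℕ) (ω : MvPowerSeries ι R) : Prop :=
  ∀ n : ι →₀ ℕ, n.degree ≠ m → MvPowerSeries.coeff n ω = 0

theorem isHomog_zero (m : ℕ) : IsHomog m (0 : MvPowerSeries ι R) := fun _ _ => map_zero _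

theorem isHomog_smul {m : ℕ} {ω : MvPowerSeries ι R} (h : IsHomog m ω) (c : k) :
    IsHomog m (c • ω) := fun n hn => by rw [coeff_ksmul, h n hn, smul_zero]

theorem isHomog_sum {α : Type*} {s : Finset α} {m : ℕ} {ω : α → MvPowerSeries ι R}
    (h : ∀ a ∈ s, IsHomog m (ω a)) : IsHomog m (∑ a ∈ s, ω a) := fun n hn => by
  rw [map_sum, Finset.sum_eq_zero fun a ha => h a ha n hn]

theorem isHomog_cmap {m : ℕ} {ω : MvPowerSeries ι R} (h : IsHomog m ω) (T : R →ₗ[k] S) :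
    IsHomog m (cmap T ω) := fun n hn => by rw [coeff_cmap, h n hn, map_zero]

theorem isHomog_mulS {m m' : ℕ} {f : MvPowerSeries ι k} {ω : MvPowerSeries ι R} (hf : IsHomog m f)
    (h : IsHomog m' ω) : IsHomog (m + m') (mulS f ω) := fun n hn => by
  classical
  rw [coeff_mulS]
  refine Finset.sum_eq_zero fun p hp => ?_
  rw [Finset.HasAntidiagonal.mem_antidiagonal] at hp
  by_cases h1 : p.1.degree = m
  · rw [h p.2 (fun h2 => hn (by rw [← hp, map_add, h1, h2])), smul_zero]
  · rw [hf p.1 h1, zero_smul]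

theorem isHomog_cst (x : R) : IsHomog 0 (cst (k := k) (ι := ι) x) := fun n hn => by
  classical
  rw [coeff_cst, if_neg]
  rintro rfl
  exact hn (map_zero _)

theorem isHomog_X (i : ι) : IsHomog 1 (MvPowerSeries.X i : MvPowerSeries ι k) := fun n hn => by
  classical
  rw [MvPowerSeries.coeff_X, if_neg]
  rintro rfl
  exact hn (Finsupp.degree_single _ _)

/-- The homogeneous component of degree `m`. -/
def homog (m : ℕ) : MvPowerSeries ι R →ₗ[k] MvPowerSeries ι R where
  toFun ω := fun n => (if n.degree = m then 1 else 0 : k) • MvPowerSeries.coeff n ω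
  map_add' ω η := by funext n; exact smul_add _ _ _
  map_smul' c ω := by funext n; exact smul_comm _ c _

theorem coeff_homog (m : ℕ) (ω : MvPowerSeries ι R) (n : ι →₀ ℕ) :
    MvPowerSeries.coeff n (homog (k := k) m ω) =
      if n.degree = m then MvPowerSeries.coeff n ω else 0 := by
  change (if n.degree = m then 1 else 0 : k) • MvPowerSeries.coeff n ω = _
  split_ifs <;> simp

theorem isHomog_homog (m : ℕ) (ω : MvPowerSeries ι R) : IsHomog m (homog (k := k) m ω) :=
  fun n hn => by rw [coeff_homog, if_neg hn]

/-- Power series are determined by their homogeneous components. -/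
theorem ext_homog {ω η : MvPowerSeries ι R} (h : ∀ m, homog (k := k) m ω = homog (k := k) m η) :
    ω = η := by
  ext n
  have := congrArg (MvPowerSeries.coeff n) (h n.degree)
  rwa [coeff_homog, coeff_homog, if_pos rfl, if_pos rfl] at this

theorem homog_of_isHomog {m : ℕ} {ω : MvPowerSeries ι R} (h : IsHomog m ω) :
    homog (k := k) m ω = ω := by
  ext n
  rw [coeff_homog]
  split_ifs with hn
  · rfl
  · rw [h n hn]

theorem homog_of_isHomog_ne {m m' : ℕ} {ω : MvPowerSeries ι R} (h : IsHomog m ω) (hm : m' ≠ m) :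
    homog (k := k) m' ω = 0 := by
  ext n
  rw [coeff_homog, map_zero]
  split_ifs with hn
  · exact h n (by omega)
  · rfl

theorem homog_cmap (m : ℕ) (T : R →ₗ[k] S) (ω : MvPowerSeries ι R) :
    homog (k := k) m (cmap T ω) = cmap T (homog (k := k) m ω) := by
  ext n
  rw [coeff_homog, coeff_cmap, coeff_cmap, coeff_homog]
  split_ifs <;> simp

theorem homog_pdY (m : ℕ) (i : ι) (ω : MvPowerSeries ι R) :
    homog (k := k) m (pdY k i ω) = pdY k i (homog (k := k) (m + 1) ω) := by
  ext n
  rw [coeff_homog, coeff_pdY, coeff_pdY, coeff_homog, map_add, Finsupp.degree_single]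
  by_cases h : n.degree = m
  · rw [if_pos h, if_pos (by omega)]
  · rw [if_neg h, if_neg (by omega), smul_zero]

theorem homog_mulS (m : ℕ) (f : MvPowerSeries ι k) (ω : MvPowerSeries ι R) :
    homog (k := k) m (mulS f ω) = ∑ p ∈ Finset.HasAntidiagonal.antidiagonal m,
      mulS (homog (k := k) p.1 f) (homog (k := k) p.2 ω) := by
  classical
  ext n
  rw [coeff_homog, map_sum]
  simp only [coeff_mulS]
  rw [Finset.sum_comm]
  split_ifs with hn
  · refine Finset.sum_congr rfl fun q hq => ?_
    rw [Finset.HasAntidiagonal.mem_antidiagonal] at hq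
    rw [Finset.sum_eq_single (q.1.degree, q.2.degree)]
    · simp only [coeff_homog, if_pos]
    · rintro ⟨a, b⟩ _ hne
      simp only [coeff_homog]
      by_cases h1 : q.1.degree = a
      · by_cases h2 : q.2.degree = b
        · exact absurd (Prod.ext h1.symm h2.symm) hne
        · rw [if_neg h2, smul_zero]
      · rw [if_neg h1, zero_smul]
    · intro h
      exact absurd (Finset.HasAntidiagonal.mem_antidiagonal.2 (by rw [← hn, ← hq, map_add])) h
  · symm
    refine Finset.sum_eq_zero fun q hq => Finset.sum_eq_zero fun p hp => ?_
    rw [Finset.HasAntidiagonal.mem_antidiagonal] at hq hp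
    simp only [coeff_homog]
    by_cases h1 : q.1.degree = p.1
    · by_cases h2 : q.2.degree = p.2
      · exact absurd (by rw [← hq, map_add, h1, h2, hp]) hn
      · rw [if_neg h2, smul_zero]
    · rw [if_neg h1, zero_smul]

theorem homog_X_mulS (m : ℕ) (i : ι) (ω : MvPowerSeries ι R) :
    homog (k := k) (m + 1) (mulS (MvPowerSeries.X i : MvPowerSeries ι k) ω) =
      mulS (MvPowerSeries.X i : MvPowerSeries ι k) (homog (k := k) m ω) := by
  rw [homog_mulS, Finset.sum_eq_single (1, m)]
  · rw [homog_of_isHomog (k := k) (isHomog_X i)]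
  · rintro ⟨a, b⟩ h hne
    rw [Finset.HasAntidiagonal.mem_antidiagonal] at h
    rw [homog_of_isHomog_ne (k := k) (isHomog_X i), map_zero, LinearMap.zero_apply]
    rintro rfl
    exact hne (Prod.ext rfl (by simp only at h ⊢; omega))
  · intro h
    exact absurd (Finset.HasAntidiagonal.mem_antidiagonal.2 (add_comm _ _)) h

end Series

/-! ### Commutation of the differentials with contractions and with the coadjoint action -/

section Commutation

variable {k : Type*} [Field k] {g : Type*} [LieRing g] [LieAlgebra k g]
  {ι : Type*} [Fintype ι] (b : Module.Basis ι k g)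

/-- Cartan's formula on generators. -/
theorem contr_chD_ι [CharZero k] (x : g) (v : Module.Dual k g) :
    contr (Module.Dual.eval k g x) (chD b (ExteriorAlgebra.ι k v)) =
      -∑ c, v ⁅x, b c⁆ • xi b c := by
  have h1 : ∀ i j, contr (Module.Dual.eval k g x) (xi b i * xi b j) =
      b.coord i x • xi b j - b.coord j x • xi b i := by
    intro i j
    rw [xi, xi, contr_ι_mul, contr_ι, Module.Dual.eval_apply, Module.Dual.eval_apply,
      ← Algebra.commutes, ← Algebra.smul_def]
  have h2 : ∀ j, v ⁅x, b j⁆ = ∑ i, b.coord i x * v ⁅b i, b j⁆ := by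
    intro j
    conv_lhs => rw [← b.sum_repr x]
    simp only [sum_lie, smul_lie, map_sum, map_smul, smul_eq_mul, Module.Basis.coord_apply]
  have h3 : ∑ i, ∑ j, (v ⁅b i, b j⁆ * b.coord i x) • xi b j = ∑ c, v ⁅x, b c⁆ • xi b c := by
    rw [Finset.sum_comm]
    refine Finset.sum_congr rfl fun j _ => ?_
    rw [h2, Finset.sum_smul]
    simp only [mul_comm]
  have h4 : ∑ i, ∑ j, (v ⁅b i, b j⁆ * b.coord j x) • xi b i = -∑ c, v ⁅x, b c⁆ • xi b c := by
    rw [← h3, Finset.sum_comm, ← Finset.sum_neg_distrib]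
    refine Finset.sum_congr rfl fun j _ => ?_
    rw [← Finset.sum_neg_distrib]
    refine Finset.sum_congr rfl fun i _ => ?_
    rw [← lie_skew, map_neg, neg_mul, neg_smul]
  rw [chD_ι]
  simp only [map_smul, map_sum, h1, smul_sub, smul_smul, Finset.sum_sub_distrib]
  rw [h3, h4, smul_neg, sub_neg_eq_add, ← two_smul k, smul_smul]
  have : (2 : k) * -2⁻¹ = -1 := by
    rw [mul_neg, mul_inv_cancel₀ two_ne_zero]
  rw [this, neg_one_smul]

/-- Cartan's formula: the commutator of `∂_x` and the differential is the coadjoint action of `x`. -/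
theorem dslot_slotD [CharZero k] (x : g) (l : ℕ) (y : Slots k g) :
    dslot x l (slotD b y) = -slotD b (dslot x l y) -
      ∑ c, gen l (b.coord c) * dslot ⁅x, b c⁆ l y := by
  refine DFunLike.congr_fun (f := dslot x l ∘ₗ slotD b) (g := -(slotD b ∘ₗ dslot x l) -
    ∑ c, LinearMap.mulLeft k (gen l (b.coord c)) ∘ₗ dslot ⁅x, b c⁆ l) (slotsHom_ext ?_ ?_) y
    |>.trans ?_
  · simp [slotD_one]
  · intro r v z hz
    simp only [LinearMap.comp_apply, LinearMap.sub_apply, LinearMap.neg_apply,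
      LinearMap.sum_apply, LinearMap.mulLeft_apply] at hz ⊢
    have h1 : dslot x l (slot r (chD b (ExteriorAlgebra.ι k v))) =
        -∑ c, (if r = l then v ⁅x, b c⁆ else 0) • gen l (b.coord c) := by
      rw [dslot_slot]
      split_ifs with h
      · subst h
        rw [contr_chD_ι]
        simp only [map_neg, map_sum, map_smul, xi, slot_ι]
      · simp
    have h2 : ∑ c, gen l (b.coord c) * dslot ⁅x, b c⁆ l (gen r v * z) =
        (∑ c, (if r = l then v ⁅x, b c⁆ else 0) • gen l (b.coord c)) * z -
          -(gen r v * ∑ c, gen l (b.coord c) * dslot ⁅x, b c⁆ l z) := by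
      rw [sub_neg_eq_add, Finset.sum_mul, Finset.mul_sum, ← Finset.sum_add_distrib]
      refine Finset.sum_congr rfl fun c _ => ?_
      rw [dslot_gen_mul, mul_sub, mul_smul_comm, smul_mul_assoc, ← mul_assoc, ← mul_assoc]
      rw [gen, gen, ι_mul_ι_comm, neg_mul, sub_neg_eq_add]
    rw [slotD_gen_mul, map_sub, dslot_mul, dslot_gen_mul, sgn_slot, sgn_chD_ι, hz, h1, h2,
      dslot_gen_mul, map_sub, map_smul, slotD_gen_mul, mul_sub, neg_mul, mul_neg]
    abel
  · simp [LinearMap.sum_apply]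

variable {R S : Type*} [Ring R] [Algebra k R] [Ring S] [Algebra k S]

/-- The coadjoint action on power series with arbitrary coefficients. -/
def cad (x : g) : MvPowerSeries ι R →ₗ[k] MvPowerSeries ι R :=
  -∑ i, ∑ j, b.coord i ⁅x, b j⁆ •
    ((mulS (MvPowerSeries.X j : MvPowerSeries ι k) : Module.End k (MvPowerSeries ι R)) ∘ₗ pdY k i)

theorem cad_apply (x : g) (ω : MvPowerSeries ι R) : cad b x ω =
    -∑ i, ∑ j, b.coord i ⁅x, b j⁆ • mulS (MvPowerSeries.X j : MvPowerSeries ι k) (pdY k i ω) := by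
  simp [cad, LinearMap.sum_apply]

theorem cad_mulS (x : g) (f : MvPowerSeries ι k) (ω : MvPowerSeries ι R) :
    cad b x (mulS f ω) = mulS (cad b x f) ω + mulS f (cad b x ω) := by
  simp only [cad_apply, pdY_mulS, map_add, smul_add, Finset.sum_add_distrib, neg_add, map_neg,
    map_sum, map_smul, LinearMap.neg_apply, LinearMap.sum_apply, LinearMap.smul_apply]
  congr 2
  · refine Finset.sum_congr rfl fun i _ => Finset.sum_congr rfl fun j _ => ?_
    rw [mulS_apply (R := k), Algebra.algebraMap_self, MvPowerSeries.map_id, RingHom.id_apply,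
      map_mul, Module.End.mul_apply]
  · refine Finset.sum_congr rfl fun i _ => Finset.sum_congr rfl fun j _ => ?_
    have h : mulS (R := R) (MvPowerSeries.X j) * mulS f = mulS f * mulS (MvPowerSeries.X j) := by
      rw [← map_mul, ← map_mul, mul_comm]
    exact congrArg _ (LinearMap.congr_fun h _)

theorem cmap_cad (T : R →ₗ[k] S) (x : g) (ω : MvPowerSeries ι R) :
    cmap T (cad b x ω) = cad b x (cmap T ω) := by
  simp only [cad_apply, map_neg, map_sum, map_smul, cmap_mulS, cmap_pdY]

theorem cad_cst (x : g) (y : R) : cad b x (cst (k := k) y) = 0 := by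
  simp [cad_apply, pdY_cst]

theorem homog_cad (m : ℕ) (x : g) (ω : MvPowerSeries ι R) :
    homog (k := k) m (cad b x ω) = cad b x (homog (k := k) m ω) := by
  simp only [cad_apply, map_neg, map_sum, map_smul]
  congr 1
  refine Finset.sum_congr rfl fun i _ => Finset.sum_congr rfl fun j _ => ?_
  congr 1
  cases m with
  | zero =>
    have h1 : homog (k := k) 0 (mulS (MvPowerSeries.X j : MvPowerSeries ι k) (pdY k i ω)) = 0 := by
      rw [homog_mulS]
      refine Finset.sum_eq_zero fun p hp => ?_
      rw [Finset.HasAntidiagonal.mem_antidiagonal] at hp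
      rw [homog_of_isHomog_ne (k := k) (isHomog_X j) (by omega), map_zero, LinearMap.zero_apply]
    have h2 : pdY k i (homog (k := k) 0 ω) = 0 := by
      ext n
      rw [coeff_pdY, coeff_homog, if_neg, smul_zero, map_zero]
      rw [map_add, Finsupp.degree_single]
      omega
    rw [h1, h2, map_zero]
  | succ m => rw [homog_X_mulS, homog_pdY]

theorem cad_smul (c : k) (x : g) : cad (R := R) b (c • x) = c • cad b x := by
  refine LinearMap.ext fun ω => ?_
  simp only [cad_apply, smul_lie, map_smul, LinearMap.smul_apply, smul_neg, Finset.smul_sum,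
    smul_smul, smul_eq_mul]

theorem cad_add (x y : g) : cad (R := R) b (x + y) = cad b x + cad b y := by
  refine LinearMap.ext fun ω => ?_
  simp only [cad_apply, add_lie, map_add, LinearMap.add_apply, _root_.add_smul,
    Finset.sum_add_distrib, neg_add]

theorem cad_X [DecidableEq ι] (x : g) (c : ι) :
    cad b x (MvPowerSeries.X c : MvPowerSeries ι k) =
      -∑ j, b.coord c ⁅x, b j⁆ • MvPowerSeries.X j := by
  rw [cad_apply, Finset.sum_eq_single c]
  · simp [pdY_X, mulS_apply]
  · intro i _ hi
    simp [pdY_X, hi]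
  · simp

theorem coadjoint_eq (x : g) : coadjoint b x = cad (R := Ch k g) b x := by
  refine LinearMap.ext fun ω => ?_
  rw [cad_apply]
  simp only [coadjoint, LinearMap.neg_apply, LinearMap.sum_apply, LinearMap.smul_apply,
    LinearMap.comp_apply, LinearMap.mulLeft_apply, mulS_apply, MvPowerSeries.map_X]
  rfl

theorem C_mul_eq (a : R) (ω : MvPowerSeries ι R) :
    MvPowerSeries.C a * ω = cmap (LinearMap.mulLeft k a) ω := by
  ext n
  rw [coeff_cmap, MvPowerSeries.coeff_C_mul, LinearMap.mulLeft_apply]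

theorem formsD_apply (ω : Forms k g ι) : formsD b ω =
    cmap (chD b) ω + ∑ a, cmap (LinearMap.mulLeft k (xi b a)) (cad b (b a) ω) := by
  simp only [formsD, LinearMap.add_apply, LinearMap.sum_apply, LinearMap.comp_apply,
    LinearMap.mulLeft_apply, coadjoint_eq, C_mul_eq (k := k)]
  rfl

theorem homog_formsD (m : ℕ) (ω : Forms k g ι) :
    homog (k := k) m (formsD b ω) = formsD b (homog (k := k) m ω) := by
  simp only [formsD_apply, map_add, map_sum, homog_cmap, homog_cad]

/-- The differential is linear over the invariant power series. -/
theorem formsD_mulS (f : MvPowerSeries ι k) (hf : ∀ x, cad b x f = 0) (ω : Forms k g ι) :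
    formsD b (mulS f ω) = mulS f (formsD b ω) := by
  simp only [formsD_apply, map_add, map_sum, cmap_mulS, cad_mulS, hf, map_zero,
    LinearMap.zero_apply, zero_add]

end Commutation

/-! ### Operators on power series with coefficients in slots -/

section Symbols

variable {k : Type*} [Field k] {g : Type*} [LieRing g] [LieAlgebra k g]
  {ι : Type*}

variable (k g ι) in
/-- Power series in the variables `y` with coefficients in the slot algebra. -/
def SlotForms : Type _ := MvPowerSeries ι (Slots k g)

instance : AddCommGroup (SlotForms k g ι) := inferInstanceAs (AddCommGroup (MvPowerSeries ι (Slots k g)))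

instance : Module k (SlotForms k g ι) := inferInstanceAs (Module k (MvPowerSeries ι (Slots k g)))

variable (k g ι) in
/-- A coefficient, as a linear map. -/
def coeffS (n : ι →₀ ℕ) : SlotForms k g ι →ₗ[k] Slots k g where
  toFun ω := MvPowerSeries.coeff n (ω : MvPowerSeries ι (Slots k g))
  map_add' _ _ := rfl
  map_smul' _ _ := rfl

theorem slotForms_ext {ω η : SlotForms k g ι} (h : ∀ n, coeffS k g ι n ω = coeffS k g ι n η) :
    ω = η := MvPowerSeries.ext h

variable (k g ι) in
/-- The coadjoint action on `SlotForms`. -/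
def cadS [Fintype ι] (b : Module.Basis ι k g) (x : g) : Module.End k (SlotForms k g ι) :=
  cad (R := Slots k g) b x

variable (k g ι) in
/-- Constant series with coefficients in slots. -/
def cstS : Slots k g →ₗ[k] SlotForms k g ι := cst (k := k) (ι := ι)

/-- The Chevalley–Eilenberg differential of all slots, on coefficients. -/
def sD [Fintype ι] (b : Module.Basis ι k g) : Module.End k (SlotForms k g ι) := cmap (slotD b)

variable (k ι) in
/-- The derivative `∂_x` in slot `l`, on coefficients. -/
def dS (x : g) (l : ℕ) : Module.End k (SlotForms k g ι) := cmap (dslot x l)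

/-- Multiplication of the coefficients by the generator `ξ^a` in slot `l`. -/
def xS (b : Module.Basis ι k g) (a : ι) (l : ℕ) : Module.End k (SlotForms k g ι) :=
  cmap (LinearMap.mulLeft k (gen l (b.coord a)))

/-- Multiplication by a series with scalar coefficients. -/
def mS (f : MvPowerSeries ι k) : Module.End k (SlotForms k g ι) := mulS f

variable (k g ι) in
/-- Multiplying all the slots, on coefficients. -/
def mulP : SlotForms k g ι →ₗ[k] Forms k g ι := cmap slotProd.toLinearMap

theorem dS_dS (x x' : g) (l l' : ℕ) : dS k ι x l * dS k ι x' l' = -(dS k ι x' l' * dS k ι x l) := by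
  refine LinearMap.ext fun ω => MvPowerSeries.ext fun n => ?_
  exact dslot_dslot x x' l l' _

theorem dS_mS (x : g) (l : ℕ) (f : MvPowerSeries ι k) : dS k ι x l * mS f = mS f * dS k ι x l :=
  LinearMap.ext fun ω => cmap_mulS (dslot x l) f ω

theorem mS_mul (f f' : MvPowerSeries ι k) : mS (g := g) (f * f') = mS f * mS f' := map_mul mulS f f'

theorem mS_add (f f' : MvPowerSeries ι k) : mS (g := g) (f + f') = mS f + mS f' := map_add mulS f f'

theorem mS_neg (f : MvPowerSeries ι k) : mS (g := g) (-f) = -mS f := map_neg mulS f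

theorem mS_smul (c : k) (f : MvPowerSeries ι k) : mS (g := g) (c • f) = c • mS f := map_smul mulS c f

theorem mS_sum {α : Type*} (s : Finset α) (f : α → MvPowerSeries ι k) :
    mS (g := g) (∑ a ∈ s, f a) = ∑ a ∈ s, mS (f a) := map_sum mulS f s

theorem mS_comm (f f' : MvPowerSeries ι k) : mS (g := g) f * mS f' = mS f' * mS f := by
  rw [← mS_mul, mul_comm, mS_mul]

theorem dS_smul (c : k) (x : g) (l : ℕ) : dS k ι (c • x) l = c • dS k ι x l := by
  rw [dS, dslot_smul]
  rfl

variable [Fintype ι] (b : Module.Basis ι k g)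

theorem dS_expand (x : g) (l : ℕ) : dS k ι x l = ∑ r, b.coord r x • dS k ι (b r) l := by
  have h : ∀ s : Finset ι, dS k ι (∑ r ∈ s, b.coord r x • b r) l =
      ∑ r ∈ s, b.coord r x • dS k ι (b r) l := by
    classical
    intro s
    induction s using Finset.induction_on with
    | empty => 
      have := dS_smul (ι := ι) (0 : k) (0 : g) l
      rwa [zero_smul, zero_smul] at this
    | insert a s ha ih =>
      rw [Finset.sum_insert ha, Finset.sum_insert ha, ← ih, ← dS_smul, dS, dslot_add]
      rfl
  rw [← h, ← b.sum_repr x]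
  simp

omit [Fintype ι] in
theorem xS_mS (a : ι) (l : ℕ) (f : MvPowerSeries ι k) : xS b a l * mS f = mS f * xS b a l :=
  LinearMap.ext fun ω => cmap_mulS (LinearMap.mulLeft k (gen l (b.coord a))) f ω

omit [Fintype ι] in
theorem dS_xS (x : g) (l : ℕ) (a : ι) (r : ℕ) : dS k ι x l * xS b a r =
    (if r = l then b.coord a x else 0) • 1 - xS b a r * dS k ι x l := by
  refine LinearMap.ext fun ω => MvPowerSeries.ext fun n => ?_
  exact dslot_gen_mul x l r (b.coord a) _

theorem dS_cad (x z : g) (l : ℕ) : dS k ι x l * cadS k g ι b z = cadS k g ι b z * dS k ι x l :=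
  LinearMap.ext fun ω => cmap_cad b (dslot x l) z ω

/-- The lift of the differential of forms to slots; the coefficients `ξ^a` of the coadjoint
action are put in slot `L`. -/
def totD (L : ℕ) : Module.End k (SlotForms k g ι) :=
  sD b + ∑ a, xS b a L * cadS k g ι b (b a)

theorem totD_mS (L : ℕ) (f : MvPowerSeries ι k) : totD b L * mS f =
    mS f * totD b L + ∑ a, xS b a L * mS (cad b (b a) f) := by
  have h1 : sD b * mS f = mS f * sD b := LinearMap.ext fun ω => cmap_mulS (slotD b) f ω
  have h2 : ∀ z, cadS k g ι b z * mS f = mS f * cadS k g ι b z + mS (cad b z f) :=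
    fun z => LinearMap.ext fun ω => (cad_mulS b z f ω).trans (add_comm _ _)
  rw [totD, add_mul, mul_add, h1, add_assoc, Finset.sum_mul, Finset.mul_sum,
    ← Finset.sum_add_distrib]
  congr 1
  refine Finset.sum_congr rfl fun a _ => ?_
  rw [mul_assoc, h2, mul_add, ← mul_assoc, xS_mS, mul_assoc]

theorem totD_dS [CharZero k] {L l : ℕ} (h : l ≠ L) (x : g) : totD b L * dS k ι x l =
    -(dS k ι x l * totD b L) - ∑ c, xS b c l * dS k ι ⁅x, b c⁆ l := by
  have h1 : sD b * dS k ι x l =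
      -(dS k ι x l * sD b) - ∑ c, xS b c l * dS k ι ⁅x, b c⁆ l := by
    refine LinearMap.ext fun ω => slotForms_ext fun n => ?_
    have := dslot_slotD b x l (coeffS k g ι n ω)
    simp only [LinearMap.sub_apply, LinearMap.neg_apply, LinearMap.sum_apply, map_sub, map_neg,
      map_sum]
    change slotD b (dslot x l (coeffS k g ι n ω)) =
      -(dslot x l (slotD b (coeffS k g ι n ω))) - ∑ c, gen l (b.coord c) *
        dslot ⁅x, b c⁆ l (coeffS k g ι n ω)
    rw [this]
    abel
  have h2 : (∑ a, xS b a L * cadS k g ι b (b a)) * dS k ι x l =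
      -(dS k ι x l * ∑ a, xS b a L * cadS k g ι b (b a)) := by
    rw [Finset.sum_mul, Finset.mul_sum, ← Finset.sum_neg_distrib]
    refine Finset.sum_congr rfl fun a _ => ?_
    rw [mul_assoc, ← dS_cad, ← mul_assoc, ← mul_assoc, dS_xS, if_neg (Ne.symm h), zero_smul,
      zero_sub, neg_mul, neg_neg]
  rw [totD, add_mul, mul_add, h1, h2]
  abel

theorem mulP_xS (a : ι) (l : ℕ) (ω : SlotForms k g ι) :
    mulP k g ι (xS b a l ω) = cmap (LinearMap.mulLeft k (xi b a)) (mulP k g ι ω) := by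
  ext n
  change slotProd (gen l (b.coord a) * _) = xi b a * slotProd _
  rw [map_mul, slotProd_gen]
  rfl

theorem mulP_totD (L : ℕ) (ω : SlotForms k g ι) :
    mulP k g ι (totD b L ω) = formsD b (mulP k g ι ω) := by
  have h : cmap (slotProd.toLinearMap ∘ₗ slotD b) ω = cmap (chD b ∘ₗ slotProd.toLinearMap) ω := by
    congr 2
    exact LinearMap.ext fun x => slotProd_slotD b x
  rw [totD, formsD_apply, LinearMap.add_apply, map_add, LinearMap.sum_apply, map_sum]
  congr 1
  refine Finset.sum_congr rfl fun a _ => ?_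
  rw [Module.End.mul_apply, mulP_xS]
  exact congrArg _ (cmap_cad b slotProd.toLinearMap (b a) ω)

theorem totD_cst (L : ℕ) (x : Slots k g) :
    totD b L (cstS k g ι x) = cstS k g ι (slotD b x) := by
  have h1 : sD b (cstS k g ι x) = cstS k g ι (slotD b x) := cmap_cst (slotD b) x
  have h2 : ∀ z, cadS k g ι b z (cstS k g ι x) = 0 := fun z => cad_cst b z x
  simp [totD, h1, h2, LinearMap.sum_apply]

/-- The derivative along a vector `v` with power series entries, in slot `l`. -/
def dV (v : ι → MvPowerSeries ι k) (l : ℕ) : Module.End k (SlotForms k g ι) :=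
  ∑ c, mS (v c) * dS k ι (b c) l

theorem dV_dS (v : ι → MvPowerSeries ι k) (l : ℕ) (x : g) (r : ℕ) :
    dV b v l * dS k ι x r = -(dS k ι x r * dV b v l) := by
  rw [dV, Finset.sum_mul, Finset.mul_sum, ← Finset.sum_neg_distrib]
  refine Finset.sum_congr rfl fun c _ => ?_
  rw [mul_assoc, dS_dS, mul_neg, ← mul_assoc, ← dS_mS, mul_assoc]

theorem dV_mS (v : ι → MvPowerSeries ι k) (l : ℕ) (f : MvPowerSeries ι k) :
    dV (g := g) b v l * mS f = mS f * dV b v l := by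
  rw [dV, Finset.sum_mul, Finset.mul_sum]
  refine Finset.sum_congr rfl fun c _ => ?_
  rw [mul_assoc, dS_mS, ← mul_assoc, mS_comm, mul_assoc]

theorem dV_dV (v v' : ι → MvPowerSeries ι k) (l l' : ℕ) :
    dV (g := g) b v l * dV b v' l' = -(dV b v' l' * dV b v l) := by
  rw [dV.eq_def b v', Finset.mul_sum, Finset.sum_mul, ← Finset.sum_neg_distrib]
  refine Finset.sum_congr rfl fun c _ => ?_
  rw [← mul_assoc, dV_mS, mul_assoc, dV_dS, mul_neg, mul_assoc]

theorem dV_xS (v : ι → MvPowerSeries ι k) {l r : ℕ} (h : r ≠ l) (a : ι) :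
    dV (g := g) b v l * xS b a r = -(xS b a r * dV b v l) := by
  rw [dV, Finset.sum_mul, Finset.mul_sum, ← Finset.sum_neg_distrib]
  refine Finset.sum_congr rfl fun c _ => ?_
  rw [mul_assoc, dS_xS, if_neg h, zero_smul, zero_sub, mul_neg, ← mul_assoc, ← mul_assoc, xS_mS]

variable (k ι) in
/-- The tautological derivative `∑_c y_c ∂_c` in slot `l`. -/
def dY (l : ℕ) : Module.End k (SlotForms k g ι) := dV b (fun c => MvPowerSeries.X c) l

/-- The vector `[y, e_a]`. -/
def adVec (a : ι) (r : ι) : MvPowerSeries ι k := ∑ c, b.coord r ⁅b c, b a⁆ • MvPowerSeries.X c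

theorem cad_X' [DecidableEq ι] (a c : ι) :
    cad b (b a) (MvPowerSeries.X c : MvPowerSeries ι k) = adVec b a c := by
  rw [cad_X, adVec, ← Finset.sum_neg_distrib]
  refine Finset.sum_congr rfl fun j _ => ?_
  rw [← lie_skew, map_neg, neg_smul, neg_neg]

theorem dV_adVec (a : ι) (l : ℕ) : dV (g := g) b (adVec b a) l =
    ∑ c, mS (MvPowerSeries.X c) * dS k ι ⁅b c, b a⁆ l := by
  simp only [dV, adVec, mS_sum, mS_smul, Finset.sum_mul, smul_mul_assoc]
  rw [Finset.sum_comm]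
  refine Finset.sum_congr rfl fun c _ => ?_
  rw [dS_expand b ⁅b c, b a⁆, Finset.mul_sum]
  simp only [mul_smul_comm]

/-- The tautological derivative commutes with the differential up to a term that vanishes when all the
slots are multiplied. -/
theorem totD_dY [DecidableEq ι] [CharZero k] {L l : ℕ} (h : l ≠ L) : totD b L * dY k ι b l =
    -(dY k ι b l * totD b L) + ∑ a, (xS b a L - xS b a l) * dV b (adVec b a) l := by
  have h1 : ∀ c, totD b L * (mS (MvPowerSeries.X c) * dS k ι (b c) l) =
      -(mS (MvPowerSeries.X c) * dS k ι (b c) l * totD b L) -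
        ∑ a, xS b a l * (mS (MvPowerSeries.X c) * dS k ι ⁅b c, b a⁆ l) +
        ∑ a, xS b a L * (mS (adVec b a c) * dS k ι (b c) l) := by
    intro c
    rw [← mul_assoc, totD_mS, add_mul, mul_assoc, totD_dS b h, mul_sub, mul_neg, mul_assoc,
      Finset.mul_sum, Finset.sum_mul]
    refine congrArg₂ (· + ·) (congrArg₂ (· - ·) rfl ?_) ?_
    · refine Finset.sum_congr rfl fun a _ => ?_
      rw [← mul_assoc, ← mul_assoc, xS_mS]
    · refine Finset.sum_congr rfl fun a _ => ?_
      rw [cad_X', mul_assoc]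
  rw [dY, dV, Finset.mul_sum, Finset.sum_congr rfl fun c _ => h1 c, Finset.sum_add_distrib,
    Finset.sum_sub_distrib, Finset.sum_neg_distrib, Finset.sum_mul, Finset.sum_comm,
    Finset.sum_comm (f := fun c a => xS b a L * (mS (adVec b a c) * dS k ι (b c) l))]
  simp only [sub_mul, Finset.sum_sub_distrib, ← Finset.mul_sum]
  rw [sub_add_eq_add_sub, add_sub_assoc]
  refine congrArg₂ (· + ·) rfl (congrArg₂ (· - ·) rfl ?_)
  refine Finset.sum_congr rfl fun a _ => ?_
  rw [dV_adVec]

variable (k ι) in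
/-- The product of the tautological derivatives in the slots `1, …, i`. -/
def prodY : ℕ → Module.End k (SlotForms k g ι)
  | 0 => 1
  | i + 1 => prodY i * dY k ι b (i + 1)

variable (k ι) in
/-- The product of the tautological derivatives in the slots `1, …, i` except `q`. -/
def prodYdel : ℕ → ℕ → Module.End k (SlotForms k g ι)
  | 0, _ => 1
  | i + 1, q => if q = i + 1 then prodY k ι b i else prodYdel i q * dY k ι b (i + 1)

theorem prodY_dV (i : ℕ) (v : ι → MvPowerSeries ι k) (l : ℕ) :
    prodY k ι b i * dV b v l = (-1 : k) ^ i • (dV b v l * prodY k ι b i) := by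
  induction i with
  | zero => simp [prodY]
  | succ i ih =>
    rw [prodY, mul_assoc, dY, dV_dV, mul_neg, ← mul_assoc, ih, smul_mul_assoc, pow_succ,
      mul_neg_one, neg_smul, mul_assoc]

theorem prodY_xS (i : ℕ) (a : ι) {r : ℕ} (h : i < r) :
    prodY k ι b i * xS b a r = (-1 : k) ^ i • (xS b a r * prodY k ι b i) := by
  induction i with
  | zero => simp [prodY]
  | succ i ih =>
    rw [prodY, mul_assoc, dY, dV_xS b _ (by omega), mul_neg, ← mul_assoc, ih (by omega),
      smul_mul_assoc, pow_succ, mul_neg_one, neg_smul, mul_assoc]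

theorem totD_prodY [DecidableEq ι] [CharZero k] {L i : ℕ} (h : i < L) :
    totD b L * prodY k ι b i = (-1 : k) ^ i • (prodY k ι b i * totD b L) +
      ∑ q ∈ Finset.range i, (-1 : k) ^ q • ((∑ a, (xS b a L - xS b a (q + 1)) *
        dV b (adVec b a) (q + 1)) * prodYdel k ι b i (q + 1)) := by
  induction i with
  | zero => simp [prodY]
  | succ i ih =>
    have hs : ∀ a, prodY k ι b i * ((xS b a L - xS b a (i + 1)) * dV b (adVec b a) (i + 1)) =
        (xS b a L - xS b a (i + 1)) * dV b (adVec b a) (i + 1) * prodY k ι b i := by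
      intro a
      rw [← mul_assoc, mul_sub, prodY_xS b i a (by omega), prodY_xS b i a (by omega), ← smul_sub,
        ← sub_mul, smul_mul_assoc, mul_assoc, prodY_dV, mul_smul_comm, smul_smul, ← mul_assoc,
        ← pow_add, Even.neg_one_pow ⟨i, rfl⟩, one_smul]
    rw [prodY, ← mul_assoc, ih (by omega), add_mul, smul_mul_assoc, mul_assoc, totD_dY b (by omega),
      mul_add, mul_neg, smul_add, ← mul_assoc, pow_succ, mul_neg_one, neg_smul, smul_neg,
      Finset.sum_range_succ, add_assoc]
    congr 1
    rw [add_comm]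
    congr 1
    · rw [Finset.sum_mul]
      refine Finset.sum_congr rfl fun q hq => ?_
      rw [Finset.mem_range] at hq
      rw [prodYdel, if_neg (by omega), smul_mul_assoc, mul_assoc]
    · rw [prodYdel, if_pos rfl, Finset.mul_sum, Finset.sum_mul]
      congr 1
      exact Finset.sum_congr rfl fun a _ => hs a

end Symbols

/-! ### Bivectors acting on slots -/

section Bivectors

variable {k : Type*} [Field k] {g : Type*} [LieRing g] [LieAlgebra k g]
  {ι : Type*} [Fintype ι] (b : Module.Basis ι k g)

/-- The action `∑_{c,d} N_{cd} ∂_c ∂_d` of a bivector `N`, the first derivative in slot `j`, the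
second in slot `l`. -/
def opQ (N : Matrix ι ι (MvPowerSeries ι k)) (j l : ℕ) : Module.End k (SlotForms k g ι) :=
  ∑ c, ∑ d, mS (N c d) * (dS k ι (b c) j * dS k ι (b d) l)

theorem opQ_transpose (N : Matrix ι ι (MvPowerSeries ι k)) (j l : ℕ) :
    opQ b N j l = -opQ b N.transpose l j := by
  rw [opQ, opQ, Finset.sum_comm, ← Finset.sum_neg_distrib]
  refine Finset.sum_congr rfl fun d _ => ?_
  rw [← Finset.sum_neg_distrib]
  refine Finset.sum_congr rfl fun c _ => ?_
  rw [dS_dS, mul_neg, Matrix.transpose_apply]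

theorem opQ_neg (N : Matrix ι ι (MvPowerSeries ι k)) (j l : ℕ) :
    opQ b (-N) j l = -opQ b N j l := by
  simp only [opQ, Matrix.neg_apply, mS_neg, neg_mul, Finset.sum_neg_distrib]

/-- The bracket `∑_{c,d} N_{cd} [e_c, e_d]` of a bivector. -/
def bracketVec (N : Matrix ι ι (MvPowerSeries ι k)) (r : ι) : MvPowerSeries ι k :=
  ∑ c, ∑ d, b.coord r ⁅b c, b d⁆ • N c d

/-- The bivector `N` is invariant under the adjoint action. -/
def IsInvariant (N : Matrix ι ι (MvPowerSeries ι k)) : Prop :=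
  ∀ a c d, cad b (b a) (N c d) =
    ∑ r, b.coord c ⁅b r, b a⁆ • N r d + ∑ r, b.coord d ⁅b r, b a⁆ • N c r

theorem dS_lie_sum (x y : g) (l : ℕ) :
    ∑ a, b.coord a x • dS k ι ⁅y, b a⁆ l = dS k ι ⁅y, x⁆ l := by
  have h : ∀ r, b.coord r ⁅y, x⁆ = ∑ a, b.coord a x * b.coord r ⁅y, b a⁆ := by
    intro r
    conv_lhs => rw [← b.sum_repr x]
    simp only [lie_sum, lie_smul, map_sum, map_smul, smul_eq_mul, Module.Basis.coord_apply]
  rw [dS_expand b ⁅y, x⁆]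
  simp only [h, Finset.sum_smul, ← smul_smul]
  rw [Finset.sum_comm]
  refine Finset.sum_congr rfl fun a _ => ?_
  rw [dS_expand b, Finset.smul_sum]

theorem totD_dS_dS [CharZero k] {L j l : ℕ} (hj : j ≠ L) (hl : l ≠ L) (x y : g) :
    totD b L * (dS k ι x j * dS k ι y l) = dS k ι x j * dS k ι y l * totD b L +
      (if j = l then dS k ι ⁅y, x⁆ l else 0) -
      ∑ a, xS b a l * (dS k ι x j * dS k ι ⁅y, b a⁆ l) -
      ∑ a, xS b a j * (dS k ι ⁅x, b a⁆ j * dS k ι y l) := by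
  have h1 : ∑ a, dS k ι x j * (xS b a l * dS k ι ⁅y, b a⁆ l) =
      (if j = l then dS k ι ⁅y, x⁆ l else 0) -
        ∑ a, xS b a l * (dS k ι x j * dS k ι ⁅y, b a⁆ l) := by
    have h2 : ∀ a, dS k ι x j * (xS b a l * dS k ι ⁅y, b a⁆ l) =
        (if j = l then b.coord a x • dS k ι ⁅y, b a⁆ l else 0) -
          xS b a l * (dS k ι x j * dS k ι ⁅y, b a⁆ l) := by
      intro a
      rw [← mul_assoc, dS_xS, sub_mul, mul_assoc, smul_mul_assoc, one_mul]
      by_cases h : j = l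
      · rw [if_pos h.symm, if_pos h]
      · rw [if_neg (Ne.symm h), if_neg h, zero_smul]
    rw [Finset.sum_congr rfl fun a _ => h2 a, Finset.sum_sub_distrib]
    congr 1
    split_ifs with h
    · exact dS_lie_sum b x y l
    · exact Finset.sum_const_zero
  rw [← mul_assoc, totD_dS b hj, sub_mul, neg_mul, mul_assoc, totD_dS b hl, mul_sub, mul_neg,
    Finset.mul_sum, h1, Finset.sum_mul]
  simp only [mul_assoc]
  abel

theorem bracketVec_dV (N : Matrix ι ι (MvPowerSeries ι k)) (l : ℕ) :
    ∑ c, ∑ d, mS (N c d) * dS k ι ⁅b d, b c⁆ l = -dV (g := g) b (bracketVec b N) l := by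
  have h : ∀ c d, mS (N c d) * dS k ι ⁅b d, b c⁆ l =
      -∑ r, (b.coord r ⁅b c, b d⁆ • mS (N c d)) * dS k ι (b r) l := by
    intro c d
    rw [dS_expand b, Finset.mul_sum, ← Finset.sum_neg_distrib]
    refine Finset.sum_congr rfl fun r _ => ?_
    rw [← lie_skew, map_neg, neg_smul, mul_neg, mul_smul_comm, smul_mul_assoc]
  simp only [h, Finset.sum_neg_distrib, dV, bracketVec, mS_sum, mS_smul, Finset.sum_mul]
  rw [neg_inj]
  symm
  rw [Finset.sum_comm]
  refine Finset.sum_congr rfl fun c _ => ?_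
  rw [Finset.sum_comm]

theorem totD_opQ [CharZero k] (N : Matrix ι ι (MvPowerSeries ι k))
    {L j l : ℕ} (hj : j ≠ L) (hl : l ≠ L) :
    totD b L * opQ b N j l = opQ b N j l * totD b L -
      (if j = l then dV b (bracketVec b N) l else 0) +
      ∑ a, xS b a L * ∑ c, ∑ d, mS (cad b (b a) (N c d)) * (dS k ι (b c) j * dS k ι (b d) l) -
      ∑ a, xS b a l * ∑ c, ∑ d, mS (N c d) * (dS k ι (b c) j * dS k ι ⁅b d, b a⁆ l) -
      ∑ a, xS b a j * ∑ c, ∑ d, mS (N c d) * (dS k ι ⁅b c, b a⁆ j * dS k ι (b d) l) := by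
  have h0 : ∀ (f : MvPowerSeries ι k) (r : ℕ) (Z : ι → Module.End k (SlotForms k g ι)),
      ∑ a, mS f * (xS b a r * Z a) = ∑ a, xS b a r * (mS f * Z a) := by
    intro f r Z
    refine Finset.sum_congr rfl fun a _ => ?_
    rw [← mul_assoc, ← mul_assoc, xS_mS]
  have h2 : ∀ c d, totD b L * (mS (N c d) * (dS k ι (b c) j * dS k ι (b d) l)) =
      mS (N c d) * (dS k ι (b c) j * dS k ι (b d) l) * totD b L +
      mS (N c d) * (if j = l then dS k ι ⁅b d, b c⁆ l else 0) -
      ∑ a, xS b a l * (mS (N c d) * (dS k ι (b c) j * dS k ι ⁅b d, b a⁆ l)) -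
      ∑ a, xS b a j * (mS (N c d) * (dS k ι ⁅b c, b a⁆ j * dS k ι (b d) l)) +
      ∑ a, xS b a L * (mS (cad b (b a) (N c d)) * (dS k ι (b c) j * dS k ι (b d) l)) := by
    intro c d
    rw [← mul_assoc, totD_mS, add_mul, mul_assoc (mS (N c d)), totD_dS_dS b hj hl, mul_sub,
      mul_sub, mul_add, Finset.sum_mul, Finset.mul_sum, Finset.mul_sum, mul_assoc (mS (N c d)),
      h0, h0]
    simp only [mul_assoc]
  have h3 : (if j = l then dV (g := g) b (bracketVec b N) l else 0) =
      -∑ c, ∑ d, mS (N c d) * (if j = l then dS k ι ⁅b d, b c⁆ l else 0) := by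
    split_ifs
    · rw [bracketVec_dV, neg_neg]
    · simp
  have h4 : ∀ F : ι → ι → ι → Module.End k (SlotForms k g ι), ∀ r : ℕ,
      ∑ a, xS b a r * ∑ c, ∑ d, F a c d = ∑ c, ∑ d, ∑ a, xS b a r * F a c d := by
    intro F r
    simp only [Finset.mul_sum]
    rw [Finset.sum_comm]
    refine Finset.sum_congr rfl fun c _ => ?_
    rw [Finset.sum_comm]
  rw [h3, h4, h4, h4, opQ]
  simp only [Finset.mul_sum, h2, Finset.sum_add_distrib, Finset.sum_sub_distrib, Finset.sum_mul]
  abel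

theorem IsInvariant.sum_cad {N : Matrix ι ι (MvPowerSeries ι k)} (hN : IsInvariant b N) (j l : ℕ)
    (a : ι) :
    ∑ c, ∑ d, mS (cad b (b a) (N c d)) * (dS k ι (b c) j * dS k ι (b d) l) =
      ∑ c, ∑ d, mS (N c d) * (dS k ι (b c) j * dS k ι ⁅b d, b a⁆ l) +
      ∑ c, ∑ d, mS (N c d) * (dS k ι ⁅b c, b a⁆ j * dS k ι (b d) l) := by
  have e1 : ∑ c, ∑ d, (∑ r, b.coord c ⁅b r, b a⁆ • mS (N r d)) *
      (dS k ι (b c) j * dS k ι (b d) l) =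
      ∑ c, ∑ d, mS (N c d) * (dS k ι ⁅b c, b a⁆ j * dS k ι (b d) l) := by
    simp only [Finset.sum_mul]
    rw [Finset.sum_congr rfl fun c _ => Finset.sum_comm, Finset.sum_comm]
    refine Finset.sum_congr rfl fun r _ => ?_
    rw [Finset.sum_comm]
    refine Finset.sum_congr rfl fun d _ => ?_
    rw [dS_expand b ⁅b r, b a⁆, Finset.sum_mul, Finset.mul_sum]
    simp only [smul_mul_assoc, mul_smul_comm]
  have e2 : ∑ c, ∑ d, (∑ r, b.coord d ⁅b r, b a⁆ • mS (N c r)) *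
      (dS k ι (b c) j * dS k ι (b d) l) =
      ∑ c, ∑ d, mS (N c d) * (dS k ι (b c) j * dS k ι ⁅b d, b a⁆ l) := by
    simp only [Finset.sum_mul]
    refine Finset.sum_congr rfl fun c _ => ?_
    rw [Finset.sum_comm]
    refine Finset.sum_congr rfl fun r _ => ?_
    rw [dS_expand b ⁅b r, b a⁆, Finset.mul_sum, Finset.mul_sum]
    simp only [smul_mul_assoc, mul_smul_comm]
  simp only [hN a, mS_add, mS_sum, mS_smul, add_mul, Finset.sum_add_distrib]
  rw [e1, e2, add_comm]

/-- An invariant bivector commutes with the differential, up to its bracket. -/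
theorem mulP_totD_opQ [CharZero k] {N : Matrix ι ι (MvPowerSeries ι k)} (hN : IsInvariant b N)
    {L j l : ℕ} (hj : j ≠ L) (hl : l ≠ L) (ω : SlotForms k g ι) :
    mulP k g ι (totD b L (opQ b N j l ω)) = mulP k g ι (opQ b N j l (totD b L ω)) -
      if j = l then mulP k g ι (dV b (bracketVec b N) l ω) else 0 := by
  have h6 := congrArg (mulP k g ι) (LinearMap.congr_fun (totD_opQ b N hj hl) ω)
  have h7 : ∀ (r : ℕ) (F : ι → Module.End k (SlotForms k g ι)),
      mulP k g ι ((∑ a, xS b a r * F a) ω) =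
        ∑ a, cmap (LinearMap.mulLeft k (xi b a)) (mulP k g ι (F a ω)) := by
    intro r F
    rw [LinearMap.sum_apply, map_sum]
    exact Finset.sum_congr rfl fun a _ => mulP_xS b a r _
  rw [LinearMap.sub_apply, LinearMap.sub_apply, LinearMap.add_apply, LinearMap.sub_apply, map_sub,
    map_sub, map_add, map_sub, h7, h7, h7] at h6
  simp only [hN.sum_cad, LinearMap.add_apply, map_add, Finset.sum_add_distrib] at h6
  rw [Module.End.mul_apply, Module.End.mul_apply] at h6
  rw [h6]
  split_ifs
  · abel
  · rw [LinearMap.zero_apply, map_zero]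
    abel

/-- A bivector is a second-order operator: its commutator with a generator is a first-order operator. -/
theorem opQ_xS (N : Matrix ι ι (MvPowerSeries ι k)) (j l r : ℕ) (a : ι) :
    opQ b N j l * xS b a r = xS b a r * opQ b N j l +
      (if r = l then ∑ c, mS (N c a) * dS k ι (b c) j else 0) -
      (if r = j then ∑ d, mS (N a d) * dS k ι (b d) l else 0) := by
  classical
  have h1 : ∀ c d, mS (N c d) * (dS k ι (b c) j * dS k ι (b d) l) * xS b a r =
      xS b a r * (mS (N c d) * (dS k ι (b c) j * dS k ι (b d) l)) +
      (if r = l then (if d = a then mS (N c d) * dS k ι (b c) j else 0) else 0) -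
      (if r = j then (if c = a then mS (N c d) * dS k ι (b d) l else 0) else 0) := by
    intro c d
    have hc : ∀ c, b.coord a (b c) = if c = a then 1 else 0 := by
      intro c
      rw [Module.Basis.coord_apply, Module.Basis.repr_self, Finsupp.single_apply]
    rw [mul_assoc, mul_assoc, dS_xS, mul_sub, ← mul_assoc (dS k ι (b c) j), dS_xS, hc, hc, mul_sub,
      sub_mul, mul_sub, ← mul_assoc (mS _) (xS b a r * _), ← mul_assoc (mS _) (xS b a r), ← xS_mS]
    simp only [mul_assoc]
    by_cases h1 : r = l <;> by_cases h2 : r = j <;> by_cases h3 : d = a <;> by_cases h4 : c = a <;>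
      simp [h1, h2, h3, h4] <;> try abel
  rw [opQ]
  simp only [Finset.sum_mul, Finset.mul_sum, h1, Finset.sum_add_distrib, Finset.sum_sub_distrib]
  congr 2
  · split_ifs
    · simp
    · simp
  · split_ifs
    · simp
    · simp

theorem adMatrix_apply (r s : ι) : adMatrix b r s = adVec b s r := by
  simp only [adMatrix, Matrix.of_apply, adVec, MvPowerSeries.smul_eq_C_mul]

/-- The effect of moving the coefficients `ξ^a` of the coadjoint action past a bivector. -/
theorem mulP_opQ_adVec (N : Matrix ι ι (MvPowerSeries ι k)) {L j l q : ℕ} (hj : j ≠ L) (hl : l ≠ L)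
    (ω : SlotForms k g ι) :
    mulP k g ι (opQ b N j l (∑ a, ((xS b a L - xS b a q) * dV b (adVec b a) q) ω)) =
      -(if q = l then mulP k g ι (opQ b (N * (adMatrix b).transpose) j q ω) else 0) -
      (if q = j then mulP k g ι (opQ b (adMatrix b * N) q l ω) else 0) := by
  have e1 : ∑ a, (∑ c, mS (N c a) * dS k ι (b c) j) * dV b (adVec b a) q =
      opQ b (N * (adMatrix b).transpose) j q := by
    simp only [opQ, Matrix.mul_apply, Matrix.transpose_apply, adMatrix_apply, mS_sum, mS_mul,
      Finset.sum_mul, dV, Finset.mul_sum]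
    rw [Finset.sum_congr rfl fun a _ => Finset.sum_comm, Finset.sum_comm]
    refine Finset.sum_congr rfl fun c _ => ?_
    rw [Finset.sum_comm]
    refine Finset.sum_congr rfl fun r _ => Finset.sum_congr rfl fun a _ => ?_
    rw [mul_assoc, ← mul_assoc (dS k ι (b c) j), dS_mS]
    simp only [mul_assoc]
  have e2 : ∑ a, (∑ d, mS (N a d) * dS k ι (b d) l) * dV b (adVec b a) q =
      -opQ b (adMatrix b * N) q l := by
    rw [opQ_transpose, neg_neg]
    simp only [opQ, Matrix.mul_apply, Matrix.transpose_apply, adMatrix_apply, mS_sum, mS_mul,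
      Finset.sum_mul, dV, Finset.mul_sum]
    rw [Finset.sum_congr rfl fun a _ => Finset.sum_comm, Finset.sum_comm]
    refine Finset.sum_congr rfl fun c _ => ?_
    rw [Finset.sum_comm]
    refine Finset.sum_congr rfl fun r _ => Finset.sum_congr rfl fun a _ => ?_
    rw [mul_assoc, ← mul_assoc (dS k ι (b c) l), dS_mS, ← mul_assoc (mS (N a c)), ← mul_assoc,
      mS_comm]
    simp only [mul_assoc]
  have h : opQ b N j l * ∑ a, (xS b a L - xS b a q) * dV b (adVec b a) q =
      (∑ a, (xS b a L - xS b a q) * (opQ b N j l * dV b (adVec b a) q)) -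
      (if q = l then opQ b (N * (adMatrix b).transpose) j q else 0) -
      (if q = j then opQ b (adMatrix b * N) q l else 0) := by
    have h1 : ∀ a, opQ b N j l * ((xS b a L - xS b a q) * dV b (adVec b a) q) =
        (xS b a L - xS b a q) * (opQ b N j l * dV b (adVec b a) q) -
        (if q = l then (∑ c, mS (N c a) * dS k ι (b c) j) * dV b (adVec b a) q else 0) +
        (if q = j then (∑ d, mS (N a d) * dS k ι (b d) l) * dV b (adVec b a) q else 0) := by
      intro a
      rw [← mul_assoc, mul_sub, opQ_xS, opQ_xS, if_neg (Ne.symm hl), if_neg (Ne.symm hj), sub_mul,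
        sub_mul, sub_mul, sub_mul, add_mul, add_mul, ite_mul, ite_mul, zero_mul]
      simp only [mul_assoc]
      abel
    rw [Finset.mul_sum, Finset.sum_congr rfl fun a _ => h1 a, Finset.sum_add_distrib,
      Finset.sum_sub_distrib]
    have t1 : ∑ a, (if q = l then (∑ c, mS (N c a) * dS k ι (b c) j) * dV b (adVec b a) q else 0) =
        if q = l then opQ b (N * (adMatrix b).transpose) j q else 0 := by
      split_ifs
      · exact e1
      · exact Finset.sum_const_zero
    have t2 : ∑ a, (if q = j then (∑ d, mS (N a d) * dS k ι (b d) l) * dV b (adVec b a) q else 0) =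
        -if q = j then opQ b (adMatrix b * N) q l else 0 := by
      split_ifs
      · exact e2
      · rw [neg_zero]
        exact Finset.sum_const_zero
    rw [t1, t2, ← sub_eq_add_neg]
  have h2 := congrArg (mulP k g ι) (LinearMap.congr_fun h ω)
  simp only [LinearMap.sub_apply, LinearMap.sum_apply, map_sub, map_sum, Module.End.mul_apply,
    mulP_xS, sub_self, Finset.sum_const_zero, zero_sub] at h2
  simp only [Module.End.mul_apply, LinearMap.sub_apply, map_sum, map_sub]
  rw [h2]
  split_ifs <;> simp

theorem mulP_totD_prodY [DecidableEq ι] [CharZero k] (i : ℕ) (x : Slots k g) :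
    formsD b (mulP k g ι (prodY k ι b i (cstS k g ι x))) =
      (-1 : k) ^ i • mulP k g ι (prodY k ι b i (cstS k g ι (slotD b x))) := by
  have h := congrArg (mulP k g ι)
    (LinearMap.congr_fun (totD_prodY (L := i + 1) b (Nat.lt_succ_self i)) (cstS k g ι x))
  simp only [LinearMap.add_apply, LinearMap.sum_apply, LinearMap.smul_apply, Module.End.mul_apply,
    LinearMap.sub_apply, map_add, map_sum, map_smul, map_sub, mulP_xS, sub_self,
    Finset.sum_const_zero, smul_zero, add_zero, totD_cst, mulP_totD] at h
  exact h

/-- The differential of forms, passed through a bivector and the product of tautological derivatives.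
The terms in which a tautological derivative is lost contain `Ad N`. -/
theorem formsD_opQ_prodY [DecidableEq ι] [CharZero k] {N : Matrix ι ι (MvPowerSeries ι k)}
    (hN : IsInvariant b N) {i j l : ℕ} (hj : j ≤ i) (hl : l ≤ i) (x : Slots k g) :
    formsD b (mulP k g ι (opQ b N j l (prodY k ι b i (cstS k g ι x)))) =
      (-1 : k) ^ i • mulP k g ι (opQ b N j l (prodY k ι b i (cstS k g ι (slotD b x)))) -
      (if j = l then mulP k g ι (dV b (bracketVec b N) l (prodY k ι b i (cstS k g ι x))) else 0) -
      ∑ q ∈ Finset.range i, (-1 : k) ^ q •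
        ((if q + 1 = l then mulP k g ι (opQ b (N * (adMatrix b).transpose) j (q + 1)
            (prodYdel k ι b i (q + 1) (cstS k g ι x))) else 0) +
          (if q + 1 = j then mulP k g ι (opQ b (adMatrix b * N) (q + 1) l
            (prodYdel k ι b i (q + 1) (cstS k g ι x))) else 0)) := by
  have hj' : j ≠ i + 1 := by omega
  have hl' : l ≠ i + 1 := by omega
  have h := LinearMap.congr_fun (totD_prodY (L := i + 1) b (Nat.lt_succ_self i)) (cstS k g ι x)
  simp only [LinearMap.add_apply, LinearMap.smul_apply, Module.End.mul_apply, totD_cst] at h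
  rw [← mulP_totD b (i + 1), mulP_totD_opQ b hN hj' hl', h, map_add, map_add, map_smul, map_smul,
    LinearMap.sum_apply, map_sum, map_sum, add_sub_right_comm, sub_eq_add_neg _ (Finset.sum _ _),
    ← Finset.sum_neg_distrib]
  congr 1
  refine Finset.sum_congr rfl fun q _ => ?_
  have h2 := mulP_opQ_adVec b N (q := q + 1) hj' hl' (prodYdel k ι b i (q + 1) (cstS k g ι x))
  rw [LinearMap.smul_apply, Module.End.mul_apply, LinearMap.sum_apply, map_smul, map_smul, h2,
    ← smul_neg]
  congr 1
  abel

end Bivectors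

/-! ### Numerical coefficients of the homotopy -/

section Coefficients

variable (k : Type*) [Field k] [CharZero k]

/-- The numbers `β(n; i, r) = ∑_{a + m = n} (B_a / a!) multichoose(r, m) / (m + i)!`. -/
def betaC (n i r : ℕ) : k :=
  ∑ p ∈ Finset.HasAntidiagonal.antidiagonal n, ((bernoulli p.1 : ℚ) : k) / (p.1.factorial : k) *
    ((Nat.multichoose r p.2 : k) / ((p.2 + i).factorial : k))

theorem betaC_zero (n i : ℕ) :
    betaC k n i 0 = ((bernoulli n : ℚ) : k) / (n.factorial : k) / (i.factorial : k) := by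
  rw [betaC, Finset.sum_eq_single (n, 0)]
  · simp [div_eq_mul_inv]
  · rintro ⟨a, m⟩ h hne
    rw [Finset.HasAntidiagonal.mem_antidiagonal] at h
    have : m ≠ 0 := by
      rintro rfl
      exact hne (Prod.ext (by simpa using h) rfl)
    obtain ⟨m, rfl⟩ := Nat.exists_eq_succ_of_ne_zero this
    simp [Nat.multichoose_zero_succ]
  · intro h
    exact absurd (Finset.HasAntidiagonal.mem_antidiagonal.2 (add_zero n)) h

theorem betaC_zero_left (i r : ℕ) : betaC k 0 i r = 1 / (i.factorial : k) := by
  simp [betaC]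

/-- The recursion for `β`, which is Pascal's rule for `multichoose`. -/
theorem betaC_sub (n i r : ℕ) :
    betaC k (n + 1) i (r + 1) - betaC k (n + 1) i r = betaC k n (i + 1) (r + 1) := by
  rw [betaC, betaC, betaC, ← Finset.sum_sub_distrib,
    Finset.Nat.sum_antidiagonal_succ' (f := fun p => ((bernoulli p.1 : ℚ) : k) /
      (p.1.factorial : k) * ((Nat.multichoose (r + 1) p.2 : k) / ((p.2 + i).factorial : k)) -
      ((bernoulli p.1 : ℚ) : k) / (p.1.factorial : k) *
        ((Nat.multichoose r p.2 : k) / ((p.2 + i).factorial : k)))]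
  simp only [Nat.multichoose_zero_right, sub_self, zero_add]
  refine Finset.sum_congr rfl fun p _ => ?_
  rw [← mul_sub, ← sub_div, Nat.multichoose_succ_succ, Nat.cast_add, add_sub_cancel_left,
    add_right_comm, add_assoc p.2 i 1]

/-- The recursion `∑_{a < n} (n choose a) B_a = 0` for the Bernoulli numbers. -/
theorem betaC_last (n i : ℕ) : betaC k n i (i + 1) = (-1) ^ n * betaC k n i 0 := by
  rw [betaC_zero]
  -- for `r = i + 1` the factor depending on `i` splits off
  have h1 : ∀ m, (Nat.multichoose (i + 1) m : k) / ((m + i).factorial : k) =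
      1 / ((m.factorial : k) * (i.factorial : k)) := by
    intro m
    have h2 : (Nat.multichoose (i + 1) m) * (m.factorial * i.factorial) = (m + i).factorial := by
      rw [Nat.multichoose_eq, show i + 1 + m - 1 = m + i by omega,
        ← Nat.add_choose_mul_factorial_mul_factorial m i, mul_assoc, Nat.choose_symm_add]
    have h3 : ((m + i).factorial : k) ≠ 0 := Nat.cast_ne_zero.2 (Nat.factorial_ne_zero _)
    have h4 : ((m.factorial : k) * (i.factorial : k)) ≠ 0 :=
      mul_ne_zero (Nat.cast_ne_zero.2 (Nat.factorial_ne_zero _))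
        (Nat.cast_ne_zero.2 (Nat.factorial_ne_zero _))
    rw [div_eq_div_iff h3 h4, one_mul]
    exact_mod_cast h2
  have h5 : ∑ p ∈ Finset.HasAntidiagonal.antidiagonal n, (bernoulli p.1 : ℚ) / (p.1.factorial : ℚ) *
      (1 / (p.2.factorial : ℚ)) = (-1) ^ n * (bernoulli n / (n.factorial : ℚ)) := by
    have h6 : ∑ a ∈ Finset.range (n + 1), (n.choose a : ℚ) * bernoulli a =
        (-1) ^ n * bernoulli n := by
      rw [Finset.sum_range_succ, sum_bernoulli, ← bernoulli'_eq_bernoulli, Nat.choose_self]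
      split_ifs with h
      · subst h
        norm_num
      · rw [bernoulli_eq_bernoulli'_of_ne_one h, Nat.cast_one, one_mul, zero_add]
    rw [← mul_div_assoc, ← h6, Finset.Nat.sum_antidiagonal_eq_sum_range_succ_mk, Finset.sum_div]
    refine Finset.sum_congr rfl fun a ha => ?_
    rw [Finset.mem_range] at ha
    rw [Nat.cast_choose ℚ (by omega : a ≤ n)]
    have h1 : (n.factorial : ℚ) ≠ 0 := Nat.cast_ne_zero.2 (Nat.factorial_ne_zero _)
    field_simp
  have h7 := congrArg (algebraMap ℚ k) h5
  simp only [map_sum, map_mul, map_div₀, map_natCast, map_one, map_pow, map_neg,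
    eq_ratCast] at h7
  rw [betaC]
  simp only [h1]
  rw [← mul_div_assoc, ← h7, Finset.sum_div]
  refine Finset.sum_congr rfl fun p _ => ?_
  rw [mul_div_assoc, div_div]

/-- The symmetry of `β` under `r ↦ i + 1 - r`, from the case `r = 0` and the recursion. -/
theorem betaC_symm (n i r : ℕ) (h : r ≤ i + 1) :
    betaC k n i (i + 1 - r) = (-1) ^ n * betaC k n i r := by
  induction i generalizing n r with
  | zero =>
    interval_cases r
    · exact betaC_last k n 0
    · have := betaC_last k n 0
      simp only [zero_add] at this ⊢
      rw [this, ← mul_assoc, ← pow_add, Even.neg_one_pow ⟨n, rfl⟩, one_mul]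
  | succ i ih =>
    rcases Nat.eq_zero_or_pos r with rfl | hr
    · exact betaC_last k n (i + 1)
    · rcases h.eq_or_lt with rfl | hlt
      · rw [Nat.sub_self, betaC_last, ← mul_assoc, ← pow_add, Even.neg_one_pow ⟨n, rfl⟩, one_mul]
      · obtain ⟨r, rfl⟩ := Nat.exists_eq_succ_of_ne_zero hr.ne'
        have e : i + 1 + 1 - (r + 1) = (i - r) + 1 := by omega
        rw [Nat.succ_eq_add_one, e, ← betaC_sub, ← betaC_sub,
          show i - r + 1 = i + 1 - r by omega, ih _ _ (by omega),
          show i - r = i + 1 - (r + 1) by omega, ih _ _ (by omega), pow_succ]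
        ring

/-- The coefficients `g(n; i; j, l)` of the homotopy: `β(n; i, l - j)` for `j < l`, with
`l - j` taken modulo `i + 1`, and the mean of the two values `β(n; i, 0)`, `β(n; i, i + 1)`
for `j = l`. -/
def gC (n i j l : ℕ) : k :=
  if j < l then betaC k n i (l - j) else if l < j then betaC k n i (i + 1 + l - j) else
    2⁻¹ * (betaC k n i 0 + betaC k n i (i + 1))

theorem gC_symm (n i j l : ℕ) (hj : j ≤ i) (hl : l ≤ i) :
    gC k n i l j = (-1) ^ n * gC k n i j l := by
  have h0 : ((-1 : k) ^ n * (-1) ^ n) = 1 := by rw [← pow_add, Even.neg_one_pow ⟨n, rfl⟩]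
  rcases lt_trichotomy j l with h | rfl | h
  · rw [gC, gC, if_neg (by omega), if_pos h, if_pos h, ← betaC_symm k n i _ (by omega)]
    congr 1
    omega
  · have := betaC_last k n i
    simp only [gC, lt_irrefl, if_false, this]
    linear_combination (-2⁻¹ * betaC k n i 0) * h0
  · rw [gC, gC, if_pos h, if_neg (by omega), if_pos h, ← betaC_symm k n i _ (by omega)]
    congr 1
    omega

theorem gC_self (n i j : ℕ) : gC k n i j j = if Odd n then 0 else betaC k n i 0 := by
  simp only [gC, lt_irrefl, if_false, betaC_last]
  split_ifs with h
  · rw [h.neg_one_pow]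
    ring
  · rw [(Nat.not_odd_iff_even.1 h).neg_one_pow]
    field_simp
    ring

/-- The defect of the recursion for the coefficients `g`, coming from `B_1 ≠ 0`. -/
def defectC (n m : ℕ) : k := if n = 0 then 2⁻¹ / (m.factorial : k) else 0

theorem gC_self_eq (n m j : ℕ) : gC k (n + 1) m j j = betaC k (n + 1) m 0 + defectC k n m := by
  rw [gC_self, defectC]
  split_ifs with h h0 h0
  · subst h0
    rw [betaC_zero, zero_add, bernoulli_one]
    push_cast
    simp only [Nat.factorial_one, Nat.cast_one, div_one]
    ring
  · rw [betaC_zero, bernoulli_eq_zero_of_odd h (by omega)]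
    simp
  · subst h0
    exact absurd odd_one h
  · rw [add_zero]

theorem gC_self_eq' (n m j : ℕ) :
    gC k (n + 1) m j j = betaC k (n + 1) m (m + 1) - defectC k n m := by
  rw [betaC_last]
  have h := gC_self_eq k n m j
  have h' := gC_self k (n + 1) m j
  rcases Nat.even_or_odd (n + 1) with h1 | h1
  · rw [h1.neg_one_pow, one_mul]
    rw [if_neg (Nat.not_odd_iff_even.2 h1)] at h'
    linear_combination 2 * h' - h
  · rw [h1.neg_one_pow]
    rw [if_pos h1] at h'
    linear_combination 2 * h' - h

/-- The recursion for the coefficients `g` along the merging of two neighbouring slots. -/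
theorem gC_faceIdx (n m q l : ℕ) (hq : q ≤ m) (hl : l ≤ m + 1) (hne : l ≠ q + 1) :
    gC k (n + 1) m (faceIdx m (q + 1) (q + 1)) (faceIdx m (q + 1) l) -
      gC k (n + 1) m (faceIdx m q (q + 1)) (faceIdx m q l) =
    -gC k n (m + 1) (q + 1) l + defectC k n m * ((if l = q + 2 then 1 else 0) +
      (if l = q then 1 else 0) + if q = m ∧ l = 0 then 1 else 0) := by
  have f0 : faceIdx m q (q + 1) = q := by
    simp only [faceIdx]; split_ifs <;> omega
  have hlt : ∀ n i j l, j < l → gC k n i j l = betaC k n i (l - j) := fun n i j l h => by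
    rw [gC, if_pos h]
  have hgt : ∀ n i j l, l < j → gC k n i j l = betaC k n i (i + 1 + l - j) := fun n i j l h => by
    rw [gC, if_neg (by omega), if_pos h]
  rcases lt_or_gt_of_ne hne with h | h
  · have f3 : faceIdx m q l = l := by
      simp only [faceIdx]; split_ifs <;> omega
    have f4 : faceIdx m (q + 1) l = l := by
      simp only [faceIdx]; split_ifs <;> omega
    rw [f0, f3, f4, hgt n (m + 1) (q + 1) l h, if_neg (show ¬ l = q + 2 by omega)]
    rcases hq.lt_or_eq with hqm | rfl
    · have f1 : faceIdx m (q + 1) (q + 1) = q + 1 := by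
        simp only [faceIdx]; split_ifs <;> omega
      rw [f1, hgt _ _ (q + 1) l h, if_neg (show ¬ (q = m ∧ l = 0) by omega)]
      have := betaC_sub k n m (m + l - q)
      rw [show m + 1 + 1 + l - (q + 1) = m + l - q + 1 by omega, ← this,
        show m + 1 + l - (q + 1) = m + l - q by omega]
      by_cases hlq : l = q
      · subst hlq
        rw [if_pos rfl, gC_self_eq', show m + l - l = m by omega]
        ring
      · rw [if_neg hlq, hgt _ _ _ _ (by omega : l < q), show m + 1 + l - q = m + l - q + 1 by omega]
        ring
    · have f1 : faceIdx q (q + 1) (q + 1) = 0 := by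
        simp only [faceIdx]; split_ifs <;> omega
      have := betaC_sub k n q l
      rw [f1, show q + 1 + 1 + l - (q + 1) = l + 1 by omega, ← this]
      have e1 : gC k (n + 1) q 0 l = betaC k (n + 1) q l +
          defectC k n q * (if q = q ∧ l = 0 then 1 else 0) := by
        by_cases h0 : l = 0
        · subst h0
          rw [gC_self_eq, if_pos ⟨rfl, rfl⟩, mul_one]
        · rw [if_neg (by omega), hlt _ _ _ _ (by omega), Nat.sub_zero, mul_zero, add_zero]
      have e2 : gC k (n + 1) q q l = betaC k (n + 1) q (l + 1) -
          defectC k n q * (if l = q then 1 else 0) := by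
        by_cases h0 : l = q
        · subst h0
          rw [gC_self_eq', if_pos rfl, mul_one]
        · rw [if_neg h0, hgt _ _ _ _ (by omega), mul_zero, sub_zero,
            show q + 1 + l - q = l + 1 by omega]
      rw [e1, e2]
      ring
  · have f1 : faceIdx m (q + 1) (q + 1) = q + 1 := by
      simp only [faceIdx]; split_ifs <;> omega
    have f3 : faceIdx m q l = l - 1 := by
      simp only [faceIdx]; split_ifs <;> omega
    have f4 : faceIdx m (q + 1) l = l - 1 := by
      simp only [faceIdx]; split_ifs <;> omega
    obtain ⟨r, rfl⟩ : ∃ r, l = q + 2 + r := ⟨l - (q + 2), by omega⟩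
    rw [f0, f1, f3, f4, hlt n (m + 1) _ _ h, hlt (n + 1) m q _ (by omega),
      if_neg (show ¬ q + 2 + r = q by omega), if_neg (show ¬ (q = m ∧ q + 2 + r = 0) by omega)]
    have := betaC_sub k n m r
    rw [show q + 2 + r - (q + 1) = r + 1 by omega, ← this,
      show q + 2 + r - 1 - q = r + 1 by omega, show q + 2 + r - 1 = q + 1 + r by omega]
    by_cases h0 : r = 0
    · subst h0
      rw [if_pos rfl, add_zero, gC_self_eq]
      ring
    · rw [if_neg (by omega), hlt _ _ _ _ (by omega), show q + 1 + r - (q + 1) = r by omega]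
      ring

theorem faceIdx_eq_of_ne {m q l : ℕ} (hq : q ≤ m) (hl : l ≤ m + 1) (hne : l ≠ q + 1) :
    faceIdx m (q + 1) l = faceIdx m q l := by
  simp only [faceIdx]
  split_ifs <;> omega

end Coefficients

/-! ### Symbols and the Hochschild operator -/

section Pullback

variable {k : Type*} [Field k] {g : Type*} [LieRing g] [LieAlgebra k g]
  {ι : Type*} [Fintype ι] (b : Module.Basis ι k g)

variable (k g ι) in
/-- The relabelling of slots, on coefficients. -/
def relS (θ : ℕ → ℕ) : Module.End k (SlotForms k g ι) := cmap (relabel θ).toLinearMap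

omit [Fintype ι] in
theorem relS_cstS (θ : ℕ → ℕ) (x : Slots k g) :
    relS k g ι θ (cstS k g ι x) = cstS k g ι (relabel θ x) := cmap_cst (relabel θ).toLinearMap x

omit [Fintype ι] in
theorem mulP_relS (θ : ℕ → ℕ) (ω : SlotForms k g ι) :
    mulP k g ι (relS k g ι θ ω) = mulP k g ι ω := by
  refine MvPowerSeries.ext fun n => ?_
  exact slotProd_relabel θ _

omit [Fintype ι] in
theorem mS_relS (f : MvPowerSeries ι k) (θ : ℕ → ℕ) :
    mS f * relS k g ι θ = relS k g ι θ * mS f :=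
  (LinearMap.ext fun ω => cmap_mulS (relabel θ).toLinearMap f ω).symm

omit [Fintype ι] in
theorem dS_relS (θ : ℕ → ℕ) (x : g) (l : ℕ) (s : Finset ℕ) (hs : ∀ r, r ∈ s ↔ θ r = l) :
    dS k ι x l * relS k g ι θ = relS k g ι θ * ∑ r ∈ s, dS k ι x r := by
  refine LinearMap.ext fun ω => slotForms_ext fun n => ?_
  have h := dslot_relabel θ x l s hs (coeffS k g ι n ω)
  rw [Module.End.mul_apply, Module.End.mul_apply, LinearMap.sum_apply]
  refine Eq.trans h ?_
  change relabel θ (∑ r ∈ s, dslot x r (coeffS k g ι n ω)) =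
    relabel θ (coeffS k g ι n (∑ r ∈ s, dS k ι x r ω))
  rw [map_sum (coeffS k g ι n)]
  rfl

theorem dV_relS (θ : ℕ → ℕ) (v : ι → MvPowerSeries ι k) (l : ℕ) (s : Finset ℕ)
    (hs : ∀ r, r ∈ s ↔ θ r = l) :
    dV b v l * relS k g ι θ = relS k g ι θ * ∑ r ∈ s, dV b v r := by
  simp only [dV]
  rw [Finset.sum_comm, Finset.sum_mul, Finset.mul_sum]
  refine Finset.sum_congr rfl fun c _ => ?_
  rw [mul_assoc, dS_relS θ _ l s hs, ← mul_assoc, mS_relS, mul_assoc, Finset.mul_sum]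

/-- Pulling back a weighted sum of derivatives of a bivector. -/
theorem sum_opQ_relS (N : Matrix ι ι (MvPowerSeries ι k)) (θ : ℕ → ℕ) (m m' : ℕ)
    (h1 : ∀ r ≤ m', θ r ≤ m) (h2 : ∀ r, θ r ≤ m → r ≤ m') (f : ℕ → ℕ → k) :
    (∑ j ∈ Finset.range (m + 1), ∑ l ∈ Finset.range (m + 1), f j l • opQ b N j l) *
        relS k g ι θ =
      relS k g ι θ * ∑ j ∈ Finset.range (m' + 1), ∑ l ∈ Finset.range (m' + 1),
        f (θ j) (θ l) • opQ b N j l := by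
  have hs : ∀ l ∈ Finset.range (m + 1), ∀ r,
      r ∈ (Finset.range (m' + 1)).filter (fun r => θ r = l) ↔ θ r = l := by
    intro l hl r
    rw [Finset.mem_filter, Finset.mem_range, and_iff_right_iff_imp]
    rintro rfl
    exact Nat.lt_succ_of_le (h2 r (Nat.le_of_lt_succ (Finset.mem_range.1 hl)))
  have hm : ∀ r ∈ Finset.range (m' + 1), θ r ∈ Finset.range (m + 1) := by
    intro r hr
    rw [Finset.mem_range] at hr ⊢
    exact Nat.lt_succ_of_le (h1 r (Nat.le_of_lt_succ hr))
  have key : ∀ c d, ∑ j ∈ Finset.range (m + 1), ∑ l ∈ Finset.range (m + 1),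
      f j l • (mS (N c d) * (dS k ι (b c) j * dS k ι (b d) l)) * relS k g ι θ =
      relS k g ι θ * ∑ j ∈ Finset.range (m' + 1), ∑ l ∈ Finset.range (m' + 1),
        f (θ j) (θ l) • (mS (N c d) * (dS k ι (b c) j * dS k ι (b d) l)) := by
    intro c d
    rw [← Finset.sum_fiberwise_of_maps_to hm, Finset.mul_sum]
    refine Finset.sum_congr rfl fun j hj => ?_
    have e1 : ∀ r ∈ (Finset.range (m' + 1)).filter (fun r => θ r = j),
        ∑ l ∈ Finset.range (m' + 1),
          f (θ r) (θ l) • (mS (N c d) * (dS k ι (b c) r * dS k ι (b d) l)) =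
        ∑ l ∈ Finset.range (m + 1), ∑ t ∈ (Finset.range (m' + 1)).filter (fun r => θ r = l),
          f j l • (mS (N c d) * (dS k ι (b c) r * dS k ι (b d) t)) := by
      intro r hr
      rw [← Finset.sum_fiberwise_of_maps_to hm]
      refine Finset.sum_congr rfl fun l _ => Finset.sum_congr rfl fun t ht => ?_
      rw [(Finset.mem_filter.1 hr).2, (Finset.mem_filter.1 ht).2]
    rw [Finset.sum_congr rfl e1, Finset.sum_comm, Finset.mul_sum]
    refine Finset.sum_congr rfl fun l hl => ?_
    rw [smul_mul_assoc, mul_assoc, mul_assoc, dS_relS θ _ l _ (hs l hl),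
      ← mul_assoc (dS k ι (b c) j), dS_relS θ _ j _ (hs j hj), ← mul_assoc, ← mul_assoc, mS_relS]
    simp only [mul_assoc, ← Finset.smul_sum, Finset.mul_sum, Finset.sum_mul, mul_smul_comm]
    rw [Finset.sum_comm]
  have e2 : ∀ (n : ℕ) (f : ℕ → ℕ → k),
      ∑ j ∈ Finset.range n, ∑ l ∈ Finset.range n, f j l • opQ b N j l =
      ∑ c, ∑ d, ∑ j ∈ Finset.range n, ∑ l ∈ Finset.range n,
        f j l • (mS (N c d) * (dS k ι (b c) j * dS k ι (b d) l)) := by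
    intro n f
    simp only [opQ, Finset.smul_sum]
    rw [Finset.sum_congr rfl fun j _ => Finset.sum_comm, Finset.sum_comm]
    refine Finset.sum_congr rfl fun c _ => ?_
    rw [Finset.sum_congr rfl fun j _ => Finset.sum_comm, Finset.sum_comm]
  rw [e2, e2 (m' + 1) (fun j l => f (θ j) (θ l))]
  simp only [Finset.sum_mul, key]
  simp only [Finset.mul_sum]

theorem prodYdel_succ_of_ne {i q : ℕ} (h : q ≠ i + 1) :
    prodYdel k ι b (i + 1) q = prodYdel k ι b i q * dY k ι b (i + 1) := by
  rw [prodYdel, if_neg h]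

theorem prodYdel_succ_self (i : ℕ) : prodYdel k ι b (i + 1) (i + 1) = prodY k ι b i := by
  rw [prodYdel, if_pos rfl]

theorem prodY_relS_merge {p : ℕ} {θ : ℕ → ℕ} (hθ : ∀ l, θ l = if l ≤ p then l else l - 1) (m : ℕ) :
    (m < p → prodY k ι b m * relS k g ι θ = relS k g ι θ * prodY k ι b m) ∧
    (p ≤ m → prodY k ι b m * relS k g ι θ = relS k g ι θ *
      ((if p = 0 then 0 else prodYdel k ι b (m + 1) p) + prodYdel k ι b (m + 1) (p + 1))) := by
  induction m with
  | zero =>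
    refine ⟨fun _ => by rw [prodY, one_mul, mul_one], fun h => ?_⟩
    obtain rfl : p = 0 := by omega
    rw [if_pos rfl, zero_add, prodYdel, if_pos rfl, prodY, one_mul, mul_one]
  | succ m ih =>
    refine ⟨fun h => ?_, fun h => ?_⟩
    · rw [prodY, mul_assoc, dY, dV_relS b θ _ (m + 1) {m + 1}, ← mul_assoc, ih.1 (by omega),
        Finset.sum_singleton, mul_assoc]
      intro r
      rw [Finset.mem_singleton, hθ]
      split_ifs <;> omega
    · rcases h.lt_or_eq with hlt | rfl
      · rw [prodY, mul_assoc, dY, dV_relS b θ _ (m + 1) {m + 2}, ← mul_assoc, ih.2 (by omega),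
          Finset.sum_singleton, mul_assoc, add_mul,
          prodYdel_succ_of_ne b (show p ≠ m + 1 + 1 by omega),
          prodYdel_succ_of_ne b (show p + 1 ≠ m + 1 + 1 by omega), ite_mul, zero_mul]
        · rfl
        · intro r
          rw [Finset.mem_singleton, hθ]
          split_ifs <;> omega
      · rw [prodY, mul_assoc, dY, dV_relS b θ _ (m + 1) {m + 1, m + 2}, ← mul_assoc,
          ih.1 (by omega), Finset.sum_pair (by omega), mul_assoc, mul_add, if_neg (by omega)]
        · congr 1
          rw [add_comm]
          simp [prodYdel, prodY, dY]
        · intro r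
          rw [Finset.mem_insert, Finset.mem_singleton, hθ]
          split_ifs <;> omega

theorem prodY_relS_cyclic {M : ℕ} {θ : ℕ → ℕ}
    (hθ : ∀ l, θ l = if l ≤ M then l else if l = M + 1 then 0 else l - 1) (m : ℕ) (hm : m ≤ M) :
    prodY k ι b m * relS k g ι θ = relS k g ι θ * prodY k ι b m := by
  induction m with
  | zero => rw [prodY, one_mul, mul_one]
  | succ m ih =>
    rw [prodY, mul_assoc, dY, dV_relS b θ _ (m + 1) {m + 1}, ← mul_assoc, ih (by omega),
      Finset.sum_singleton, mul_assoc]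
    intro r
    rw [Finset.mem_singleton, hθ]
    by_cases h1 : r ≤ M
    · rw [if_pos h1]
    · rw [if_neg h1]
      by_cases h2 : r = M + 1
      · rw [if_pos h2]
        omega
      · rw [if_neg h2]
        omega

/-- The product of tautological derivatives, pulled back along a face. -/
theorem prodY_relS (m p : ℕ) (hp : p ≤ m + 1) :
    prodY k ι b m * relS k g ι (faceIdx m p) = relS k g ι (faceIdx m p) *
      ((if p = 0 then 0 else prodYdel k ι b (m + 1) p) +
        if p = m + 1 then 0 else prodYdel k ι b (m + 1) (p + 1)) := by
  rcases hp.lt_or_eq with h | rfl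
  · rw [if_neg h.ne, (prodY_relS_merge b (p := p) (fun l => ?_) m).2 (by omega)]
    simp only [faceIdx, if_pos (show p ≤ m by omega)]
  · rw [if_neg (by omega), if_pos rfl, add_zero, prodY_relS_cyclic b (fun l => ?_) m le_rfl,
      prodYdel, if_pos rfl]
    simp only [faceIdx, if_neg (show ¬ m + 1 ≤ m by omega)]

theorem faceIdx_le {m p r : ℕ} (hr : r ≤ m + 1) : faceIdx m p r ≤ m := by
  simp only [faceIdx]
  split_ifs <;> omega

theorem le_of_faceIdx_le {m p r : ℕ} (h : faceIdx m p r ≤ m) : r ≤ m + 1 := by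
  simp only [faceIdx] at h
  split_ifs at h <;> omega

/-- Summation by parts over the faces. -/
theorem sum_faces_by_parts {P : Type*} [AddCommGroup P] [Module k P] (m : ℕ) (F : ℕ → ℕ → P) :
    ∑ p ∈ Finset.range (m + 2), (-1 : k) ^ p • ((if p = 0 then 0 else F p p) +
      if p = m + 1 then 0 else F p (p + 1)) =
    ∑ q ∈ Finset.range (m + 1), (-1 : k) ^ q • (F q (q + 1) - F (q + 1) (q + 1)) := by
  simp only [smul_add, smul_sub, Finset.sum_add_distrib, Finset.sum_sub_distrib]
  rw [Finset.sum_range_succ', Finset.sum_range_succ (fun p => (-1 : k) ^ p • if p = m + 1 then 0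
    else F p (p + 1))]
  simp only [if_true, smul_zero, add_zero]
  rw [add_comm, sub_eq_add_neg, ← Finset.sum_neg_distrib]
  congr 1
  · refine Finset.sum_congr rfl fun q hq => ?_
    rw [Finset.mem_range] at hq
    rw [if_neg (by omega)]
  · refine Finset.sum_congr rfl fun q hq => ?_
    rw [if_neg (by omega), pow_succ, mul_neg_one, neg_smul]

/-- The symbol of the homotopy in arity `i`, for the bivector `N`. -/
def opG [CharZero k] (N : Matrix ι ι (MvPowerSeries ι k)) (n i : ℕ) :
    Module.End k (SlotForms k g ι) :=
  (2⁻¹ : k) • ∑ j ∈ Finset.range (i + 1), ∑ l ∈ Finset.range (i + 1), gC k n i j l • opQ b N j l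

/-- A double sum of a symmetric function that is supported on the cross with centre `(Q, Q)`. -/
theorem sum_sum_cross {P : Type*} [AddCommGroup P] [Module k P] [CharZero k] (m Q : ℕ) (hQ : Q < m)
    (F : ℕ → ℕ → P) (h0 : ∀ j < m, ∀ l < m, j ≠ Q → l ≠ Q → F j l = 0) (h1 : F Q Q = 0)
    (h2 : ∀ l < m, F l Q = F Q l) :
    (2⁻¹ : k) • ∑ j ∈ Finset.range m, ∑ l ∈ Finset.range m, F j l =
      ∑ l ∈ Finset.range m, F Q l := by
  have e1 : ∀ j ∈ (Finset.range m).erase Q, ∑ l ∈ Finset.range m, F j l = F Q j := by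
    intro j hj
    have hjm : j < m := Finset.mem_range.1 (Finset.mem_of_mem_erase hj)
    rw [Finset.sum_eq_single Q, h2 j hjm]
    · exact fun l hlm hl => h0 j hjm l (Finset.mem_range.1 hlm) (Finset.ne_of_mem_erase hj) hl
    · intro h
      exact absurd (Finset.mem_range.2 hQ) h
  rw [← Finset.add_sum_erase _ _ (Finset.mem_range.2 hQ), Finset.sum_congr rfl e1,
    Finset.sum_erase _ h1, ← two_smul k, smul_smul, inv_mul_cancel₀ two_ne_zero, one_smul]

/-- The symbol of the homotopy composed with the Hochschild operator. The terms with the coefficient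
`defectC` survive in the homotopy identity only for `n = 0`, where they are the deformation `d_0`. -/
theorem mulP_opG_slotB [CharZero k] {N : Matrix ι ι (MvPowerSeries ι k)} {n : ℕ}
    (hN : N.transpose = (-1 : k) ^ n • N) (m : ℕ) (x : Slots k g) :
    mulP k g ι (opG b N (n + 1) m (prodY k ι b m (cstS k g ι (slotB m x)))) =
      ∑ q ∈ Finset.range (m + 1), (-1 : k) ^ q • ∑ l ∈ Finset.range (m + 2),
        (gC k n (m + 1) (q + 1) l - defectC k n m * ((if l = q + 2 then 1 else 0) +
      (if l = q then 1 else 0) + if q = m ∧ l = 0 then 1 else 0)) •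
          mulP k g ι (opQ b N (q + 1) l (prodYdel k ι b (m + 1) (q + 1) (cstS k g ι x))) := by
  -- the symmetry of the coefficients `g` matches that of the bivector
  have hQt : ∀ j l, opQ (g := g) b N l j = (-(-1 : k) ^ n) • opQ b N j l := by
    intro j l
    rw [opQ_transpose, hN]
    simp only [opQ, Matrix.smul_apply, mS_smul, smul_mul_assoc, ← Finset.smul_sum, neg_smul]
  have hself : Even n → ∀ j, opQ (g := g) b N j j = 0 := by
    intro hn j
    have h := hQt j j
    rw [hn.neg_one_pow, neg_one_smul, eq_neg_iff_add_eq_zero, ← two_smul k] at h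
    exact (smul_eq_zero.1 h).resolve_left two_ne_zero
  -- the pullback along each face, split into the two omitted slots
  have e1 : ∀ p ∈ Finset.range (m + 2),
      mulP k g ι (opG b N (n + 1) m (prodY k ι b m (cstS k g ι (relabel (faceIdx m p) x)))) =
      (if p = 0 then 0 else mulP k g ι (((2⁻¹ : k) • ∑ j ∈ Finset.range (m + 2),
        ∑ l ∈ Finset.range (m + 2), gC k (n + 1) m (faceIdx m p j) (faceIdx m p l) • opQ b N j l)
          (prodYdel k ι b (m + 1) p (cstS k g ι x)))) +
      (if p = m + 1 then 0 else mulP k g ι (((2⁻¹ : k) • ∑ j ∈ Finset.range (m + 2),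
        ∑ l ∈ Finset.range (m + 2), gC k (n + 1) m (faceIdx m p j) (faceIdx m p l) • opQ b N j l)
          (prodYdel k ι b (m + 1) (p + 1) (cstS k g ι x)))) := by
    intro p hp
    rw [Finset.mem_range] at hp
    rw [← relS_cstS, ← Module.End.mul_apply (prodY k ι b m), prodY_relS b m p (by omega),
      Module.End.mul_apply, ← Module.End.mul_apply (opG b N (n + 1) m), opG, smul_mul_assoc,
      sum_opQ_relS b N (faceIdx m p) m (m + 1) (fun r hr => faceIdx_le hr)
        (fun r hr => le_of_faceIdx_le hr), ← mul_smul_comm, Module.End.mul_apply, mulP_relS,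
      LinearMap.add_apply, map_add, map_add]
    congr 1 <;> split_ifs <;> simp only [LinearMap.zero_apply, map_zero]
  rw [slotB_apply, map_sum, map_sum, map_sum, map_sum]
  simp only [map_smul]
  rw [Finset.sum_congr rfl fun p hp => congrArg _ (e1 p hp),
    sum_faces_by_parts m (fun p q => mulP k g ι (((2⁻¹ : k) • ∑ j ∈ Finset.range (m + 2),
        ∑ l ∈ Finset.range (m + 2), gC k (n + 1) m (faceIdx m p j) (faceIdx m p l) • opQ b N j l)
          (prodYdel k ι b (m + 1) q (cstS k g ι x))))]
  -- the faces `q` and `q + 1` differ only on the slot `q + 1`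
  refine Finset.sum_congr rfl fun q hq => ?_
  rw [Finset.mem_range] at hq
  congr 1
  rw [← map_sub, ← LinearMap.sub_apply, ← smul_sub]
  simp only [← Finset.sum_sub_distrib, ← sub_smul]
  rw [sum_sum_cross (m + 2) (q + 1) (by omega)]
  · rw [LinearMap.sum_apply, map_sum]
    refine Finset.sum_congr rfl fun l hl => ?_
    rw [Finset.mem_range] at hl
    rw [LinearMap.smul_apply, map_smul]
    by_cases hne : l = q + 1
    · subst hne
      rw [gC_self, gC_self, sub_self, zero_smul, gC_self,
        if_neg (show ¬ q + 1 = q + 2 by omega), if_neg (show ¬ q + 1 = q by omega),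
        if_neg (show ¬ (q = m ∧ q + 1 = 0) by omega), add_zero, add_zero, mul_zero, sub_zero]
      split_ifs with ho
      · rw [zero_smul]
      · rw [hself (Nat.not_odd_iff_even.1 ho), LinearMap.zero_apply, map_zero, smul_zero]
    · have h := gC_faceIdx k n m q l (by omega) (by omega) hne
      congr 1
      linear_combination -h
  · intro j hj' l hl' hj hl
    rw [faceIdx_eq_of_ne (by omega) (by omega) hj, faceIdx_eq_of_ne (by omega) (by omega) hl,
      sub_self, zero_smul]
  · rw [gC_self, gC_self, sub_self, zero_smul]
  · intro l hl
    have hg : ∀ p, gC k (n + 1) m (faceIdx m p l) (faceIdx m p (q + 1)) =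
        (-1) ^ (n + 1) * gC k (n + 1) m (faceIdx m p (q + 1)) (faceIdx m p l) := fun p =>
      gC_symm k _ _ _ _ (faceIdx_le (by omega)) (faceIdx_le (by omega))
    have hs : ((-1 : k) ^ (n + 1)) * -(-1) ^ n = 1 := by
      rw [pow_succ, mul_neg_one, neg_mul_neg, ← pow_add, Even.neg_one_pow ⟨n, rfl⟩]
    rw [hg, hg, ← mul_sub, hQt (q + 1) l, smul_smul, mul_right_comm, hs, one_mul]

end Pullback

/-! ### Invariant bivectors built from the scalar product -/

section Metric

variable {k : Type*} [Field k] {g : Type*} [LieRing g] [LieAlgebra k g]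
  {ι : Type*} [Fintype ι] [DecidableEq ι] (b : Module.Basis ι k g)
  (B : LinearMap.BilinForm k g) (hB : B.Nondegenerate)

theorem coord_eq_dualBasis (d : ι) (x : g) : b.coord d x = B (B.dualBasis hB b d) x := by
  conv_rhs => rw [← b.sum_repr x]
  simp only [map_sum, map_smul, LinearMap.BilinForm.apply_dualBasis_left, smul_eq_mul, mul_ite,
    mul_one, mul_zero, Finset.sum_ite_eq', Finset.mem_univ, if_true,
    Module.Basis.coord_apply]

/-- The matrix of the scalar product on the dual space. -/
def gramInv (c d : ι) : k := b.coord d (B.dualBasis hB b c)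

theorem gramInv_symm (hsymm : B.IsSymm) (c d : ι) :
    gramInv b B hB c d = gramInv b B hB d c := by
  rw [gramInv, gramInv, coord_eq_dualBasis b B hB, coord_eq_dualBasis b B hB]
  exact hsymm.eq _ _

theorem sum_gramInv (c : ι) : ∑ d, gramInv b B hB c d • b d = B.dualBasis hB b c :=
  b.sum_repr _

/-- The bivector of the scalar product. -/
def gramMatrix : Matrix ι ι (MvPowerSeries ι k) :=
  Matrix.of fun c d => algebraMap k _ (gramInv b B hB c d)

/-- The matrix of `ad(b a)`, up to sign: `b t ↦ [b t, b a]`. -/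
def structMatrix (a : ι) : Matrix ι ι (MvPowerSeries ι k) :=
  Matrix.of fun r t => algebraMap k _ (b.coord r ⁅b t, b a⁆)

/-- The entrywise coadjoint action. -/
def cadM (a : ι) (N : Matrix ι ι (MvPowerSeries ι k)) : Matrix ι ι (MvPowerSeries ι k) :=
  N.map (cad b (b a))

theorem cad_mul (x : g) (f f' : MvPowerSeries ι k) :
    cad b x (f * f') = cad b x f * f' + f * cad b x f' := by
  have := cad_mulS b x f f'
  simp only [mulS_apply, Algebra.algebraMap_self, MvPowerSeries.map_id, RingHom.id_apply] at this
  exact this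

theorem cadM_mul (a : ι) (N N' : Matrix ι ι (MvPowerSeries ι k)) :
    cadM b a (N * N') = cadM b a N * N' + N * cadM b a N' := by
  ext r s
  simp only [cadM, Matrix.map_apply, Matrix.mul_apply, Matrix.add_apply, map_sum, cad_mul,
    Finset.sum_add_distrib]

theorem isInvariant_iff (N : Matrix ι ι (MvPowerSeries ι k)) : IsInvariant b N ↔
    ∀ a, cadM b a N = structMatrix b a * N + N * (structMatrix b a).transpose := by
  have h : ∀ a c d, (structMatrix b a * N + N * (structMatrix b a).transpose) c d =
      ∑ r, b.coord c ⁅b r, b a⁆ • N r d + ∑ r, b.coord d ⁅b r, b a⁆ • N c r := by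
    intro a c d
    rw [Matrix.add_apply, Matrix.mul_apply, Matrix.mul_apply]
    simp only [structMatrix, Matrix.of_apply, Matrix.transpose_apply, Algebra.smul_def,
      mul_comm (N c _)]
  refine forall_congr' fun a => ?_
  rw [← Matrix.ext_iff]
  simp only [h]
  rfl

theorem cad_algebraMap (x : g) (c : k) :
    cad b x (algebraMap k (MvPowerSeries ι k) c) = 0 := cad_cst b x c

/-- Invariance of the scalar product. -/
theorem isInvariant_gramMatrix (hsymm : B.IsSymm) (hinv : ∀ x y z : g, B ⁅x, y⁆ z = B x ⁅y, z⁆) :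
    IsInvariant b (gramMatrix b B hB) := by
  intro a c d
  have h1 : ∀ c d, ∑ r, b.coord d ⁅b r, b a⁆ * gramInv b B hB c r =
      B (B.dualBasis hB b d) ⁅B.dualBasis hB b c, b a⁆ := by
    intro c d
    rw [← coord_eq_dualBasis, ← sum_gramInv b B hB c]
    simp only [sum_lie, smul_lie, map_sum, map_smul, smul_eq_mul, mul_comm]
  have h2 : B (B.dualBasis hB b d) ⁅B.dualBasis hB b c, b a⁆ +
      B (B.dualBasis hB b c) ⁅B.dualBasis hB b d, b a⁆ = 0 := by
    rw [← hinv, ← hinv, ← lie_skew, map_neg, LinearMap.neg_apply, neg_add_cancel]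
  simp only [gramMatrix, Matrix.of_apply, cad_algebraMap,
    Algebra.smul_def, ← map_mul, ← map_sum, ← map_add]
  rw [← h1, ← h1, add_comm] at h2
  simp only [gramInv_symm b B hB hsymm _ d, h2, map_zero]

theorem cadM_adMatrix (a : ι) : cadM b a (adMatrix b) =
    structMatrix b a * adMatrix b - adMatrix b * structMatrix b a := by
  ext1 r s
  have e0 : ∀ c, b.coord r ⁅⁅b c, b a⁆, b s⁆ = ∑ i, b.coord r ⁅b i, b s⁆ * b.coord i ⁅b c, b a⁆ := by
    intro c
    conv_lhs => rw [← b.sum_repr ⁅b c, b a⁆]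
    simp only [sum_lie, smul_lie, map_sum, map_smul, smul_eq_mul, Module.Basis.coord_apply, mul_comm]
  have e1 : cadM b a (adMatrix b) r s =
      ∑ c, b.coord r ⁅⁅b c, b a⁆, b s⁆ • MvPowerSeries.X c := by
    simp only [cadM, Matrix.map_apply, adMatrix_apply, adVec, map_sum, map_smul, cad_X', e0,
      Finset.smul_sum, Finset.sum_smul, smul_smul]
    rw [Finset.sum_comm]
  have e2 : (structMatrix b a * adMatrix b) r s =
      ∑ c, b.coord r ⁅⁅b c, b s⁆, b a⁆ • MvPowerSeries.X c := by
    have h : ∀ c, b.coord r ⁅⁅b c, b s⁆, b a⁆ =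
        ∑ t, b.coord r ⁅b t, b a⁆ * b.coord t ⁅b c, b s⁆ := by
      intro c
      conv_lhs => rw [← b.sum_repr ⁅b c, b s⁆]
      simp only [sum_lie, smul_lie, map_sum, map_smul, smul_eq_mul, Module.Basis.coord_apply,
        mul_comm]
    simp only [Matrix.mul_apply, structMatrix, Matrix.of_apply, adMatrix_apply, adVec, h,
      ← Algebra.smul_def, Finset.smul_sum, Finset.sum_smul, smul_smul]
    rw [Finset.sum_comm]
  have e3 : (adMatrix b * structMatrix b a) r s =
      ∑ c, b.coord r ⁅b c, ⁅b s, b a⁆⁆ • MvPowerSeries.X c := by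
    have h : ∀ c, b.coord r ⁅b c, ⁅b s, b a⁆⁆ =
        ∑ t, b.coord t ⁅b s, b a⁆ * b.coord r ⁅b c, b t⁆ := by
      intro c
      conv_lhs => rw [← b.sum_repr ⁅b s, b a⁆]
      simp only [lie_sum, lie_smul, map_sum, map_smul, smul_eq_mul, Module.Basis.coord_apply]
    simp only [Matrix.mul_apply, structMatrix, Matrix.of_apply, adMatrix_apply, adVec, h,
      mul_comm _ (algebraMap k _ _), ← Algebra.smul_def, Finset.smul_sum, Finset.sum_smul,
      smul_smul]
    rw [Finset.sum_comm]
  rw [Matrix.sub_apply, e1, e2, e3, ← Finset.sum_sub_distrib]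
  refine Finset.sum_congr rfl fun c _ => ?_
  rw [← sub_smul, ← map_sub]
  congr 2
  rw [lie_lie (b c) (b a) (b s), ← lie_skew (b s) (b a), lie_neg, ← lie_skew (b a) ⁅b c, b s⁆,
    sub_neg_eq_add, sub_neg_eq_add, add_comm]

theorem IsInvariant.adMatrix_mul {N : Matrix ι ι (MvPowerSeries ι k)} (hN : IsInvariant b N) :
    IsInvariant b (adMatrix b * N) := by
  rw [isInvariant_iff] at hN ⊢
  intro a
  rw [cadM_mul, hN, cadM_adMatrix]
  noncomm_ring

theorem cadM_adMatrix_pow (a : ι) (s : ℕ) : cadM b a (adMatrix b ^ s) =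
    structMatrix b a * adMatrix b ^ s - adMatrix b ^ s * structMatrix b a := by
  induction s with
  | zero =>
    rw [pow_zero, mul_one, one_mul, sub_self]
    ext1 r c
    rw [cadM, Matrix.map_apply, Matrix.one_apply, Matrix.zero_apply]
    split_ifs
    · rw [← map_one (algebraMap k (MvPowerSeries ι k)), cad_algebraMap]
    · exact map_zero _
  | succ s ih =>
    rw [pow_succ, cadM_mul, ih, cadM_adMatrix]
    noncomm_ring

/-- The functions `Tr(Ad^s)` on `g` are invariant. -/
theorem cad_trace_pow (x : g) (s : ℕ) : cad b x (adMatrix b ^ s).trace = 0 := by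
  have h : ∀ a, cad b (b a) (adMatrix b ^ s).trace = 0 := by
    intro a
    have h1 : cad b (b a) (adMatrix b ^ s).trace = (cadM b a (adMatrix b ^ s)).trace := by
      simp only [Matrix.trace, map_sum, cadM, Matrix.diag_apply, Matrix.map_apply]
    rw [h1, cadM_adMatrix_pow, Matrix.trace_sub, Matrix.trace_mul_comm, sub_self]
  have h2 : cad (R := k) b x = ∑ a, b.coord a x • cad b (b a) := by
    have hs : ∀ s : Finset ι, cad (R := k) b (∑ a ∈ s, b.coord a x • b a) =
        ∑ a ∈ s, b.coord a x • cad b (b a) := by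
      intro s
      induction s using Finset.induction_on with
      | empty => 
        have := cad_smul (R := k) b (0 : k) (0 : g)
        rwa [zero_smul, zero_smul] at this
      | insert a s ha ih => rw [Finset.sum_insert ha, Finset.sum_insert ha, cad_add, cad_smul, ih]
    conv_lhs => rw [← b.sum_repr x]
    exact hs Finset.univ
  rw [h2, LinearMap.sum_apply]
  exact Finset.sum_eq_zero fun a _ => by rw [LinearMap.smul_apply, h, smul_zero]

variable (hsymm : B.IsSymm) (hinv : ∀ x y z : g, B ⁅x, y⁆ z = B x ⁅y, z⁆)
include hsymm hinv

theorem gramMatrix_transpose : (gramMatrix b B hB).transpose = gramMatrix b B hB := by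
  ext1 c d
  simp only [gramMatrix, Matrix.transpose_apply, Matrix.of_apply, gramInv_symm b B hB hsymm d c]

theorem adMatrix_mul_gramMatrix_apply (r d : ι) : (adMatrix b * gramMatrix b B hB) r d =
    ∑ c, B (B.dualBasis hB b r) ⁅b c, B.dualBasis hB b d⁆ • MvPowerSeries.X c := by
  have h : ∀ c, B (B.dualBasis hB b r) ⁅b c, B.dualBasis hB b d⁆ =
      ∑ s, gramInv b B hB s d * b.coord r ⁅b c, b s⁆ := by
    intro c
    rw [← coord_eq_dualBasis, ← sum_gramInv b B hB d]
    simp only [lie_sum, lie_smul, map_sum, map_smul, smul_eq_mul, gramInv_symm b B hB hsymm d]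
  simp only [Matrix.mul_apply, adMatrix_apply, adVec, gramMatrix, Matrix.of_apply, h,
    mul_comm _ (algebraMap k _ _), ← Algebra.smul_def, Finset.smul_sum, Finset.sum_smul, smul_smul]
  rw [Finset.sum_comm]

/-- The operators `ad x` are skew with respect to an invariant scalar product. -/
theorem gramMatrix_mul_adMatrix_transpose :
    gramMatrix b B hB * (adMatrix b).transpose = -(adMatrix b * gramMatrix b B hB) := by
  have h : (adMatrix b * gramMatrix b B hB).transpose = -(adMatrix b * gramMatrix b B hB) := by
    ext1 r d
    rw [Matrix.transpose_apply, Matrix.neg_apply,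
      adMatrix_mul_gramMatrix_apply b B hB hsymm hinv,
      adMatrix_mul_gramMatrix_apply b B hB hsymm hinv, ← Finset.sum_neg_distrib]
    refine Finset.sum_congr rfl fun c _ => ?_
    rw [← neg_smul]
    congr 1
    rw [← hinv, hsymm.eq, ← lie_skew, map_neg]
  rw [← h, Matrix.transpose_mul, gramMatrix_transpose b B hB hsymm hinv]

theorem gramMatrix_pow_transpose (s : ℕ) : (adMatrix b ^ s * gramMatrix b B hB).transpose =
    (-1 : k) ^ s • (adMatrix b ^ s * gramMatrix b B hB) := by
  induction s with
  | zero => rw [pow_zero, one_mul, pow_zero, one_smul, gramMatrix_transpose b B hB hsymm hinv]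
  | succ s ih =>
    rw [pow_succ', mul_assoc, Matrix.transpose_mul, ih, smul_mul_assoc, mul_assoc,
      gramMatrix_mul_adMatrix_transpose b B hB hsymm hinv, mul_neg, ← mul_assoc, ← pow_succ, pow_succ',
      pow_succ, mul_neg_one, neg_smul, smul_neg, mul_assoc]

theorem gramMatrix_pow_mul_transpose (s : ℕ) :
    adMatrix b ^ s * gramMatrix b B hB * (adMatrix b).transpose =
      -(adMatrix b ^ (s + 1) * gramMatrix b B hB) := by
  rw [mul_assoc, gramMatrix_mul_adMatrix_transpose b B hB hsymm hinv, mul_neg, ← mul_assoc,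
    ← pow_succ]

theorem isInvariant_pow (s : ℕ) : IsInvariant b (adMatrix b ^ s * gramMatrix b B hB) := by
  induction s with
  | zero =>
    rw [pow_zero, one_mul]
    exact isInvariant_gramMatrix b B hB hsymm hinv
  | succ s ih =>
    rw [pow_succ', mul_assoc]
    exact ih.adMatrix_mul b

/-- The bracket of the bivector `Ad^s β` is the gradient of the trace of `Ad^(s+1)`. -/
theorem bracketVec_pow (s : ℕ) (i : ι) :
    ((s : k) + 1) • bracketVec b (adMatrix b ^ s * gramMatrix b B hB) i =
      ∑ r, gramInv b B hB i r • pdY k r (adMatrix b ^ (s + 1)).trace := by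
  have pd_mul : ∀ r (f f' : MvPowerSeries ι k),
      pdY k r (f * f') = pdY k r f * f' + f * pdY k r f' := by
    intro r f f'
    have := pdY_mulS (k := k) r f f'
    simp only [mulS_apply, Algebra.algebraMap_self, MvPowerSeries.map_id, RingHom.id_apply] at this
    exact this
  have pdM_mul : ∀ r (N N' : Matrix ι ι (MvPowerSeries ι k)), (N * N').map (pdY k r) =
      N.map (pdY k r) * N' + N * N'.map (pdY k r) := by
    intro r N N'
    ext1 s t
    simp only [Matrix.map_apply, Matrix.mul_apply, Matrix.add_apply, map_sum, pd_mul,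
      Finset.sum_add_distrib]
  have htr : ∀ r (n : ℕ), pdY k r (adMatrix b ^ (n + 1)).trace =
      ((n : k) + 1) • (adMatrix b ^ n * (adMatrix b).map (pdY k r)).trace := by
    intro r n
    have h1 : ∀ m n : ℕ, (adMatrix b ^ m * ((adMatrix b ^ (n + 1)).map (pdY k r))).trace =
        ((n : k) + 1) • (adMatrix b ^ (m + n) * (adMatrix b).map (pdY k r)).trace := by
      intro m n
      induction n generalizing m with
      | zero => simp
      | succ n ih =>
        rw [pow_succ, pdM_mul, mul_add, Matrix.trace_add, ← mul_assoc, Matrix.trace_mul_comm,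
          ← mul_assoc, ← pow_succ', ih, ← mul_assoc, ← pow_add, ← add_assoc, add_right_comm,
          Nat.cast_add, Nat.cast_one]
        simp only [_root_.add_smul, one_smul]
    have h2 := h1 0 n
    rw [pow_zero, one_mul, zero_add] at h2
    rw [← h2]
    simp only [Matrix.trace, map_sum, Matrix.diag_apply, Matrix.map_apply]
  have hE : ∀ r t u, (adMatrix b).map (pdY k r) t u =
      algebraMap k (MvPowerSeries ι k) (b.coord t ⁅b r, b u⁆) := by
    intro r t u
    rw [Matrix.map_apply, adMatrix_apply, adVec, map_sum]
    simp only [map_smul, pdY_X, smul_ite, smul_zero, Finset.sum_ite_eq, Finset.mem_univ, if_true]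
    rw [Algebra.algebraMap_eq_smul_one]
  simp only [htr, smul_comm _ ((s : k) + 1), ← Finset.smul_sum]
  congr 1
  set M := adMatrix b ^ s with hM
  have h1 : ∀ c e, ∑ d, gramInv b B hB e d * b.coord i ⁅b c, b d⁆ =
      ∑ r, gramInv b B hB i r * b.coord e ⁅b r, b c⁆ := by
    intro c e
    have l1 : ∑ d, gramInv b B hB e d * b.coord i ⁅b c, b d⁆ =
        B (B.dualBasis hB b i) ⁅b c, B.dualBasis hB b e⁆ := by
      rw [← coord_eq_dualBasis, ← sum_gramInv b B hB e]
      simp only [lie_sum, lie_smul, map_sum, map_smul, smul_eq_mul]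
    have l2 : ∑ r, gramInv b B hB i r * b.coord e ⁅b r, b c⁆ =
        B (B.dualBasis hB b e) ⁅B.dualBasis hB b i, b c⁆ := by
      rw [← coord_eq_dualBasis, ← sum_gramInv b B hB i]
      simp only [sum_lie, smul_lie, map_sum, map_smul, smul_eq_mul]
    rw [l1, l2, ← hinv, hsymm.eq]
  have e1 : bracketVec b (M * gramMatrix b B hB) i = ∑ c, ∑ e,
      (∑ d, gramInv b B hB e d * b.coord i ⁅b c, b d⁆) • M c e := by
    simp only [bracketVec, Matrix.mul_apply, gramMatrix, Matrix.of_apply,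
      mul_comm _ (algebraMap k _ _), ← Algebra.smul_def, Finset.smul_sum, Finset.sum_smul,
      smul_smul]
    refine Finset.sum_congr rfl fun c _ => ?_
    rw [Finset.sum_comm]
    simp only [mul_comm]
  have e2 : ∑ r, gramInv b B hB i r • (M * (adMatrix b).map (pdY k r)).trace = ∑ c, ∑ e,
      (∑ r, gramInv b B hB i r * b.coord e ⁅b r, b c⁆) • M c e := by
    simp only [Matrix.trace, Matrix.diag_apply, Matrix.mul_apply, hE,
      mul_comm _ (algebraMap k _ _), ← Algebra.smul_def, Finset.smul_sum, Finset.sum_smul,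
      smul_smul]
    rw [Finset.sum_comm]
    refine Finset.sum_congr rfl fun c _ => ?_
    rw [Finset.sum_comm]
  rw [e1, e2]
  simp only [h1]

end Metric

/-! ### The Poisson bracket on slots -/

section PoissonFaces

variable {k : Type*} [Field k] {g : Type*} [LieRing g] [LieAlgebra k g]

theorem face_zero {A : Type*} [Ring A] [Algebra k A] {i : ℕ} (j : Fin (i + 1)) :
    face (k := k) (A := A) 0 j = 0 := by
  have h := face_add_smul (k := k) (A := A) 0 0 1 j
  rw [smul_zero, add_zero, one_smul] at h
  exact left_eq_add.1 h

theorem face_smul {A : Type*} [Ring A] [Algebra k A] (t : k) (ν : A →ₗ[k] A →ₗ[k] A) {i : ℕ}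
    (j : Fin (i + 1)) : face (t • ν) j = t • face ν j := by
  have h := face_add_smul 0 ν t j
  rwa [zero_add, face_zero, zero_add] at h

theorem face_sum {A : Type*} [Ring A] [Algebra k A] {α : Type*} (s : Finset α)
    (ν : α → A →ₗ[k] A →ₗ[k] A) {i : ℕ} (j : Fin (i + 1)) :
    face (∑ c ∈ s, ν c) j = ∑ c ∈ s, face (ν c) j := by
  classical
  induction s using Finset.induction_on with
  | empty => rw [Finset.sum_empty, Finset.sum_empty, face_zero]
  | insert c s hc ih =>
    have h := face_add_smul (∑ c ∈ s, ν c) (ν c) 1 j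
    rw [one_smul, one_smul] at h
    rw [Finset.sum_insert hc, Finset.sum_insert hc, add_comm (ν c), h, ih, add_comm (face (ν c) j)]

/-- Differentiating one slot of a tensor, with Koszul sign. -/
theorem dslot_toSlots_tprod (x : g) (i : ℕ) (j : Fin (i + 1)) (a : Fin (i + 1) → Ch k g) :
    dslot x j (toSlots i (PiTensorProduct.tprod k a)) = toSlots i (PiTensorProduct.tprod k
      fun r => if r < j then parity k g (a r) else if r = j then partialXi x (a r) else a r) := by
  rw [toSlots_tprod, toSlots_tprod, oddDerivation_prod_ofFn _ (dslot_one x j) (dslot_mul x j),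
    Finset.sum_eq_single j]
  · congr 2
    funext r
    rw [sgn_slot, dslot_slot]
    split_ifs with _ h2 h3 h3
    · rfl
    · rfl
    · exact absurd (congrArg Fin.val h2) h3
    · rfl
  · intro r _ hr
    refine List.prod_eq_zero ((List.mem_ofFn' _ _).2 ⟨r, ?_⟩)
    dsimp only
    rw [if_neg (lt_irrefl r), if_pos rfl, dslot_slot, if_neg (fun h => hr (Fin.ext h))]
  · exact fun h => absurd (Finset.mem_univ _) h

/-- A face with the product `(a ∂_x)(∂_x' a')` differentiates the two neighbouring slots and merges them. -/
theorem toSlots_face_deriv (x x' : g) (i : ℕ) (j : Fin (i + 1)) (t : Tens k (Ch k g) (i + 1)) :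
    toSlots i (face ((LinearMap.mul k (Ch k g)).compl₁₂
      ((parity k g).toLinearMap ∘ₗ partialXi x) (partialXi x')) j t) =
    -relabel (faceIdx i j) (dslot x j (dslot x' (j + 1) (toSlots (i + 1) t))) := by
  set μ := (LinearMap.mul k (Ch k g)).compl₁₂
      ((parity k g).toLinearMap ∘ₗ partialXi x) (partialXi x') with hμ
  refine DFunLike.congr_fun (f := toSlots i ∘ₗ face μ j)
    (g := -((relabel (faceIdx i j)).toLinearMap ∘ₗ dslot x j ∘ₗ dslot x' (j + 1) ∘ₗ
      toSlots (i + 1)))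
    (PiTensorProduct.ext (MultilinearMap.ext fun a => ?_)) t
  have h1 := dslot_toSlots_tprod x' (i + 1) j.succ a
  simp only [LinearMap.compMultilinearMap_apply, LinearMap.comp_apply, LinearMap.neg_apply]
  rw [Fin.val_succ] at h1
  rw [h1]
  have h2 := fun a' : Fin (i + 1 + 1) → Ch k g => dslot_toSlots_tprod x (i + 1) j.castSucc a'
  simp only [Fin.val_castSucc] at h2
  have hpp : ∀ y : Ch k g, parity k g (parity k g y) = y := sgn_sgn
  have hpd : ∀ y : Ch k g, parity k g (partialXi x y) = -partialXi x (parity k g y) :=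
    sgn_contr _
  rw [h2, AlgHom.toLinearMap_apply, ← toSlots_face, face_tprod, face_tprod]
  set e : Fin (i + 1 + 1) → Ch k g := fun r => if r < j.castSucc then parity k g (if r < j.succ then
    parity k g (a r) else if r = j.succ then partialXi x' (a r) else a r) else
      if r = j.castSucc then partialXi x (if r < j.succ then
        parity k g (a r) else if r = j.succ then partialXi x' (a r) else a r) else
      (if r < j.succ then
        parity k g (a r) else if r = j.succ then partialXi x' (a r) else a r) with he
  have key : Fin.contractNth j.castSucc (fun x y => μ x y) a = Function.update
      (Fin.contractNth j.castSucc (fun x y => chMul k g x y) e) j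
      ((-1 : k) • Fin.contractNth j.castSucc (fun x y => chMul k g x y) e j) := by
    rw [he]
    funext r
    by_cases hr : r = j
    · subst hr
      have c1 : r.castSucc < r.succ := by simp [Fin.lt_def]
      have c2 : ¬ r.succ < r.castSucc := by simp [Fin.lt_def]
      have c3 : r.succ ≠ r.castSucc := c1.ne'
      rw [Function.update_self, Fin.contractNth_apply_of_eq _ _ _ _ (by simp),
        Fin.contractNth_apply_of_eq _ _ _ _ (by simp), if_neg (lt_irrefl _), if_pos rfl,
        if_pos c1, if_neg c2, if_neg c3, if_neg (lt_irrefl _), if_pos rfl, hμ,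
        LinearMap.compl₁₂_apply, LinearMap.comp_apply, AlgHom.toLinearMap_apply, hpd, neg_smul,
        one_smul, map_neg]
      rfl
    · rw [Function.update_of_ne hr]
      have hr' : (r : ℕ) ≠ j := fun h => hr (Fin.ext h)
      rcases lt_or_gt_of_ne hr' with h | h
      · have c1 : r.castSucc < j.castSucc := by simpa using h
        have c2 : r.castSucc < j.succ := by simp only [Fin.lt_def, Fin.val_castSucc, Fin.val_succ]; omega
        rw [Fin.contractNth_apply_of_lt _ _ _ _ (by simpa using h),
          Fin.contractNth_apply_of_lt _ _ _ _ (by simpa using h), if_pos c1, if_pos c2, hpp]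
      · have c1 : ¬ r.succ < j.castSucc := by
          simp only [Fin.lt_def, Fin.val_castSucc, Fin.val_succ]; omega
        have c2 : ¬ r.succ < j.succ := by simp only [Fin.lt_def, Fin.val_succ]; omega
        have c3 : r.succ ≠ j.succ := fun h' => hr (Fin.succ_injective _ h')
        have c4 : r.succ ≠ j.castSucc := fun h' => by
          have := congrArg Fin.val h'
          simp at this
          omega
        rw [Fin.contractNth_apply_of_gt _ _ _ _ (by simpa using h),
          Fin.contractNth_apply_of_gt _ _ _ _ (by simpa using h), if_neg c1, if_neg c4, if_neg c2,
          if_neg c3]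
  rw [key, MultilinearMap.map_update_smul, Function.update_eq_self, neg_smul, one_smul, map_neg]

variable {ι : Type*} [Fintype ι] [DecidableEq ι] (b : Module.Basis ι k g)
  (B : LinearMap.BilinForm k g) (hB : B.Nondegenerate)

/-- The bivector of the scalar product, contracted with the slots `p` and `r`. -/
def slotQ (p r : ℕ) : Slots k g →ₗ[k] Slots k g :=
  ∑ c, dslot (b c) p ∘ₗ dslot (B.dualBasis hB b c) r

theorem toSlots_face_poisson (i : ℕ) (j : Fin (i + 1)) (t : Tens k (Ch k g) (i + 1)) :
    toSlots i (face (poisson b B hB) j t) =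
      -relabel (faceIdx i j) (slotQ b B hB j (j + 1) (toSlots (i + 1) t)) := by
  rw [poisson, face_sum]
  simp only [LinearMap.sum_apply, map_sum, toSlots_face_deriv, Finset.sum_neg_distrib, slotQ,
    LinearMap.comp_apply]

/-- The first-order deformation of the Hochschild differential, on slots. -/
theorem toSlots_hochB_poisson [CharZero k] (i : ℕ) (t : Tens k (Ch k g) (i + 1)) :
    toSlots i (hochB (parity k g) ((2⁻¹ : k) • poisson b B hB) i t) =
      (-2⁻¹ : k) • ∑ p ∈ Finset.range (i + 2), (-1 : k) ^ p • relabel (faceIdx i p)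
        (slotQ b B hB p (if p = i + 1 then 0 else p + 1) (toSlots (i + 1) t)) := by
  have h0 : ∀ (x : g) (y : Slots k g),
      dslot x 0 (relabel (rotIdx (i + 1)) y) = relabel (rotIdx (i + 1)) (dslot x (i + 1) y) := by
    intro x y
    rw [dslot_relabel _ x 0 {i + 1}, Finset.sum_singleton]
    intro r
    simp only [Finset.mem_singleton, rotIdx]
    grind
  have h1 : ∀ (x : g) (y : Slots k g),
      dslot x 1 (relabel (rotIdx (i + 1)) y) = relabel (rotIdx (i + 1)) (dslot x 0 y) := by
    intro x y
    rw [dslot_relabel _ x 1 {0}, Finset.sum_singleton]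
    intro r
    simp only [Finset.mem_singleton, rotIdx]
    grind
  have h2 : ∀ y : Slots k g, relabel (faceIdx i 0) (slotQ b B hB 0 (0 + 1)
      (relabel (rotIdx (i + 1)) y)) = relabel (faceIdx i (i + 1)) (slotQ b B hB (i + 1) 0 y) := by
    intro y
    simp only [slotQ, LinearMap.sum_apply, LinearMap.comp_apply, zero_add, h1, h0, map_sum,
      relabel_relabel]
    refine Finset.sum_congr rfl fun c _ => ?_
    congr 2
    funext l
    simp only [Function.comp_apply, faceIdx, rotIdx]
    grind
  rw [Finset.sum_range_succ, ← Fin.sum_univ_eq_sum_range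
    (fun p => (-1 : k) ^ p • relabel (faceIdx i p)
        (slotQ b B hB p (if p = i + 1 then 0 else p + 1) (toSlots (i + 1) t))), if_pos rfl, ← h2,
    ← toSlots_rotate]
  simp only [hochB, face_smul, LinearMap.add_apply, LinearMap.sum_apply, LinearMap.smul_apply,
    map_add, map_sum, map_smul, toSlots_face_poisson, LinearMap.comp_apply, smul_add,
    Finset.smul_sum, Fin.val_zero, smul_neg, neg_smul]
  congr 1
  · refine Finset.sum_congr rfl fun p _ => ?_
    rw [if_neg (show ¬ (p : ℕ) = i + 1 by omega), smul_comm]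
  · rw [smul_comm]

end PoissonFaces

/-! ### The Hochschild–Kostant–Rosenberg map on slots -/

section HkrSlots

variable {k : Type*} [Field k] {g : Type*} [LieRing g] [LieAlgebra k g]
  {ι : Type*} [Fintype ι] (b : Module.Basis ι k g)

theorem dslot_restr (s : ℕ → Prop) [DecidablePred s] (x : g) (l : ℕ) (y : Slots k g) :
    dslot x l (restr s y) = if s l then restr s (dslot x l y) else 0 := by
  have h : (dslot x l ∘ₗ (restr s).toLinearMap : Slots k g →ₗ[k] Slots k g) =
      (if s l then (1 : k) else 0) • (restr s).toLinearMap ∘ₗ dslot x l := by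
    refine slotsHom_ext ?_ ?_
    · simp only [LinearMap.comp_apply, AlgHom.toLinearMap_apply, LinearMap.smul_apply, map_one,
        dslot_one, map_zero, smul_zero]
    · intro r v y hy
      simp only [LinearMap.comp_apply, AlgHom.toLinearMap_apply, LinearMap.smul_apply] at hy ⊢
      rw [map_mul (restr s), restr_gen, dslot_gen_mul, map_sub, map_smul, map_mul (restr s), restr_gen]
      by_cases hr : s r
      · rw [if_pos hr, dslot_gen_mul, hy, smul_sub, mul_smul_comm]
        by_cases hl : r = l
        · subst hl
          rw [if_pos hr, one_smul, one_smul]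
        · rw [if_neg hl, zero_smul, smul_zero]
      · rw [if_neg hr, zero_mul, map_zero, zero_mul, sub_zero]
        by_cases hl : r = l
        · subst hl
          rw [if_neg hr, zero_smul]
        · rw [if_neg hl, zero_smul, smul_zero]
  have h' := LinearMap.congr_fun h y
  simp only [LinearMap.comp_apply, AlgHom.toLinearMap_apply, LinearMap.smul_apply] at h'
  rw [h']
  split_ifs
  · rw [one_smul]
  · rw [zero_smul]

/-- Merging all the slots into the slot `0` is multiplying them. -/
theorem relabel_eq_slot {i : ℕ} {y : Slots k g} (hy : restr (· ≤ i) y = y) :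
    relabel (fun l => if l ≤ i then 0 else l) y = slot 0 (slotProd y) := by
  have h : (relabel fun l => if l ≤ i then 0 else l).comp (restr (· ≤ i)) =
      ((slot 0).comp slotProd).comp (restr (g := g) (k := k) (· ≤ i)) := by
    refine slotsAlgHom_ext fun l v => ?_
    simp only [AlgHom.comp_apply, restr_gen]
    split_ifs with h
    · rw [relabel_gen, if_pos h, slotProd_gen, slot_ι]
    · simp only [map_zero]
  have h' := DFunLike.congr_fun h y
  simp only [AlgHom.comp_apply, hy] at h'
  exact h'

/-- The derivative of a product of slots. -/
theorem partialXi_slotProd (x : g) {i : ℕ} {y : Slots k g} (hy : restr (· ≤ i) y = y) :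
    partialXi x (slotProd y) = slotProd (∑ l ∈ Finset.range (i + 1), dslot x l y) := by
  have h1 := dslot_slot x 0 0 (slotProd y)
  rw [if_pos rfl, ← relabel_eq_slot hy, dslot_relabel _ x 0 (Finset.range (i + 1))] at h1
  · have h2 := congrArg slotProd h1
    rw [slotProd_relabel, slotProd_slot] at h2
    exact h2.symm
  · intro r
    rw [Finset.mem_range]
    split_ifs <;> omega

variable (k g ι) in
/-- Killing the slots above `i`, on coefficients. -/
def restrS (i : ℕ) : Module.End k (SlotForms k g ι) := cmap (restr (· ≤ i)).toLinearMap

theorem dS_restrS (x : g) {l i : ℕ} (h : l ≤ i) :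
    dS k ι x l * restrS k g ι i = restrS k g ι i * dS k ι x l := by
  refine LinearMap.ext fun ω => slotForms_ext fun n => ?_
  have := dslot_restr (· ≤ i) x l (coeffS k g ι n ω)
  rw [if_pos h] at this
  exact this

theorem prodY_restrS {m i : ℕ} (h : m ≤ i) :
    prodY k ι b m * restrS k g ι i = restrS k g ι i * prodY k ι b m := by
  induction m with
  | zero => rw [prodY, one_mul, mul_one]
  | succ m ih =>
    have h1 : dY k ι b (m + 1) * restrS k g ι i = restrS k g ι i * dY k ι b (m + 1) := by
      simp only [dY, dV, Finset.sum_mul, Finset.mul_sum]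
      refine Finset.sum_congr rfl fun c _ => ?_
      rw [mul_assoc, dS_restrS _ h, ← mul_assoc, ← mul_assoc]
      congr 1
      exact (LinearMap.ext fun ω => cmap_mulS (restr (· ≤ i)).toLinearMap _ ω).symm
    rw [prodY, mul_assoc, h1, ← mul_assoc, ih (by omega), mul_assoc]

theorem prodY_cstS_restr (i : ℕ) {y : Slots k g} (hy : restr (· ≤ i) y = y) :
    restrS k g ι i (prodY k ι b i (cstS k g ι y)) = prodY k ι b i (cstS k g ι y) := by
  have h1 : restrS k g ι i (cstS k g ι y) = cstS k g ι y :=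
    (cmap_cst (restr (· ≤ i)).toLinearMap y).trans (congrArg (cstS k g ι) hy)
  rw [← Module.End.mul_apply, ← prodY_restrS b le_rfl, Module.End.mul_apply, h1]

theorem partialXi_mulP (x : g) {i : ℕ} {ω : SlotForms k g ι} (h : restrS k g ι i ω = ω) :
    cmap (partialXi x) (mulP k g ι ω) =
      mulP k g ι (∑ l ∈ Finset.range (i + 1), dS k ι x l ω) := by
  refine MvPowerSeries.ext fun n => ?_
  have hn : restr (· ≤ i) (coeffS k g ι n ω) = coeffS k g ι n ω :=
    congrArg (coeffS k g ι n) h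
  rw [map_sum, map_sum]
  refine (partialXi_slotProd x hn).trans ?_
  rw [map_sum]
  rfl

/-- The component of the Hochschild–Kostant–Rosenberg map on `i`-chains, on slots. -/
def hkrS (i : ℕ) : Slots k g →ₗ[k] Forms k g ι :=
  ((-1 : k) ^ i / (Nat.factorial i : k)) • mulP k g ι ∘ₗ prodY k ι b i ∘ₗ cstS k g ι

theorem hkrS_apply (i : ℕ) (x : Slots k g) : hkrS b i x =
    ((-1 : k) ^ i / (Nat.factorial i : k)) • mulP k g ι (prodY k ι b i (cstS k g ι x)) := rfl

theorem dslot_prod_eq_zero (x : g) (l : ℕ) : ∀ {n : ℕ} (f : Fin n → Slots k g),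
    (∀ j, dslot x l (f j) = 0) → dslot x l (List.ofFn f).prod = 0
  | 0, f, _ => by simp
  | n + 1, f, h => by
    rw [List.ofFn_succ, List.prod_cons, dslot_mul, h,
      dslot_prod_eq_zero x l _ fun j => h j.succ, mul_zero, zero_mul, add_zero]

/-- Multiplication of the coefficients by `w` from the right. -/
def rS (w : Slots k g) : Module.End k (SlotForms k g ι) := cmap (LinearMap.mulRight k w)

/-- Multiplication from the right by `d_dR w`, the factors being put in slot `l`. -/
def mulRightDR (l : ℕ) (w : Ch k g) : Module.End k (SlotForms k g ι) :=
  ∑ c, mS (MvPowerSeries.X c) * rS (slot l (partialXi (b c) w))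

theorem dY_mulRightDR {l r : ℕ} (h : l ≠ r) (w : Ch k g) :
    dY k ι b l * mulRightDR b r w = mulRightDR b r w * dY k ι b l := by
  have h1 : ∀ (x : g) c, dS k ι x l * rS (slot r (partialXi (b c) w)) =
      rS (slot r (partialXi (b c) w)) * dS k ι x l := by
    intro x c
    refine LinearMap.ext fun ω => slotForms_ext fun n => ?_
    change dslot x l (coeffS k g ι n ω * _) = dslot x l (coeffS k g ι n ω) * _
    rw [dslot_mul, dslot_slot, if_neg h.symm, mul_zero, add_zero]
  have h2 : ∀ (f : MvPowerSeries ι k) c,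
      rS (slot r (partialXi (b c) w)) * mS f =
      mS f * rS (slot r (partialXi (b c) w)) := fun f c =>
    LinearMap.ext fun ω => cmap_mulS (LinearMap.mulRight k (slot r (partialXi (b c) w))) f ω
  simp only [mulRightDR, Finset.mul_sum, Finset.sum_mul]
  refine Finset.sum_congr rfl fun c _ => ?_
  rw [dY, ← mul_assoc, dV_mS]
  simp only [dV, Finset.mul_sum, Finset.sum_mul]
  refine Finset.sum_congr rfl fun e _ => ?_
  rw [mul_assoc, mul_assoc, mul_assoc, h1, ← mul_assoc (rS _), h2, mul_assoc]

theorem mulP_mulRightDR (l : ℕ) (w : Ch k g) (ω : SlotForms k g ι) :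
    mulP k g ι (mulRightDR b l w ω) = mulP k g ι ω * deRham b w := by
  have h1 : ∀ c, (MvPowerSeries.monomial (R := Ch k g) (Finsupp.single c 1)) (partialXi (b c) w) =
      MvPowerSeries.C (partialXi (b c) w) * MvPowerSeries.X c := by
    intro c
    rw [MvPowerSeries.C, MvPowerSeries.X]
    change _ = MvPowerSeries.monomial 0 _ * _
    rw [MvPowerSeries.monomial_mul_monomial, zero_add, mul_one]
  have h2 : ∀ (c : ι) (η : Forms k g ι), mulS (MvPowerSeries.X c : MvPowerSeries ι k) η =
      η * MvPowerSeries.X c := by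
    intro c η
    rw [mulS_apply, MvPowerSeries.map_X]
    exact (MvPowerSeries.commute_X η c).symm.eq
  rw [mulRightDR, LinearMap.sum_apply, map_sum, deRham, LinearMap.sum_apply, Finset.mul_sum]
  refine Finset.sum_congr rfl fun c _ => ?_
  rw [LinearMap.comp_apply, LinearMap.restrictScalars_apply, h1, ← mul_assoc, ← h2]
  refine (cmap_mulS (slotProd.toLinearMap) _ _).trans (congrArg _ ?_)
  refine MvPowerSeries.ext fun n => ?_
  rw [MvPowerSeries.coeff_mul_C]
  change slotProd (coeffS k g ι n ω * _) = slotProd (coeffS k g ι n ω) * _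
  rw [map_mul, slotProd_slot]

/-- On an ordered product of slots, the tautological derivatives act as `d_dR` on the factors, and the
signs of passing them to the left are powers of the parity automorphism. -/
theorem mulP_prodY_prod : ∀ (i : ℕ) (a : Fin (i + 1) → Ch k g),
    mulP k g ι (prodY k ι b i (cstS k g ι
      (List.ofFn fun j : Fin (i + 1) => slot (j : ℕ) (a j)).prod)) =
    (List.ofFn fun j : Fin (i + 1) => (if j = 0 then constForm else deRham b)
      (((parity k g).toLinearMap ^ (i - (j : ℕ))) (a j))).prod
  | 0, a => by
    simp only [List.ofFn_succ, List.ofFn_zero, List.prod_cons, List.prod_nil, mul_one, prodY,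
      Module.End.one_apply, if_true, Fin.val_zero, pow_zero, Nat.sub_self]
    refine (cmap_cst slotProd.toLinearMap _).trans ?_
    rw [AlgHom.toLinearMap_apply, slotProd_slot]
    rfl
  | i + 1, a => by
    have hR : ∀ f : Fin (i + 1 + 1) → Slots k g, (List.ofFn f).prod =
        (List.ofFn fun r : Fin (i + 1) => f r.castSucc).prod * f (Fin.last (i + 1)) := by
      intro f
      rw [List.ofFn_succ', List.prod_concat]
    have hR' : ∀ f : Fin (i + 1 + 1) → Forms k g ι, (List.ofFn f).prod =
        (List.ofFn fun r : Fin (i + 1) => f r.castSucc).prod * f (Fin.last (i + 1)) := by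
      intro f
      rw [List.ofFn_succ', List.prod_concat]
    rw [hR, hR']
    set u : Slots k g := (List.ofFn fun j : Fin (i + 1) =>
      slot ((j.castSucc : Fin (i + 2)) : ℕ) (a j.castSucc)).prod with hu
    have h0 : ∀ x : g, dslot x (i + 1) u = 0 := by
      intro x
      refine dslot_prod_eq_zero x (i + 1) _ fun j => ?_
      rw [dslot_slot, if_neg]
      have := j.isLt
      simp only [Fin.val_castSucc]
      omega
    have hs : sgn u = (List.ofFn fun j : Fin (i + 1) =>
        slot (j : ℕ) (parity k g (a j.castSucc))).prod := by
      rw [hu, algHom_prod_ofFn]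
      congr 2
      funext j
      exact sgn_slot _ _
    have h1 : dY k ι b (i + 1) (cstS k g ι (u * slot (i + 1) (a (Fin.last (i + 1))))) =
        mulRightDR b (i + 1) (a (Fin.last (i + 1))) (cstS k g ι (sgn u)) := by
      rw [dY, dV, mulRightDR, LinearMap.sum_apply, LinearMap.sum_apply]
      refine Finset.sum_congr rfl fun c _ => ?_
      rw [Module.End.mul_apply, Module.End.mul_apply]
      congr 1
      refine (cmap_cst _ _).trans (Eq.trans ?_ (cmap_cst _ _).symm)
      rw [dslot_mul, h0, zero_mul, zero_add, dslot_slot, if_pos rfl]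
      rfl
    have h2 : ∀ m ≤ i, prodY k ι b m * mulRightDR b (i + 1) (a (Fin.last (i + 1))) =
        mulRightDR b (i + 1) (a (Fin.last (i + 1))) * prodY k ι b m := by
      intro m hm
      induction m with
      | zero => rw [prodY, one_mul, mul_one]
      | succ m ih =>
        rw [prodY, mul_assoc, dY_mulRightDR b (by omega), ← mul_assoc, ih (by omega), mul_assoc]
    rw [Fin.val_last, prodY, Module.End.mul_apply, h1, ← Module.End.mul_apply, h2 i le_rfl,
      Module.End.mul_apply, mulP_mulRightDR, hs, mulP_prodY_prod i]
    congr 1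
    · congr 2
      funext j
      have hj : i + 1 - ((j.castSucc : Fin (i + 2)) : ℕ) = i - (j : ℕ) + 1 := by
        have := j.isLt
        simp only [Fin.val_castSucc]
        omega
      rw [hj, pow_succ, Module.End.mul_apply]
      simp only [Fin.castSucc_eq_zero_iff]
      rfl
    · rw [if_neg (Fin.last_pos).ne', Nat.sub_self, pow_zero]
      rfl

theorem hkrTens_eq (i : ℕ) (t : Tens k (Ch k g) i) : hkrTens b i t = hkrS b i (toSlots i t) := by
  refine DFunLike.congr_fun (f := hkrTens b i) (g := hkrS b i ∘ₗ toSlots i)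
    (PiTensorProduct.ext (MultilinearMap.ext fun a => ?_)) t
  simp only [LinearMap.compMultilinearMap_apply, LinearMap.comp_apply, toSlots_tprod, hkrS_apply,
    mulP_prodY_prod, hkrTens, LinearMap.smul_apply, PiTensorProduct.lift.tprod,
    MultilinearMap.compLinearMap_apply, MultilinearMap.mkPiAlgebraFin_apply]

/-! ### The Brylinski operator on slots -/

variable (k g) in
/-- The partial derivative `∂/∂y_r` of forms with coefficients in slots. -/
def pdS (r : ι) : Module.End k (SlotForms k g ι) := pdY k r

omit [Fintype ι] in
theorem pdS_mulP (r : ι) (ω : SlotForms k g ι) :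
    partialY k g r (mulP k g ι ω) = mulP k g ι (pdS k g r ω) :=
  (cmap_pdY slotProd.toLinearMap r ω).symm

theorem pdS_dY [DecidableEq ι] (r : ι) (l : ℕ) :
    pdS k g r * dY k ι b l = dY k ι b l * pdS k g r + dS k ι (b r) l := by
  have h1 : ∀ c, pdS k g r * (mS (MvPowerSeries.X c) * dS k ι (b c) l) =
      mS (MvPowerSeries.X c) * dS k ι (b c) l * pdS k g r +
        if r = c then dS k ι (b c) l else 0 := by
    intro c
    refine LinearMap.ext fun ω => ?_
    refine (pdY_mulS r (MvPowerSeries.X c) _).trans ?_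
    rw [pdY_X, add_comm]
    refine congrArg₂ (· + ·) (congrArg (mulS _) (cmap_pdY (dslot (b c) l) r ω).symm) ?_
    split_ifs
    · rw [map_one]
      rfl
    · rw [map_zero]
      rfl
  rw [dY, dV, Finset.mul_sum, Finset.sum_congr rfl fun c _ => h1 c, Finset.sum_add_distrib,
    Finset.sum_mul, Finset.sum_ite_eq, if_pos (Finset.mem_univ r)]

theorem dS_dY (x : g) (l r : ℕ) :
    dY k ι b l * dS k ι x r = -(dS k ι x r * dY k ι b l) := dV_dS b _ l x r

theorem prodY_dS (i : ℕ) (x : g) (r : ℕ) :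
    prodY k ι b i * dS k ι x r = (-1 : k) ^ i • (dS k ι x r * prodY k ι b i) := by
  induction i with
  | zero => rw [prodY, one_mul, mul_one, pow_zero, one_smul]
  | succ i ih =>
    rw [prodY, mul_assoc, dS_dY, mul_neg, ← mul_assoc, ih, pow_succ, mul_neg_one, neg_smul,
      smul_mul_assoc, mul_assoc]

/-- The partial derivative `∂/∂y_r` replaces one tautological derivative by `∂_r`. -/
theorem pdS_prodY [DecidableEq ι] (r : ι) (i : ℕ) :
    pdS k g r * prodY k ι b i = prodY k ι b i * pdS k g r +
      ∑ q ∈ Finset.range i, (-1 : k) ^ q • (dS k ι (b r) (q + 1) * prodYdel k ι b i (q + 1)) := by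
  induction i with
  | zero => rw [prodY, one_mul, mul_one, Finset.sum_range_zero, add_zero]
  | succ i ih =>
    rw [prodY, ← mul_assoc, ih, add_mul, mul_assoc, pdS_dY, mul_add, ← mul_assoc, prodY_dS,
      Finset.sum_range_succ, prodYdel_succ_self, Finset.sum_mul, add_assoc, add_comm (_ • _)]
    congr 2
    refine Finset.sum_congr rfl fun q hq => ?_
    rw [Finset.mem_range] at hq
    rw [prodYdel_succ_of_ne b (by omega), smul_mul_assoc, mul_assoc]

theorem prodYdel_restrS {q m i : ℕ} (h : m ≤ i) :
    prodYdel k ι b m q * restrS k g ι i = restrS k g ι i * prodYdel k ι b m q := by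
  induction m with
  | zero => rw [prodYdel, one_mul, mul_one]
  | succ m ih =>
    by_cases hq : q = m + 1
    · rw [hq, prodYdel_succ_self, prodY_restrS b (by omega)]
    · have h1 : dY k ι b (m + 1) * restrS k g ι i = restrS k g ι i * dY k ι b (m + 1) := by
        simp only [dY, dV, Finset.sum_mul, Finset.mul_sum]
        refine Finset.sum_congr rfl fun c _ => ?_
        rw [mul_assoc, dS_restrS _ h, ← mul_assoc, ← mul_assoc]
        congr 1
        exact (LinearMap.ext fun ω => cmap_mulS (restr (· ≤ i)).toLinearMap _ ω).symm
      rw [prodYdel_succ_of_ne b hq, mul_assoc, h1, ← mul_assoc, ih (by omega), mul_assoc]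

end HkrSlots

/-! ### The homotopy on slots -/

section HomotopySlots

variable {k : Type*} [Field k] [CharZero k] {g : Type*} [LieRing g] [LieAlgebra k g]
  {ι : Type*} [Fintype ι] [DecidableEq ι] (b : Module.Basis ι k g)
  (B : LinearMap.BilinForm k g) (hB : B.Nondegenerate)

/-- The invariant bivector `Ad^s β`, where `β` is the bivector of the scalar product. -/
def bivec (s : ℕ) : Matrix ι ι (MvPowerSeries ι k) := adMatrix b ^ s * gramMatrix b B hB

/-- The part of the homotopy of polynomial degree `s` on `i`-chains, on slots. -/
def homS (s i : ℕ) : Slots k g →ₗ[k] Forms k g ι :=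
  (-1 : k) ^ i • mulP k g ι ∘ₗ opG b (bivec b B hB s) (s + 1) i ∘ₗ prodY k ι b i ∘ₗ cstS k g ι

theorem homS_apply (s i : ℕ) (x : Slots k g) : homS b B hB s i x = (-1 : k) ^ i •
    mulP k g ι (opG b (bivec b B hB s) (s + 1) i (prodY k ι b i (cstS k g ι x))) := rfl

theorem mulP_opG (N : Matrix ι ι (MvPowerSeries ι k)) (n i : ℕ) (ω : SlotForms k g ι) :
    mulP k g ι (opG b N n i ω) = (2⁻¹ : k) • ∑ j ∈ Finset.range (i + 1),
      ∑ l ∈ Finset.range (i + 1), gC k n i j l • mulP k g ι (opQ b N j l ω) := by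
  simp only [opG, LinearMap.smul_apply, LinearMap.sum_apply, map_smul, map_sum]

/-- The derivation `∑_c v_c ∂_c` of forms. -/
def vecD (v : ι → MvPowerSeries ι k) : Forms k g ι →ₗ[k] Forms k g ι :=
  ∑ c, (mulS (v c) : Module.End k (Forms k g ι)) ∘ₗ cmap (partialXi (b c))

omit [CharZero k] [DecidableEq ι] in
theorem vecD_smul (t : k) (v : ι → MvPowerSeries ι k) :
    vecD (g := g) b (fun c => t • v c) = t • vecD b v := by
  simp only [vecD, map_smul, Finset.smul_sum, LinearMap.smul_comp]

omit [CharZero k] [DecidableEq ι] in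
theorem vecD_mulP (v : ι → MvPowerSeries ι k) {i : ℕ} {ω : SlotForms k g ι}
    (h : restrS k g ι i ω = ω) :
    vecD b v (mulP k g ι ω) = ∑ l ∈ Finset.range (i + 1), mulP k g ι (dV b v l ω) := by
  have h1 : ∀ (f : MvPowerSeries ι k) (η : SlotForms k g ι),
      mulS f (mulP k g ι η) = mulP k g ι (mS f η) := fun f η =>
    (cmap_mulS slotProd.toLinearMap f η).symm
  simp only [vecD, LinearMap.sum_apply, LinearMap.comp_apply, partialXi_mulP _ h, h1, dV, map_sum,
    Module.End.mul_apply]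
  rw [Finset.sum_comm]

/-- The vector field `∂ log j^{1/2}` in polynomial degree `n`; see `bracketVec_pow`. -/
def dufloVec (n : ℕ) (c : ι) : MvPowerSeries ι k :=
  (2⁻¹ * if Odd (n + 1) then 0 else ((bernoulli (n + 1) : ℚ) : k) / ((n + 1).factorial : k)) •
    bracketVec b (bivec b B hB n) c

theorem gC_self_bernoulli (n i j : ℕ) : gC k n i j j =
    (if Odd n then 0 else ((bernoulli n : ℚ) : k) / (n.factorial : k)) * (1 / (i.factorial : k)) := by
  rw [gC_self]
  split_ifs
  · rw [zero_mul]
  · rw [betaC_zero, mul_one_div]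

/-- The diagonal coefficients of the homotopy do not depend on the slot, so that the brackets of the
bivectors add up to a derivation of forms. -/
theorem sum_gC_self (n i : ℕ) {y : Slots k g} (hy : restr (· ≤ i) y = y) :
    (-1 : k) ^ i • (2⁻¹ : k) • ∑ j ∈ Finset.range (i + 1), gC k (n + 1) i j j •
      mulP k g ι (dV b (bracketVec b (bivec b B hB n)) j (prodY k ι b i (cstS k g ι y))) =
    vecD b (dufloVec b B hB n) (hkrS b i y) := by
  have h1 : vecD (g := g) b (dufloVec b B hB n) = (2⁻¹ * if Odd (n + 1) then 0 else
      ((bernoulli (n + 1) : ℚ) : k) / ((n + 1).factorial : k)) •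
        vecD b (bracketVec b (bivec b B hB n)) := vecD_smul b _ _
  rw [h1, hkrS_apply, map_smul, LinearMap.smul_apply, vecD_mulP b _ (prodY_cstS_restr b i hy)]
  simp only [gC_self_bernoulli, ← Finset.smul_sum, smul_smul]
  congr 1
  ring

variable (hsymm : B.IsSymm) (hinv : ∀ x y z : g, B ⁅x, y⁆ z = B x ⁅y, z⁆)
include hsymm hinv

/-- The commutator of the homotopy with the internal differential. -/
theorem formsD_homS (s i : ℕ) {y : Slots k g} (hy : restr (· ≤ i) y = y) :
    formsD b (homS b B hB s i y) = (-1 : k) ^ i • homS b B hB s i (slotD b y) -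
      vecD b (dufloVec b B hB s) (hkrS b i y) -
      (-1 : k) ^ i • ∑ q ∈ Finset.range i, (-1 : k) ^ q • ∑ l ∈ Finset.range (i + 1),
        gC k (s + 1) i (q + 1) l • mulP k g ι (opQ b (bivec b B hB (s + 1)) (q + 1) l
          (prodYdel k ι b i (q + 1) (cstS k g ι y))) := by
  have hinv' : IsInvariant b (bivec b B hB s) := isInvariant_pow b B hB hsymm hinv s
  have hN' : adMatrix b * bivec b B hB s = bivec b B hB (s + 1) := by
    rw [bivec, bivec, ← mul_assoc, ← pow_succ']
  have hT : bivec b B hB s * (adMatrix b).transpose = -bivec b B hB (s + 1) :=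
    gramMatrix_pow_mul_transpose b B hB hsymm hinv s
  have hQ : ∀ j l (ω : SlotForms k g ι), mulP k g ι (opQ b (-bivec b B hB (s + 1)) j l ω) =
      (-1 : k) ^ (s + 1) • mulP k g ι (opQ b (bivec b B hB (s + 1)) l j ω) := by
    intro j l ω
    have hsm : ∀ (t : k) (N : Matrix ι ι (MvPowerSeries ι k)),
        opQ (g := g) b (t • N) l j = t • opQ b N l j := by
      intro t N
      simp only [opQ, Matrix.smul_apply, mS_smul, smul_mul_assoc, Finset.smul_sum]
    rw [opQ_transpose, Matrix.transpose_neg, opQ_neg, neg_neg, bivec,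
      gramMatrix_pow_transpose b B hB hsymm hinv, hsm, LinearMap.smul_apply, map_smul]
  have hg : ∀ j ≤ i, ∀ q < i, gC k (s + 1) i j (q + 1) * (-1 : k) ^ (s + 1) =
      gC k (s + 1) i (q + 1) j := by
    intro j hj q hq
    rw [gC_symm k (s + 1) i j (q + 1) hj (by omega), mul_comm]
  set F : ℕ → ℕ → Forms k g ι := fun q l => mulP k g ι (opQ b (bivec b B hB (s + 1)) (q + 1) l
          (prodYdel k ι b i (q + 1) (cstS k g ι y))) with hF
  -- one term of the homotopy; `F q l` is the term in which `D_{q+1}` is lost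
  have hterm : ∀ j ∈ Finset.range (i + 1), ∀ l ∈ Finset.range (i + 1),
      gC k (s + 1) i j l •
        formsD b (mulP k g ι (opQ b (bivec b B hB s) j l (prodY k ι b i (cstS k g ι y)))) =
      (-1 : k) ^ i • gC k (s + 1) i j l •
        mulP k g ι (opQ b (bivec b B hB s) j l (prodY k ι b i (cstS k g ι (slotD b y)))) -
      (if j = l then gC k (s + 1) i j j • mulP k g ι (dV b (bracketVec b (bivec b B hB s)) j
        (prodY k ι b i (cstS k g ι y))) else 0) -
      ∑ q ∈ Finset.range i, (-1 : k) ^ q •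
        ((if q + 1 = l then gC k (s + 1) i (q + 1) j • F q j else 0) +
          (if q + 1 = j then gC k (s + 1) i (q + 1) l • F q l else 0)) := by
    intro j hj l hl
    rw [Finset.mem_range] at hj hl
    rw [formsD_opQ_prodY b hinv' (by omega) (by omega), smul_sub, smul_sub, smul_comm, smul_ite,
      smul_zero, Finset.smul_sum, hN', hT]
    congr 1
    · congr 1
      split_ifs with h
      · rw [h]
      · rfl
    · refine Finset.sum_congr rfl fun q hq => ?_
      rw [Finset.mem_range] at hq
      rw [smul_comm, smul_add, smul_ite, smul_ite, smul_zero, hQ, smul_smul]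
      congr 2
      · split_ifs with h
        · rw [← h, hg j (by omega) q hq]
        · rfl
      · split_ifs with h
        · rw [← h]
        · rfl
  have hsum : ∑ j ∈ Finset.range (i + 1), ∑ l ∈ Finset.range (i + 1),
      ∑ q ∈ Finset.range i, (-1 : k) ^ q •
        ((if q + 1 = l then gC k (s + 1) i (q + 1) j • F q j else 0) +
          (if q + 1 = j then gC k (s + 1) i (q + 1) l • F q l else 0)) =
      (2 : k) • ∑ q ∈ Finset.range i, (-1 : k) ^ q • ∑ l ∈ Finset.range (i + 1),
        gC k (s + 1) i (q + 1) l • F q l := by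
    rw [Finset.sum_congr rfl fun j _ => Finset.sum_comm, Finset.sum_comm, Finset.smul_sum]
    refine Finset.sum_congr rfl fun q hq => ?_
    have hq' : q + 1 ∈ Finset.range (i + 1) := by
      rw [Finset.mem_range] at hq ⊢
      omega
    simp only [← Finset.smul_sum, Finset.sum_add_distrib, Finset.sum_ite_eq, if_pos hq']
    rw [Finset.sum_comm (f := fun j l => if q + 1 = j then gC k (s + 1) i (q + 1) l • F q l else 0)]
    simp only [Finset.sum_ite_eq, if_pos hq']
    rw [← two_smul k, smul_comm]
  rw [homS_apply, map_smul, mulP_opG, map_smul, map_sum, ← sum_gC_self b B hB s i hy]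
  simp only [map_sum, map_smul]
  rw [Finset.sum_congr rfl fun j hj => Finset.sum_congr rfl fun l hl => hterm j hj l hl]
  simp only [Finset.sum_sub_distrib]
  rw [hsum, homS_apply, mulP_opG, smul_sub, smul_sub, smul_sub, smul_sub, smul_smul (2⁻¹ : k) 2,
    inv_mul_cancel₀ (two_ne_zero), one_smul]
  congr 1
  congr 1
  · simp only [← Finset.smul_sum]
    rw [smul_comm (2⁻¹ : k)]
  · congr 2
    refine Finset.sum_congr rfl fun j hj => ?_
    rw [Finset.sum_ite_eq, if_pos hj]

/-- The homotopy identity on `(m + 1)`-chains. -/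
theorem formsD_homS_succ (s m : ℕ) {y : Slots k g} (hy : restr (· ≤ m + 1) y = y) :
    formsD b (homS b B hB s (m + 1) y) = (-1 : k) ^ (m + 1) • homS b B hB s (m + 1) (slotD b y) +
      homS b B hB (s + 1) m (slotB m y) - vecD b (dufloVec b B hB s) (hkrS b (m + 1) y) := by
  have h1 := mulP_opG_slotB b (N := bivec b B hB (s + 1)) (gramMatrix_pow_transpose b B hB hsymm hinv (s + 1)) m y
  rw [formsD_homS b B hB hsymm hinv s (m + 1) hy, homS_apply b B hB (s + 1) m, h1]
  simp only [defectC, if_neg (Nat.succ_ne_zero s), zero_mul, sub_zero]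
  rw [pow_succ, mul_neg_one, neg_smul, neg_smul]
  abel

/-- The homotopy identity on `0`-chains. -/
theorem formsD_homS_zero (s : ℕ) {y : Slots k g} (hy : restr (· ≤ 0) y = y) :
    formsD b (homS b B hB s 0 y) = homS b B hB s 0 (slotD b y) -
      vecD b (dufloVec b B hB s) (hkrS b 0 y) := by
  rw [formsD_homS b B hB hsymm hinv s 0 hy, Finset.sum_range_zero, smul_zero, sub_zero, pow_zero,
    one_smul]

omit hinv in
/-- The bivector of the scalar product, contracted with two slots. -/
theorem opQ_bivec_zero (p r : ℕ) : opQ (g := g) b (bivec b B hB 0) p r =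
    ∑ c, dS k ι (b c) p * dS k ι (B.dualBasis hB b c) r := by
  have h : ∀ c, dS k ι (B.dualBasis hB b c) r = ∑ d, gramInv b B hB c d • dS k ι (b d) r :=
    fun c => dS_expand b _ r
  have h2 : ∀ t : k, mS (g := g) (algebraMap k (MvPowerSeries ι k) t) =
      algebraMap k (Module.End k (SlotForms k g ι)) t := fun t => AlgHom.commutes mulS t
  simp only [opQ, bivec, pow_zero, one_mul, gramMatrix, Matrix.of_apply, h, h2, Finset.mul_sum,
    ← Algebra.smul_def, mul_smul_comm]

omit hinv in
theorem opQ_bivec_zero_symm (p r : ℕ) : opQ (g := g) b (bivec b B hB 0) p r =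
    -opQ b (bivec b B hB 0) r p := by
  have ht : (bivec b B hB 0).transpose = bivec b B hB 0 := by
    ext1 c d
    simp only [bivec, pow_zero, one_mul, gramMatrix, Matrix.transpose_apply, Matrix.of_apply,
      gramInv_symm b B hB hsymm d c]
  rw [opQ_transpose, ht]

omit hinv in
theorem opQ_bivec_zero_cstS (p r : ℕ) (y : Slots k g) :
    opQ b (bivec b B hB 0) p r (cstS k g ι y) = cstS k g ι (slotQ b B hB p r y) := by
  rw [opQ_bivec_zero b B hB hsymm, slotQ, LinearMap.sum_apply, LinearMap.sum_apply, map_sum]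
  refine Finset.sum_congr rfl fun c _ => ?_
  exact cmap_cst (dslot (b c) p ∘ₗ dslot (B.dualBasis hB b c) r) y

omit hinv in
/-- The Brylinski operator lets one derivative of the bivector act on a variable `y`, that is on one of
the tautological derivatives, and the other on all the slots. -/
theorem brylinski_hkrS (i : ℕ) {y : Slots k g} (hy : restr (· ≤ i) y = y) :
    brylinski b B hB (hkrS b i y) = -((-1 : k) ^ i / (i.factorial : k)) •
      ∑ q ∈ Finset.range i, (-1 : k) ^ q • ∑ l ∈ Finset.range (i + 1),
        mulP k g ι (opQ b (bivec b B hB 0) (q + 1) l (prodYdel k ι b i (q + 1) (cstS k g ι y))) := by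
  have hdel : ∀ q, restrS k g ι i (prodYdel k ι b i q (cstS k g ι y)) =
      prodYdel k ι b i q (cstS k g ι y) := by
    intro q
    have h1 : restrS k g ι i (cstS k g ι y) = cstS k g ι y :=
      (cmap_cst (restr (· ≤ i)).toLinearMap y).trans (congrArg (cstS k g ι) hy)
    rw [← Module.End.mul_apply, ← prodYdel_restrS b le_rfl, Module.End.mul_apply, h1]
  have hres : ∀ (x : g) q, q < i → restrS k g ι i (dS k ι x (q + 1)
      (prodYdel k ι b i (q + 1) (cstS k g ι y))) =
      dS k ι x (q + 1) (prodYdel k ι b i (q + 1) (cstS k g ι y)) := by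
    intro x q hq
    rw [← Module.End.mul_apply, ← dS_restrS _ (by omega), Module.End.mul_apply, hdel]
  have hpd : ∀ x : g, partialYVec b x (mulP k g ι (prodY k ι b i (cstS k g ι y))) =
      ∑ q ∈ Finset.range i, (-1 : k) ^ q • mulP k g ι (dS k ι x (q + 1)
        (prodYdel k ι b i (q + 1) (cstS k g ι y))) := by
    intro x
    have h1 : ∀ r, partialY k g r (mulP k g ι (prodY k ι b i (cstS k g ι y))) =
        ∑ q ∈ Finset.range i, (-1 : k) ^ q • mulP k g ι (dS k ι (b r) (q + 1)
          (prodYdel k ι b i (q + 1) (cstS k g ι y))) := by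
      intro r
      have h2 : pdS k g r (cstS k g ι y) = 0 := pdY_cst r y
      rw [pdS_mulP, ← Module.End.mul_apply, pdS_prodY, LinearMap.add_apply, Module.End.mul_apply,
        h2, map_zero, zero_add, LinearMap.sum_apply, map_sum]
      simp only [LinearMap.smul_apply, map_smul, Module.End.mul_apply]
    simp only [partialYVec, LinearMap.sum_apply, LinearMap.smul_apply, h1, Finset.smul_sum]
    rw [Finset.sum_comm]
    refine Finset.sum_congr rfl fun q _ => ?_
    rw [dS_expand b x, LinearMap.sum_apply, map_sum, Finset.smul_sum]
    refine Finset.sum_congr rfl fun r _ => ?_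
    rw [smul_comm, LinearMap.smul_apply, map_smul]
  have hQ : ∀ q, q < i → ∀ l, mulP k g ι (opQ b (bivec b B hB 0) (q + 1) l
      (prodYdel k ι b i (q + 1) (cstS k g ι y))) =
      -∑ c, mulP k g ι (dS k ι (b c) l (dS k ι (B.dualBasis hB b c) (q + 1)
        (prodYdel k ι b i (q + 1) (cstS k g ι y)))) := by
    intro q _ l
    rw [opQ_bivec_zero_symm b B hB hsymm, opQ_bivec_zero b B hB hsymm, LinearMap.neg_apply, map_neg,
      LinearMap.sum_apply, map_sum]
    rfl
  have hbr : brylinski b B hB (mulP k g ι (prodY k ι b i (cstS k g ι y))) =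
      -∑ q ∈ Finset.range i, (-1 : k) ^ q • ∑ l ∈ Finset.range (i + 1),
        mulP k g ι (opQ b (bivec b B hB 0) (q + 1) l (prodYdel k ι b i (q + 1) (cstS k g ι y))) := by
    have hc : ∀ c, coeffMap (partialXi (b c)) (partialYVec b (B.dualBasis hB b c)
        (mulP k g ι (prodY k ι b i (cstS k g ι y)))) = ∑ q ∈ Finset.range i, (-1 : k) ^ q •
          ∑ l ∈ Finset.range (i + 1), mulP k g ι (dS k ι (b c) l (dS k ι (B.dualBasis hB b c) (q + 1)
          (prodYdel k ι b i (q + 1) (cstS k g ι y)))) := by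
      intro c
      rw [hpd, map_sum]
      refine Finset.sum_congr rfl fun q hq => ?_
      rw [map_smul, ← map_sum]
      congr 1
      exact partialXi_mulP (b c) (hres _ q (Finset.mem_range.1 hq))
    simp only [brylinski, LinearMap.sum_apply, LinearMap.comp_apply, hc]
    rw [Finset.sum_comm, ← Finset.sum_neg_distrib]
    refine Finset.sum_congr rfl fun q hq => ?_
    rw [← Finset.smul_sum, ← smul_neg, Finset.sum_comm, ← Finset.sum_neg_distrib]
    congr 1
    refine Finset.sum_congr rfl fun l _ => ?_
    rw [hQ q (Finset.mem_range.1 hq) l, neg_neg]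
  rw [hkrS_apply, map_smul, hbr, smul_neg, neg_smul]

/-- The first-order deformation of the Hochschild differential, on slots. -/
def slotBr (i : ℕ) (y : Slots k g) : Slots k g :=
  (-2⁻¹ : k) • ∑ p ∈ Finset.range (i + 2), (-1 : k) ^ p • relabel (faceIdx i p)
    (slotQ b B hB p (if p = i + 1 then 0 else p + 1) y)

omit hinv in
/-- The deformation `d_0` followed by the symbol, in terms of derivatives in neighbouring slots. -/
theorem hkrS_slotBr (m : ℕ) (y : Slots k g) :
    hkrS b m (slotBr b B hB m y) = ((-1 : k) ^ m / (m.factorial : k)) • (2⁻¹ : k) •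
      ∑ q ∈ Finset.range (m + 1), (-1 : k) ^ q •
        (mulP k g ι (opQ b (bivec b B hB 0) (q + 1) q
            (prodYdel k ι b (m + 1) (q + 1) (cstS k g ι y))) +
          mulP k g ι (opQ b (bivec b B hB 0) (q + 1) (if q = m then 0 else q + 2)
            (prodYdel k ι b (m + 1) (q + 1) (cstS k g ι y)))) := by
  have hdQ : ∀ i q (x x' : g) p r, prodYdel k ι b i q * (dS k ι x p * dS k ι x' r) =
      dS k ι x p * dS k ι x' r * prodYdel k ι b i q := by
    intro i q x x' p r
    have h1 : ∀ l, dY k ι b l * (dS k ι x p * dS k ι x' r) =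
        dS k ι x p * dS k ι x' r * dY k ι b l := by
      intro l
      rw [← mul_assoc, dS_dY, neg_mul, mul_assoc, dS_dY, mul_neg, neg_neg, mul_assoc]
    have h2 : ∀ m, prodY k ι b m * (dS k ι x p * dS k ι x' r) =
        dS k ι x p * dS k ι x' r * prodY k ι b m := by
      intro m
      induction m with
      | zero => rw [prodY, one_mul, mul_one]
      | succ m ih => rw [prodY, mul_assoc, h1, ← mul_assoc, ih, mul_assoc]
    induction i with
    | zero => rw [prodYdel, one_mul, mul_one]
    | succ i ih =>
      by_cases hq : q = i + 1
      · rw [hq, prodYdel_succ_self, h2]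
      · rw [prodYdel_succ_of_ne b hq, mul_assoc, h1, ← mul_assoc, ih, mul_assoc]
  set F : ℕ → ℕ → Forms k g ι := fun p q => mulP k g ι (opQ b (bivec b B hB 0) p
    (if p = m + 1 then 0 else p + 1) (prodYdel k ι b (m + 1) q (cstS k g ι y))) with hF
  have hcomm : ∀ p q r, prodYdel k ι b (m + 1) q (cstS k g ι (slotQ b B hB p r y)) =
      opQ b (bivec b B hB 0) p r (prodYdel k ι b (m + 1) q (cstS k g ι y)) := by
    intro p q r
    rw [← opQ_bivec_zero_cstS b B hB hsymm, ← Module.End.mul_apply, ← Module.End.mul_apply,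
      opQ_bivec_zero b B hB hsymm, Finset.mul_sum, Finset.sum_mul]
    simp only [hdQ]
  have hp : ∀ p ∈ Finset.range (m + 2), mulP k g ι (prodY k ι b m (cstS k g ι
      (relabel (faceIdx m p) (slotQ b B hB p (if p = m + 1 then 0 else p + 1) y)))) =
      (if p = 0 then 0 else F p p) + if p = m + 1 then 0 else F p (p + 1) := by
    intro p hp
    rw [Finset.mem_range] at hp
    rw [← relS_cstS, ← Module.End.mul_apply (prodY k ι b m), prodY_relS b m p (by omega),
      Module.End.mul_apply, mulP_relS, LinearMap.add_apply, map_add]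
    congr 1
    · by_cases h : p = 0
      · rw [if_pos h, if_pos h, LinearMap.zero_apply, map_zero]
      · rw [if_neg h, if_neg h, hcomm]
    · by_cases h : p = m + 1
      · simp only [if_pos h, LinearMap.zero_apply, map_zero]
      · simp only [if_neg h, hcomm, hF]
  rw [hkrS_apply, slotBr]
  simp only [map_smul, map_sum]
  rw [Finset.sum_congr rfl fun p h => congrArg _ (hp p h), sum_faces_by_parts]
  refine congrArg (_ • ·) ?_
  rw [neg_smul, ← smul_neg, ← Finset.sum_neg_distrib]
  refine congrArg (_ • ·) ?_
  refine Finset.sum_congr rfl fun q hq => ?_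
  rw [Finset.mem_range] at hq
  rw [← smul_neg, neg_sub, sub_eq_add_neg, add_comm]
  refine congrArg (_ • ·) (congrArg₂ (· + ·) ?_ ?_)
  · rw [hF]
    beta_reduce
    rw [if_neg (by omega), opQ_bivec_zero_symm b B hB hsymm q, LinearMap.neg_apply, map_neg, neg_neg]
  · simp only [hF, Nat.add_right_cancel_iff]

omit hinv in
/-- The homotopy identity relating the deformation of the Hochschild differential and the
Brylinski operator. -/
theorem homS_slotB (m : ℕ) {y : Slots k g} (hy : restr (· ≤ m + 1) y = y) :
    homS b B hB 0 m (slotB m y) =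
      brylinski b B hB (hkrS b (m + 1) y) - hkrS b m (slotBr b B hB m y) := by
  have hN : (bivec b B hB 0).transpose = (-1 : k) ^ 0 • bivec b B hB 0 := by
    rw [pow_zero, one_smul]
    ext1 c d
    simp only [bivec, pow_zero, one_mul, gramMatrix, Matrix.transpose_apply, Matrix.of_apply,
      gramInv_symm b B hB hsymm d c]
  rw [homS_apply, mulP_opG_slotB b hN m y, brylinski_hkrS b B hB hsymm (m + 1) hy,
    hkrS_slotBr b B hB hsymm]
  have hg : ∀ q < m + 1, ∀ l < m + 2, gC k 0 (m + 1) (q + 1) l = 1 / ((m + 1).factorial : k) := by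
    intro q _ l _
    rcases lt_trichotomy (q + 1) l with h | h | h
    · rw [gC, if_pos h, betaC_zero_left]
    · rw [← h, gC_self, if_neg (by decide), betaC_zero_left]
    · rw [gC, if_neg (by omega), if_pos h, betaC_zero_left]
  set F : ℕ → ℕ → Forms k g ι := fun q l => mulP k g ι (opQ b (bivec b B hB 0) (q + 1) l
    (prodYdel k ι b (m + 1) (q + 1) (cstS k g ι y))) with hF
  have hq : ∀ q ∈ Finset.range (m + 1), ∑ l ∈ Finset.range (m + 2),
      (gC k 0 (m + 1) (q + 1) l - defectC k 0 m * ((if l = q + 2 then 1 else 0) +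
        (if l = q then 1 else 0) + if q = m ∧ l = 0 then 1 else 0)) • F q l =
      (1 / ((m + 1).factorial : k)) • ∑ l ∈ Finset.range (m + 2), F q l -
        (2⁻¹ / (m.factorial : k)) • (F q q + F q (if q = m then 0 else q + 2)) := by
    intro q hq
    rw [Finset.mem_range] at hq
    have h1 : ∀ l ∈ Finset.range (m + 2), (gC k 0 (m + 1) (q + 1) l - defectC k 0 m *
        ((if l = q + 2 then 1 else 0) +
        (if l = q then 1 else 0) + if q = m ∧ l = 0 then 1 else 0)) • F q l =
        (1 / ((m + 1).factorial : k)) • F q l - (2⁻¹ / (m.factorial : k)) •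
          ((if q = l then F q l else 0) +
            if (if q = m then 0 else q + 2) = l then F q l else 0) := by
      intro l hl
      rw [Finset.mem_range] at hl
      rw [hg q hq l hl, sub_smul, defectC, if_pos rfl, mul_smul]
      congr 2
      have e : (if (if q = m then 0 else q + 2) = l then F q l else 0) =
          ((if l = q + 2 then (1 : k) else 0) + if q = m ∧ l = 0 then 1 else 0) • F q l := by
        by_cases h : q = m
        · rw [if_pos h, if_neg (show ¬ l = q + 2 by omega), zero_add]
          by_cases h' : l = 0
          · rw [if_pos h'.symm, if_pos ⟨h, h'⟩, one_smul]
          · rw [if_neg (Ne.symm h'), if_neg (fun h'' => h' h''.2), zero_smul]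
        · rw [if_neg h, if_neg (show ¬ (q = m ∧ l = 0) from fun h'' => h h''.1), add_zero]
          by_cases h' : l = q + 2
          · rw [if_pos h'.symm, if_pos h', one_smul]
          · rw [if_neg (Ne.symm h'), if_neg h', zero_smul]
      have e' : (if q = l then F q l else 0) = (if l = q then (1 : k) else 0) • F q l := by
        by_cases h' : l = q
        · rw [if_pos h'.symm, if_pos h', one_smul]
        · rw [if_neg (Ne.symm h'), if_neg h', zero_smul]
      rw [e, e', ← _root_.add_smul]
      congr 1
      ring
    have h2 : (if q = m then 0 else q + 2) ∈ Finset.range (m + 2) := by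
      rw [Finset.mem_range]
      split_ifs <;> omega
    rw [Finset.sum_congr rfl h1, Finset.sum_sub_distrib, ← Finset.smul_sum, ← Finset.smul_sum,
      Finset.sum_add_distrib, Finset.sum_ite_eq, Finset.sum_ite_eq, if_pos h2,
      if_pos (Finset.mem_range.2 (by omega))]
  rw [Finset.sum_congr rfl fun q h => congrArg _ (hq q h)]
  simp only [smul_sub, Finset.sum_sub_distrib, smul_comm _ (1 / ((m + 1).factorial : k)),
    smul_comm _ (2⁻¹ / (m.factorial : k)), ← Finset.smul_sum]
  rw [smul_smul, smul_smul, smul_smul]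
  congr 2
  · rw [pow_succ]
    ring
  · ring

end HomotopySlots

/-! ### The Duflo character and the conjugated Brylinski operator -/

section DufloCharacter

variable {k : Type*} [Field k] {g : Type*} [LieRing g] [LieAlgebra k g] {ι : Type*}

theorem pdY_mul (r : ι) (f f' : MvPowerSeries ι k) :
    pdY k r (f * f') = pdY k r f * f' + f * pdY k r f' := by
  have := pdY_mulS (k := k) r f f'
  simp only [mulS_apply, Algebra.algebraMap_self, MvPowerSeries.map_id, RingHom.id_apply] at this
  exact this

theorem pdY_pow (r : ι) (f : MvPowerSeries ι k) (n : ℕ) :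
    pdY k r (f ^ (n + 1)) = ((n : k) + 1) • (pdY k r f * f ^ n) := by
  induction n with
  | zero => simp
  | succ n ih =>
    rw [pow_succ, pdY_mul, ih, smul_mul_assoc, mul_assoc, ← pow_succ, mul_comm (f ^ (n + 1)),
      Nat.cast_succ]
    simp only [_root_.add_smul, one_smul]

variable [CharZero k]

/-- A coefficient of `exp L` is that of a partial sum of the exponential series. -/
theorem exp_subst_coeff {L : MvPowerSeries ι k} (hL : MvPowerSeries.constantCoeff L = 0)
    (n : ι →₀ ℕ) {N : ℕ} (hN : n.degree < N) :
    MvPowerSeries.coeff n ((PowerSeries.exp k).subst L) =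
      MvPowerSeries.coeff n (∑ d ∈ Finset.range N, (1 / (d.factorial : k)) • L ^ d) := by
  rw [PowerSeries.coeff_subst (PowerSeries.HasSubst.of_constantCoeff_zero hL), map_sum,
    finsum_eq_sum_of_support_subset]
  · refine Finset.sum_congr rfl fun d _ => ?_
    rw [PowerSeries.coeff_exp, coeff_ksmul, map_div₀, map_one, map_natCast]
  · intro d hd
    rw [Function.mem_support] at hd
    rw [Finset.coe_range, Set.mem_Iio]
    by_contra h
    refine hd ?_
    rw [MvPowerSeries.coeff_eq_zero_of_constantCoeff_nilpotent (m := 1) (by rw [hL, pow_one])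
      (by omega), smul_zero]

/-- The chain rule for the exponential of a power series. -/
theorem pdY_exp_subst {L : MvPowerSeries ι k} (hL : MvPowerSeries.constantCoeff L = 0) (r : ι) :
    pdY k r ((PowerSeries.exp k).subst L) = pdY k r L * (PowerSeries.exp k).subst L := by
  classical
  ext n
  have h1 : pdY k r (∑ d ∈ Finset.range (n.degree + 2), (1 / (d.factorial : k)) • L ^ d) =
      pdY k r L * ∑ d ∈ Finset.range (n.degree + 1), (1 / (d.factorial : k)) • L ^ d := by
    have h0 : pdY k r (1 : MvPowerSeries ι k) = 0 := pdY_cst r 1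
    rw [Finset.sum_range_succ', map_add, map_sum, Finset.mul_sum, map_smul, pow_zero, h0, smul_zero,
      add_zero]
    refine Finset.sum_congr rfl fun d _ => ?_
    rw [map_smul, pdY_pow, smul_smul, mul_smul_comm]
    congr 1
    rw [Nat.factorial_succ, Nat.cast_mul, Nat.cast_succ]
    have : (d : k) + 1 ≠ 0 := Nat.cast_add_one_ne_zero d
    have : (d.factorial : k) ≠ 0 := Nat.cast_ne_zero.2 (Nat.factorial_ne_zero d)
    field_simp
  rw [coeff_pdY, exp_subst_coeff hL (n + Finsupp.single r 1) (N := n.degree + 2)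
    (by rw [map_add, Finsupp.degree_single]; omega), ← coeff_pdY, h1, MvPowerSeries.coeff_mul,
    MvPowerSeries.coeff_mul]
  refine Finset.sum_congr rfl fun p hp => ?_
  rw [exp_subst_coeff hL p.2 (N := n.degree + 1)]
  rw [Finset.HasAntidiagonal.mem_antidiagonal] at hp
  rw [← hp, map_add]
  omega

variable [Fintype ι] [DecidableEq ι] (b : Module.Basis ι k g)

theorem constantCoeff_logDuflo : MvPowerSeries.constantCoeff (logDuflo b) = 0 := by
  change MvPowerSeries.coeff 0 (logDuflo b) = 0
  have h : Finset.Icc 1 (Finsupp.degree (0 : ι →₀ ℕ)) = ∅ := by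
    rw [map_zero]
    rfl
  change ∑ n ∈ Finset.Icc 1 (Finsupp.degree (0 : ι →₀ ℕ)),
    ((bernoulli (2 * n) : ℚ) : k) / (4 * n * (Nat.factorial (2 * n) : k)) *
      MvPowerSeries.coeff 0 (adMatrix b ^ (2 * n)).trace = 0
  rw [h, Finset.sum_empty]

theorem duflo_mul_inv : duflo b * (duflo b)⁻¹ = 1 := by
  refine MvPowerSeries.mul_inv_cancel _ ?_
  have h := exp_subst_coeff (constantCoeff_logDuflo b) 0 (N := 1) (by rw [map_zero]; exact one_pos)
  have h' : MvPowerSeries.constantCoeff (duflo b) = 1 := by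
    refine h.trans ?_
    rw [Finset.sum_range_one, Nat.factorial_zero, Nat.cast_one, div_one, one_smul, pow_zero]
    exact map_one (MvPowerSeries.constantCoeff (σ := ι) (R := k))
  rw [h']
  exact one_ne_zero

theorem sum_sum_antisymm {P : Type*} [AddCommGroup P] [Module k P] (A : ι → ι → P)
    (h : ∀ i j, A i j = -A j i) : ∑ i, ∑ j, A i j = 0 := by
  have h1 : ∑ i, ∑ j, A i j = -∑ i, ∑ j, A i j := by
    conv_lhs => rw [Finset.sum_comm]
    simp only [← Finset.sum_neg_distrib]
    exact Finset.sum_congr rfl fun i _ => Finset.sum_congr rfl fun j _ => h j i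
  have h2 : (2 : k) • ∑ i, ∑ j, A i j = 0 := by
    rw [two_smul]
    nth_rewrite 1 [h1]
    exact neg_add_cancel _
  exact (smul_eq_zero.1 h2).resolve_left two_ne_zero

theorem isHomog_mul {m m' : ℕ} {f f' : MvPowerSeries ι k} (hf : IsHomog m f) (hf' : IsHomog m' f') :
    IsHomog (m + m') (f * f') := by
  have h := isHomog_mulS hf hf'
  rw [mulS_apply] at h
  simp only [Algebra.algebraMap_self, MvPowerSeries.map_id, RingHom.id_apply] at h
  exact h

theorem isHomog_adMatrix_pow (n : ℕ) (r s : ι) : IsHomog n ((adMatrix b ^ n) r s) := by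
  induction n generalizing r s with
  | zero =>
    rw [pow_zero, Matrix.one_apply]
    split_ifs
    · exact isHomog_cst (R := k) 1
    · exact isHomog_zero 0
  | succ n ih =>
    rw [pow_succ, Matrix.mul_apply]
    refine isHomog_sum fun c _ => isHomog_mul (ih r c) ?_
    rw [adMatrix_apply, adVec]
    exact isHomog_sum fun c _ => isHomog_smul (isHomog_X c) _

theorem isHomog_trace_adMatrix_pow (n : ℕ) : IsHomog n (adMatrix b ^ n).trace :=
  isHomog_sum fun r _ => isHomog_adMatrix_pow b n r r

theorem homog_logDuflo (n : ℕ) : homog (k := k) (n + 1) (logDuflo b) =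
    (if Odd (n + 1) then 0 else ((bernoulli (n + 1) : ℚ) : k) /
      (2 * ((n : k) + 1) * ((n + 1).factorial : k))) • (adMatrix b ^ (n + 1)).trace := by
  ext m
  rw [coeff_homog, coeff_ksmul]
  by_cases hm : m.degree = n + 1
  · rw [if_pos hm]
    change ∑ j ∈ Finset.Icc 1 m.degree, _ = _
    rw [hm]
    split_ifs with hodd
    · rw [zero_smul]
      refine Finset.sum_eq_zero fun j _ => ?_
      rw [isHomog_trace_adMatrix_pow b (2 * j) m, mul_zero]
      rw [hm]
      intro h
      rw [h] at hodd
      exact (Nat.not_odd_iff_even.2 (even_two_mul j)) hodd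
    · obtain ⟨j, hj⟩ := even_iff_exists_two_mul.1 (Nat.not_odd_iff_even.1 hodd)
      rw [Finset.sum_eq_single j, ← hj, smul_eq_mul]
      · congr 2
        have h2 : (n : k) + 1 = 2 * j := by exact_mod_cast hj
        rw [h2]
        ring
      · intro j' _ hne
        rw [isHomog_trace_adMatrix_pow b (2 * j') m (by omega), mul_zero]
      · intro h
        exact absurd (Finset.mem_Icc.2 ⟨by omega, by omega⟩) h
  · rw [if_neg hm, isHomog_trace_adMatrix_pow b (n + 1) m hm, smul_zero]

variable (B : LinearMap.BilinForm k g) (hB : B.Nondegenerate)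

/-- The gradient of `log j^{1/2}` with respect to the scalar product. -/
def gradDuflo (c : ι) : MvPowerSeries ι k := ∑ r, gramInv b B hB c r • pdY k r (logDuflo b)

/-- The conjugated Brylinski operator differs from the Brylinski operator by a derivation. -/
theorem twistedBrylinski_apply (ω : Forms k g ι) : twistedBrylinski b B hB ω =
    brylinski b B hB ω + vecD b (gradDuflo b B hB) ω := by
  have h1 : ∀ η : Forms k g ι, mulS (duflo b)⁻¹ (mulS (duflo b) η) = η := by
    intro η
    rw [← Module.End.mul_apply, ← map_mul, mul_comm, duflo_mul_inv, map_one, Module.End.one_apply]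
  have h2 : ∀ r, pdY k r (duflo b) = pdY k r (logDuflo b) * duflo b := fun r =>
    pdY_exp_subst (constantCoeff_logDuflo b) r
  have h3 : ∀ r (η : Forms k g ι), partialY k g r (mulS (duflo b) η) =
      mulS (duflo b) (partialY k g r η + mulS (pdY k r (logDuflo b)) η) := by
    intro r η
    refine (pdY_mulS r (duflo b) η).trans ?_
    rw [h2, map_add, add_comm, mul_comm, map_mul]
    rfl
  have h4 : ∀ i, coeffMap (partialXi (b i)) (partialYVec b (B.dualBasis hB b i)
      (mulS (duflo b) ω)) = mulS (duflo b) (coeffMap (partialXi (b i))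
        (partialYVec b (B.dualBasis hB b i) ω) +
          ∑ r, gramInv b B hB i r • mulS (pdY k r (logDuflo b)) (cmap (partialXi (b i)) ω)) := by
    intro i
    have e : ∀ η : Forms k g ι, coeffMap (partialXi (b i)) η = cmap (partialXi (b i)) η :=
      fun _ => rfl
    simp only [partialYVec, LinearMap.sum_apply, LinearMap.smul_apply, h3, e, map_sum, map_smul,
      cmap_mulS, map_add, smul_add, Finset.sum_add_distrib, gramInv]
  have h5 : brylinski b B hB (mulS (duflo b) ω) = mulS (duflo b)
      (brylinski b B hB ω + vecD b (gradDuflo b B hB) ω) := by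
    simp only [brylinski, vecD, gradDuflo, LinearMap.sum_apply, LinearMap.comp_apply, h4, map_add,
      map_sum, map_smul, LinearMap.smul_apply, Finset.sum_add_distrib]
  change mulS (duflo b)⁻¹ (brylinski b B hB (mulS (duflo b) ω)) = _
  rw [h5, h1]

variable (hsymm : B.IsSymm) (hinv : ∀ x y z : g, B ⁅x, y⁆ z = B x ⁅y, z⁆)
include hsymm hinv

/-- The homogeneous components of the gradient of `log j^{1/2}` are the brackets of the bivectors
`Ad^n β` with Bernoulli coefficients. -/
theorem homog_gradDuflo (n : ℕ) (c : ι) :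
    homog (k := k) n (gradDuflo b B hB c) = dufloVec b B hB n c := by
  have hn : (n : k) + 1 ≠ 0 := Nat.cast_add_one_ne_zero n
  simp only [gradDuflo, map_sum, map_smul, homog_pdY, homog_logDuflo, smul_comm (gramInv b B hB c _),
    ← Finset.smul_sum]
  rw [← bracketVec_pow b B hB hsymm hinv, smul_smul, dufloVec, bivec]
  congr 1
  split_ifs
  · rw [mul_zero, zero_mul]
  · have : ((n + 1).factorial : k) ≠ 0 := Nat.cast_ne_zero.2 (Nat.factorial_ne_zero _)
    field_simp

omit hsymm hinv in
/-- The Duflo character is invariant. -/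
theorem cad_logDuflo (x : g) : cad b x (logDuflo b) = 0 := by
  refine ext_homog (k := k) fun m => ?_
  rw [homog_cad, map_zero]
  cases m with
  | zero =>
    have h : homog (k := k) 0 (logDuflo b) = 0 := by
      ext n
      rw [coeff_homog, map_zero]
      split_ifs with hn
      · rw [(Finsupp.degree_eq_zero_iff n).1 hn]
        exact constantCoeff_logDuflo b
      · rfl
    rw [h, map_zero]
  | succ m => rw [homog_logDuflo, map_smul, cad_trace_pow, smul_zero]

omit hsymm hinv in
theorem cad_duflo (x : g) : cad b x (duflo b) = 0 := by
  have h2 : ∀ r, pdY k r (duflo b) = mulS (duflo b) (pdY k r (logDuflo b)) := by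
    intro r
    rw [mulS_apply]
    simp only [Algebra.algebraMap_self, MvPowerSeries.map_id, RingHom.id_apply]
    rw [mul_comm]
    exact pdY_exp_subst (constantCoeff_logDuflo b) r
  have h3 : cad b x (duflo b) = mulS (duflo b) (cad b x (logDuflo b)) := by
    have h4 : ∀ (f : MvPowerSeries ι k) (i : ι),
        mulS f (mulS (duflo b) (pdY k i (logDuflo b))) =
          mulS (duflo b) (mulS f (pdY k i (logDuflo b))) := by
      intro f i
      rw [← Module.End.mul_apply, ← map_mul, mul_comm, map_mul, Module.End.mul_apply]
    simp only [cad_apply, h2, map_neg, map_sum, map_smul, h4]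
  rw [h3, cad_logDuflo, map_zero]

omit hsymm hinv in
theorem cad_duflo_inv (x : g) : cad b x (duflo b)⁻¹ = 0 := by
  have h := cad_mul b x (duflo b) (duflo b)⁻¹
  rw [duflo_mul_inv, cad_duflo, zero_mul, zero_add] at h
  have h1 : cad b x (1 : MvPowerSeries ι k) = 0 := cad_cst b x (1 : k)
  rw [h1] at h
  calc cad b x (duflo b)⁻¹ = (duflo b)⁻¹ * (duflo b * cad b x (duflo b)⁻¹) := by
        rw [← mul_assoc, mul_comm (duflo b)⁻¹, duflo_mul_inv, one_mul]
    _ = 0 := by rw [← h, mul_zero]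

/-- The invariance of the tensor `∑_c b_c ⊗ b^c`. -/
theorem coord_lie_dualBasis (z : g) (c r : ι) : b.coord r ⁅z, B.dualBasis hB b c⁆ =
    ∑ d, b.coord c ⁅b d, z⁆ * gramInv b B hB d r := by
  have h1 : b.coord c ⁅B.dualBasis hB b r, z⁆ = ∑ d, b.coord c ⁅b d, z⁆ * gramInv b B hB d r := by
    rw [← sum_gramInv b B hB r]
    simp only [sum_lie, smul_lie, map_sum, map_smul, smul_eq_mul, gramInv_symm b B hB hsymm r,
      mul_comm]
  rw [← h1, coord_eq_dualBasis b B hB, coord_eq_dualBasis b B hB, ← hinv, hsymm.eq]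

theorem sum_dS_lie_pdS (z : g) (l : ℕ) :
    ∑ c, dS k ι (b c) l * ∑ r, b.coord r ⁅z, B.dualBasis hB b c⁆ • pdS k g r =
      ∑ c, dS k ι ⁅b c, z⁆ l * ∑ r, gramInv b B hB c r • pdS k g r := by
  have h : ∀ c, dS k ι ⁅b c, z⁆ l = ∑ d, b.coord d ⁅b c, z⁆ • dS k ι (b d) l :=
    fun c => dS_expand b _ l
  simp only [coord_lie_dualBasis b B hB hsymm hinv, h, Finset.sum_mul, Finset.mul_sum,
    smul_mul_assoc, mul_smul_comm, Finset.sum_smul]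
  rw [Finset.sum_congr rfl fun c _ => Finset.sum_comm, Finset.sum_comm]
  refine Finset.sum_congr rfl fun d _ => ?_
  rw [Finset.sum_comm]
  simp only [Finset.smul_sum, smul_smul, mul_comm (gramInv b B hB d _)]

omit hsymm hinv in
theorem pdY_cad {R : Type*} [Ring R] [Algebra k R] (z : g) (r : ι) (ω : MvPowerSeries ι R) :
    pdY k r (cad b z ω) = -∑ i, b.coord i ⁅z, b r⁆ • pdY k i ω - ∑ j, ∑ i, b.coord i ⁅z, b j⁆ •
      mulS (MvPowerSeries.X j : MvPowerSeries ι k) (pdY k r (pdY k i ω)) := by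
  rw [cad_apply]
  simp only [map_neg, map_sum, map_smul, pdY_mulS, pdY_X, smul_add, Finset.sum_add_distrib,
    neg_add]
  rw [sub_eq_add_neg]
  congr 2
  · refine Finset.sum_congr rfl fun i _ => ?_
    rw [Finset.sum_eq_single r]
    · rw [if_pos rfl, map_one, Module.End.one_apply]
    · intro j _ hj
      rw [if_neg hj.symm, map_zero, LinearMap.zero_apply, smul_zero]
    · exact fun h => absurd (Finset.mem_univ r) h
  · rw [Finset.sum_comm]

omit hsymm hinv in
theorem cad_pdY {R : Type*} [Ring R] [Algebra k R] (z : g) (r : ι) (ω : MvPowerSeries ι R) :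
    cad b z (pdY k r ω) = pdY k r (cad b z ω) + ∑ i, b.coord i ⁅z, b r⁆ • pdY k i ω := by
  rw [pdY_cad, cad_apply, Finset.sum_comm]
  simp only [pdY_pdY r]
  abel

/-- The Casimir element acts by zero. -/
theorem sum_pdY_cad {R : Type*} [Ring R] [Algebra k R] (ω : MvPowerSeries ι R) :
    ∑ c, ∑ r, gramInv b B hB c r • pdY k r (cad b (b c) ω) = 0 := by
  have h2 : ∀ c r, gramInv b B hB c r • pdY k r (cad b (b c) ω) =
      -(gramInv b B hB c r • ∑ i, b.coord i ⁅b c, b r⁆ • pdY k i ω) -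
      ∑ j, mulS (MvPowerSeries.X j : MvPowerSeries ι k) (∑ i,
        (b.coord i ⁅b c, b j⁆ * gramInv b B hB c r) • pdY k r (pdY k i ω)) := by
    intro c r
    simp only [pdY_cad, smul_sub, smul_neg, Finset.smul_sum, map_sum, map_smul, smul_smul, mul_comm]
  simp only [h2, Finset.sum_sub_distrib, Finset.sum_neg_distrib]
  rw [sum_sum_antisymm (k := k) (fun c r => gramInv b B hB c r • ∑ i, b.coord i ⁅b c, b r⁆ • pdY k i ω),
    neg_zero, zero_sub, neg_eq_zero, Finset.sum_congr rfl fun c _ => Finset.sum_comm,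
    Finset.sum_comm]
  · refine Finset.sum_eq_zero fun j _ => ?_
    have h3 : ∀ i r, ∑ c, b.coord i ⁅b c, b j⁆ * gramInv b B hB c r =
        -∑ c, b.coord r ⁅b c, b j⁆ * gramInv b B hB c i := by
      intro i r
      rw [← coord_lie_dualBasis b B hB hsymm hinv, ← coord_lie_dualBasis b B hB hsymm hinv,
        coord_eq_dualBasis b B hB, coord_eq_dualBasis b B hB, ← hinv, hsymm.eq, ← lie_skew, map_neg]
    have h4 : ∑ c, ∑ r, mulS (MvPowerSeries.X j : MvPowerSeries ι k) (∑ i,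
        (b.coord i ⁅b c, b j⁆ * gramInv b B hB c r) • pdY k r (pdY k i ω)) =
        mulS (MvPowerSeries.X j : MvPowerSeries ι k) (∑ i, ∑ r,
          (∑ c, b.coord i ⁅b c, b j⁆ * gramInv b B hB c r) • pdY k r (pdY k i ω)) := by
      simp only [map_sum, Finset.sum_smul]
      rw [Finset.sum_comm, Finset.sum_congr rfl fun r _ => Finset.sum_comm, Finset.sum_comm]
    rw [h4, sum_sum_antisymm (k := k), map_zero]
    intro i r
    rw [h3, neg_smul, pdY_pdY]
  · intro c r
    simp only [gramInv_symm b B hB hsymm r c, ← lie_skew (b r), map_neg, neg_smul,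
      Finset.sum_neg_distrib, smul_neg, neg_neg]

omit hsymm hinv in
theorem slotD_restr (s : ℕ → Prop) [DecidablePred s] (y : Slots k g) :
    slotD b (restr s y) = restr s (slotD b y) := by
  refine DFunLike.congr_fun (f := slotD b ∘ₗ (restr s).toLinearMap)
    (g := (restr s).toLinearMap ∘ₗ slotD b) (slotsHom_ext ?_ ?_) y
  · simp only [LinearMap.comp_apply, AlgHom.toLinearMap_apply, map_one, slotD_one, map_zero]
  · intro r v y hy
    simp only [LinearMap.comp_apply, AlgHom.toLinearMap_apply] at hy ⊢
    rw [map_mul (restr s), restr_gen, slotD_gen_mul, map_sub, map_mul (restr s),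
      map_mul (restr s), restr_gen]
    by_cases h : s r
    · rw [if_pos h, slotD_gen_mul, hy, restr_slot_of_mem s h]
    · have h0 : restr s (slot r (chD b (ExteriorAlgebra.ι k v))) = 0 := by
        rw [chD_ι]
        simp only [map_smul, map_sum, map_mul, xi, slot_ι, restr_gen, if_neg h, zero_mul, smul_zero,
          Finset.sum_const_zero]
      rw [if_neg h, zero_mul, zero_mul, map_zero, h0, zero_mul, sub_zero]

omit hsymm hinv in
theorem totD_pdS (L : ℕ) (r : ι) : totD b L * pdS k g r = pdS k g r * totD b L +
    ∑ a, xS b a L * ∑ i, b.coord i ⁅b a, b r⁆ • pdS k g i := by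
  have h1 : sD b * pdS k g r = pdS k g r * sD b := LinearMap.ext fun ω => cmap_pdY (slotD b) r ω
  have h2 : ∀ a, xS b a L * pdS k g r = pdS k g r * xS b a L := fun a =>
    LinearMap.ext fun ω => cmap_pdY (LinearMap.mulLeft k (gen L (b.coord a))) r ω
  have h3 : ∀ a, cadS k g ι b (b a) * pdS k g r = pdS k g r * cadS k g ι b (b a) +
      ∑ i, b.coord i ⁅b a, b r⁆ • pdS k g i := by
    intro a
    refine LinearMap.ext fun ω => ?_
    rw [LinearMap.add_apply, LinearMap.sum_apply]
    exact cad_pdY b (b a) r ω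
  rw [totD, add_mul, mul_add, h1, add_assoc, Finset.sum_mul, Finset.mul_sum,
    ← Finset.sum_add_distrib]
  refine congrArg₂ (· + ·) rfl (Finset.sum_congr rfl fun a _ => ?_)
  rw [mul_assoc, h3, mul_add, ← mul_assoc, h2, mul_assoc]

/-- The Brylinski operator anticommutes with the Chevalley–Eilenberg differential: the tensor
`∑_c b_c ⊗ b^c` is invariant and the Casimir element acts by zero. -/
theorem formsD_brylinski (ω : Forms k g ι) :
    formsD b (brylinski b B hB ω) = -brylinski b B hB (formsD b ω) := by
  obtain ⟨P, hP⟩ : ∃ P : g → Module.End k (SlotForms k g ι),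
      ∀ v, P v = ∑ r, b.coord r v • pdS k g r := ⟨_, fun _ => rfl⟩
  -- forms are lifted to the slot `0`, and the coefficients of the coadjoint action to the slot `1`
  have hsur : ∃ η : SlotForms k g ι, restrS k g ι 0 η = η ∧ mulP k g ι η = ω := by
    refine ⟨(cmap (slot 0).toLinearMap : Forms k g ι →ₗ[k] MvPowerSeries ι (Slots k g)) ω,
      slotForms_ext fun n => ?_, MvPowerSeries.ext fun n => ?_⟩
    · exact restr_slot_of_mem (· ≤ 0) le_rfl _
    · exact slotProd_slot 0 _
  obtain ⟨η, hη, rfl⟩ := hsur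
  set T : Module.End k (SlotForms k g ι) :=
    ∑ c, dS k ι (b c) 0 * P (B.dualBasis hB b c) with hT
  have hPr : ∀ v, P v * restrS k g ι 0 = restrS k g ι 0 * P v := by
    intro v
    simp only [hP, Finset.sum_mul, Finset.mul_sum, smul_mul_assoc, mul_smul_comm]
    refine Finset.sum_congr rfl fun r _ => ?_
    congr 1
    exact (LinearMap.ext fun ω => cmap_pdY (restr (· ≤ 0)).toLinearMap r ω).symm
  have hbr : ∀ θ : SlotForms k g ι, restrS k g ι 0 θ = θ →
      brylinski b B hB (mulP k g ι θ) = mulP k g ι (T θ) := by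
    intro θ hθ
    rw [brylinski, LinearMap.sum_apply, hT, LinearMap.sum_apply, map_sum]
    refine Finset.sum_congr rfl fun c _ => ?_
    have h1 : partialYVec b (B.dualBasis hB b c) (mulP k g ι θ) =
        mulP k g ι (P (B.dualBasis hB b c) θ) := by
      simp only [partialYVec, hP, LinearMap.sum_apply, LinearMap.smul_apply, pdS_mulP, map_sum,
        map_smul]
    have h2 : restrS k g ι 0 (P (B.dualBasis hB b c) θ) = P (B.dualBasis hB b c) θ := by
      rw [← Module.End.mul_apply, ← hPr, Module.End.mul_apply, hθ]
    rw [LinearMap.comp_apply, h1]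
    refine (partialXi_mulP (b c) h2).trans ?_
    rw [Finset.sum_range_one]
    rfl
  have hPt : ∀ v, totD b 1 * P v = P v * totD b 1 + ∑ a, xS b a 1 * P ⁅b a, v⁆ := by
    intro v
    have h1 : ∀ a, P ⁅b a, v⁆ = ∑ r, b.coord r v • ∑ i, b.coord i ⁅b a, b r⁆ • pdS k g i := by
      intro a
      have h : ∀ i, b.coord i ⁅b a, v⁆ = ∑ r, b.coord r v * b.coord i ⁅b a, b r⁆ := by
        intro i
        conv_lhs => rw [← b.sum_repr v]
        simp only [lie_sum, lie_smul, map_sum, map_smul, smul_eq_mul, Module.Basis.coord_apply]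
      simp only [hP, h, Finset.sum_smul, Finset.smul_sum, smul_smul]
      rw [Finset.sum_comm]
    simp only [h1]
    simp only [hP, Finset.mul_sum, Finset.sum_mul, mul_smul_comm, smul_mul_assoc, totD_pdS, smul_add,
      Finset.sum_add_distrib, Finset.smul_sum]
    congr 1
    rw [Finset.sum_comm]
  have hPx : ∀ v a l, P v * xS b a l = xS b a l * P v := by
    intro v a l
    simp only [hP, Finset.sum_mul, Finset.mul_sum, smul_mul_assoc, mul_smul_comm]
    refine Finset.sum_congr rfl fun r _ => ?_
    congr 1
    exact (LinearMap.ext fun ω => cmap_pdY (LinearMap.mulLeft k (gen l (b.coord a))) r ω).symm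
  have hTt : totD b 1 * T = -(T * totD b 1) +
      ∑ a, xS b a 1 * (∑ c, dS k ι (b c) 0 * P ⁅b a, B.dualBasis hB b c⁆) -
      ∑ a, xS b a 0 * ∑ c, dS k ι ⁅b c, b a⁆ 0 * P (B.dualBasis hB b c) := by
    have hc : ∀ c, totD b 1 * (dS k ι (b c) 0 * P (B.dualBasis hB b c)) =
        -(dS k ι (b c) 0 * P (B.dualBasis hB b c) * totD b 1) +
        ∑ a, xS b a 1 * (dS k ι (b c) 0 * P ⁅b a, B.dualBasis hB b c⁆) -
        ∑ a, xS b a 0 * (dS k ι ⁅b c, b a⁆ 0 * P (B.dualBasis hB b c)) := by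
      intro c
      have hx : ∀ a, dS k ι (b c) 0 * (xS b a 1 * P ⁅b a, B.dualBasis hB b c⁆) =
          -(xS b a 1 * (dS k ι (b c) 0 * P ⁅b a, B.dualBasis hB b c⁆)) := by
        intro a
        rw [← mul_assoc, dS_xS, if_neg one_ne_zero, zero_smul, zero_sub, neg_mul, mul_assoc]
      rw [← mul_assoc, totD_dS b zero_ne_one, sub_mul, neg_mul, mul_assoc, hPt, mul_add,
        Finset.mul_sum, Finset.sum_mul, Finset.sum_congr rfl fun a _ => hx a,
        Finset.sum_neg_distrib, neg_add, neg_neg]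
      simp only [mul_assoc]
    rw [hT, Finset.mul_sum, Finset.sum_congr rfl fun c _ => hc c, Finset.sum_sub_distrib,
      Finset.sum_add_distrib, Finset.sum_neg_distrib, Finset.sum_mul]
    simp only [Finset.mul_sum]
    rw [Finset.sum_comm (f := fun c a => xS b a 1 * _),
      Finset.sum_comm (f := fun c a => xS b a 0 * _)]
  -- the Casimir element appears when `∂_c` meets the coefficients of the coadjoint action
  have hcas : ∑ c, P (B.dualBasis hB b c) * cadS k g ι b (b c) = 0 := by
    refine LinearMap.ext fun ω => ?_
    simp only [hP, LinearMap.sum_apply, Module.End.mul_apply, LinearMap.smul_apply,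
      LinearMap.zero_apply]
    exact sum_pdY_cad b B hB hsymm hinv ω
  have hmx : ∀ (a : ι) (l : ℕ) (F : Module.End k (SlotForms k g ι)), mulP k g ι ((xS b a l * F) η) =
      cmap (LinearMap.mulLeft k (xi b a)) (mulP k g ι (F η)) := fun a l F => mulP_xS b a l _
  have hT0 : mulP k g ι ((T * totD b 0) η) = mulP k g ι ((T * totD b 1) η) := by
    have hx : ∀ c a, dS k ι (b c) 0 * (P (B.dualBasis hB b c) *
        ((xS b a 0 - xS b a 1) * cadS k g ι b (b a))) =
        (if c = a then P (B.dualBasis hB b c) * cadS k g ι b (b a) else 0) -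
          (xS b a 0 - xS b a 1) * (dS k ι (b c) 0 * (P (B.dualBasis hB b c) * cadS k g ι b (b a))) := by
      intro c a
      rw [← mul_assoc (P _), mul_sub, hPx, hPx, ← sub_mul, ← mul_assoc, ← mul_assoc, mul_sub, dS_xS,
        dS_xS, if_pos rfl, if_neg one_ne_zero, zero_smul, zero_sub, Module.Basis.coord_apply,
        Module.Basis.repr_self, Finsupp.single_apply]
      split_ifs with h
      · rw [one_smul]
        noncomm_ring
      · rw [zero_smul]
        noncomm_ring
    have hd : T * totD b 0 = T * totD b 1 + (∑ c, P (B.dualBasis hB b c) * cadS k g ι b (b c) -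
        ∑ c, ∑ a, (xS b a 0 - xS b a 1) *
          (dS k ι (b c) 0 * (P (B.dualBasis hB b c) * cadS k g ι b (b a)))) := by
      have h1 : totD b 0 = totD b 1 + ∑ a, (xS b a 0 - xS b a 1) * cadS k g ι b (b a) := by
        simp only [totD, sub_mul, Finset.sum_sub_distrib]
        abel
      rw [h1, mul_add, hT, Finset.sum_mul, Finset.sum_mul, ← Finset.sum_sub_distrib]
      congr 1
      refine Finset.sum_congr rfl fun c _ => ?_
      rw [mul_assoc, Finset.mul_sum, Finset.mul_sum, Finset.sum_congr rfl fun a _ => hx c a,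
        Finset.sum_sub_distrib, Finset.sum_ite_eq, if_pos (Finset.mem_univ c)]
    rw [hd, hcas, zero_sub, LinearMap.add_apply, map_add, LinearMap.neg_apply, map_neg]
    simp only [LinearMap.sum_apply, map_sum, sub_mul, LinearMap.sub_apply, map_sub, hmx, sub_self,
      Finset.sum_const_zero, neg_zero, add_zero]
  have h0 : restrS k g ι 0 (totD b 0 η) = totD b 0 η := by
    have e1 : restrS k g ι 0 * sD b = sD b * restrS k g ι 0 :=
      LinearMap.ext fun ω => slotForms_ext fun n => (slotD_restr b (· ≤ 0) _).symm
    have e2 : ∀ a, restrS k g ι 0 * xS b a 0 = xS b a 0 * restrS k g ι 0 := by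
      intro a
      refine LinearMap.ext fun ω => slotForms_ext fun n => ?_
      change restr (· ≤ 0) (gen 0 (b.coord a) * coeffS k g ι n ω) = gen 0 (b.coord a) * restr _ _
      rw [map_mul, restr_gen, if_pos le_rfl]
      rfl
    have e3 : ∀ z, restrS k g ι 0 * cadS k g ι b z = cadS k g ι b z * restrS k g ι 0 := fun z =>
      LinearMap.ext fun ω => cmap_cad b (restr (· ≤ 0)).toLinearMap z ω
    have e4 : restrS k g ι 0 * totD b 0 = totD b 0 * restrS k g ι 0 := by
      rw [totD, mul_add, add_mul, e1, Finset.mul_sum, Finset.sum_mul]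
      congr 1
      refine Finset.sum_congr rfl fun a _ => ?_
      rw [← mul_assoc, e2, mul_assoc, e3, mul_assoc]
    rw [← Module.End.mul_apply, e4, Module.End.mul_apply, hη]
  have hsum : ∀ a, ∑ c, dS k ι (b c) 0 * P ⁅b a, B.dualBasis hB b c⁆ =
      ∑ c, dS k ι ⁅b c, b a⁆ 0 * P (B.dualBasis hB b c) := by
    intro a
    simp only [hP]
    exact sum_dS_lie_pdS b B hB hsymm hinv (b a) 0
  rw [hbr η hη, ← mulP_totD b 1, ← mulP_totD b 0 η, hbr _ h0, ← Module.End.mul_apply, hTt,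
    ← Module.End.mul_apply T, hT0]
  simp only [LinearMap.sub_apply, LinearMap.add_apply, LinearMap.neg_apply, LinearMap.sum_apply,
    map_sub, map_add, map_neg, map_sum, hmx, hsum]
  rw [add_sub_cancel_right]

/-- The conjugated Brylinski operator anticommutes with the Chevalley–Eilenberg differential. -/
theorem formsD_twistedBrylinski (ω : Forms k g ι) :
    formsD b (twistedBrylinski b B hB ω) = -twistedBrylinski b B hB (formsD b ω) := by
  change formsD b (mulS (duflo b)⁻¹ (brylinski b B hB (mulS (duflo b) ω))) =
    -mulS (duflo b)⁻¹ (brylinski b B hB (mulS (duflo b) (formsD b ω)))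
  rw [formsD_mulS b _ (cad_duflo_inv b), formsD_brylinski b B hB hsymm hinv,
    formsD_mulS b _ (cad_duflo b), map_neg]

end DufloCharacter

/-! ### The homotopy between the two first-order deformations -/

section Homotopy

variable {k : Type*} [Field k] [CharZero k] {g : Type*} [LieRing g] [LieAlgebra k g]
  {ι : Type*} [Fintype ι] (b : Module.Basis ι k g)

omit [CharZero k] in
theorem isHomog_dY {m : ℕ} {ω : SlotForms k g ι} (h : IsHomog (R := Slots k g) m ω) (l : ℕ) :
    IsHomog (R := Slots k g) (1 + m) (dY k ι b l ω) := by
  rw [dY, dV, LinearMap.sum_apply]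
  refine isHomog_sum fun c _ => ?_
  rw [Module.End.mul_apply]
  exact isHomog_mulS (isHomog_X c) (isHomog_cmap h _)

omit [CharZero k] in
theorem isHomog_prodY : ∀ (i : ℕ) {m : ℕ} {ω : SlotForms k g ι},
    IsHomog (R := Slots k g) m ω → IsHomog (R := Slots k g) (i + m) (prodY k ι b i ω)
  | 0, m, ω, h => by rwa [zero_add]
  | i + 1, m, ω, h => by
    have h' := isHomog_prodY i (isHomog_dY b h (i + 1))
    rw [← add_assoc] at h'
    exact h'

omit [CharZero k] in
theorem isHomog_opQ {s : ℕ} {N : Matrix ι ι (MvPowerSeries ι k)} (hN : ∀ c d, IsHomog s (N c d))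
    {m : ℕ} {ω : SlotForms k g ι} (h : IsHomog (R := Slots k g) m ω) (j l : ℕ) :
    IsHomog (R := Slots k g) (s + m) (opQ b N j l ω) := by
  simp only [opQ, LinearMap.sum_apply]
  refine isHomog_sum fun c _ => isHomog_sum fun d _ => ?_
  rw [Module.End.mul_apply, Module.End.mul_apply]
  exact isHomog_mulS (hN c d) (isHomog_cmap (isHomog_cmap h (dslot (b d) l)) (dslot (b c) j))

omit [CharZero k] in
theorem isHomog_hkrS (i : ℕ) (x : Slots k g) : IsHomog i (hkrS (ι := ι) b i x) :=
  isHomog_smul (isHomog_cmap (isHomog_prodY b i (isHomog_cst x)) slotProd.toLinearMap) _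

omit [CharZero k] in
/-- Tensors with a factor `1` in the slot `j` are killed by the derivative in that slot, hence by
the product of the derivatives in the slots `1, …, m`. -/
theorem prodY_eq_zero {j : ℕ} (hj : j ≠ 0) : ∀ {m : ℕ} {ω : SlotForms k g ι}, j ≤ m →
    (∀ x, dS k ι x j ω = 0) → prodY k ι b m ω = 0
  | 0, _, h, _ => absurd (Nat.le_zero.1 h) hj
  | m + 1, ω, h, hω => by
    rw [prodY, Module.End.mul_apply]
    rcases h.lt_or_eq with h' | rfl
    · refine prodY_eq_zero hj (Nat.le_of_lt_succ h') fun x => ?_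
      have := LinearMap.congr_fun (dS_dY (k := k) (ι := ι) b x (m + 1) j) ω
      rw [Module.End.mul_apply, hω, map_zero, LinearMap.neg_apply, Module.End.mul_apply] at this
      exact neg_eq_zero.1 this.symm
    · rw [dY, dV, LinearMap.sum_apply, Finset.sum_eq_zero, map_zero]
      intro c _
      rw [Module.End.mul_apply, hω, map_zero]

omit [CharZero k] in
theorem prodY_cstS_degenerate {i : ℕ} {a : Fin (i + 1) → Ch k g} {j : Fin (i + 1)} (hj : j ≠ 0)
    (ha : a j = 1) :
    prodY k ι b i (cstS k g ι (toSlots i (PiTensorProduct.tprod k a))) = 0 := by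
  refine prodY_eq_zero b (Fin.val_ne_zero_iff.2 hj) (Nat.le_of_lt_succ j.isLt) fun x => ?_
  refine (cmap_cst (dslot x j) _).trans ?_
  suffices h : dslot x j (toSlots i (PiTensorProduct.tprod k a)) = 0 from
    (congrArg (cstS k g ι) h).trans (map_zero _)
  rw [toSlots_tprod]
  refine dslot_prod_eq_zero x j _ fun r => ?_
  rw [dslot_slot]
  split_ifs with h
  · rw [Fin.ext h, ha]
    exact (congrArg (slot (j : ℕ)) (CliffordAlgebra.contractLeft_one _ _)).trans (map_zero _)
  · rfl

/-- The Hochschild–Kostant–Rosenberg map on `A ⊗ (A/k)^{⊗ i}`. -/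
def hkrN (i : ℕ) : NTens k (Ch k g) i →ₗ[k] Forms k g ι :=
  (degenerate k (Ch k g) i).liftQ (hkrTens b i) (hkrTens_degenerate b i)

omit [CharZero k] in
theorem hkrN_mk (i : ℕ) (t : Tens k (Ch k g) i) :
    hkrN b i (Submodule.Quotient.mk t) = hkrS b i (toSlots i t) :=
  (Submodule.liftQ_apply _ _ _).trans (hkrTens_eq b i t)

omit [CharZero k] in
theorem isHomog_hkrN (i : ℕ) (x : NTens k (Ch k g) i) : IsHomog i (hkrN b i x) := by
  obtain ⟨t, rfl⟩ := Submodule.Quotient.mk_surjective _ x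
  rw [hkrN_mk]
  exact isHomog_hkrS b i _

omit [CharZero k] in
theorem homog_hkr (m : ℕ) (c : Chains k (Ch k g)) : homog (k := k) m (hkr b c) = hkrN b m (c m) := by
  refine MvPowerSeries.ext fun n => ?_
  rw [coeff_homog]
  split_ifs with h
  · subst h
    rfl
  · exact (isHomog_hkrN b m (c m) n h).symm

/-- Each tautological derivative occurs with opposite signs for the two faces that merge its slot. -/
theorem hkrS_slotB (m : ℕ) (y : Slots k g) : hkrS (ι := ι) b m (slotB m y) = 0 := by
  rw [hkrS_apply, slotB_apply, map_sum, map_sum, map_sum, smul_eq_zero]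
  right
  have e : ∀ p ∈ Finset.range (m + 2), mulP k g ι (prodY k ι b m (cstS k g ι
      ((-1 : k) ^ p • relabel (faceIdx m p) y))) = (-1 : k) ^ p •
      ((if p = 0 then 0 else mulP k g ι (prodYdel k ι b (m + 1) p (cstS k g ι y))) +
        if p = m + 1 then 0 else mulP k g ι (prodYdel k ι b (m + 1) (p + 1) (cstS k g ι y))) := by
    intro p hp
    rw [Finset.mem_range] at hp
    rw [map_smul, map_smul, map_smul, ← relS_cstS, ← Module.End.mul_apply,
      prodY_relS b m p (by omega), Module.End.mul_apply, mulP_relS, LinearMap.add_apply, map_add]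
    congr 2 <;> split_ifs <;> simp only [LinearMap.zero_apply, map_zero]
  rw [Finset.sum_congr rfl e, sum_faces_by_parts m fun _ q =>
    mulP k g ι (prodYdel k ι b (m + 1) q (cstS k g ι y))]
  simp only [sub_self, smul_zero, Finset.sum_const_zero]

theorem hkrN_nB (m : ℕ) (x : NTens k (Ch k g) (m + 1)) : hkrN (ι := ι) b m (nB m x) = 0 := by
  obtain ⟨t, rfl⟩ := Submodule.Quotient.mk_surjective _ x
  rw [nB, Submodule.mapQ_apply, hkrN_mk, toSlots_hochB, hkrS_slotB]

variable [DecidableEq ι]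

theorem formsD_hkrN (m : ℕ) (x : NTens k (Ch k g) m) :
    formsD b (hkrN b m x) = (-1 : k) ^ m • hkrN b m (nD b m x) := by
  obtain ⟨t, rfl⟩ := Submodule.Quotient.mk_surjective _ x
  rw [nD, Submodule.mapQ_apply, hkrN_mk, hkrN_mk, toSlots_tensD, hkrS_apply, hkrS_apply, map_smul,
    mulP_totD_prodY, smul_comm]

/-- The Hochschild–Kostant–Rosenberg map is a chain map. -/
theorem formsD_hkr (c : Chains k (Ch k g)) : formsD b (hkr b c) = hkr b (hochD b c) := by
  refine ext_homog (k := k) fun m => ?_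
  rw [homog_formsD, homog_hkr, homog_hkr, formsD_hkrN, hochD_apply, map_add, map_smul, hkrN_nB,
    zero_add]

variable (B : LinearMap.BilinForm k g) (hB : B.Nondegenerate)

theorem isHomog_homS (s i : ℕ) (x : Slots k g) : IsHomog (s + i) (homS b B hB s i x) := by
  have hN : ∀ c d, IsHomog s (bivec b B hB s c d) := by
    intro c d
    simp only [bivec, Matrix.mul_apply, gramMatrix, Matrix.of_apply]
    refine isHomog_sum fun e _ => ?_
    rw [← Algebra.commutes, ← Algebra.smul_def]
    exact isHomog_smul (isHomog_adMatrix_pow b s c e) _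
  rw [homS_apply]
  refine isHomog_smul (isHomog_cmap ?_ _) _
  simp only [opG, LinearMap.smul_apply, LinearMap.sum_apply]
  refine isHomog_smul (isHomog_sum fun j _ => isHomog_sum fun l _ => ?_) _
  refine isHomog_smul (isHomog_opQ b hN ?_ j l) _
  exact isHomog_prodY b i (isHomog_cst x)

/-- The part of the homotopy of polynomial degree `s` on `A ⊗ (A/k)^{⊗ i}`. -/
def homN (s i : ℕ) : NTens k (Ch k g) i →ₗ[k] Forms k g ι :=
  (degenerate k (Ch k g) i).liftQ (homS b B hB s i ∘ₗ toSlots i) <| by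
    refine Submodule.span_le.2 ?_
    rintro _ ⟨a, ⟨j, hj, ha⟩, rfl⟩
    change homS b B hB s i (toSlots i (PiTensorProduct.tprod k a)) = 0
    rw [homS_apply, prodY_cstS_degenerate b hj ha, map_zero, map_zero, smul_zero]

theorem homN_mk (s i : ℕ) (t : Tens k (Ch k g) i) :
    homN b B hB s i (Submodule.Quotient.mk t) = homS b B hB s i (toSlots i t) :=
  Submodule.liftQ_apply _ _ _

theorem isHomog_homN (s i : ℕ) (x : NTens k (Ch k g) i) : IsHomog (s + i) (homN b B hB s i x) := by
  obtain ⟨t, rfl⟩ := Submodule.Quotient.mk_surjective _ x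
  rw [homN_mk]
  exact isHomog_homS b B hB s i _

/-- The homotopy between `Φ ∘ d_0` and `j^{-1/2} ∘ d_Br ∘ j^{1/2} ∘ Φ`. -/
def homotopyH : Chains k (Ch k g) →ₗ[k] Forms k g ι where
  toFun c := fun n => MvPowerSeries.coeff n
    (∑ p ∈ Finset.HasAntidiagonal.antidiagonal n.degree, homN b B hB p.1 p.2 (c p.2))
  map_add' c c' := by
    funext n
    simp only [Pi.add_apply, map_add, Finset.sum_add_distrib]
    rfl
  map_smul' r c := by
    funext n
    simp only [Pi.smul_apply, map_smul, ← Finset.smul_sum]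
    rfl

theorem homog_homotopyH (m : ℕ) (c : Chains k (Ch k g)) : homog (k := k) m (homotopyH b B hB c) =
    ∑ p ∈ Finset.HasAntidiagonal.antidiagonal m, homN b B hB p.1 p.2 (c p.2) := by
  refine MvPowerSeries.ext fun n => ?_
  rw [coeff_homog]
  split_ifs with h
  · subst h
    rfl
  · rw [map_sum]
    refine (Finset.sum_eq_zero fun p hp => ?_).symm
    rw [Finset.HasAntidiagonal.mem_antidiagonal] at hp
    exact isHomog_homN b B hB p.1 p.2 _ n (by rwa [hp])

/-- The Hochschild operator of half the Poisson bracket on normalized chains. -/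
def nBr (i : ℕ) : NTens k (Ch k g) (i + 1) →ₗ[k] NTens k (Ch k g) i :=
  Submodule.mapQ _ _ (hochB (parity k g) ((2⁻¹ : k) • poisson b B hB) i)
    (hochB_degenerate _ _ (poisson_unit b B hB) i)

theorem hochD0_apply (c : Chains k (Ch k g)) (i : ℕ) :
    hochD0 b B hB c i = nBr b B hB i (c (i + 1)) := rfl

variable (hsymm : B.IsSymm) (hinv : ∀ x y z : g, B ⁅x, y⁆ z = B x ⁅y, z⁆)

include hsymm in
theorem homN_nB (m : ℕ) (x : NTens k (Ch k g) (m + 1)) : homN b B hB 0 m (nB m x) =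
    brylinski b B hB (hkrN b (m + 1) x) - hkrN b m (nBr b B hB m x) := by
  obtain ⟨t, rfl⟩ := Submodule.Quotient.mk_surjective _ x
  rw [nB, nBr, Submodule.mapQ_apply, Submodule.mapQ_apply, homN_mk, hkrN_mk, hkrN_mk,
    toSlots_hochB, toSlots_hochB_poisson]
  exact homS_slotB b B hB hsymm m (restr_toSlots (m + 1) t)

include hsymm hinv

theorem formsD_homN_succ (s m : ℕ) (x : NTens k (Ch k g) (m + 1)) :
    formsD b (homN b B hB s (m + 1) x) = (-1 : k) ^ (m + 1) • homN b B hB s (m + 1) (nD b (m + 1) x) +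
      homN b B hB (s + 1) m (nB m x) - vecD b (dufloVec b B hB s) (hkrN b (m + 1) x) := by
  obtain ⟨t, rfl⟩ := Submodule.Quotient.mk_surjective _ x
  rw [nB, nD, Submodule.mapQ_apply, Submodule.mapQ_apply, homN_mk, homN_mk, homN_mk, hkrN_mk,
    toSlots_hochB, toSlots_tensD]
  exact formsD_homS_succ b B hB hsymm hinv s m (restr_toSlots (m + 1) t)

theorem formsD_homN_zero (s : ℕ) (x : NTens k (Ch k g) 0) :
    formsD b (homN b B hB s 0 x) = homN b B hB s 0 (nD b 0 x) -
      vecD b (dufloVec b B hB s) (hkrN b 0 x) := by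
  obtain ⟨t, rfl⟩ := Submodule.Quotient.mk_surjective _ x
  rw [nD, Submodule.mapQ_apply, homN_mk, homN_mk, hkrN_mk, toSlots_tensD]
  exact formsD_homS_zero b B hB hsymm hinv s (restr_toSlots 0 t)

theorem homog_twistedBrylinski (m : ℕ) (ω : Forms k g ι) :
    homog (k := k) m (twistedBrylinski b B hB ω) = brylinski b B hB (homog (k := k) (m + 1) ω) +
      ∑ p ∈ Finset.HasAntidiagonal.antidiagonal m,
        vecD b (dufloVec b B hB p.1) (homog (k := k) p.2 ω) := by
  have h1 : homog (k := k) m (brylinski b B hB ω) =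
      brylinski b B hB (homog (k := k) (m + 1) ω) := by
    simp only [brylinski, partialYVec, LinearMap.sum_apply, LinearMap.comp_apply,
      LinearMap.smul_apply, map_sum, map_smul]
    refine Finset.sum_congr rfl fun c _ => Finset.sum_congr rfl fun r _ => congrArg _ ?_
    exact (homog_cmap m (partialXi (b c)) (pdY k r ω)).trans
      (congrArg (cmap (partialXi (b c))) (homog_pdY m r ω))
  rw [twistedBrylinski_apply, map_add, h1]
  congr 1
  simp only [vecD, LinearMap.sum_apply, LinearMap.comp_apply, map_sum, homog_mulS,
    homog_gradDuflo b B hB hsymm hinv, homog_cmap]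
  exact Finset.sum_comm

/-- The operators `Φ ∘ d_0` and `j^{-1/2} ∘ d_Br ∘ j^{1/2} ∘ Φ` differ by the commutator of the
homotopy with the differentials. -/
theorem hkr_hochD0_sub (c : Chains k (Ch k g)) :
    hkr b (hochD0 b B hB c) - twistedBrylinski b B hB (hkr b c) =
      formsD b (homotopyH b B hB c) - homotopyH b B hB (hochD b c) := by
  refine ext_homog (k := k) fun m => ?_
  rw [map_sub, map_sub, homog_formsD, homog_homotopyH, homog_homotopyH, homog_hkr, hochD0_apply,
    homog_twistedBrylinski b B hB hsymm hinv, map_sum]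
  simp only [homog_hkr, hochD_apply, map_add, map_smul, Finset.sum_add_distrib]
  have h0 := homN_nB b B hB hsymm m (c (m + 1))
  have key : ∑ p ∈ Finset.HasAntidiagonal.antidiagonal m, formsD b (homN b B hB p.1 p.2 (c p.2)) +
      ∑ p ∈ Finset.HasAntidiagonal.antidiagonal m,
        vecD b (dufloVec b B hB p.1) (hkrN b p.2 (c p.2)) + homN b B hB 0 m (nB m (c (m + 1))) =
      ∑ p ∈ Finset.HasAntidiagonal.antidiagonal m, homN b B hB p.1 p.2 (nB p.2 (c (p.2 + 1))) +
      ∑ p ∈ Finset.HasAntidiagonal.antidiagonal m,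
        (-1 : k) ^ p.2 • homN b B hB p.1 p.2 (nD b p.2 (c p.2)) := by
    cases m with
    | zero =>
      simp only [Finset.Nat.antidiagonal_zero, Finset.sum_singleton,
        formsD_homN_zero b B hB hsymm hinv, pow_zero, one_smul]
      abel
    | succ m =>
      rw [Finset.Nat.sum_antidiagonal_succ' (f := fun p => formsD b (homN b B hB p.1 p.2 (c p.2))),
        Finset.Nat.sum_antidiagonal_succ' (f := fun p =>
          vecD b (dufloVec b B hB p.1) (hkrN b p.2 (c p.2))),
        Finset.Nat.sum_antidiagonal_succ' (f := fun p =>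
          (-1 : k) ^ p.2 • homN b B hB p.1 p.2 (nD b p.2 (c p.2))),
        Finset.Nat.sum_antidiagonal_succ (f := fun p =>
          homN b B hB p.1 p.2 (nB p.2 (c (p.2 + 1))))]
      simp only [formsD_homN_zero b B hB hsymm hinv, formsD_homN_succ b B hB hsymm hinv,
        Finset.sum_add_distrib, Finset.sum_sub_distrib, pow_zero, one_smul]
      abel
  rw [eq_sub_iff_add_eq.2 (eq_sub_iff_add_eq.2 key), h0]
  abel

end Homotopy

/-! ### Exactness of one-sided bar complexes -/

section BarExact

variable {k : Type*} [Field k] [CharZero k] {g : Type*} [LieRing g] [LieAlgebra k g]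

theorem restr_congr {s t : ℕ → Prop} [DecidablePred s] [DecidablePred t] (h : ∀ l, s l ↔ t l)
    (x : Slots k g) : restr s x = restr t x := by
  refine DFunLike.congr_fun (f := restr s) (g := restr t) (slotsAlgHom_ext fun l v => ?_) x
  simp only [restr_gen, h]

theorem restr_of_imp {s t : ℕ → Prop} [DecidablePred s] [DecidablePred t] (h : ∀ l, s l → t l)
    (x : Slots k g) : restr s (restr t x) = restr s x := by
  rw [restr_restr]
  exact restr_congr (fun l => ⟨And.left, fun hl => ⟨hl, h l hl⟩⟩) x

theorem restr_of_imp' {s t : ℕ → Prop} [DecidablePred s] [DecidablePred t] (h : ∀ l, t l → s l)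
    (x : Slots k g) : restr s (restr t x) = restr t x := by
  rw [restr_restr]
  exact restr_congr (fun l => ⟨And.right, fun hl => ⟨h l hl, hl⟩⟩) x

theorem restr_relabel (s : ℕ → Prop) [DecidablePred s] (θ : ℕ → ℕ) (x : Slots k g) :
    restr s (relabel θ x) = relabel θ (restr (fun l => s (θ l)) x) := by
  refine DFunLike.congr_fun (f := (restr s).comp (relabel θ))
    (g := (relabel θ).comp (restr fun l => s (θ l))) (slotsAlgHom_ext fun l v => ?_) x
  simp only [AlgHom.comp_apply, relabel_gen, restr_gen]
  split_ifs
  · rw [relabel_gen]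
  · rw [map_zero]

/-- The map of slots that merges the slots `p` and `p + 1`. -/
def mergeIdx (p l : ℕ) : ℕ := if l ≤ p then l else l - 1

/-- The differential of the bar complex of a module, on elements that are normalized in all the
slots except `0`. The slot `0` contains the module and the slots `1, …, i + 1` the bar
construction; the slot after these is a coefficient algebra that takes no part. The last face
of the bar construction vanishes on normalized elements, and is left out. -/
def modB (i : ℕ) : Slots k g →ₗ[k] Slots k g :=
  ∑ p ∈ Finset.range (i + 1), (-1 : k) ^ p • (relabel (mergeIdx p)).toLinearMap

theorem modB_apply (i : ℕ) (x : Slots k g) :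
    modB i x = ∑ p ∈ Finset.range (i + 1), (-1 : k) ^ p • relabel (mergeIdx p) x := by
  simp only [modB, LinearMap.sum_apply, LinearMap.smul_apply, AlgHom.toLinearMap_apply]

theorem modB_modB (i : ℕ) (x : Slots k g) : modB i (modB (i + 1) x) = 0 := by
  simp only [modB_apply, map_sum, map_smul, Finset.smul_sum, smul_smul, ← pow_add,
    relabel_relabel]
  have h := sum_faces_eq_zero (k := k) (P := Slots k g) (i + 1)
    (fun p q => relabel (mergeIdx p ∘ mergeIdx q) x)
    fun p q hpq hq => by
      congr 2
      funext l
      simp only [Function.comp_apply, mergeIdx]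
      grind
  rw [Finset.sum_comm]
  refine Eq.trans (Finset.sum_congr rfl fun p _ => Finset.sum_congr rfl fun q _ => ?_) h
  rw [add_comm q p]

/-- Elements with slots `0, …, i + 1` that are normalized in the slots `1, …, i`: they vanish when one
of these slots is killed. -/
structure IsNormal (i : ℕ) (x : Slots k g) : Prop where
  supp : restr (· ≤ i + 1) x = x
  kill : ∀ l, 1 ≤ l → l ≤ i → restr (· ≠ l) x = 0

theorem IsNormal.restr_eq_zero {i : ℕ} {x : Slots k g} (hx : IsNormal i x) {s : ℕ → Prop}
    [DecidablePred s] {l : ℕ} (h1 : 1 ≤ l) (h2 : l ≤ i) (hl : ¬ s l) : restr s x = 0 := by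
  rw [← restr_of_imp (s := s) (t := (· ≠ l)) (fun r hr h => hl (h ▸ hr)) x, hx.kill l h1 h2, map_zero]

theorem isNormal_relabel_merge {m : ℕ} {x : Slots k g} (hx : IsNormal (m + 1) x) {p : ℕ} (hp : p ≤ m) :
    IsNormal m (relabel (mergeIdx p) x) where
  supp := by
    rw [restr_relabel]
    congr 1
    nth_rewrite 1 [← hx.supp]
    rw [restr_of_imp', hx.supp]
    intro l hl
    simp only [mergeIdx]
    split_ifs <;> omega
  kill l h1 h2 := by
    rw [restr_relabel, hx.restr_eq_zero (l := if l ≤ p then l else l + 1), map_zero]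
    · split_ifs <;> omega
    · split_ifs <;> omega
    · simp only [mergeIdx]
      split_ifs <;> omega

theorem IsNormal.add {m : ℕ} {x y : Slots k g} (hx : IsNormal m x) (hy : IsNormal m y) :
    IsNormal m (x + y) :=
  ⟨by rw [map_add, hx.supp, hy.supp], fun l h1 h2 => by rw [map_add, hx.kill l h1 h2,
    hy.kill l h1 h2, add_zero]⟩

theorem IsNormal.smul {m : ℕ} {x : Slots k g} (hx : IsNormal m x) (c : k) : IsNormal m (c • x) :=
  ⟨by rw [map_smul, hx.supp], fun l h1 h2 => by rw [map_smul, hx.kill l h1 h2, smul_zero]⟩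

theorem IsNormal.sub {m : ℕ} {x y : Slots k g} (hx : IsNormal m x) (hy : IsNormal m y) :
    IsNormal m (x - y) :=
  ⟨by rw [map_sub, hx.supp, hy.supp], fun l h1 h2 => by rw [map_sub, hx.kill l h1 h2,
    hy.kill l h1 h2, sub_zero]⟩

theorem isNormal_zero (m : ℕ) : IsNormal m (0 : Slots k g) :=
  ⟨map_zero _, fun _ _ _ => map_zero _⟩

theorem isNormal_sum {m : ℕ} {α : Type*} {s : Finset α} {f : α → Slots k g}
    (h : ∀ a ∈ s, IsNormal m (f a)) : IsNormal m (∑ a ∈ s, f a) := by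
  classical
  induction s using Finset.induction_on with
  | empty => exact isNormal_zero m
  | insert a s ha ih =>
    rw [Finset.sum_insert ha]
    exact (h a (Finset.mem_insert_self a s)).add (ih fun c hc => h c (Finset.mem_insert_of_mem hc))

theorem isNormal_modB {m : ℕ} {x : Slots k g} (hx : IsNormal (m + 1) x) : IsNormal m (modB m x) := by
  rw [modB_apply]
  refine isNormal_sum fun p hp => (isNormal_relabel_merge hx ?_).smul _
  rw [Finset.mem_range] at hp
  omega

theorem isNormal_gen_mul {m : ℕ} {x : Slots k g} (hx : IsNormal m x) (v : Module.Dual k g) :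
    IsNormal m (gen 0 v * x) where
  supp := by rw [map_mul, hx.supp, restr_gen, if_pos (Nat.zero_le _)]
  kill l h1 h2 := by rw [map_mul, hx.kill l h1 h2, mul_zero]

theorem isNormal_dslot {m : ℕ} {x : Slots k g} (hx : IsNormal m x) (z : g) :
    IsNormal m (dslot z 0 x) where
  supp := by
    have := dslot_restr (· ≤ m + 1) z 0 x
    rwa [hx.supp, if_pos (Nat.zero_le _), eq_comm] at this
  kill l h1 h2 := by
    have := dslot_restr (· ≠ l) z 0 x
    rwa [hx.kill l h1 h2, map_zero, if_pos (by omega), eq_comm] at this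

theorem isNormal_kill_zero {m : ℕ} {x : Slots k g} (hx : IsNormal m x) :
    IsNormal m (restr (· ≠ 0) x) where
  supp := by
    rw [restr_restr, ← restr_congr (s := fun l => l ≠ 0 ∧ l ≤ m + 1) (fun l => and_comm),
      ← restr_restr, hx.supp]
  kill l h1 h2 := by
    rw [restr_restr]
    exact hx.restr_eq_zero h1 h2 fun h => h.1 rfl

theorem isNormal_relabel_succ {m : ℕ} {x : Slots k g} (hx : IsNormal m x)
    (h0 : restr (· ≠ 0) x = 0) : IsNormal (m + 1) (relabel Nat.succ x) where
  supp := by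
    rw [restr_relabel]
    congr 1
    rw [← restr_congr (s := (· ≤ m + 1)) (fun l => Nat.succ_le_succ_iff.symm), hx.supp]
  kill l h1 h2 := by
    rw [restr_relabel]
    obtain ⟨r, rfl⟩ := Nat.exists_eq_add_of_le' h1
    rcases Nat.eq_zero_or_pos r with rfl | hr
    · rw [← restr_congr (s := (· ≠ 0)) (fun l => Nat.succ_ne_succ_iff.symm), h0, map_zero]
    · rw [hx.restr_eq_zero hr (by omega) (fun h => h rfl), map_zero]

/-- Moving the module into the bar construction is a contracting homotopy of the bar complex, the
extra degeneracy. -/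
theorem modB_relabel_succ (m : ℕ) (x : Slots k g) :
    modB (m + 1) (relabel Nat.succ x) = x - relabel Nat.succ (modB m x) := by
  have h0 : relabel (mergeIdx 0) (relabel Nat.succ x) = x := by
    rw [relabel_relabel]
    refine DFunLike.congr_fun (f := relabel (mergeIdx 0 ∘ Nat.succ)) (g := AlgHom.id k _)
      (slotsAlgHom_ext fun l v => ?_) x
    simp [relabel_gen, mergeIdx]
  rw [modB_apply, modB_apply, Finset.sum_range_succ', pow_zero, one_smul, h0, map_sum, add_comm,
    sub_eq_add_neg, ← Finset.sum_neg_distrib]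
  congr 1
  refine Finset.sum_congr rfl fun p _ => ?_
  rw [relabel_relabel, map_smul, relabel_relabel, pow_succ, mul_neg_one, neg_smul]
  congr 3
  congr 1
  funext l
  simp only [Function.comp_apply, mergeIdx]
  split_ifs <;> omega

/-- The bar complex of the free module of rank one is exact. -/
theorem modB_exact_free {m : ℕ} {x : Slots k g} (hx : IsNormal (m + 1) x) (h : modB m x = 0) :
    ∃ y, IsNormal (m + 2) y ∧ x = modB (m + 1) y := by
  have hk : ∀ z : Slots k g, restr (· ≠ 0) (restr (· ≠ 0) z) = restr (· ≠ 0) z :=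
    fun z => restr_of_imp (fun _ h => h) z
  have h0 : relabel Nat.succ (relabel (mergeIdx 0) (restr (· ≠ 0) x)) = restr (· ≠ 0) x := by
    rw [relabel_relabel]
    refine DFunLike.congr_fun (f := (relabel (Nat.succ ∘ mergeIdx 0)).comp (restr (· ≠ 0)))
      (g := restr (· ≠ 0)) (slotsAlgHom_ext fun l v => ?_) x
    simp only [AlgHom.comp_apply, restr_gen]
    split_ifs with hl
    · rw [relabel_gen]
      congr 1
      simp only [Function.comp_apply, mergeIdx, Nat.le_zero, if_neg hl]
      omega
    · rw [map_zero]
  -- Only the face that multiplies slot `1` into the module survives on `restr (· ≠ 0) x`.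
  have h1 : modB m (restr (· ≠ 0) x) = relabel (mergeIdx 0) (restr (· ≠ 0) x) := by
    have h2 : ∀ p, relabel (mergeIdx (p + 1)) (restr (· ≠ 0) x) =
        restr (· ≠ 0) (relabel (mergeIdx (p + 1)) x) := by
      intro p
      rw [restr_relabel]
      congr 1
      refine restr_congr (fun l => ?_) x
      simp only [mergeIdx]
      split_ifs <;> omega
    have h3 : restr (· ≠ 0) (relabel (mergeIdx 0) x) = 0 := by
      rw [restr_relabel, hx.restr_eq_zero le_rfl (Nat.le_add_left 1 m), map_zero]
      simp [mergeIdx]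
    have h4 := congrArg (restr (k := k) (g := g) (· ≠ 0)) h
    rw [modB_apply, map_sum, Finset.sum_range_succ', map_smul, h3, smul_zero, add_zero,
      map_zero] at h4
    rw [modB_apply, Finset.sum_range_succ', pow_zero, one_smul]
    simp only [map_smul] at h4
    simp only [h2, h4, zero_add]
  refine ⟨relabel Nat.succ (x - restr (· ≠ 0) x),
    isNormal_relabel_succ (hx.sub (isNormal_kill_zero hx)) ?_, ?_⟩
  · rw [map_sub, hk, sub_self]
  · rw [modB_relabel_succ, map_sub, h, h1, zero_sub, map_neg, h0]
    abel

theorem modB_exact_zero {x : Slots k g} (hx : IsNormal 0 x) (h : restr (· ≠ 0) x = 0) :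
    ∃ y, IsNormal 1 y ∧ x = modB 0 y := by
  refine ⟨relabel Nat.succ x, isNormal_relabel_succ hx h, ?_⟩
  rw [modB_apply, Finset.sum_range_one, pow_zero, one_smul, relabel_relabel]
  refine DFunLike.congr_fun (f := AlgHom.id k _) (g := relabel (mergeIdx 0 ∘ Nat.succ))
    (slotsAlgHom_ext fun l v => ?_) x
  simp [relabel_gen, mergeIdx]

end BarExact

/-! ### Exactness for quotients of the free module by variables -/

section QuotientExact

variable {k : Type*} [Field k] [CharZero k] {g : Type*} [LieRing g] [LieAlgebra k g]
  {ι : Type*} [Fintype ι] [DecidableEq ι] (b : Module.Basis ι k g)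

/-- The projection of the dual space that kills the coordinates in `s`. -/
def coordProj (s : Finset ι) : Module.Dual k g →ₗ[k] Module.Dual k g :=
  LinearMap.id - ∑ c ∈ s, (Module.Dual.eval k g (b c)).smulRight (b.coord c)

theorem coordProj_apply (s : Finset ι) (v : Module.Dual k g) :
    coordProj b s v = v - ∑ c ∈ s, v (b c) • b.coord c := by
  simp [coordProj, LinearMap.sum_apply]

theorem coordProj_coord (s : Finset ι) (a : ι) :
    coordProj b s (b.coord a) = if a ∈ s then 0 else b.coord a := by
  rw [coordProj_apply]
  have h : ∀ c, b.coord a (b c) = if c = a then 1 else 0 := by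
    intro c
    rw [Module.Basis.coord_apply, Module.Basis.repr_self, Finsupp.single_apply]
  simp only [h, ite_smul, one_smul, zero_smul, Finset.sum_ite_eq']
  split_ifs
  · exact sub_self _
  · exact sub_zero _

theorem coordProj_coordProj (s : Finset ι) (v : Module.Dual k g) :
    coordProj b s (coordProj b s v) = coordProj b s v := by
  nth_rewrite 2 [coordProj_apply]
  rw [map_sub, map_sum, Finset.sum_eq_zero, sub_zero]
  intro c hc
  rw [map_smul, coordProj_coord, if_pos hc, smul_zero]

theorem coordProj_insert {s : Finset ι} {a : ι} (ha : a ∉ s) (v : Module.Dual k g) :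
    coordProj b (insert a s) v = coordProj b s v - v (b a) • b.coord a := by
  rw [coordProj_apply, coordProj_apply, Finset.sum_insert ha]
  abel

theorem coordProj_apply_of_notMem {s : Finset ι} {a : ι} (ha : a ∉ s) (v : Module.Dual k g) :
    coordProj b s v (b a) = v (b a) := by
  rw [coordProj_apply, LinearMap.sub_apply, LinearMap.sum_apply, Finset.sum_eq_zero, sub_zero]
  intro c hc
  rw [LinearMap.smul_apply, Module.Basis.coord_apply, Module.Basis.repr_self,
    Finsupp.single_eq_of_ne (fun h : c = a => ha (h ▸ hc)), smul_zero]

theorem coordProj_univ (v : Module.Dual k g) : coordProj b Finset.univ v = 0 := by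
  rw [coordProj_apply, sub_eq_zero]
  refine b.ext fun a => ?_
  rw [LinearMap.sum_apply, Finset.sum_eq_single a]
  · simp
  · intro c _ hc
    simp [hc.symm]
  · simp

/-- The quotient of the module in slot `0` by the variables in `s`, realized by killing these
variables. -/
def modQuot (s : Finset ι) : Slots k g →ₐ[k] Slots k g :=
  ExteriorAlgebra.map (Finsupp.lsum k fun l =>
    Finsupp.lsingle l ∘ₗ if l = 0 then coordProj b s else LinearMap.id)

theorem modQuot_gen (s : Finset ι) (l : ℕ) (v : Module.Dual k g) :
    modQuot b s (gen l v) = gen l (if l = 0 then coordProj b s v else v) := by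
  rw [modQuot, gen, ExteriorAlgebra.map_apply_ι]
  split_ifs with h <;> simp [h, gen]

theorem modQuot_gen_zero (s : Finset ι) (v : Module.Dual k g) :
    modQuot b s (gen 0 v) = gen 0 (coordProj b s v) := by
  rw [modQuot_gen, if_pos rfl]

theorem modQuot_empty (x : Slots k g) : modQuot b ∅ x = x := by
  refine DFunLike.congr_fun (f := modQuot b ∅) (g := AlgHom.id k _)
    (slotsAlgHom_ext fun l v => ?_) x
  rw [modQuot_gen, coordProj_apply, Finset.sum_empty, sub_zero, ite_self]
  rfl

theorem modQuot_univ (x : Slots k g) : modQuot b Finset.univ x = restr (· ≠ 0) x := by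
  refine DFunLike.congr_fun (f := modQuot b Finset.univ) (g := restr (· ≠ 0))
    (slotsAlgHom_ext fun l v => ?_) x
  rw [modQuot_gen, restr_gen, coordProj_univ]
  by_cases h : l = 0
  · rw [if_pos h, if_neg (not_not.2 h), gen, Finsupp.single_zero, map_zero]
  · rw [if_neg h, if_pos h]

theorem modQuot_relabel (s : Finset ι) {θ : ℕ → ℕ} (h0 : ∀ l, θ l = 0 ↔ l = 0) (x : Slots k g) :
    modQuot b s (relabel θ x) = relabel θ (modQuot b s x) := by
  refine DFunLike.congr_fun (f := (modQuot b s).comp (relabel θ))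
    (g := (relabel θ).comp (modQuot b s)) (slotsAlgHom_ext fun l v => ?_) x
  simp only [AlgHom.comp_apply, relabel_gen, modQuot_gen, h0]

theorem modQuot_relabel_modQuot (s : Finset ι) {θ : ℕ → ℕ} (h0 : θ 0 = 0) (x : Slots k g) :
    modQuot b s (relabel θ (modQuot b s x)) = modQuot b s (relabel θ x) := by
  refine DFunLike.congr_fun (f := ((modQuot b s).comp (relabel θ)).comp (modQuot b s))
    (g := (modQuot b s).comp (relabel θ)) (slotsAlgHom_ext fun l v => ?_) x
  simp only [AlgHom.comp_apply, relabel_gen, modQuot_gen]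
  by_cases h : l = 0
  · subst h
    rw [if_pos rfl, h0, if_pos rfl, if_pos rfl, coordProj_coordProj]
  · rw [if_neg h]

theorem modQuot_modB_modQuot (s : Finset ι) (m : ℕ) (x : Slots k g) :
    modQuot b s (modB m (modQuot b s x)) = modQuot b s (modB m x) := by
  simp only [modB_apply, map_sum, map_smul]
  exact Finset.sum_congr rfl fun p _ => congrArg _ (modQuot_relabel_modQuot b s (by simp [mergeIdx]) x)

theorem modQuot_restr (s : Finset ι) (t : ℕ → Prop) [DecidablePred t] (x : Slots k g) :
    modQuot b s (restr t x) = restr t (modQuot b s x) := by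
  refine DFunLike.congr_fun (f := (modQuot b s).comp (restr t))
    (g := (restr t).comp (modQuot b s)) (slotsAlgHom_ext fun l v => ?_) x
  simp only [AlgHom.comp_apply, restr_gen, modQuot_gen]
  split_ifs <;> simp only [map_zero, modQuot_gen, if_true, if_false, *]

theorem isNormal_modQuot {m : ℕ} {x : Slots k g} (hx : IsNormal m x) (s : Finset ι) :
    IsNormal m (modQuot b s x) where
  supp := by rw [← modQuot_restr, hx.supp]
  kill l h1 h2 := by rw [← modQuot_restr, hx.kill l h1 h2, map_zero]

theorem dslot_modQuot (s : Finset ι) (a : ι) (l : ℕ) (h : l = 0 → a ∉ s) (x : Slots k g) :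
    dslot (b a) l (modQuot b s x) = modQuot b s (dslot (b a) l x) := by
  refine DFunLike.congr_fun (f := dslot (b a) l ∘ₗ (modQuot b s).toLinearMap)
    (g := (modQuot b s).toLinearMap ∘ₗ dslot (b a) l) (slotsHom_ext ?_ fun r v y hy => ?_) x
  · simp only [LinearMap.comp_apply, AlgHom.toLinearMap_apply, map_one, dslot_one, map_zero]
  · simp only [LinearMap.comp_apply, AlgHom.toLinearMap_apply] at hy ⊢
    rw [map_mul, modQuot_gen, dslot_gen_mul, hy, dslot_gen_mul, map_sub, map_smul, map_mul,
      modQuot_gen]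
    congr 2
    by_cases hr : r = l
    · subst hr
      rw [if_pos rfl, if_pos rfl]
      by_cases h0 : r = 0
      · rw [if_pos h0, coordProj_apply_of_notMem b (h h0)]
      · rw [if_neg h0]
    · rw [if_neg hr, if_neg hr]

/-- Killing one more variable `ξ` is the projection `1 - ξ ∂`. -/
theorem modQuot_insert {s : Finset ι} {a : ι} (ha : a ∉ s) (x : Slots k g) :
    modQuot b (insert a s) x =
      modQuot b s x - gen 0 (b.coord a) * dslot (b a) 0 (modQuot b s x) := by
  have hx : ∀ v v' : Module.Dual k g, gen 0 v * gen 0 v' = -(gen 0 v' * gen 0 v : Slots k g) :=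
    fun v v' => ι_mul_ι_comm _ _
  refine DFunLike.congr_fun (f := (modQuot b (insert a s)).toLinearMap)
    (g := (modQuot b s).toLinearMap - LinearMap.mulLeft k (gen 0 (b.coord a)) ∘ₗ
      dslot (b a) 0 ∘ₗ (modQuot b s).toLinearMap) (slotsHom_ext ?_ fun r v y hy => ?_) x
  · simp only [LinearMap.comp_apply, LinearMap.sub_apply, AlgHom.toLinearMap_apply, map_one,
      dslot_one, LinearMap.mulLeft_apply, mul_zero, sub_zero]
  · simp only [LinearMap.comp_apply, LinearMap.sub_apply, AlgHom.toLinearMap_apply,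
      LinearMap.mulLeft_apply] at hy ⊢
    rw [map_mul, map_mul, hy, modQuot_gen, modQuot_gen, dslot_gen_mul]
    by_cases hr : r = 0
    · subst hr
      have hg : (gen 0 (coordProj b (insert a s) v) : Slots k g) =
          gen 0 (coordProj b s v) - v (b a) • gen 0 (b.coord a) := by
        rw [coordProj_insert b ha, ← slot_ι, ← slot_ι, ← slot_ι, map_sub, map_smul, map_sub, map_smul]
      have hz : (gen 0 (b.coord a) * gen 0 (b.coord a) : Slots k g) = 0 :=
        ExteriorAlgebra.ι_sq_zero _
      rw [if_pos rfl, if_pos rfl, if_pos rfl, hg, coordProj_apply_of_notMem b ha]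
      simp only [sub_mul, mul_sub, smul_mul_assoc, mul_smul_comm, ← mul_assoc, hz,
        smul_zero, sub_zero]
      rw [hx (b.coord a)]
      simp only [neg_mul]
      abel
    · have hx' : (gen 0 (b.coord a) * gen r v : Slots k g) = -(gen r v * gen 0 (b.coord a)) :=
        ι_mul_ι_comm _ _
      rw [if_neg hr, if_neg hr, if_neg hr, zero_smul, zero_sub, mul_sub, mul_neg, ← mul_assoc,
        ← mul_assoc, hx', neg_mul, neg_neg]

/-! ### The symbol map on bar complexes -/

/-- Killing the slot `q`, on coefficients. -/
def killS (q : ℕ) : Module.End k (SlotForms k g ι) := cmap (restr (· ≠ q)).toLinearMap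

omit [CharZero k] [Fintype ι] [DecidableEq ι] in
theorem dS_killS (x : g) {l q : ℕ} (h : l ≠ q) :
    dS k ι x l * killS q = killS q * dS k ι x l := by
  refine LinearMap.ext fun ω => slotForms_ext fun n => ?_
  have := dslot_restr (· ≠ q) x l (coeffS k g ι n ω)
  rw [if_pos h] at this
  exact this

omit [CharZero k] [DecidableEq ι] in
theorem dY_killS {l q : ℕ} (h : l ≠ q) : dY k ι b l * killS q = killS q * dY k ι b l := by
  simp only [dY, dV, Finset.sum_mul, Finset.mul_sum]
  refine Finset.sum_congr rfl fun c _ => ?_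
  rw [mul_assoc, dS_killS _ h, ← mul_assoc, ← mul_assoc]
  congr 1
  exact (LinearMap.ext fun ω => cmap_mulS (restr (· ≠ q)).toLinearMap _ ω).symm

omit [CharZero k] [DecidableEq ι] in
theorem prodY_killS {m q : ℕ} (h : q = 0 ∨ m < q) :
    prodY k ι b m * killS q = killS q * prodY k ι b m := by
  induction m with
  | zero => rw [prodY, one_mul, mul_one]
  | succ m ih => rw [prodY, mul_assoc, dY_killS b (by omega), ← mul_assoc, ih (by omega), mul_assoc]

omit [CharZero k] [DecidableEq ι] in
theorem prodYdel_killS (m q : ℕ) :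
    prodYdel k ι b m q * killS q = killS q * prodYdel k ι b m q := by
  induction m with
  | zero => rw [prodYdel, one_mul, mul_one]
  | succ m ih =>
    by_cases hq : q = m + 1
    · subst hq
      rw [prodYdel_succ_self, prodY_killS b (Or.inr (Nat.lt_succ_self m))]
    · rw [prodYdel_succ_of_ne b hq, mul_assoc, dY_killS b (Ne.symm hq), ← mul_assoc, ih, mul_assoc]

variable (k g ι) in
/-- The augmentation of the module and of the bar construction with slots `1, …, i`. -/
def augS (i : ℕ) : SlotForms k g ι →ₗ[k] Forms k g ι :=
  cmap (slotProd.comp (restr (· = i + 1))).toLinearMap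

omit [Fintype ι] [DecidableEq ι] in
theorem augS_killS {i q : ℕ} (h : q ≤ i) (ω : SlotForms k g ι) :
    augS k g ι i (killS q ω) = augS k g ι i ω := by
  refine MvPowerSeries.ext fun n => ?_
  change slotProd (restr (· = i + 1) (restr (· ≠ q) (coeffS k g ι n ω))) = slotProd (restr _ _)
  rw [restr_of_imp fun l hl => by omega]
  rfl

omit [Fintype ι] [DecidableEq ι] in
theorem augS_eq_zero {i q : ℕ} (h : q ≤ i) {ω : SlotForms k g ι} (hω : killS q ω = 0) :
    augS k g ι i ω = 0 := by
  rw [← augS_killS h, hω, map_zero]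

omit [Fintype ι] [DecidableEq ι] in
theorem augS_relS {m p : ℕ} (hp : p ≤ m) (ω : SlotForms k g ι) :
    augS k g ι m (relS k g ι (faceIdx m p) ω) = augS k g ι (m + 1) ω := by
  refine MvPowerSeries.ext fun n => ?_
  change slotProd (restr (· = m + 1) (relabel (faceIdx m p) (coeffS k g ι n ω))) =
    slotProd (restr (· = m + 1 + 1) (coeffS k g ι n ω))
  rw [restr_relabel, slotProd_relabel]
  congr 1
  refine restr_congr (fun l => ?_) _
  simp only [faceIdx, if_pos hp]
  split_ifs <;> omega

/-- The component on `i`-chains of the Hochschild–Kostant–Rosenberg map, without its factor, on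
bar complexes of modules. -/
def symb (i : ℕ) : Slots k g →ₗ[k] Forms k g ι := augS k g ι i ∘ₗ prodY k ι b i ∘ₗ cstS k g ι

/-- The map `symb` with the tautological derivative in slot `q` replaced by `∂_a`. -/
def symbDel (a : ι) (i q : ℕ) : Slots k g →ₗ[k] Forms k g ι :=
  augS k g ι i ∘ₗ dS k ι (b a) q ∘ₗ prodYdel k ι b i q ∘ₗ cstS k g ι

/-- A normalized element has to be differentiated in each of its normalized slots for its augmentation
not to vanish. -/
theorem augS_dS_prodYdel_eq_zero (a : ι) {i q r : ℕ} (h : r ≠ q) {x : Slots k g} (hx : IsNormal i x)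
    (h1 : 1 ≤ q) (h2 : q ≤ i) :
    augS k g ι i (dS k ι (b a) r (prodYdel k ι b i q (cstS k g ι x))) = 0 := by
  refine augS_eq_zero h2 ?_
  have hk : killS q (cstS k g ι x) = 0 :=
    (cmap_cst (restr (· ≠ q)).toLinearMap x).trans
      ((congrArg (cstS k g ι) (hx.kill q h1 h2)).trans (map_zero _))
  rw [← Module.End.mul_apply, ← dS_killS _ h, Module.End.mul_apply, ← Module.End.mul_apply (killS q),
    ← prodYdel_killS, Module.End.mul_apply, hk, map_zero, map_zero]

theorem relS_cstS_modB (m : ℕ) (x : Slots k g) : cstS k g ι (modB m x) =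
    ∑ p ∈ Finset.range (m + 1), (-1 : k) ^ p • relS k g ι (faceIdx m p) (cstS k g ι x) := by
  rw [modB_apply, map_sum]
  refine Finset.sum_congr rfl fun p hp => ?_
  rw [Finset.mem_range] at hp
  have : faceIdx m p = mergeIdx p := by
    funext l
    rw [faceIdx, mergeIdx, if_pos (by omega)]
  rw [map_smul, relS_cstS, this]

/-- The only faces of the bar differential that contribute are those involving the slot `r`. -/
theorem augS_dS_prodY_modB (a : ι) {m r : ℕ} (hr : r ≤ m) {x : Slots k g} (hx : IsNormal (m + 1) x) :
    augS k g ι m (dS k ι (b a) r (prodY k ι b m (cstS k g ι (modB m x)))) =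
      (-1 : k) ^ r • ((if r = 0 then 0 else symbDel b a (m + 1) r x) + symbDel b a (m + 1) (r + 1) x) := by
  rw [relS_cstS_modB]
  simp only [map_sum, map_smul]
  have h : ∀ p ∈ Finset.range (m + 1), augS k g ι m (dS k ι (b a) r (prodY k ι b m
      (relS k g ι (faceIdx m p) (cstS k g ι x)))) = if p = r then
        (if r = 0 then 0 else symbDel b a (m + 1) r x) + symbDel b a (m + 1) (r + 1) x else 0 := by
    intro p hp
    rw [Finset.mem_range] at hp
    have hs : ∀ l, l ∈ (Finset.range (m + 2)).filter (fun l => faceIdx m p l = r) ↔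
        faceIdx m p l = r := by
      intro l
      rw [Finset.mem_filter, Finset.mem_range, and_iff_right_iff_imp]
      simp only [faceIdx, if_pos (show p ≤ m by omega)]
      split_ifs <;> omega
    have hterm : ∀ q, 1 ≤ q → q ≤ m + 1 →
        augS k g ι (m + 1) ((∑ l ∈ (Finset.range (m + 2)).filter (fun l => faceIdx m p l = r),
          dS k ι (b a) l) (prodYdel k ι b (m + 1) q (cstS k g ι x))) =
        if faceIdx m p q = r then symbDel b a (m + 1) q x else 0 := by
      intro q h1 h2
      rw [LinearMap.sum_apply, map_sum]
      split_ifs with hq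
      · rw [Finset.sum_eq_single q]
        · rfl
        · exact fun l _ hl => augS_dS_prodYdel_eq_zero b a hl hx h1 h2
        · exact fun hl => absurd ((hs q).2 hq) hl
      · exact Finset.sum_eq_zero fun l hl => augS_dS_prodYdel_eq_zero b a
          (fun h => hq (by rw [← h, (hs l).1 hl])) hx h1 h2
    rw [← Module.End.mul_apply (prodY k ι b m), prodY_relS b m p (by omega), Module.End.mul_apply,
      ← Module.End.mul_apply (dS k ι (b a) r), dS_relS _ _ _ _ hs, Module.End.mul_apply,
      augS_relS (by omega), LinearMap.add_apply, map_add, map_add, if_neg (show ¬ p = m + 1 by omega),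
      hterm (p + 1) (by omega) (by omega)]
    have hp1 : faceIdx m p (p + 1) = r ↔ p = r := by
      simp only [faceIdx, if_pos (show p ≤ m by omega)]
      split_ifs <;> omega
    by_cases hp0 : p = 0
    · subst hp0
      rw [if_pos rfl, LinearMap.zero_apply, map_zero, map_zero, zero_add]
      simp only [hp1]
      split_ifs with h1 h2
      · subst h1
        exact (zero_add _).symm
      · exact absurd h1.symm h2
      · rfl
    · rw [if_neg hp0, hterm p (by omega) (by omega)]
      have hp2 : faceIdx m p p = r ↔ p = r := by
        simp only [faceIdx, if_pos (show p ≤ m by omega)]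
        split_ifs <;> omega
      simp only [hp1, hp2]
      split_ifs with h1 h2
      · omega
      · rw [h1]
      · exact add_zero _
  rw [Finset.sum_congr rfl fun p hp => congrArg _ (h p hp), Finset.sum_eq_single r]
  · rw [if_pos rfl]
  · intro p _ hp
    rw [if_neg hp, smul_zero]
  · intro hr'
    rw [Finset.mem_range] at hr'
    omega

end QuotientExact

section QuotientExactness

variable {k : Type*} [Field k] [CharZero k] {g : Type*} [LieRing g] [LieAlgebra k g]
  {ι : Type*} [Fintype ι] [DecidableEq ι] (b : Module.Basis ι k g)

theorem modQuot_modQuot (s : Finset ι) (x : Slots k g) :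
    modQuot b s (modQuot b s x) = modQuot b s x := by
  refine DFunLike.congr_fun (f := (modQuot b s).comp (modQuot b s)) (g := modQuot b s)
    (slotsAlgHom_ext fun l v => ?_) x
  simp only [AlgHom.comp_apply, modQuot_gen]
  split_ifs
  · rw [coordProj_coordProj]
  · rfl

/-- The quotient of the module, on coefficients. -/
def quotS (s : Finset ι) : Module.End k (SlotForms k g ι) := cmap (modQuot b s).toLinearMap

theorem dS_quotS (s : Finset ι) (a : ι) (l : ℕ) (h : l = 0 → a ∉ s) :
    dS k ι (b a) l * quotS b s = quotS b s * dS k ι (b a) l :=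
  LinearMap.ext fun ω => slotForms_ext fun n => dslot_modQuot b s a l h (coeffS k g ι n ω)

theorem prodY_quotS (s : Finset ι) (m : ℕ) :
    prodY k ι b m * quotS b s = quotS b s * prodY k ι b m := by
  induction m with
  | zero => rw [prodY, one_mul, mul_one]
  | succ m ih =>
    have h : dY k ι b (m + 1) * quotS b s = quotS b s * dY k ι b (m + 1) := by
      simp only [dY, dV, Finset.sum_mul, Finset.mul_sum]
      refine Finset.sum_congr rfl fun c _ => ?_
      rw [mul_assoc, dS_quotS b s c _ (fun h => absurd h (Nat.succ_ne_zero m)), ← mul_assoc,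
        ← mul_assoc]
      congr 1
      exact (LinearMap.ext fun ω => cmap_mulS (modQuot b s).toLinearMap _ ω).symm
    rw [prodY, mul_assoc, h, ← mul_assoc, ih, mul_assoc]

theorem augS_quotS (s : Finset ι) (i : ℕ) (ω : SlotForms k g ι) :
    augS k g ι i (quotS b s ω) = augS k g ι i ω := by
  refine MvPowerSeries.ext fun n => ?_
  refine DFunLike.congr_fun (f := (slotProd.comp (restr (· = i + 1))).comp (modQuot b s))
    (g := slotProd.comp (restr (· = i + 1))) (slotsAlgHom_ext fun l v => ?_) (coeffS k g ι n ω)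
  simp only [AlgHom.comp_apply, modQuot_gen, restr_gen]
  by_cases h : l = 0
  · rw [if_neg (by omega), if_neg (by omega)]
  · rw [if_neg h]

theorem augS_dS_prodY_modQuot (s : Finset ι) (a : ι) (m r : ℕ) (h : r = 0 → a ∉ s) (x : Slots k g) :
    augS k g ι m (dS k ι (b a) r (prodY k ι b m (cstS k g ι (modQuot b s x)))) =
      augS k g ι m (dS k ι (b a) r (prodY k ι b m (cstS k g ι x))) := by
  have h1 : cstS k g ι (modQuot b s x) = quotS b s (cstS k g ι x) :=
    (cmap_cst (modQuot b s).toLinearMap x).symm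
  rw [h1, ← Module.End.mul_apply (prodY k ι b m), prodY_quotS, Module.End.mul_apply,
    ← Module.End.mul_apply (dS k ι (b a) r), dS_quotS b s a r h, Module.End.mul_apply, augS_quotS]

theorem partialY_symb (a : ι) (i : ℕ) (x : Slots k g) : partialY k g a (symb b i x) =
    ∑ q ∈ Finset.range i, (-1 : k) ^ q • symbDel b a i (q + 1) x := by
  have h1 : ∀ ω : SlotForms k g ι, partialY k g a (augS k g ι i ω) = augS k g ι i (pdS k g a ω) :=
    fun ω => (cmap_pdY (slotProd.comp (restr (· = i + 1))).toLinearMap a ω).symm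
  have h2 : pdS k g a (cstS k g ι x) = 0 := pdY_cst a x
  simp only [symb, LinearMap.comp_apply, h1]
  rw [← Module.End.mul_apply, pdS_prodY, LinearMap.add_apply, Module.End.mul_apply, h2, map_zero,
    zero_add, LinearMap.sum_apply, map_sum]
  simp only [LinearMap.smul_apply, map_smul]
  rfl

omit [CharZero k] in
theorem restr_eq_slot (l : ℕ) (x : Slots k g) :
    restr (· = l) x = slot l (slotProd (restr (· = l) x)) := by
  refine DFunLike.congr_fun (f := restr (· = l))
    (g := ((slot l).comp slotProd).comp (restr (· = l))) (slotsAlgHom_ext fun r v => ?_) x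
  simp only [AlgHom.comp_apply, restr_gen]
  split_ifs with h
  · rw [slotProd_gen, slot_ι, h]
  · simp only [map_zero]

theorem modB_gen_mul (m : ℕ) (v : Module.Dual k g) (x : Slots k g) :
    modB m (gen 0 v * x) = gen 0 v * modB m x := by
  rw [modB_apply, modB_apply, Finset.mul_sum]
  refine Finset.sum_congr rfl fun p _ => ?_
  rw [map_mul, relabel_gen, mergeIdx, if_pos (Nat.zero_le p), mul_smul_comm]

theorem symb_gen_mul (i : ℕ) (v : Module.Dual k g) (x : Slots k g) :
    symb b i (gen 0 v * x) = 0 := by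
  refine augS_eq_zero (Nat.zero_le i) ?_
  have h : killS 0 (cstS k g ι (gen 0 v * x)) = 0 := by
    refine (cmap_cst (restr (· ≠ 0)).toLinearMap _).trans ?_
    rw [AlgHom.toLinearMap_apply, map_mul, restr_gen, if_neg (not_not.2 rfl), zero_mul]
    exact map_zero (cstS k g ι)
  change killS 0 (prodY k ι b i (cstS k g ι (gen 0 v * x))) = 0
  rw [← Module.End.mul_apply, ← prodY_killS b (Or.inl rfl), Module.End.mul_apply, h, map_zero]

/-- If `x` is a cycle modulo the variables in `s` and its symbol vanishes, then the symbol still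
vanishes when the tautological derivative in slot `1` is replaced by `∂_a`: because `x` is a cycle, all
slots contribute equally to the partial derivative of the symbol. -/
theorem symbDel_eq_zero {s : Finset ι} {a : ι} {m : ℕ} {x : Slots k g} (hx : IsNormal (m + 1) x)
    (hB : modQuot b s (modB m x) = 0) (hsymb : symb b (m + 1) x = 0) :
    symbDel b a (m + 1) 1 x = 0 := by
  have h1 : ∀ r, r + 1 ≤ m → symbDel b a (m + 1) (r + 1 + 1) x = -symbDel b a (m + 1) (r + 1) x := by
    intro r hr
    have h2 := augS_dS_prodY_modB b a hr hx
    rw [← augS_dS_prodY_modQuot b s a m (r + 1) (fun h => absurd h (Nat.succ_ne_zero r)), hB,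
      if_neg (Nat.succ_ne_zero r), map_zero, map_zero, map_zero, map_zero, eq_comm, smul_eq_zero] at h2
    exact eq_neg_of_add_eq_zero_right (h2.resolve_left (pow_ne_zero _ (neg_ne_zero.2 one_ne_zero)))
  have h2 : ∀ q, q ≤ m → (-1 : k) ^ q • symbDel b a (m + 1) (q + 1) x = symbDel b a (m + 1) 1 x := by
    intro q hq
    induction q with
    | zero => rw [pow_zero, one_smul]
    | succ q ih =>
      rw [h1 q hq, pow_succ, mul_neg_one, neg_smul, smul_neg, neg_neg]
      exact ih (by omega)
  have h3 := partialY_symb b a (m + 1) x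
  rw [hsymb, map_zero, Finset.sum_congr rfl fun q hq => h2 q (by rw [Finset.mem_range] at hq; omega),
    Finset.sum_const, Finset.card_range, ← Nat.cast_smul_eq_nsmul k, eq_comm, smul_eq_zero] at h3
  exact h3.resolve_left (Nat.cast_ne_zero.2 (Nat.succ_ne_zero m))

/-- The bar complex of the quotient of the free module by some of the variables is exact at the
elements with vanishing symbol. The quotients are linked by short exact sequences
`0 → Λ/(s ∪ {a}) → Λ/s → Λ/(s ∪ {a}) → 0`, which give an induction on the number of variables and
on the length. -/
theorem modB_exact (i : ℕ) : ∀ (s : Finset ι) (x : Slots k g), IsNormal i x →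
    (∀ m, i = m + 1 → modQuot b s (modB m x) = 0) → symb b i x = 0 →
    ∃ y, IsNormal (i + 1) y ∧ modQuot b s x = modQuot b s (modB i y) := by
  induction i with
  | zero =>
    intro s x hx _ hsymb
    have h1 : slotProd (restr (· = 1) x) = 0 := by
      have := congrArg (MvPowerSeries.coeff (0 : ι →₀ ℕ)) hsymb
      have h2 : symb b 0 x = cst (k := k) (ι := ι) (slotProd (restr (· = 1) x)) :=
        cmap_cst (slotProd.comp (restr (· = 1))).toLinearMap x
      rw [h2, coeff_cst, if_pos rfl, map_zero] at this
      exact this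
    obtain ⟨y, hy, h⟩ := modB_exact_zero hx (by
      rw [← hx.supp, restr_restr, restr_congr (t := (· = 1)) (fun l => by omega), restr_eq_slot,
        h1, map_zero])
    exact ⟨y, hy, by rw [← h]⟩
  | succ m ih =>
    intro s
    induction s using Finset.induction_on with
    | empty =>
      intro x hx hB _
      have hB' := hB m rfl
      rw [modQuot_empty] at hB'
      obtain ⟨y, hy, h⟩ := modB_exact_free hx hB'
      exact ⟨y, hy, by rw [← h]⟩
    | insert a s ha ihs =>
      intro x hx hB hsymb
      have hB' := hB m rfl
      -- modulo `s`, the boundary of `x` is divisible by the variable `a`; the quotient `w` is a cycle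
      -- without symbol modulo `insert a s`, to which the induction hypothesis on the length applies
      set z := modQuot b s (modB m x) with hz
      set w := dslot (b a) 0 z with hw
      have hzw : z = gen 0 (b.coord a) * w := by
        rw [modQuot_insert b ha] at hB'
        exact sub_eq_zero.1 hB'
      have hmul : ∀ u : Slots k g, gen 0 (b.coord a) * u = 0 → u = gen 0 (b.coord a) * dslot (b a) 0 u := by
        intro u hu
        have := dslot_gen_mul (b a) 0 0 (b.coord a) u
        rw [hu, map_zero, if_pos rfl, Module.Basis.coord_apply, Module.Basis.repr_self,
          Finsupp.single_eq_same, one_smul, eq_comm, sub_eq_zero] at this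
        exact this
      have hsq : ∀ u : Slots k g, gen 0 (b.coord a) * (gen 0 (b.coord a) * u) = 0 := by
        intro u
        rw [← mul_assoc]
        exact (congrArg (· * u) (ExteriorAlgebra.ι_sq_zero _)).trans (zero_mul u)
      have hgen : modQuot b s (gen 0 (b.coord a)) = gen 0 (b.coord a) := by
        rw [modQuot_gen_zero, coordProj_coord, if_neg ha]
      have hwN : IsNormal m w := isNormal_dslot (isNormal_modQuot b (isNormal_modB hx) s) _
      have hws : modQuot b s w = w := by
        rw [hw, ← dslot_modQuot b s a 0 (fun _ => ha), hz, modQuot_modQuot]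
      have hwB : ∀ m', m = m' + 1 → modQuot b (insert a s) (modB m' w) = 0 := by
        intro m' hm'
        subst hm'
        have h1 : gen 0 (b.coord a) * modQuot b s (modB m' w) = 0 := by
          rw [← hgen, ← map_mul, ← modB_gen_mul, ← hzw, hz, modQuot_modB_modQuot, modB_modB, map_zero]
        rw [modQuot_insert b ha, sub_eq_zero]
        exact hmul _ h1
      have hwsymb : symb b m w = 0 := by
        have h1 : w = modQuot b s (dslot (b a) 0 (modB m x)) := by
          rw [hw, hz, dslot_modQuot b s a 0 fun _ => ha]
        have h2 : cstS k g ι w = dS k ι (b a) 0 (cstS k g ι z) := (cmap_cst (dslot (b a) 0) z).symm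
        have h3 := augS_dS_prodY_modB b a (Nat.zero_le m) hx
        rw [if_pos rfl, zero_add, symbDel_eq_zero b hx hB' hsymb, smul_zero] at h3
        rw [symb, LinearMap.comp_apply, LinearMap.comp_apply, h2, ← Module.End.mul_apply, prodY_dS,
          LinearMap.smul_apply, map_smul, Module.End.mul_apply, hz,
          augS_dS_prodY_modQuot b s a m 0 (fun _ => ha), h3, smul_zero]
      obtain ⟨u, hu, huw⟩ := ih (insert a s) w hwN hwB hwsymb
      -- `x` corrected by a multiple of the variable `a` is a cycle modulo `s`
      obtain ⟨y, hy, hyx⟩ := ihs (x - gen 0 (b.coord a) * u) (hx.sub (isNormal_gen_mul hu _))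
        (by
          intro m' hm'
          obtain rfl : m = m' := Nat.succ_injective hm'
          rw [map_sub, map_sub, modB_gen_mul, map_mul, hgen, ← hz, hzw]
          have h1 := huw
          rw [modQuot_insert b ha, modQuot_insert b ha, hws] at h1
          have h2 := congrArg (gen 0 (b.coord a) * ·) h1
          simp only [mul_sub, hsq, sub_zero] at h2
          rw [h2, sub_self])
        (by rw [map_sub, hsymb, symb_gen_mul, sub_zero])
      refine ⟨y, hy, ?_⟩
      rw [modQuot_insert b ha, modQuot_insert b ha (modB (m + 1) y), ← hyx, map_sub, map_mul, hgen,
        map_sub, mul_sub, ← sub_add]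
      have h1 : gen 0 (b.coord a) * dslot (b a) 0 (gen 0 (b.coord a) * modQuot b s u) =
          gen 0 (b.coord a) * modQuot b s u := by
        rw [dslot_gen_mul, if_pos rfl, Module.Basis.coord_apply, Module.Basis.repr_self,
          Finsupp.single_eq_same, one_smul, mul_sub, hsq, sub_zero]
      rw [h1]
      abel

end QuotientExactness

/-! ### From Hochschild chains to the bar complex -/

section ChangeOfVariables

variable {k : Type*} [Field k] [CharZero k] {g : Type*} [LieRing g] [LieAlgebra k g]

variable (k g) in
/-- The inclusion of the generators in slot `l`. -/
abbrev slotSingle (l : ℕ) : Module.Dual k g →ₗ[k] ℕ →₀ Module.Dual k g := Finsupp.lsingle l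

/-- The change of variables that turns the Hochschild complex into a bar complex, for `i`-chains:
the generators in the slots `l = 1, …, i` are shifted by those in the slot `0`, and the slot `0`
is moved to the slot `i + 1`. -/
def barOut (i : ℕ) : Slots k g →ₐ[k] Slots k g :=
  ExteriorAlgebra.map (Finsupp.lsum k fun l =>
    (if l = 0 then 0 else slotSingle k g l) + slotSingle k g (i + 1))

/-- The inverse of `barOut`. -/
def barIn (i : ℕ) : Slots k g →ₐ[k] Slots k g :=
  ExteriorAlgebra.map (Finsupp.lsum k fun l =>
    if l = 0 then 0 else if l ≤ i then slotSingle k g l + (-1 : k) • slotSingle k g 0 else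
      if l = i + 1 then slotSingle k g 0 else 0)

omit [CharZero k] in
theorem barOut_gen (i l : ℕ) (v : Module.Dual k g) :
    barOut i (gen l v) = (if l = 0 then 0 else gen l v) + gen (i + 1) v := by
  rw [barOut, gen, ExteriorAlgebra.map_apply_ι]
  split_ifs with h <;> simp [h, gen]

omit [CharZero k] in
theorem barIn_gen (i l : ℕ) (v : Module.Dual k g) : barIn i (gen l v) =
    if l = 0 then 0 else if l ≤ i then gen l v - gen 0 v else if l = i + 1 then gen 0 v else 0 := by
  have h : barIn i (gen l v) = (ExteriorAlgebra.ι k ((if l = 0 then 0 else if l ≤ i then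
      slotSingle k g l + (-1 : k) • slotSingle k g 0 else if l = i + 1 then slotSingle k g 0 else 0) v)) := by
    rw [barIn, gen, ExteriorAlgebra.map_apply_ι, Finsupp.lsum_single]
  rw [h]
  split_ifs
  · rw [LinearMap.zero_apply, map_zero]
  · rw [LinearMap.add_apply, LinearMap.smul_apply, map_add, map_smul, neg_one_smul, sub_eq_add_neg]
    rfl
  · rfl
  · rw [LinearMap.zero_apply, map_zero]

omit [CharZero k] in
/-- Two homomorphisms agree on elements with slots in `s` if they do so on the generators. -/
theorem algHom_congr_supp {A : Type*} [Ring A] [Algebra k A] {S T : Slots k g →ₐ[k] A}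
    {s : ℕ → Prop} [DecidablePred s] (h : ∀ l v, s l → S (gen l v) = T (gen l v)) {x : Slots k g}
    (hx : restr s x = x) : S x = T x := by
  rw [← hx]
  refine DFunLike.congr_fun (f := S.comp (restr s)) (g := T.comp (restr s))
    (slotsAlgHom_ext fun l v => ?_) x
  simp only [AlgHom.comp_apply, restr_gen]
  split_ifs with hl
  · exact h l v hl
  · rw [map_zero, map_zero]

omit [CharZero k] in
theorem barIn_barOut {i : ℕ} {y : Slots k g} (hy : restr (· ≤ i) y = y) :
    barIn i (barOut i y) = y := by
  refine algHom_congr_supp (S := (barIn i).comp (barOut i)) (T := AlgHom.id k _) (fun l v hl => ?_) hy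
  simp only [AlgHom.comp_apply, AlgHom.id_apply, barOut_gen, map_add, barIn_gen,
    if_neg (Nat.succ_ne_zero i), if_neg (show ¬ i + 1 ≤ i by omega), if_true]
  split_ifs with h0
  · rw [map_zero, zero_add, h0]
  · rw [barIn_gen, if_neg h0, if_pos hl, sub_add_cancel]

omit [CharZero k] in
theorem barOut_barIn {i : ℕ} {x : Slots k g} (hx : restr (fun l => 1 ≤ l ∧ l ≤ i + 1) x = x) :
    barOut i (barIn i x) = x := by
  refine algHom_congr_supp (S := (barOut i).comp (barIn i)) (T := AlgHom.id k _) (fun l v hl => ?_) hx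
  simp only [AlgHom.comp_apply, AlgHom.id_apply, barIn_gen]
  rw [if_neg (by omega)]
  split_ifs with h1 h2
  · rw [map_sub, barOut_gen, barOut_gen, if_neg (by omega), if_pos rfl, zero_add, add_sub_cancel_right]
  · rw [barOut_gen, if_pos rfl, zero_add, h2]
  · omega

omit [CharZero k] in
theorem restr_barIn (i : ℕ) (x : Slots k g) : restr (· ≤ i) (barIn i x) = barIn i x := by
  refine DFunLike.congr_fun (f := (restr (· ≤ i)).comp (barIn i)) (g := barIn i)
    (slotsAlgHom_ext fun l v => ?_) x
  simp only [AlgHom.comp_apply, barIn_gen]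
  split_ifs with h1 h2
  · exact map_zero _
  · rw [map_sub, restr_gen, restr_gen, if_pos h2, if_pos (Nat.zero_le i)]
  · rw [restr_gen, if_pos (Nat.zero_le i)]
  · exact map_zero _

omit [CharZero k] in
theorem restr_barOut {i : ℕ} {y : Slots k g} (hy : restr (· ≤ i) y = y) :
    restr (fun l => 1 ≤ l ∧ l ≤ i + 1) (barOut i y) = barOut i y := by
  refine algHom_congr_supp (S := (restr _).comp (barOut i)) (T := barOut i) (fun l v hl => ?_) hy
  simp only [AlgHom.comp_apply, barOut_gen, map_add, restr_gen]
  rw [if_pos (show 1 ≤ i + 1 ∧ i + 1 ≤ i + 1 by omega)]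
  congr 1
  split_ifs with h0
  · exact map_zero _
  · rw [restr_gen, if_pos (by omega)]

omit [CharZero k] in
theorem restr_barIn_kill {i l : ℕ} (h1 : 1 ≤ l) (x : Slots k g) :
    restr (· ≠ l) (barIn i (restr (· ≠ l) x)) = barIn i (restr (· ≠ l) x) := by
  refine DFunLike.congr_fun (f := ((restr (· ≠ l)).comp (barIn i)).comp (restr (· ≠ l)))
    (g := (barIn i).comp (restr (· ≠ l))) (slotsAlgHom_ext fun r v => ?_) x
  simp only [AlgHom.comp_apply, restr_gen]
  split_ifs with h
  · rw [barIn_gen]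
    split_ifs
    · exact map_zero _
    · rw [map_sub, restr_gen, restr_gen, if_pos h, if_pos (by omega)]
    · rw [restr_gen, if_pos (by omega)]
    · exact map_zero _
  · rw [map_zero, map_zero]

omit [CharZero k] in
/-- The change of variables is compatible with killing slots, hence with normalization. -/
theorem restr_barOut_kill {i l : ℕ} (h2 : l ≤ i) (y : Slots k g) :
    restr (· ≠ l) (barOut i (restr (· ≠ l) y)) = barOut i (restr (· ≠ l) y) := by
  refine DFunLike.congr_fun (f := ((restr (· ≠ l)).comp (barOut i)).comp (restr (· ≠ l)))
    (g := (barOut i).comp (restr (· ≠ l))) (slotsAlgHom_ext fun r v => ?_) y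
  simp only [AlgHom.comp_apply, restr_gen]
  split_ifs with h
  · have h' : (restr (· ≠ l) (gen (i + 1) v) : Slots k g) = gen (i + 1) v := by
      rw [restr_gen, if_pos (by omega)]
    rw [barOut_gen, map_add, h']
    split_ifs
    · rw [map_zero]
    · rw [restr_gen, if_pos h]
  · rw [map_zero, map_zero]

variable {ι : Type*} [Fintype ι] [DecidableEq ι] (b : Module.Basis ι k g)

/-- On normalized chains, the Hochschild operator is the differential of the bar complex with
coefficients in the trivial module. -/
theorem barOut_slotB {m : ℕ} {y : Slots k g} (hy : restr (· ≤ m + 1) y = y)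
    (hN : IsNormal (m + 1) (barOut (m + 1) y)) :
    barOut m (slotB m y) = modQuot b Finset.univ (modB m (barOut (m + 1) y)) := by
  set z := barOut (m + 1) y with hz
  have hz0 : restr (· ≠ 0) z = z := by
    rw [hz, ← restr_barOut hy]
    exact restr_of_imp' (fun l hl => by omega) _
  -- The faces that merge two factors of the bar construction.
  have hmid : ∀ p, 1 ≤ p → p ≤ m → barOut m (relabel (faceIdx m p) y) = relabel (mergeIdx p) z := by
    intro p h1 h2
    refine algHom_congr_supp (S := (barOut m).comp (relabel (faceIdx m p)))
      (T := (relabel (mergeIdx p)).comp (barOut (m + 1))) (fun l v hl => ?_) hy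
    simp only [AlgHom.comp_apply, relabel_gen, barOut_gen, map_add, faceIdx, if_pos h2]
    have e1 : mergeIdx p (m + 1 + 1) = m + 1 := by
      rw [mergeIdx, if_neg (by omega), Nat.add_sub_cancel]
    rw [e1]
    congr 1
    by_cases h0 : l = 0
    · subst h0
      rw [if_pos (Nat.zero_le p), if_pos rfl, map_zero]
    · rw [if_neg h0, relabel_gen, mergeIdx, if_neg (by split_ifs <;> omega)]
  -- The two extreme faces vanish on normalized elements.
  have hfst : barOut m (relabel (faceIdx m 0) y) = 0 := by
    have h : barOut m (relabel (faceIdx m 0) y) = relabel (mergeIdx 0) (restr (· ≠ 1) z) := by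
      refine algHom_congr_supp (S := (barOut m).comp (relabel (faceIdx m 0)))
        (T := ((relabel (mergeIdx 0)).comp (restr (· ≠ 1))).comp (barOut (m + 1))) (fun l v hl => ?_) hy
      simp only [AlgHom.comp_apply, relabel_gen, barOut_gen, map_add, faceIdx, if_pos (Nat.zero_le m),
        restr_gen, if_pos (show m + 1 + 1 ≠ 1 by omega)]
      have e1 : mergeIdx 0 (m + 1 + 1) = m + 1 := rfl
      rw [e1]
      congr 1
      by_cases h0 : l = 0
      · subst h0
        simp
      · by_cases h1 : l = 1
        · subst h1
          simp [restr_gen]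
        · rw [if_neg (by rw [if_neg (by omega)]; omega), if_neg h0, restr_gen, if_pos h1, relabel_gen,
            mergeIdx]
    rw [h, hN.kill 1 le_rfl (by omega), map_zero]
  have hlst : barOut m (relabel (faceIdx m (m + 1)) y) = 0 := by
    have h : barOut m (relabel (faceIdx m (m + 1)) y) =
        relabel (mergeIdx (m + 1)) (restr (· ≠ m + 1) z) := by
      refine algHom_congr_supp (S := (barOut m).comp (relabel (faceIdx m (m + 1))))
        (T := ((relabel (mergeIdx (m + 1))).comp (restr (· ≠ m + 1))).comp (barOut (m + 1)))
        (fun l v hl => ?_) hy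
      simp only [AlgHom.comp_apply, relabel_gen, barOut_gen, map_add, faceIdx,
        if_neg (show ¬ m + 1 ≤ m by omega), restr_gen, if_pos (show m + 1 + 1 ≠ m + 1 by omega)]
      have e1 : mergeIdx (m + 1) (m + 1 + 1) = m + 1 := by
        rw [mergeIdx, if_neg (by omega), Nat.add_sub_cancel]
      rw [e1]
      congr 1
      by_cases h0 : l = 0
      · subst h0
        simp
      · by_cases h1 : l = m + 1
        · subst h1
          simp [restr_gen]
        · rw [if_pos (show l ≤ m by omega), if_neg h0, restr_gen, if_pos h1, relabel_gen, mergeIdx,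
            if_pos hl]
    rw [h, hN.kill (m + 1) (by omega) le_rfl, map_zero]
  have hmid' : ∀ p, modQuot b Finset.univ (relabel (mergeIdx (p + 1)) z) =
      relabel (mergeIdx (p + 1)) z := by
    intro p
    rw [modQuot_relabel, modQuot_univ, hz0]
    intro l
    rw [mergeIdx]
    split_ifs <;> omega
  have hfst' : modQuot b Finset.univ (relabel (mergeIdx 0) z) = 0 := by
    rw [modQuot_univ, restr_relabel, hN.restr_eq_zero le_rfl (Nat.le_add_left 1 m), map_zero]
    simp [mergeIdx]
  rw [slotB_apply, modB_apply, Finset.sum_range_succ, Finset.sum_range_succ', map_add, map_add,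
    Finset.sum_range_succ', map_add, map_smul, map_smul, map_smul, hfst, hlst, hfst', smul_zero,
    smul_zero, add_zero, add_zero, add_zero, map_sum, map_sum]
  refine Finset.sum_congr rfl fun p hp => ?_
  rw [Finset.mem_range] at hp
  rw [map_smul, map_smul, hmid', hmid (p + 1) (by omega) (by omega)]

omit [DecidableEq ι] [CharZero k] in
/-- In the new variables the product of the slots becomes the augmentation of all slots but the last. -/
theorem mulP_prodY_barIn (i : ℕ) (x : Slots k g) :
    mulP k g ι (prodY k ι b i (cstS k g ι (barIn i x))) = symb b i x := by
  obtain ⟨U, hU⟩ : ∃ U : Module.End k (SlotForms k g ι), ∀ ω, U ω = cmap (barIn i).toLinearMap ω :=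
    ⟨cmap (barIn i).toLinearMap, fun _ => rfl⟩
  have hd : ∀ (z : g) l, 1 ≤ l → l ≤ i → dS k ι z l * U = U * dS k ι z l := by
    intro z l h1 h2
    refine LinearMap.ext fun ω => ?_
    rw [Module.End.mul_apply, Module.End.mul_apply, hU, hU]
    refine slotForms_ext fun n => ?_
    refine DFunLike.congr_fun (f := dslot z l ∘ₗ (barIn i).toLinearMap)
      (g := (barIn i).toLinearMap ∘ₗ dslot z l) (slotsHom_ext ?_ fun r v y hy => ?_) (coeffS k g ι n ω)
    · simp only [LinearMap.comp_apply, AlgHom.toLinearMap_apply, map_one, dslot_one, map_zero]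
    · simp only [LinearMap.comp_apply, AlgHom.toLinearMap_apply] at hy ⊢
      have hgen : ∀ Y : Slots k g, dslot z l (barIn i (gen r v) * Y) =
          (if r = l then v z else 0) • Y - barIn i (gen r v) * dslot z l Y := by
        intro Y
        rw [barIn_gen]
        by_cases h0 : r = 0
        · rw [if_pos h0, zero_mul, map_zero, if_neg (by omega), zero_smul, zero_mul, sub_zero]
        by_cases hi : r ≤ i
        · rw [if_neg h0, if_pos hi, sub_mul, map_sub, dslot_gen_mul, dslot_gen_mul,
            if_neg (show ¬ 0 = l by omega), zero_smul, sub_mul]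
          abel
        rw [if_neg h0, if_neg hi, if_neg (show ¬ r = l by omega), zero_smul]
        split_ifs
        · rw [dslot_gen_mul, if_neg (show ¬ 0 = l by omega), zero_smul]
        · rw [zero_mul, zero_mul, map_zero, sub_zero]
      rw [map_mul (barIn i), hgen, dslot_gen_mul, map_sub, map_smul, map_mul (barIn i), hy]
  have hY : ∀ m ≤ i, prodY k ι b m * U = U * prodY k ι b m := by
    intro m hm
    induction m with
    | zero => rw [prodY, one_mul, mul_one]
    | succ m ih =>
      have h : dY k ι b (m + 1) * U = U * dY k ι b (m + 1) := by
        simp only [dY, dV, Finset.sum_mul, Finset.mul_sum]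
        refine Finset.sum_congr rfl fun c _ => ?_
        rw [mul_assoc, hd _ _ (by omega) hm, ← mul_assoc, ← mul_assoc]
        congr 1
        refine LinearMap.ext fun ω => ?_
        rw [Module.End.mul_apply, Module.End.mul_apply, hU, hU]
        exact (cmap_mulS (barIn i).toLinearMap _ ω).symm
      rw [prodY, mul_assoc, h, ← mul_assoc, ih (by omega), mul_assoc]
  have hc : cstS k g ι (barIn i x) = U (cstS k g ι x) :=
    ((hU _).trans (cmap_cst (barIn i).toLinearMap x)).symm
  rw [hc, ← Module.End.mul_apply, hY i le_rfl, Module.End.mul_apply, hU, symb]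
  refine MvPowerSeries.ext fun n => ?_
  refine DFunLike.congr_fun (f := slotProd.comp (barIn i)) (g := slotProd.comp (restr (· = i + 1)))
    (slotsAlgHom_ext fun l v => ?_) _
  simp only [AlgHom.comp_apply, barIn_gen, restr_gen]
  split_ifs
  any_goals omega
  any_goals simp only [map_zero, map_sub, slotProd_gen, sub_self]

end ChangeOfVariables

/-! ### Exactness of the normalized Hochschild complex -/

section HochschildExact

variable {k : Type*} [Field k] [CharZero k] {g : Type*} [LieRing g] [LieAlgebra k g]

/-- Killing a slot puts a scalar there, which makes a tensor degenerate. -/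
theorem ofSlots_kill_mem (i : ℕ) {l : ℕ} (h1 : 1 ≤ l) (h2 : l ≤ i) (x : Slots k g) :
    ofSlots i (restr (· ≠ l) x) ∈ degenerate k (Ch k g) i := by
  have key : ∀ t : Tens k (Ch k g) i, ofSlots i (restr (· ≠ l) (toSlots i t)) ∈
      degenerate k (Ch k g) i := by
    intro t
    have ht : t ∈ Submodule.span k (Set.range (PiTensorProduct.tprod k)) := by
      rw [PiTensorProduct.span_tprod_eq_top]
      trivial
    refine Submodule.span_induction ?_ ?_ ?_ ?_ ht
    · rintro _ ⟨a, rfl⟩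
      set j : Fin (i + 1) := ⟨l, Nat.lt_succ_of_le h2⟩ with hj
      have hs : ∀ a : Ch k g, restr (· ≠ l) (slot l a) =
          slot l (algebraMap k (Ch k g) (ExteriorAlgebra.algebraMapInv a)) := by
        intro a
        refine DFunLike.congr_fun (f := (restr (· ≠ l)).comp (slot l))
          (g := (slot l).comp ((Algebra.ofId k (Ch k g)).comp ExteriorAlgebra.algebraMapInv)) ?_ a
        ext v
        have h0 : restr (· ≠ l) (gen l v) = 0 := by rw [restr_gen, if_neg (not_not.2 rfl)]
        simp [slot_ι, h0, ExteriorAlgebra.algebraMapInv]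
      have h : restr (· ≠ l) (toSlots i (PiTensorProduct.tprod k a)) = toSlots i
          (PiTensorProduct.tprod k (Function.update a j
            (algebraMap k (Ch k g) (ExteriorAlgebra.algebraMapInv (a j))))) := by
        rw [toSlots_tprod, toSlots_tprod, algHom_prod_ofFn]
        congr 2
        funext r
        by_cases hr : r = j
        · subst hr
          rw [Function.update_self]
          exact hs _
        · rw [Function.update_of_ne hr]
          exact restr_slot_of_mem (· ≠ l) (fun h => hr (Fin.ext h)) _
      rw [h, ofSlots_toSlots, Algebra.algebraMap_eq_smul_one, MultilinearMap.map_update_smul]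
      exact Submodule.smul_mem _ _ (tprod_mem_degenerate j
        (fun h => absurd (congrArg Fin.val h) (by simp [hj]; omega)) (Function.update_self ..))
    · rw [map_zero, map_zero, map_zero]
      exact zero_mem _
    · intro t t' _ _ ht ht'
      rw [map_add, map_add, map_add]
      exact add_mem ht ht'
    · intro c t _ ht
      rw [map_smul, map_smul, map_smul]
      exact Submodule.smul_mem _ c ht
  have h := key (ofSlots i x)
  rwa [toSlots_ofSlots, restr_restr, ← ofSlots_restr, restr_restr, ← restr_congr
    (s := fun r => r ≤ i ∧ r ≠ l) (fun r => by omega), ← restr_restr, ofSlots_restr] at h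

/-- Every class of normalized chains is represented by a normalized element of the bar complex. -/
theorem exists_normal (i : ℕ) (t : Tens k (Ch k g) i) : ∃ t', t - t' ∈ degenerate k (Ch k g) i ∧
    IsNormal i (barOut i (toSlots i t')) := by
  have hsupp : ∀ t' : Tens k (Ch k g) i, restr (fun l => 1 ≤ l ∧ l ≤ i + 1)
      (barOut i (toSlots i t')) = barOut i (toSlots i t') := fun t' => restr_barOut (restr_toSlots i t')
  have key : ∀ m ≤ i, ∃ t', t - t' ∈ degenerate k (Ch k g) i ∧
      ∀ l, 1 ≤ l → l ≤ m → restr (· ≠ l) (barOut i (toSlots i t')) = 0 := by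
    intro m hm
    induction m with
    | zero => exact ⟨t, by rw [sub_self]; exact zero_mem _, fun l h1 h2 => by omega⟩
    | succ m ih =>
      obtain ⟨t', ht', hk⟩ := ih (by omega)
      set z := restr (· ≠ m + 1) (barOut i (toSlots i t')) with hz
      have hzs : restr (fun l => 1 ≤ l ∧ l ≤ i + 1) z = z := by
        rw [hz, restr_restr, restr_congr (t := fun l => l ≠ m + 1 ∧ (1 ≤ l ∧ l ≤ i + 1))
          (fun l => and_comm), ← restr_restr, hsupp]
      have hdeg : ofSlots i (barIn i z) ∈ degenerate k (Ch k g) i := by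
        rw [hz, ← restr_barIn_kill (by omega)]
        exact ofSlots_kill_mem i (by omega) hm _
      have hsub : barOut i (toSlots i (t' - ofSlots i (barIn i z))) =
          barOut i (toSlots i t') - z := by
        rw [map_sub, map_sub, toSlots_ofSlots, restr_barIn, barOut_barIn hzs]
      refine ⟨t' - ofSlots i (barIn i z), ?_, fun l h1 h2 => ?_⟩
      · rw [← sub_add]
        exact add_mem ht' hdeg
      · rw [hsub, map_sub]
        rcases h2.lt_or_eq with h | rfl
        · rw [hk l h1 (by omega), hz, restr_restr, restr_congr (t := fun r => r ≠ m + 1 ∧ r ≠ l)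
            (fun r => and_comm), ← restr_restr, hk l h1 (by omega), map_zero, sub_zero]
        · rw [hz, restr_of_imp fun r hr => hr, sub_self]
  obtain ⟨t', ht', hk⟩ := key i le_rfl
  refine ⟨t', ht', ⟨?_, hk⟩⟩
  rw [← hsupp t']
  exact restr_of_imp' (fun l hl => hl.2) _

/-- The projection onto the elements that are normalized in the slots `1, …, m`, the product of the
projections `1 - κ_l` for the maps `κ_l` that kill the slot `l`. -/
def normalize : ℕ → Slots k g →ₗ[k] Slots k g
  | 0 => LinearMap.id
  | m + 1 => (LinearMap.id - (restr (· ≠ m + 1)).toLinearMap) ∘ₗ normalize m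

omit [CharZero k] in
theorem normalize_succ (m : ℕ) (x : Slots k g) :
    normalize (m + 1) x = normalize m x - restr (· ≠ m + 1) (normalize m x) := rfl

omit [CharZero k] in
theorem normalize_of_normal {m : ℕ} {x : Slots k g}
    (hx : ∀ l, 1 ≤ l → l ≤ m → restr (· ≠ l) x = 0) : normalize m x = x := by
  induction m with
  | zero => rfl
  | succ m ih =>
    rw [normalize_succ, ih fun l h1 h2 => hx l h1 (by omega), hx (m + 1) (by omega) le_rfl, sub_zero]

theorem restr_normalize (l m : ℕ) (x : Slots k g) :
    restr (· ≠ l) (normalize m x) = normalize m (restr (· ≠ l) x) := by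
  induction m with
  | zero => rfl
  | succ m ih =>
    rw [normalize_succ, normalize_succ, map_sub, ← ih, restr_restr, restr_restr]
    congr 1
    exact restr_congr (fun r => and_comm) _

theorem normalize_eq_zero {m l : ℕ} (h1 : 1 ≤ l) (h2 : l ≤ m) {x : Slots k g}
    (hx : restr (· ≠ l) x = x) : normalize m x = 0 := by
  induction m with
  | zero => omega
  | succ m ih =>
    rw [normalize_succ]
    rcases h2.lt_or_eq with h | rfl
    · rw [ih (by omega), map_zero, sub_zero]
    · rw [restr_normalize, hx, sub_self]

/-- The normalized representative of a class of chains is unique. -/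
theorem eq_zero_of_mem_degenerate {i : ℕ} {t : Tens k (Ch k g) i} (ht : t ∈ degenerate k (Ch k g) i)
    (hN : IsNormal i (barOut i (toSlots i t))) : barOut i (toSlots i t) = 0 := by
  rw [← normalize_of_normal hN.kill]
  refine Submodule.span_induction (p := fun t _ => normalize i (barOut i (toSlots i t)) = 0)
    ?_ ?_ ?_ ?_ ht
  · rintro _ ⟨a, ⟨j, hj, ha⟩, rfl⟩
    have hj1 : 1 ≤ (j : ℕ) := Nat.one_le_iff_ne_zero.2 (Fin.val_ne_zero_iff.2 hj)
    have hj2 : (j : ℕ) ≤ i := Nat.le_of_lt_succ j.isLt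
    have h : restr (· ≠ (j : ℕ)) (toSlots i (PiTensorProduct.tprod k a)) =
        toSlots i (PiTensorProduct.tprod k a) := by
      rw [toSlots_tprod, algHom_prod_ofFn]
      congr 2
      funext r
      by_cases hr : r = j
      · subst hr
        rw [ha, map_one, map_one]
      · exact restr_slot_of_mem (· ≠ (j : ℕ)) (fun h => hr (Fin.ext h)) _
    refine normalize_eq_zero hj1 hj2 ?_
    have h' := restr_barOut_kill (i := i) hj2 (toSlots i (PiTensorProduct.tprod k a))
    rwa [h] at h'
  · simp only [map_zero]
  · intro t t' _ _ ht ht'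
    simp only [map_add, ht, ht', add_zero]
  · intro c t _ ht
    simp only [map_smul, ht, smul_zero]

variable {ι : Type*} [Fintype ι] [DecidableEq ι] (b : Module.Basis ι k g)

theorem hkrS_barIn (i : ℕ) (x : Slots k g) :
    hkrS (ι := ι) b i (barIn i x) = ((-1 : k) ^ i / (Nat.factorial i : k)) • symb b i x := by
  rw [hkrS_apply, mulP_prodY_barIn]

theorem hkrN_mk_barOut (i : ℕ) (t : Tens k (Ch k g) i) : hkrN (ι := ι) b i (Submodule.Quotient.mk t) =
    ((-1 : k) ^ i / (Nat.factorial i : k)) • symb b i (barOut i (toSlots i t)) := by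
  rw [hkrN_mk, ← hkrS_barIn, barIn_barOut (restr_toSlots i t)]

/-- Exactness of the bar complex with trivial coefficients, transferred to normalized representatives. -/
theorem nB_exact_of_normal {i : ℕ} {t : Tens k (Ch k g) i} (hN : IsNormal i (barOut i (toSlots i t)))
    (hB : ∀ m, i = m + 1 → modQuot b Finset.univ (modB m (barOut i (toSlots i t))) = 0)
    (hsymb : hkrN (ι := ι) b i (Submodule.Quotient.mk t) = 0) :
    ∃ y, nB i y = (Submodule.Quotient.mk t : NTens k (Ch k g) i) := by
  have hfac : (-1 : k) ^ i / (Nat.factorial i : k) ≠ 0 :=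
    div_ne_zero (pow_ne_zero _ (neg_ne_zero.2 one_ne_zero))
      (Nat.cast_ne_zero.2 (Nat.factorial_ne_zero i))
  rw [hkrN_mk_barOut, smul_eq_zero] at hsymb
  obtain ⟨y, hy, hxy⟩ := modB_exact b i Finset.univ _ hN hB (hsymb.resolve_left hfac)
  set y₀ := modQuot b Finset.univ y with hy₀
  have hy₀N : IsNormal (i + 1) y₀ := isNormal_modQuot b hy _
  have hy₀s : restr (fun l => 1 ≤ l ∧ l ≤ i + 1 + 1) y₀ = y₀ := by
    rw [restr_congr (t := fun l => l ≠ 0 ∧ l ≤ i + 1 + 1) (fun l => by omega), ← restr_restr,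
      hy₀N.supp, hy₀, ← modQuot_univ b, modQuot_modQuot]
  have hts : toSlots (i + 1) (ofSlots (i + 1) (barIn (i + 1) y₀)) = barIn (i + 1) y₀ := by
    rw [toSlots_ofSlots, restr_barIn]
  have hout := barOut_barIn hy₀s
  refine ⟨Submodule.Quotient.mk (ofSlots (i + 1) (barIn (i + 1) y₀)), ?_⟩
  rw [nB, Submodule.mapQ_apply]
  congr 1
  apply toSlots_injective
  rw [toSlots_hochB, hts]
  have hx0 : modQuot b Finset.univ (barOut i (toSlots i t)) = barOut i (toSlots i t) := by
    rw [modQuot_univ, ← restr_barOut (restr_toSlots i t)]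
    exact restr_of_imp' (fun l hl => by omega) _
  have h := barOut_slotB b (restr_barIn (i + 1) y₀) (by rwa [hout])
  rw [hout, hy₀, modQuot_modB_modQuot, ← hxy, hx0, ← hy₀] at h
  have hs : restr (· ≤ i) (slotB i (barIn (i + 1) y₀)) = slotB i (barIn (i + 1) y₀) := by
    rw [← hts, ← toSlots_hochB, restr_toSlots]
  rw [← barIn_barOut hs, h, barIn_barOut (restr_toSlots i t)]

theorem nB_exact_zero (x : NTens k (Ch k g) 0) (h : hkrN (ι := ι) b 0 x = 0) : ∃ y, nB 0 y = x := by
  obtain ⟨t, rfl⟩ := Submodule.Quotient.mk_surjective _ x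
  obtain ⟨t', ht', hN⟩ := exists_normal 0 t
  have e : (Submodule.Quotient.mk t : NTens k (Ch k g) 0) = Submodule.Quotient.mk t' :=
    (Submodule.Quotient.eq _).2 ht'
  rw [e] at h ⊢
  exact nB_exact_of_normal b hN (fun m hm => absurd hm (Nat.succ_ne_zero m).symm) h

theorem nB_exact_succ (m : ℕ) (x : NTens k (Ch k g) (m + 1)) (hx : nB m x = 0)
    (h : hkrN (ι := ι) b (m + 1) x = 0) : ∃ y, nB (m + 1) y = x := by
  obtain ⟨t, rfl⟩ := Submodule.Quotient.mk_surjective _ x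
  obtain ⟨t', ht', hN⟩ := exists_normal (m + 1) t
  have e : (Submodule.Quotient.mk t : NTens k (Ch k g) (m + 1)) = Submodule.Quotient.mk t' :=
    (Submodule.Quotient.eq _).2 ht'
  rw [e] at h hx ⊢
  refine nB_exact_of_normal b hN (fun m' hm' => ?_) h
  obtain rfl : m = m' := Nat.succ_injective hm'
  rw [nB, Submodule.mapQ_apply, Submodule.Quotient.mk_eq_zero] at hx
  have h1 : barOut m (toSlots m (hochB (parity k g) (chMul k g) m t')) =
      modQuot b Finset.univ (modB m (barOut (m + 1) (toSlots (m + 1) t'))) := by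
    rw [toSlots_hochB, barOut_slotB b (restr_toSlots (m + 1) t') hN]
  rw [← h1]
  refine eq_zero_of_mem_degenerate hx ?_
  rw [h1]
  exact isNormal_modQuot b (isNormal_modB hN) _

/-! ### Symmetric tensors -/

/-- The form `ω`, restricted to polynomial degree `i`, as a symmetric tensor in the slots
`1, …, i` with coefficients in the slot `n`. -/
def symTens : ℕ → ℕ → Forms k g ι →ₗ[k] Slots k g
  | 0, n => (slot n).toLinearMap ∘ₗ ((MvPowerSeries.coeff (R := Ch k g) (0 : ι →₀ ℕ)).restrictScalars k)
  | i + 1, n => ∑ c, LinearMap.mulLeft k (gen (i + 1) (b.coord c)) ∘ₗ symTens i n ∘ₗ partialY k g c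

theorem symTens_succ (i n : ℕ) (ω : Forms k g ι) : symTens b (i + 1) n ω =
    ∑ c, gen (i + 1) (b.coord c) * symTens b i n (partialY k g c ω) := by
  simp only [symTens, LinearMap.sum_apply, LinearMap.comp_apply, LinearMap.mulLeft_apply]

theorem restr_symTens (s : ℕ → Prop) [DecidablePred s] {n : ℕ} (hn : s n) (i : ℕ)
    (ω : Forms k g ι) : restr s (symTens b i n ω) =
      if ∀ l, 1 ≤ l → l ≤ i → s l then symTens b i n ω else 0 := by
  induction i generalizing ω with
  | zero =>
    rw [if_pos fun l h1 h2 => by omega]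
    exact restr_slot_of_mem s hn _
  | succ i ih =>
    rw [symTens_succ, map_sum]
    simp only [map_mul, ih, restr_gen]
    by_cases hi : s (i + 1)
    · by_cases hl : ∀ l, 1 ≤ l → l ≤ i → s l
      · simp only [if_pos hi, if_pos hl]
        rw [if_pos]
        intro l h1 h2
        rcases h2.lt_or_eq with h | rfl
        · exact hl l h1 (by omega)
        · exact hi
      · simp only [if_neg hl, mul_zero, Finset.sum_const_zero]
        rw [if_neg fun h => hl fun l h1 h2 => h l h1 (by omega)]
    · simp only [if_neg hi, zero_mul, Finset.sum_const_zero]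
      rw [if_neg fun h => hi (h (i + 1) (by omega) le_rfl)]

/-- Merging two slots of a symmetric tensor gives zero: odd generators anticommute. -/
theorem relabel_symTens (p n : ℕ) {i : ℕ} (h1 : 1 ≤ p) (h2 : p < i) (ω : Forms k g ι) :
    relabel (mergeIdx p) (symTens b i n ω) = 0 := by
  induction i generalizing ω with
  | zero => omega
  | succ i ih =>
    rw [symTens_succ, map_sum]
    rcases (Nat.le_of_lt_succ h2).lt_or_eq with h | rfl
    · refine Finset.sum_eq_zero fun c _ => ?_
      rw [map_mul, ih h, mul_zero]
    · obtain ⟨q, rfl⟩ := Nat.exists_eq_add_of_le' h1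
      have e : ∀ c, relabel (mergeIdx (q + 1)) (gen (q + 1 + 1) (b.coord c) *
          symTens b (q + 1) n (partialY k g c ω)) =
          ∑ d, gen (q + 1) (b.coord c) * (gen (q + 1) (b.coord d) *
            relabel (mergeIdx (q + 1)) (symTens b q n (partialY k g d (partialY k g c ω)))) := by
        intro c
        rw [symTens_succ, map_mul, map_sum, Finset.mul_sum]
        refine Finset.sum_congr rfl fun d _ => ?_
        rw [map_mul, relabel_gen, relabel_gen, mergeIdx, if_neg (by omega), mergeIdx, if_pos le_rfl]
        rfl
      rw [Finset.sum_congr rfl fun c _ => e c]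
      refine sum_sum_antisymm (k := k) _ fun c d => ?_
      have hc : partialY k g d (partialY k g c ω) = partialY k g c (partialY k g d ω) :=
        pdY_pdY d c ω
      have hg : (gen (q + 1) (b.coord c) * gen (q + 1) (b.coord d) : Slots k g) =
          -(gen (q + 1) (b.coord d) * gen (q + 1) (b.coord c)) := ι_mul_ι_comm _ _
      rw [← mul_assoc, hg, hc, neg_mul, mul_assoc]

/-- Euler's formula. -/
theorem sum_X_partialY {m : ℕ} {ω : Forms k g ι} (h : IsHomog m ω) :
    ∑ c, mulS (MvPowerSeries.X c : MvPowerSeries ι k) (partialY k g c ω) = (m : k) • ω := by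
  have hX : ∀ (c : ι) (η : Forms k g ι) (n : ι →₀ ℕ), MvPowerSeries.coeff n
      (mulS (MvPowerSeries.X c : MvPowerSeries ι k) (partialY k g c ω)) =
      (n c : k) • MvPowerSeries.coeff n ω := by
    intro c η n
    rw [mulS_apply, MvPowerSeries.map_X]
    by_cases hc : n c = 0
    · rw [hc, Nat.cast_zero, zero_smul, MvPowerSeries.X_def, MvPowerSeries.coeff_monomial_mul,
        if_neg]
      intro hle
      have := hle c
      rw [Finsupp.single_eq_same, hc] at this
      omega
    · obtain ⟨n', rfl⟩ : ∃ n', n = Finsupp.single c 1 + n' :=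
        ⟨n - Finsupp.single c 1, (add_tsub_cancel_of_le (Finsupp.single_le_iff.2
          (Nat.one_le_iff_ne_zero.2 hc))).symm⟩
      rw [MvPowerSeries.X_def, MvPowerSeries.coeff_add_monomial_mul, one_mul]
      refine (coeff_pdY c ω n').trans ?_
      rw [Finsupp.add_apply, Finsupp.single_eq_same, add_comm n', Nat.cast_add, Nat.cast_one,
        add_comm (1 : k)]
  refine MvPowerSeries.ext fun n => ?_
  rw [map_sum, Finset.sum_congr rfl fun c _ => hX c ω n, ← Finset.sum_smul, coeff_ksmul]
  by_cases hn : n.degree = m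
  · rw [← hn, Finsupp.degree_eq_sum, Nat.cast_sum]
  · rw [h n hn, smul_zero, smul_zero]

variable (k g ι) in
/-- The augmentation of all slots but `n`. -/
def augAt (n : ℕ) : SlotForms k g ι →ₗ[k] Forms k g ι :=
  cmap (slotProd.comp (restr (· = n))).toLinearMap

/-- The symbol of the symmetric tensor of `ω` is `i!` times the component of `ω` of degree `i`. -/
theorem prodY_symTens {i n : ℕ} (hn : i < n) (ω : Forms k g ι) :
    augAt k g ι n (prodY k ι b i (cstS k g ι (symTens b i n ω))) =
      (Nat.factorial i : k) • homog (k := k) i ω := by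
  induction i generalizing ω with
  | zero =>
    rw [Nat.factorial_zero, Nat.cast_one, one_smul]
    have e : homog (k := k) 0 ω = cst (k := k) (ι := ι) (MvPowerSeries.coeff (0 : ι →₀ ℕ) ω) := by
      refine MvPowerSeries.ext fun m => ?_
      rw [coeff_homog, coeff_cst]
      by_cases hm : m = 0
      · rw [if_pos hm, hm, map_zero, if_pos rfl]
      · rw [if_neg hm, if_neg (fun h => hm ((Finsupp.degree_eq_zero_iff m).1 h))]
    rw [e]
    refine (cmap_cst (slotProd.comp (restr (· = n))).toLinearMap _).trans (congrArg _ ?_)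
    change slotProd (restr (· = n) (slot n _)) = _
    rw [restr_slot_of_mem (· = n) rfl, slotProd_slot]
    rfl
  | succ i ih =>
    have h1 : dY k ι b (i + 1) (cstS k g ι (symTens b (i + 1) n ω)) =
        ∑ c, mS (MvPowerSeries.X c) (cstS k g ι (symTens b i n (partialY k g c ω))) := by
      rw [dY, dV, LinearMap.sum_apply]
      refine Finset.sum_congr rfl fun c _ => ?_
      rw [Module.End.mul_apply]
      congr 1
      refine (cmap_cst (dslot (b c) (i + 1)) _).trans (congrArg (cstS k g ι) ?_)
      rw [symTens_succ, map_sum, Finset.sum_eq_single c]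
      · have h0 : dslot (b c) (i + 1) (symTens b i n (partialY k g c ω)) = 0 := by
          have := dslot_restr (· ≠ i + 1) (b c) (i + 1) (symTens b i n (partialY k g c ω))
          rwa [restr_symTens b (· ≠ i + 1) (by omega), if_pos (fun l h1 h2 => by omega),
            if_neg (not_not.2 rfl)] at this
        rw [dslot_gen_mul, if_pos rfl, h0, mul_zero, sub_zero, Module.Basis.coord_apply,
          Module.Basis.repr_self, Finsupp.single_eq_same, one_smul]
      · intro d _ hd
        have h0 : dslot (b c) (i + 1) (symTens b i n (partialY k g d ω)) = 0 := by
          have := dslot_restr (· ≠ i + 1) (b c) (i + 1) (symTens b i n (partialY k g d ω))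
          rwa [restr_symTens b (· ≠ i + 1) (by omega), if_pos (fun l h1 h2 => by omega),
            if_neg (not_not.2 rfl)] at this
        rw [dslot_gen_mul, h0, mul_zero, sub_zero, Module.Basis.coord_apply,
          Module.Basis.repr_self, Finsupp.single_eq_of_ne hd, ite_self, zero_smul]
      · exact fun h => absurd (Finset.mem_univ c) h
    have hmS : ∀ (f : MvPowerSeries ι k) m, prodY k ι b m * mS f = mS f * prodY k ι b m := by
      intro f m
      induction m with
      | zero => rw [prodY, one_mul, mul_one]
      | succ m ihm => rw [prodY, mul_assoc, dY, dV_mS, ← mul_assoc, ihm, mul_assoc]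
    rw [prodY, Module.End.mul_apply, h1, map_sum, map_sum]
    have h2 : ∀ c, augAt k g ι n (prodY k ι b i
        (mS (MvPowerSeries.X c) (cstS k g ι (symTens b i n (partialY k g c ω))))) =
        mulS (MvPowerSeries.X c : MvPowerSeries ι k)
          ((Nat.factorial i : k) • homog (k := k) i (partialY k g c ω)) := by
      intro c
      rw [← Module.End.mul_apply (prodY k ι b i), hmS, Module.End.mul_apply, ← ih (by omega)]
      exact cmap_mulS (slotProd.comp (restr (· = n))).toLinearMap _ _
    have h3 : ∀ c, homog (k := k) i (partialY k g c ω) = partialY k g c (homog (k := k) (i + 1) ω) :=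
      fun c => homog_pdY i c ω
    rw [Finset.sum_congr rfl fun c _ => h2 c]
    simp only [map_smul, h3]
    rw [← Finset.smul_sum, sum_X_partialY (isHomog_homog (i + 1) ω), smul_smul, Nat.factorial_succ,
      mul_comm, Nat.cast_mul]

/-- The section of the Hochschild–Kostant–Rosenberg map by symmetric tensors. -/
def hkrInv (i : ℕ) : Forms k g ι →ₗ[k] NTens k (Ch k g) i :=
  (-1 : k) ^ i • (degenerate k (Ch k g) i).mkQ ∘ₗ ofSlots i ∘ₗ (barIn i).toLinearMap ∘ₗ
    symTens b i (i + 1)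

theorem hkrInv_apply (i : ℕ) (ω : Forms k g ι) : hkrInv b i ω = (-1 : k) ^ i •
    Submodule.Quotient.mk (ofSlots i (barIn i (symTens b i (i + 1) ω))) := rfl

theorem toSlots_barIn_symTens (i : ℕ) (x : Slots k g) :
    toSlots i (ofSlots i (barIn i x)) = barIn i x := by
  rw [toSlots_ofSlots, restr_barIn]

theorem hkrN_hkrInv (i : ℕ) (ω : Forms k g ι) : hkrN b i (hkrInv b i ω) = homog (k := k) i ω := by
  have h : symb b i (symTens b i (i + 1) ω) = (Nat.factorial i : k) • homog (k := k) i ω :=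
    prodY_symTens b (Nat.lt_succ_self i) ω
  have hf : (Nat.factorial i : k) ≠ 0 := Nat.cast_ne_zero.2 (Nat.factorial_ne_zero i)
  rw [hkrInv_apply, map_smul, hkrN_mk, toSlots_barIn_symTens, hkrS_barIn, h, smul_smul, smul_smul,
    mul_assoc, div_mul_cancel₀ _ hf, ← mul_pow, neg_one_mul, neg_neg, one_pow, one_smul]

/-- Symmetric tensors are Hochschild cycles. -/
theorem nB_hkrInv (m : ℕ) (ω : Forms k g ι) : nB m (hkrInv b (m + 1) ω) = 0 := by
  rw [hkrInv_apply, map_smul, nB, Submodule.mapQ_apply, smul_eq_zero]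
  right
  rw [show hochB (parity k g) (chMul k g) m (ofSlots (m + 1) (barIn (m + 1)
    (symTens b (m + 1) (m + 1 + 1) ω))) = 0 from ?_, Submodule.Quotient.mk_zero]
  set z := symTens b (m + 1) (m + 1 + 1) ω with hz
  have hzs : restr (fun l => 1 ≤ l ∧ l ≤ m + 1 + 1) z = z := by
    rw [hz, restr_symTens b (fun l => 1 ≤ l ∧ l ≤ m + 1 + 1) (by omega),
      if_pos (fun l h1 h2 => by omega)]
  have hN : IsNormal (m + 1) z := by
    refine ⟨?_, fun l h1 h2 => ?_⟩
    · rw [hz, restr_symTens b (· ≤ m + 1 + 1) le_rfl, if_pos (fun l h1 h2 => by omega)]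
    · rw [hz, restr_symTens b (· ≠ l) (by omega), if_neg fun h => h l h1 h2 rfl]
  have hout := barOut_barIn hzs
  have h := barOut_slotB b (restr_barIn (m + 1) z) (by rwa [hout])
  have h0 : modQuot b Finset.univ (modB m z) = 0 := by
    rw [modB_apply, map_sum]
    refine Finset.sum_eq_zero fun p hp => ?_
    rw [Finset.mem_range] at hp
    rw [map_smul, smul_eq_zero]
    right
    rcases Nat.eq_zero_or_pos p with rfl | hp0
    · rw [modQuot_univ, restr_relabel, hN.restr_eq_zero le_rfl (Nat.le_add_left 1 m), map_zero]
      simp [mergeIdx]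
    · rw [hz, relabel_symTens b p _ hp0 hp, map_zero]
  rw [hout, h0] at h
  apply toSlots_injective
  rw [toSlots_hochB, toSlots_barIn_symTens, map_zero]
  have hs : restr (· ≤ m) (slotB m (barIn (m + 1) z)) = slotB m (barIn (m + 1) z) := by
    rw [← toSlots_barIn_symTens, ← toSlots_hochB, restr_toSlots]
  rw [← barIn_barOut hs, h, map_zero]

end HochschildExact

/-! ### Gradings as eigenspaces of scaling operators -/

section Scaling

variable {k : Type*} [Field k] {M N P : Type*} [AddCommGroup M] [Module k M]
  [AddCommGroup N] [Module k N] [AddCommGroup P] [Module k P]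

/-- The part of degree `n` of the grading `G` is the eigenspace of `S` for the eigenvalue `2^n`. -/
def IsScaling (G : ℤ → Submodule k M) (S : M →ₗ[k] M) : Prop :=
  ∀ n x, x ∈ G n ↔ S x = (2 : k) ^ n • x

/-- `T` raises degrees by `p`, in terms of the scaling operators `S` and `S'`. -/
def Scales (S : M →ₗ[k] M) (S' : N →ₗ[k] N) (p : ℤ) (T : M →ₗ[k] N) : Prop :=
  ∀ x, S' (T x) = (2 : k) ^ p • T (S x)

variable {S : M →ₗ[k] M} {S' : N →ₗ[k] N} {S'' : P →ₗ[k] P} {p q : ℤ}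

theorem Scales.add {T U : M →ₗ[k] N} (hT : Scales S S' p T) (hU : Scales S S' p U) :
    Scales S S' p (T + U) := fun x => by
  rw [LinearMap.add_apply, LinearMap.add_apply, map_add, hT, hU, smul_add]

theorem Scales.smul {T : M →ₗ[k] N} (hT : Scales S S' p T) (c : k) : Scales S S' p (c • T) :=
  fun x => by rw [LinearMap.smul_apply, LinearMap.smul_apply, map_smul, hT, smul_comm]

theorem Scales.sum {α : Type*} {s : Finset α} {T : α → M →ₗ[k] N}
    (hT : ∀ a, Scales S S' p (T a)) : Scales S S' p (∑ a ∈ s, T a) := fun x => by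
  simp only [LinearMap.sum_apply, map_sum, hT _ x, Finset.smul_sum]

variable [CharZero k]

theorem Scales.comp {T : M →ₗ[k] N} {U : N →ₗ[k] P} (hU : Scales S' S'' q U) (hT : Scales S S' p T)
    {r : ℤ} (hr : q + p = r) : Scales S S'' r (U ∘ₗ T) := fun x => by
  rw [LinearMap.comp_apply, hU, hT, map_smul, smul_smul, ← zpow_add₀ two_ne_zero, hr]
  rfl

theorem Scales.hasDegree {G : ℤ → Submodule k M} {G' : ℤ → Submodule k N} (hG : IsScaling G S)
    (hG' : IsScaling G' S') {T : M →ₗ[k] N} (hT : Scales S S' p T) : HasDegree G G' p T :=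
  fun m x hx => by
    rw [hG', hT, (hG m x).1 hx, map_smul, smul_smul, ← zpow_add₀ two_ne_zero, add_comm]

theorem zpow_two_injective : Function.Injective fun n : ℤ => (2 : k) ^ n := by
  intro m n h
  have h' : ((2 : ℚ) ^ m : ℚ) = (2 : ℚ) ^ n := by
    have : (((2 : ℚ) ^ m : ℚ) : k) = ((2 : ℚ) ^ n : ℚ) := by push_cast; exact h
    exact_mod_cast this
  exact zpow_right_injective₀ two_pos (by norm_num) h'

theorem iSupIndep_of_scaling {G : ℤ → Submodule k M}
    (h : ∀ n, ∀ x ∈ G n, S x = (2 : k) ^ n • x) : iSupIndep G :=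
  (((Module.End.eigenspaces_iSupIndep S).comp (zpow_two_injective (k := k))).mono
    (fun n x hx => Module.End.mem_eigenspace_iff.2 (h n x hx)))

/-- If the parts of `G` lie in the eigenspaces and span, they are the eigenspaces. -/
theorem isScaling_of_iSup_eq_top {G : ℤ → Submodule k M}
    (h : ∀ n, ∀ x ∈ G n, S x = (2 : k) ^ n • x) (htop : ⨆ n, G n = ⊤) : IsScaling G S := by
  refine fun m x => ⟨h m x, fun hx => ?_⟩
  set E : ℤ → Submodule k M := fun n => Module.End.eigenspace S ((2 : k) ^ n) with hE
  have hle : ∀ n, G n ≤ E n := fun n x hx => Module.End.mem_eigenspace_iff.2 (h n x hx)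
  have hind : iSupIndep E := (Module.End.eigenspaces_iSupIndep S).comp (zpow_two_injective (k := k))
  have h1 : G m ⊔ ⨆ n, ⨆ (_ : n ≠ m), G n = ⊤ := by
    rw [eq_top_iff, ← htop]
    refine iSup_le fun n => ?_
    by_cases hn : n = m
    · subst hn
      exact le_sup_left
    · exact (le_iSup₂ (f := fun n (_ : n ≠ m) => G n) n hn).trans le_sup_right
  -- eigenspaces are independent; the modular law then cuts `E m` down to `G m`
  have h2 : (⨆ n, ⨆ (_ : n ≠ m), G n) ⊓ E m ≤ ⊥ := by
    refine (hind m).symm.le_bot.trans' (inf_le_inf_right _ ?_)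
    exact iSup₂_mono fun n _ => hle n
  have h3 : (G m ⊔ ⨆ n, ⨆ (_ : n ≠ m), G n) ⊓ E m ≤ G m := by
    rw [sup_inf_assoc_of_le _ (hle m)]
    exact sup_le le_rfl (h2.trans bot_le)
  refine h3 ?_
  rw [h1, top_inf_eq]
  exact Module.End.mem_eigenspace_iff.2 hx

/-- A map of degree `0` has a generalized inverse of degree `0`. -/
theorem exists_graded_section {G : ℤ → Submodule k M} {G' : ℤ → Submodule k N} (hG' : IsScaling G' S')
    (htop : ⨆ n, G n = ⊤) (htop' : ⨆ n, G' n = ⊤) {f : M →ₗ[k] N} (hf : HasDegree G G' 0 f) :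
    ∃ σ : N →ₗ[k] M, HasDegree G' G 0 σ ∧ ∀ x, f (σ (f x)) = f x := by
  have hs : ∀ n, ∃ s : N →ₗ[k] M, (∀ y, s y ∈ G n) ∧ ∀ x ∈ G n, f (s (f x)) = f x := by
    intro n
    obtain ⟨r, hr⟩ := (f.domRestrict (G n)).rangeRestrict.exists_rightInverse_of_surjective
      (LinearMap.range_rangeRestrict _)
    obtain ⟨s, hs⟩ := r.exists_extend
    refine ⟨(G n).subtype ∘ₗ s, fun y => (s y).2, fun x hx => ?_⟩
    set y : LinearMap.range (f.domRestrict (G n)) := ⟨f x, ⟨x, hx⟩, rfl⟩ with hy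
    have h1 : s (f x) = r y := LinearMap.congr_fun hs y
    have h2 := congrArg Subtype.val (LinearMap.congr_fun hr y)
    change f ((s (f x) : G n) : M) = f x
    rw [h1]
    exact h2
  choose s hsG hsf using hs
  have hint : DirectSum.IsInternal G' := DirectSum.isInternal_submodule_of_iSupIndep_of_iSup_eq_top
    (iSupIndep_of_scaling fun n x hx => (hG' n x).1 hx) htop'
  set E := LinearEquiv.ofBijective (DirectSum.coeLinearMap G') hint with hE
  set σ : N →ₗ[k] M := DirectSum.toModule k ℤ M (fun n => s n ∘ₗ (G' n).subtype) ∘ₗ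
    E.symm.toLinearMap with hσ
  have hσn : ∀ n, ∀ y ∈ G' n, σ y = s n y := by
    intro n y hy
    have h : E.symm y = DirectSum.lof k ℤ (fun n => G' n) n ⟨y, hy⟩ := by
      rw [LinearEquiv.symm_apply_eq]
      exact (DirectSum.coeLinearMap_lof G' n ⟨y, hy⟩).symm
    rw [hσ, LinearMap.comp_apply, LinearEquiv.coe_coe, h, DirectSum.toModule_lof]
    rfl
  refine ⟨σ, fun n y hy => ?_, fun x => ?_⟩
  · rw [hσn n y hy, add_zero]
    exact hsG n y
  · have hx : x ∈ ⨆ n, G n := by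
      rw [htop]
      trivial
    refine Submodule.iSup_induction G (motive := fun x => f (σ (f x)) = f x) hx ?_ ?_ ?_
    · intro n x hx
      have h := hf n x hx
      rw [add_zero] at h
      rw [hσn n _ h, hsf n x hx]
    · rw [map_zero, map_zero, map_zero]
    · intro x y hx hy
      rw [map_add, map_add, map_add, hx, hy]

end Scaling

/-! ### Degrees of the operators -/

section Degrees

variable {k : Type*} [Field k] {M N : Type*} [AddCommGroup M] [Module k M]
  [AddCommGroup N] [Module k N]

/-- The scaling operator of an exterior algebra, the automorphism with `v ↦ 2 v`. -/
def scal : ExteriorAlgebra k M →ₐ[k] ExteriorAlgebra k M := ExteriorAlgebra.map ((2 : k) • LinearMap.id)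

theorem scal_ι (v : M) : scal (ExteriorAlgebra.ι k v) = (2 : k) • ExteriorAlgebra.ι k v := by
  rw [scal, ExteriorAlgebra.map_apply_ι, LinearMap.smul_apply, LinearMap.id_apply, map_smul]

theorem scal_map (f : M →ₗ[k] N) (x : ExteriorAlgebra k M) :
    scal (ExteriorAlgebra.map f x) = ExteriorAlgebra.map f (scal x) := by
  have h : scal.comp (ExteriorAlgebra.map f) = (ExteriorAlgebra.map f).comp scal := by
    refine ExteriorAlgebra.hom_ext (LinearMap.ext fun v => ?_)
    simp [scal_ι]
  exact AlgHom.congr_fun h x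

theorem scal_of_mem {n : ℕ} {x : ExteriorAlgebra k M} (hx : x ∈ ⋀[k]^n M) :
    scal x = (2 : k) ^ n • x := by
  rw [← ExteriorAlgebra.ιMulti_span_fixedDegree] at hx
  refine Submodule.span_induction (p := fun x _ => scal x = (2 : k) ^ n • x) ?_ ?_ ?_ ?_ hx
  · rintro _ ⟨v, rfl⟩
    rw [scal, ExteriorAlgebra.map_apply_ιMulti]
    change ExteriorAlgebra.ιMulti k n (fun i => (2 : k) • v i) = _
    exact ((ExteriorAlgebra.ιMulti k n).map_smul_univ (fun _ => (2 : k)) v).trans (by simp)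
  · rw [map_zero, smul_zero]
  · intro x y _ _ hx hy
    rw [map_add, hx, hy, smul_add]
  · intro c x _ hx
    rw [map_smul, hx, smul_comm]

variable [CharZero k]

theorem scales_contr (d : Module.Dual k M) :
    Scales (scal (M := M)).toLinearMap (scal (M := M)).toLinearMap (-1) (contr d) := fun x => by
  have h : contr d (scal x) = (2 : k) • scal (contr d x) := by
    rw [scal, contr_map, LinearMap.comp_smul, LinearMap.comp_id, contr, map_smul,
      LinearMap.smul_apply, map_smul]
  change scal (contr d x) = (2 : k) ^ (-1 : ℤ) • contr d (scal x)
  rw [h, smul_smul, zpow_neg_one, inv_mul_cancel₀ two_ne_zero, one_smul]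

theorem scales_mulLeft_ι (v : M) : Scales (scal (M := M)).toLinearMap (scal (M := M)).toLinearMap 1
    (LinearMap.mulLeft k (ExteriorAlgebra.ι k v)) := fun x => by
  change scal (_ * x) = (2 : k) ^ (1 : ℤ) • (_ * scal x)
  rw [map_mul, scal_ι, zpow_one, smul_mul_assoc]

theorem scales_map (f : M →ₗ[k] N) : Scales (scal (M := M)).toLinearMap (scal (M := N)).toLinearMap 0
    (ExteriorAlgebra.map f).toLinearMap := fun x => by
  rw [zpow_zero, one_smul]
  exact scal_map f x

variable {ι : Type*} {R R' : Type*} [Ring R] [Algebra k R] [Ring R'] [Algebra k R']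

omit [CharZero k] in
theorem Scales.cmap {S : R →ₗ[k] R} {S' : R' →ₗ[k] R'} {p : ℤ} {T : R →ₗ[k] R'}
    (h : Scales S S' p T) : Scales (cmap (ι := ι) S) (cmap S') p (cmap T) := fun ω =>
  MvPowerSeries.ext fun n => h (MvPowerSeries.coeff n ω)

omit [CharZero k] in
theorem scales_mulS (S : R →ₗ[k] R) (f : MvPowerSeries ι k) :
    Scales (cmap (ι := ι) S) (CEHochschild.cmap S) 0 (mulS f) := fun ω => by
  rw [zpow_zero, one_smul, cmap_mulS]

omit [CharZero k] in
theorem scales_pdY (S : R →ₗ[k] R) (i : ι) :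
    Scales (cmap (ι := ι) S) (CEHochschild.cmap S) 0 (pdY k i) := fun ω => by
  rw [zpow_zero, one_smul, cmap_pdY]

end Degrees

section HochschildDegrees

variable {k : Type*} [Field k] [CharZero k] {g : Type*} [LieRing g] [LieAlgebra k g]

variable (k g) in
/-- The scaling operator of `Ch(g)`. -/
abbrev scalCh : Ch k g →ₗ[k] Ch k g := (scal (k := k) (M := Module.Dual k g)).toLinearMap

variable (k g) in
/-- The scaling operator of the slot algebra. -/
abbrev scalSlots : Slots k g →ₗ[k] Slots k g := (scal (k := k) (M := ℕ →₀ Module.Dual k g)).toLinearMap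

/-- The scaling operator of the tensor power of `Ch(g)`. -/
def scalTens (i : ℕ) : Tens k (Ch k g) i →ₗ[k] Tens k (Ch k g) i :=
  PiTensorProduct.map fun _ => scalCh k g

omit [CharZero k] in
theorem scalTens_tprod (i : ℕ) (a : Fin (i + 1) → Ch k g) : scalTens i (PiTensorProduct.tprod k a) =
    PiTensorProduct.tprod k fun j => scal (a j) := PiTensorProduct.map_tprod _ _

/-- The scaling operator of normalized chains. -/
def scalN (i : ℕ) : NTens k (Ch k g) i →ₗ[k] NTens k (Ch k g) i :=
  Submodule.mapQ _ _ (scalTens i) <| by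
    refine Submodule.span_le.2 ?_
    rintro _ ⟨a, ⟨j, hj, ha⟩, rfl⟩
    change scalTens i (PiTensorProduct.tprod k a) ∈ degenerate k (Ch k g) i
    rw [scalTens_tprod]
    exact tprod_mem_degenerate j hj (by rw [ha, map_one])

omit [CharZero k] in
theorem toSlots_scalTens (i : ℕ) (t : Tens k (Ch k g) i) :
    toSlots i (scalTens i t) = scal (toSlots i t) := by
  have h : toSlots i ∘ₗ scalTens i = scalSlots k g ∘ₗ toSlots i := by
    refine PiTensorProduct.ext (MultilinearMap.ext fun a => ?_)
    change toSlots i (scalTens i (PiTensorProduct.tprod k a)) = scal (toSlots i _)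
    rw [scalTens_tprod, toSlots_tprod, toSlots_tprod, algHom_prod_ofFn]
    congr 2
    funext r
    exact (scal_map _ _).symm
  exact LinearMap.congr_fun h t

omit [CharZero k] in
theorem chDeg_le_scaling (m : ℤ) (x : Ch k g) (hx : x ∈ ⨆ (p : ℕ) (_ : (p : ℤ) = m), chDeg k g p) :
    scalCh k g x = (2 : k) ^ m • x := by
  have h : ⨆ (p : ℕ) (_ : (p : ℤ) = m), chDeg k g p ≤
      Module.End.eigenspace (scalCh k g) ((2 : k) ^ m) := by
    refine iSup₂_le fun p hp y hy => Module.End.mem_eigenspace_iff.2 ?_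
    subst hp
    rw [zpow_natCast]
    exact scal_of_mem hy
  exact Module.End.mem_eigenspace_iff.1 (h hx)

theorem isScaling_chDeg : IsScaling (fun m : ℤ => ⨆ (p : ℕ) (_ : (p : ℤ) = m), chDeg k g p)
    (scalCh k g) := by
  refine isScaling_of_iSup_eq_top chDeg_le_scaling ?_
  rw [eq_top_iff, ← (DirectSum.Decomposition.isInternal
    (fun p : ℕ => ⋀[k]^p (Module.Dual k g))).submodule_iSup_eq_top]
  exact iSup_le fun p => le_iSup_of_le (p : ℤ) (le_iSup₂_of_le p rfl le_rfl)

theorem isScaling_formsDeg {ι : Type*} : IsScaling (formsDeg k g ι) (cmap (scalCh k g)) := by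
  intro m ω
  refine ⟨fun h => MvPowerSeries.ext fun n => (isScaling_chDeg m _).1 (h n), fun h n => ?_⟩
  refine (isScaling_chDeg m _).2 ?_
  exact congrArg (MvPowerSeries.coeff n) h

variable (k g) in
/-- The grading of normalized chains of length `i` by internal degree. -/
def ntensDeg (i : ℕ) (n : ℤ) : Submodule k (NTens k (Ch k g) i) :=
  (tensDeg (chDeg k g) i n).map (degenerate k (Ch k g) i).mkQ

omit [CharZero k] in
theorem iSup_ntensDeg (i : ℕ) : ⨆ n, ntensDeg k g i n = ⊤ := by
  classical
  have h : ⨆ n, tensDeg (chDeg k g) i n = ⊤ := by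
    rw [eq_top_iff, ← PiTensorProduct.span_tprod_eq_top]
    refine Submodule.span_le.2 ?_
    rintro _ ⟨a, rfl⟩
    have ha : a = fun j => ∑ p ∈ (DirectSum.decompose (fun p : ℕ => ⋀[k]^p (Module.Dual k g)) (a j)).support,
        (DirectSum.decompose (fun p : ℕ => ⋀[k]^p (Module.Dual k g)) (a j) p : Ch k g) :=
      funext fun j => (DirectSum.sum_support_decompose _ (a j)).symm
    rw [ha, MultilinearMap.map_sum_finset]
    refine sum_mem fun r _ => ?_
    exact Submodule.mem_iSup_of_mem ((∑ j, r j : ℕ) : ℤ)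
      (Submodule.subset_span ⟨_, r, fun j => SetLike.coe_mem _, rfl, rfl⟩)
  simp only [ntensDeg]
  rw [← Submodule.map_iSup, h, Submodule.map_top, Submodule.range_mkQ]

theorem isScaling_ntensDeg (i : ℕ) : IsScaling (ntensDeg k g i) (scalN i) := by
  refine isScaling_of_iSup_eq_top ?_ (iSup_ntensDeg i)
  rintro n _ ⟨t, ht, rfl⟩
  refine Submodule.span_induction (p := fun (t : Tens k (Ch k g) i) _ =>
    scalN i ((degenerate k (Ch k g) i).mkQ t) =
    (2 : k) ^ n • (degenerate k (Ch k g) i).mkQ t) ?_ ?_ ?_ ?_ ht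
  · rintro _ ⟨a, p, hp, hn, rfl⟩
    change Submodule.Quotient.mk (scalTens i (PiTensorProduct.tprod k a)) =
      (2 : k) ^ n • Submodule.Quotient.mk _
    rw [scalTens_tprod]
    have h : (fun j => scal (a j)) = fun j => (2 : k) ^ p j • a j :=
      funext fun j => scal_of_mem (hp j)
    rw [h, MultilinearMap.map_smul_univ, Submodule.Quotient.mk_smul, Finset.prod_pow_eq_pow_sum, ← hn,
      zpow_natCast]
  · rw [map_zero, map_zero, smul_zero]
  · intro x y _ _ hx hy
    rw [map_add, map_add, hx, hy, smul_add]
  · intro c x _ hx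
    rw [map_smul, map_smul, hx, smul_comm]

omit [CharZero k] in
theorem scalN_mk (i : ℕ) (t : Tens k (Ch k g) i) :
    scalN i (Submodule.Quotient.mk t) = Submodule.Quotient.mk (scalTens i t) := rfl

theorem scales_nB (i : ℕ) : Scales (scalN (k := k) (g := g) (i + 1)) (scalN i) 0 (nB i) := by
  intro x
  obtain ⟨t, rfl⟩ := Submodule.Quotient.mk_surjective _ x
  rw [zpow_zero, one_smul, scalN_mk, nB, Submodule.mapQ_apply, Submodule.mapQ_apply, scalN_mk]
  congr 1
  apply toSlots_injective
  rw [toSlots_scalTens, toSlots_hochB, toSlots_hochB, toSlots_scalTens, slotB_apply, slotB_apply, map_sum]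
  refine Finset.sum_congr rfl fun p _ => ?_
  rw [map_smul]
  congr 1
  exact scal_map _ _

variable {ι : Type*} [Fintype ι] (b : Module.Basis ι k g)

theorem scales_chD : Scales (scalCh k g) (scalCh k g) 1 (chD b) := by
  refine Scales.smul (Scales.sum fun i => Scales.sum fun j => ?_) _
  have h : LinearMap.mulLeft k (xi b i * xi b j) =
      LinearMap.mulLeft k (xi b i) ∘ₗ LinearMap.mulLeft k (xi b j) :=
    LinearMap.ext fun x => mul_assoc _ _ _
  rw [h]
  exact ((scales_mulLeft_ι _).comp (scales_mulLeft_ι _) rfl).comp (scales_contr _) (by norm_num)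

theorem scales_slotD : Scales (scalSlots k g) (scalSlots k g) 1 (slotD b) := by
  intro x
  have h : scalSlots k g ∘ₗ slotD b = (2 : k) • (slotD b ∘ₗ scalSlots k g) := by
    refine slotsHom_ext ?_ fun l v x hx => ?_
    · change scal (slotD b 1) = (2 : k) • slotD b (scal 1)
      rw [map_one scal, slotD_one, map_zero, smul_zero]
    · change scal (slotD b x) = (2 : k) • slotD b (scal x) at hx
      change scal (slotD b (gen l v * x)) = (2 : k) • slotD b (scal (gen l v * x))
      have hg : scal (gen l v) = (2 : k) • gen l v := scal_ι _
      have hv := scales_chD b (ExteriorAlgebra.ι k v)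
      change scal (chD b _) = (2 : k) ^ (1 : ℤ) • chD b (scal (ExteriorAlgebra.ι k v)) at hv
      rw [scal_ι, map_smul, zpow_one] at hv
      have hs : scal (slot l (chD b (ExteriorAlgebra.ι k v))) =
          slot l (scal (chD b (ExteriorAlgebra.ι k v))) := scal_map _ _
      rw [slotD_gen_mul, map_sub, map_mul, map_mul, map_mul, hx, hg, hs, hv,
        smul_mul_assoc (2 : k) (gen l v) (scal x), map_smul (slotD b), slotD_gen_mul]
      simp only [map_smul, smul_mul_assoc, mul_smul_comm, smul_sub]
  rw [zpow_one]
  exact LinearMap.congr_fun h x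

theorem scales_nD (i : ℕ) : Scales (scalN i) (scalN i) 1 (nD b i) := by
  intro x
  obtain ⟨t, rfl⟩ := Submodule.Quotient.mk_surjective _ x
  rw [scalN_mk, nD, Submodule.mapQ_apply, Submodule.mapQ_apply, scalN_mk, ← Submodule.Quotient.mk_smul]
  congr 1
  apply toSlots_injective
  rw [toSlots_scalTens, toSlots_tensD, map_smul, toSlots_tensD, toSlots_scalTens]
  exact scales_slotD b _

variable (k g ι) in
/-- The scaling operator of `SlotForms`. -/
def scalS : SlotForms k g ι →ₗ[k] SlotForms k g ι := cmap (scalSlots k g)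

omit [Fintype ι] in
theorem scales_dS (x : g) (l : ℕ) : Scales (scalS k g ι) (scalS k g ι) (-1) (dS k ι x l) :=
  (scales_contr _).cmap

theorem scales_dY (l : ℕ) : Scales (scalS k g ι) (scalS k g ι) (-1) (dY k ι b l) :=
  Scales.sum fun c => (scales_mulS (scalSlots k g) (MvPowerSeries.X c)).comp (scales_dS (b c) l) rfl

theorem scales_prodY (i : ℕ) : Scales (scalS k g ι) (scalS k g ι) (-i) (prodY k ι b i) := by
  induction i with
  | zero => exact fun x => by simp [prodY]
  | succ i ih => exact ih.comp (scales_dY b (i + 1)) (by push_cast; ring)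

omit [Fintype ι] in
theorem scales_cstS : Scales (scalSlots k g) (scalS k g ι) 0 (cstS k g ι) := fun x => by
  rw [zpow_zero, one_smul]
  exact cmap_cst _ x

omit [Fintype ι] in
theorem scales_mulP : Scales (scalS k g ι) (cmap (scalCh k g)) 0 (mulP k g ι) := (scales_map _).cmap

theorem scales_hkrN (i : ℕ) : Scales (scalN i) (cmap (scalCh k g)) (-i) (hkrN b i) := by
  intro x
  obtain ⟨t, rfl⟩ := Submodule.Quotient.mk_surjective _ x
  rw [scalN_mk, hkrN_mk, hkrN_mk, toSlots_scalTens]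
  exact Scales.smul (scales_mulP.comp ((scales_prodY b i).comp scales_cstS rfl) (by ring)) _ _

theorem scales_formsD : Scales (cmap (ι := ι) (scalCh k g)) (cmap (scalCh k g)) 1 (formsD b) := by
  refine (scales_chD b).cmap.add (Scales.sum fun a => ?_)
  have h : LinearMap.mulLeft k (MvPowerSeries.C (xi b a) : Forms k g ι) =
      cmap (LinearMap.mulLeft k (xi b a)) := LinearMap.ext fun ω => C_mul_eq _ ω
  rw [h, coadjoint_eq]
  refine (scales_mulLeft_ι _).cmap.comp (q := 1) (p := 0) (fun ω => ?_) rfl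
  rw [zpow_zero, one_smul, cmap_cad]

variable [DecidableEq ι]

theorem scales_symTens (i n : ℕ) : Scales (cmap (scalCh k g)) (scalSlots k g) i (symTens b i n) := by
  induction i with
  | zero =>
    intro ω
    simp only [Nat.cast_zero, zpow_zero, one_smul]
    exact scal_map _ _
  | succ i ih =>
    refine Scales.sum fun c => ?_
    refine (scales_mulLeft_ι _).comp (ih.comp (scales_pdY (scalCh k g) c) (add_zero _)) ?_
    push_cast
    ring

theorem scales_hkrInv (i : ℕ) : Scales (cmap (scalCh k g)) (scalN i) i (hkrInv b i) := by
  have h1 : Scales (scalSlots k g) (scalN i) 0 ((degenerate k (Ch k g) i).mkQ ∘ₗ ofSlots i) := by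
    intro x
    rw [zpow_zero, one_smul]
    change scalN i (Submodule.Quotient.mk _) = Submodule.Quotient.mk _
    rw [scalN_mk]
    congr 1
    apply toSlots_injective
    rw [toSlots_scalTens, toSlots_ofSlots, toSlots_ofSlots]
    exact scal_map _ _
  have h2 : Scales (scalSlots k g) (scalSlots k g) 0 (barIn (k := k) (g := g) i).toLinearMap :=
    scales_map _
  exact Scales.smul (h1.comp (h2.comp (scales_symTens b i (i + 1)) (zero_add _)) (zero_add _)) _

variable (B : LinearMap.BilinForm k g) (hB : B.Nondegenerate)

theorem scales_homN (s i : ℕ) : Scales (scalN i) (cmap (scalCh k g)) (-i - 2) (homN b B hB s i) := by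
  intro x
  obtain ⟨t, rfl⟩ := Submodule.Quotient.mk_surjective _ x
  rw [scalN_mk, homN_mk, homN_mk, toSlots_scalTens]
  have hQ : ∀ N j l, Scales (scalS k g ι) (scalS k g ι) (-2) (opQ b N j l) := fun N j l =>
    Scales.sum fun c => Scales.sum fun d => (scales_mulS (scalSlots k g) (N c d)).comp
      ((scales_dS (b c) j).comp (scales_dS (b d) l) rfl) rfl
  have hG : Scales (scalS k g ι) (scalS k g ι) (-2) (opG b (bivec b B hB s) (s + 1) i) :=
    Scales.smul (Scales.sum fun j => Scales.sum fun l => Scales.smul (hQ _ _ _) _) _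
  exact Scales.smul (scales_mulP.comp (hG.comp ((scales_prodY b i).comp scales_cstS rfl) rfl)
    (by ring)) _ _

theorem scales_twistedBrylinski :
    Scales (cmap (ι := ι) (scalCh k g)) (cmap (scalCh k g)) (-1) (twistedBrylinski b B hB) := by
  refine (scales_mulS (scalCh k g) (duflo b)⁻¹).comp (Scales.comp (q := -1)
    (Scales.sum fun i => (scales_contr _).cmap.comp (p := 0) ?_ rfl)
    (scales_mulS (scalCh k g) (duflo b)) rfl) rfl
  exact Scales.sum fun j => Scales.smul (scales_pdY (scalCh k g) j) _

end HochschildDegrees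

/-! ### Homological perturbation -/

section Perturbation

variable (k : Type*) [Field k] (M : ℕ → Type*) [∀ i, AddCommGroup (M i)] [∀ i, Module k (M i)]
  (N : Type*) [AddCommGroup N] [Module k N]

/-- Graded data for homological perturbation: the complex `(M, b)` is exact up to its retract
`⨁_i π_i N`, and `δ` is a perturbation of `b` for which `φ` remains a chain map to `(N, d)`. -/
structure PerturbationData where
  /-- The unperturbed differential. -/
  b : ∀ i, M (i + 1) →ₗ[k] M i
  /-- The perturbation. -/
  δ : ∀ i, M i →ₗ[k] M i
  /-- The projection to the retract. -/
  φ : ∀ i, M i →ₗ[k] N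
  /-- The inclusion of the retract. -/
  ψ : ∀ i, N →ₗ[k] M i
  /-- The projection of `N` to its part of weight `i`. -/
  π : ℕ → N →ₗ[k] N
  /-- The differential of `N`. -/
  d : N →ₗ[k] N
  /-- A generalized inverse of `b`. -/
  σ : ∀ i, M i →ₗ[k] M (i + 1)
  b_b : ∀ i x, b i (b (i + 1) x) = 0
  b_δ : ∀ i x, b i (δ (i + 1) x) = -δ i (b i x)
  δ_δ : ∀ i x, δ i (δ i x) = 0
  φ_b : ∀ i x, φ i (b i x) = 0
  φ_δ : ∀ i x, φ i (δ i x) = d (φ i x)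
  φ_ψ : ∀ i x, φ i (ψ i x) = π i x
  π_φ : ∀ i x, π i (φ i x) = φ i x
  ψ_π : ∀ i x, ψ i (π i x) = ψ i x
  b_ψ : ∀ i x, b i (ψ (i + 1) x) = 0
  π_d : ∀ i x, π i (d x) = d (π i x)
  b_σ_b : ∀ i x, b i (σ i (b i x)) = b i x
  exact_zero : ∀ x, φ 0 x = 0 → ∃ y, b 0 y = x
  exact_succ : ∀ i x, b i x = 0 → φ (i + 1) x = 0 → ∃ y, b (i + 1) y = x

namespace PerturbationData

variable {k M N} (P : PerturbationData k M N)

/-- The part of a chain that the contracting homotopy still has to remove: the projection to the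
boundaries along the retract and the image of the homotopy one step below. -/
def residue : ∀ i, M i →ₗ[k] M i
  | 0 => LinearMap.id - P.ψ 0 ∘ₗ P.φ 0
  | i + 1 => LinearMap.id - P.ψ (i + 1) ∘ₗ P.φ (i + 1) -
      (LinearMap.id - P.ψ (i + 1) ∘ₗ P.φ (i + 1)) ∘ₗ P.σ i ∘ₗ residue i ∘ₗ P.b i

/-- The contracting homotopy of `(M, b)` onto the retract. -/
def contraction (i : ℕ) : M i →ₗ[k] M (i + 1) :=
  (LinearMap.id - P.ψ (i + 1) ∘ₗ P.φ (i + 1)) ∘ₗ P.σ i ∘ₗ P.residue i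

theorem contraction_apply (i : ℕ) (x : M i) : P.contraction i x =
    P.σ i (P.residue i x) - P.ψ (i + 1) (P.φ (i + 1) (P.σ i (P.residue i x))) := rfl

theorem residue_zero (x : M 0) : P.residue 0 x = x - P.ψ 0 (P.φ 0 x) := rfl

theorem residue_succ (i : ℕ) (x : M (i + 1)) : P.residue (i + 1) x =
    x - P.ψ (i + 1) (P.φ (i + 1) x) - P.contraction i (P.b i x) := rfl

theorem φ_contraction (i : ℕ) (x : M i) : P.φ (i + 1) (P.contraction i x) = 0 := by
  rw [contraction_apply, map_sub, P.φ_ψ, P.π_φ, sub_self]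

theorem b_contraction_of_mem {i : ℕ} {x : M i} (h : ∃ y, P.b i y = P.residue i x) :
    P.b i (P.contraction i x) = P.residue i x := by
  obtain ⟨y, hy⟩ := h
  rw [contraction_apply, map_sub, P.b_ψ, sub_zero, ← hy, P.b_σ_b]

theorem b_contraction (i : ℕ) (x : M i) : P.b i (P.contraction i x) = P.residue i x := by
  induction i with
  | zero =>
    refine P.b_contraction_of_mem (P.exact_zero _ ?_)
    rw [residue_zero, map_sub, P.φ_ψ, P.π_φ, sub_self]
  | succ i ih =>
    refine P.b_contraction_of_mem (P.exact_succ _ _ ?_ ?_)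
    · rw [residue_succ, map_sub, map_sub, P.b_ψ, ih]
      have h : P.residue i (P.b i x) = P.b i x := by
        cases i with
        | zero => rw [residue_zero, P.φ_b, map_zero, sub_zero]
        | succ i => rw [residue_succ, P.φ_b, P.b_b, map_zero, map_zero, sub_zero, sub_zero]
      rw [h, sub_zero, sub_self]
    · rw [residue_succ, map_sub, map_sub, P.φ_ψ, P.π_φ, P.φ_contraction, sub_self, sub_zero]

/-- The perturbed inclusion `∑_n (-h δ)^n ψ`, where `h` is the contracting homotopy. -/
def incl : ∀ i, N →ₗ[k] M i
  | 0 => P.ψ 0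
  | i + 1 => P.ψ (i + 1) - P.contraction i ∘ₗ P.δ i ∘ₗ incl i

theorem incl_succ (i : ℕ) (ω : N) :
    P.incl (i + 1) ω = P.ψ (i + 1) ω - P.contraction i (P.δ i (P.incl i ω)) := rfl

theorem φ_incl (i : ℕ) (ω : N) : P.φ i (P.incl i ω) = P.π i ω := by
  cases i with
  | zero => exact P.φ_ψ 0 ω
  | succ i => rw [incl_succ, map_sub, P.φ_ψ, P.φ_contraction, sub_zero]

/-- The perturbed inclusion is a chain map. -/
theorem b_incl (i : ℕ) (ω : N) :
    P.b i (P.incl (i + 1) ω) + P.δ i (P.incl i ω) = P.incl i (P.d ω) := by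
  have hφ : ∀ i, P.ψ i (P.φ i (P.δ i (P.incl i ω))) = P.ψ i (P.d ω) := fun i => by
    rw [P.φ_δ, P.φ_incl, ← P.π_d, P.ψ_π]
  induction i with
  | zero =>
    rw [incl_succ, map_sub, P.b_ψ, P.b_contraction, residue_zero, hφ, zero_sub, neg_sub,
      sub_add_cancel]
    rfl
  | succ i ih =>
    have h := congrArg (P.δ i) ih
    rw [map_add, P.δ_δ, add_zero] at h
    rw [incl_succ _ (i + 1), map_sub, P.b_ψ, P.b_contraction, residue_succ, hφ, P.b_δ, h, map_neg,
      incl_succ _ i (P.d ω)]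
    abel

/-- The homotopy `∑_n (-h δ)^n h` of the perturbed complex. Only the components `c j` with `j < i`
enter in degree `i`. -/
def htpy : ∀ i, ((i : ℕ) → M i) →ₗ[k] M i
  | 0 => 0
  | i + 1 => P.contraction i ∘ₗ (LinearMap.proj i - P.δ i ∘ₗ htpy i)

theorem htpy_succ (i : ℕ) (c : (i : ℕ) → M i) :
    P.htpy (i + 1) c = P.contraction i (c i - P.δ i (P.htpy i c)) := rfl

theorem φ_htpy (i : ℕ) (c : (i : ℕ) → M i) : P.φ i (P.htpy i c) = 0 := by
  cases i with
  | zero => exact map_zero _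
  | succ i => rw [htpy_succ, P.φ_contraction]

/-- The homotopy identity of the perturbed complex, for a chain `c`, its boundary `c'` and its image
`ω` in `N`. -/
theorem b_htpy {c c' : (i : ℕ) → M i} {ω : N} (hc : ∀ i, c' i = P.b i (c (i + 1)) + P.δ i (c i))
    (hω : ∀ i, P.π i ω = P.φ i (c i)) (i : ℕ) :
    P.b i (P.htpy (i + 1) c) + P.δ i (P.htpy i c) + P.htpy i c' = c i - P.incl i ω := by
  have hφ : ∀ i, P.ψ i (P.φ i (c i - P.δ i (P.htpy i c))) = P.ψ i ω := fun i => by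
    rw [map_sub, P.φ_δ, P.φ_htpy, map_zero, sub_zero, ← hω, P.ψ_π]
  induction i with
  | zero =>
    rw [htpy_succ, P.b_contraction, residue_zero, hφ]
    simp only [htpy, incl, LinearMap.zero_apply, map_zero]
    abel
  | succ i ih =>
    have h := congrArg (P.δ i) ih
    rw [map_add, map_add, P.δ_δ, add_zero, map_sub, ← eq_sub_iff_add_eq] at h
    have e : P.b i (c (i + 1) - P.δ (i + 1) (P.htpy (i + 1) c)) =
        c' i - P.δ i (P.htpy i c') - P.δ i (P.incl i ω) := by
      rw [map_sub, P.b_δ, h, hc]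
      abel
    rw [htpy_succ _ (i + 1), P.b_contraction, residue_succ, hφ, e, htpy_succ _ i c', incl_succ,
      map_sub (P.contraction i) _ (P.δ i (P.incl i ω))]
    abel

variable (G : ∀ i, ℤ → Submodule k (M i)) (G' : ℤ → Submodule k N)

/-- The data are compatible with gradings `G` and `G'`. -/
structure IsGraded : Prop where
  b : ∀ i, HasDegree (G (i + 1)) (G i) 0 (P.b i)
  δ : ∀ i, HasDegree (G i) (G i) 1 (P.δ i)
  φ : ∀ i, HasDegree (G i) G' (-i) (P.φ i)
  ψ : ∀ i, HasDegree G' (G i) i (P.ψ i)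
  σ : ∀ i, HasDegree (G i) (G (i + 1)) 0 (P.σ i)

variable {P G G'} (hP : P.IsGraded G G')
include hP

theorem IsGraded.sub_ψ_φ (i : ℕ) {m : ℤ} {x : M i} (hx : x ∈ G i m) : x - P.ψ i (P.φ i x) ∈ G i m := by
  have h := hP.ψ i _ _ (hP.φ i m x hx)
  rw [neg_add_cancel_right] at h
  exact sub_mem hx h

theorem IsGraded.contraction_of_residue {i : ℕ} {m : ℤ} {x : M i} (h : P.residue i x ∈ G i m) :
    P.contraction i x ∈ G (i + 1) m := by
  have h' := hP.σ i m _ h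
  rw [add_zero] at h'
  exact hP.sub_ψ_φ (i + 1) h'

theorem IsGraded.residue (i : ℕ) {m : ℤ} {x : M i} (hx : x ∈ G i m) : P.residue i x ∈ G i m := by
  induction i with
  | zero => exact hP.sub_ψ_φ 0 hx
  | succ i ih =>
    have h := hP.b i m x hx
    rw [add_zero] at h
    exact sub_mem (hP.sub_ψ_φ (i + 1) hx) (hP.contraction_of_residue (ih h))

theorem IsGraded.contraction (i : ℕ) {m : ℤ} {x : M i} (hx : x ∈ G i m) :
    P.contraction i x ∈ G (i + 1) m := hP.contraction_of_residue (hP.residue i hx)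

theorem IsGraded.incl (i : ℕ) {m : ℤ} {ω : N} (hω : ω ∈ G' m) : P.incl i ω ∈ G i (m + i) := by
  induction i with
  | zero => exact hP.ψ 0 m ω hω
  | succ i ih =>
    refine sub_mem (hP.ψ (i + 1) m ω hω) (hP.contraction i ?_)
    rw [Nat.cast_succ, ← add_assoc]
    exact hP.δ i _ _ ih

theorem IsGraded.htpy (i : ℕ) {m : ℤ} {c : (i : ℕ) → M i} (hc : ∀ i, c i ∈ G i (m + i)) :
    P.htpy i c ∈ G i (m - 1 + i) := by
  induction i with
  | zero => exact zero_mem _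
  | succ i ih =>
    have e : m - 1 + ((i + 1 : ℕ) : ℤ) = m + i := by push_cast; ring
    rw [e]
    refine hP.contraction i (sub_mem (hc i) ?_)
    have h := hP.δ i _ _ ih
    rwa [show m - 1 + (i : ℤ) + 1 = m + i by ring] at h

end PerturbationData

end Perturbation

/-! ### Homotopy equivalences -/

section HomotopyEquivalence

variable {k : Type*} [Field k] {M N : Type*} [AddCommGroup M] [Module k M]
  [AddCommGroup N] [Module k N] {gM : ℤ → Submodule k M} {dM : M →ₗ[k] M}
  {gN : ℤ → Submodule k N} {dN : N →ₗ[k] N} {f : M →ₗ[k] N} {e : N →ₗ[k] M}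

theorem ChainHomotopic.exists_apply {f' : M →ₗ[k] N} (h : ChainHomotopic gM dM gN dN 0 f f') :
    ∃ h : M →ₗ[k] N, HasDegree gM gN (-1) h ∧ ∀ x, f x - f' x = dN (h x) + h (dM x) := by
  obtain ⟨h, hdeg, hh⟩ := h.homotopy
  refine ⟨h, hdeg, fun x => ?_⟩
  have := LinearMap.congr_fun hh x
  rw [show (0 - 1 : ℤ).negOnePow = -1 from rfl, Units.val_neg, Units.val_one, neg_one_smul,
    sub_neg_eq_add] at this
  exact this

theorem ChainHomotopic.of_apply {f' h : M →ₗ[k] N} (hf : IsChainMap gM dM gN dN 0 f)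
    (hf' : IsChainMap gM dM gN dN 0 f') (hdeg : HasDegree gM gN (-1) h)
    (hh : ∀ x, f x - f' x = dN (h x) + h (dM x)) : ChainHomotopic gM dM gN dN 0 f f' := by
  refine ⟨hf, hf', h, hdeg, LinearMap.ext fun x => ?_⟩
  rw [show (0 - 1 : ℤ).negOnePow = -1 from rfl, Units.val_neg, Units.val_one, neg_one_smul,
    sub_neg_eq_add]
  exact hh x

theorem isChainMap_zero_iff : IsChainMap gM dM gN dN 0 f ↔
    HasDegree gM gN 0 f ∧ ∀ x, dN (f x) = f (dM x) := by
  refine ⟨fun h => ⟨h.degree, fun x => ?_⟩, fun h => ⟨h.1, LinearMap.ext fun x => ?_⟩⟩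
  · have := LinearMap.congr_fun h.comm x
    rwa [Int.negOnePow_zero, Units.val_one, one_smul] at this
  · rw [Int.negOnePow_zero, Units.val_one, one_smul]
    exact h.2 x

theorem isChainMap_id : IsChainMap gM dM gM dM 0 LinearMap.id :=
  isChainMap_zero_iff.2 ⟨fun m x hx => by rwa [add_zero], fun _ => rfl⟩

theorem IsChainMap.comp {e : N →ₗ[k] M} (he : IsChainMap gN dN gM dM 0 e)
    (hf : IsChainMap gM dM gN dN 0 f) : IsChainMap gM dM gM dM 0 (e ∘ₗ f) := by
  rw [isChainMap_zero_iff] at *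
  refine ⟨fun m x hx => ?_, fun x => ?_⟩
  · have := he.1 _ _ (hf.1 m x hx)
    rwa [add_zero] at this
  · rw [LinearMap.comp_apply, LinearMap.comp_apply, he.2, hf.2]

theorem IsHomotopyInverse.isQuasiIso (hM : IsDifferential gM dM) (hN : IsDifferential gN dN)
    (hf : IsChainMap gM dM gN dN 0 f) (he : IsHomotopyInverse gM dM gN dN f e) :
    IsQuasiIso gM dM gN dN f := by
  obtain ⟨hedeg, hecomm⟩ := isChainMap_zero_iff.1 he.chain
  obtain ⟨h, hdeg, hh⟩ := he.left.exists_apply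
  obtain ⟨h', hdeg', hh'⟩ := he.right.exists_apply
  refine ⟨hM, hN, hf, ?_, ?_⟩
  · rintro m x hx hdx ⟨y, hy, hxy⟩
    refine ⟨e y - h x, sub_mem ?_ (hdeg m x hx), ?_⟩
    · have := hedeg _ y hy
      rwa [add_zero] at this
    · have := hh x
      rw [LinearMap.comp_apply, LinearMap.id_apply, hxy, hdx, map_zero, add_zero, ← hecomm] at this
      rw [map_sub, ← this, sub_sub_cancel]
  · intro m y hy hdy
    refine ⟨e y, ?_, ?_, -h' y, neg_mem (hdeg' m y hy), ?_⟩
    · have := hedeg m y hy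
      rwa [add_zero] at this
    · rw [hecomm, hdy, map_zero]
    · have := hh' y
      rw [LinearMap.comp_apply, LinearMap.id_apply, hdy, map_zero, add_zero] at this
      rw [map_neg, ← this, neg_sub]

/-- If `D` differs from `T ∘ f` by the commutator of `H` with the differentials, where `T` anticommutes
with the differential, then `D ∘ e` is homotopic to `T` for every homotopy inverse `e` of `f`. Here
`D` is not assumed to commute with the differentials; this follows. -/
theorem IsHomotopyInverse.chainHomotopic {D H : M →ₗ[k] N} {T : N →ₗ[k] N}
    (he : IsHomotopyInverse gM dM gN dN f e)
    (hd : HasDegree gN gN 1 dN) (hdM : HasDegree gM gM 1 dM) (hf : HasDegree gM gN 0 f)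
    (hT : HasDegree gN gN (-1) T) (hdT : ∀ y, dN (T y) = -T (dN y)) (hdd : ∀ y, dN (dN y) = 0)
    (hH : HasDegree gM gN (-2) H) (hD : ∀ x, D x - T (f x) = dN (H x) - H (dM x)) :
    ChainHomotopic gN dN gN dN (-1) (D ∘ₗ e) T := by
  obtain ⟨hedeg, hecomm⟩ := isChainMap_zero_iff.1 he.chain
  obtain ⟨h, hdeg, hh⟩ := he.right.exists_apply
  have hD' : ∀ x, D x = T (f x) + (dN (H x) - H (dM x)) := fun x => by
    rw [← hD, add_sub_cancel]
  have hT' : IsChainMap gN dN gN dN (-1) T := by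
    refine ⟨hT, LinearMap.ext fun y => ?_⟩
    rw [show (-1 : ℤ).negOnePow = -1 from rfl, Units.val_neg, Units.val_one, neg_one_smul]
    exact hdT y
  refine ⟨⟨fun m y hy => ?_, LinearMap.ext fun y => ?_⟩, hT', H ∘ₗ e - T ∘ₗ h, fun m y hy => ?_,
    LinearMap.ext fun y => ?_⟩
  · have h0 := hedeg m y hy
    rw [LinearMap.comp_apply, hD']
    have h1 := hT _ _ (hf _ _ h0)
    have h2 := hd _ _ (hH _ _ h0)
    have h3 := hH _ _ (hdM _ _ h0)
    rw [add_zero, add_zero] at h1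
    rw [show m + 0 + -2 + 1 = m + -1 by ring] at h2
    rw [show m + 0 + 1 + -2 = m + -1 by ring] at h3
    exact add_mem h1 (sub_mem h2 h3)
  · rw [show (-1 : ℤ).negOnePow = -1 from rfl, Units.val_neg, Units.val_one, neg_one_smul]
    have hfe : ∀ y, f (e y) = y + (dN (h y) + h (dN y)) := fun y => by
      rw [← hh, LinearMap.id_apply, LinearMap.comp_apply, add_sub_cancel]
    change dN (D (e y)) = -D (e (dN y))
    simp only [hD', hfe, map_add, map_sub, hdT, hdd, hecomm, map_zero]
    simp only [← hecomm]
    abel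
  · have h0 := hH _ _ (hedeg m y hy)
    have h1 := hT _ _ (hdeg m y hy)
    rw [show m + 0 + -2 = m + (-1 - 1) by ring] at h0
    rw [show m + -1 + -1 = m + (-1 - 1) by ring] at h1
    exact sub_mem h0 h1
  · rw [show (-1 - 1 : ℤ).negOnePow = 1 from rfl, Units.val_one, one_smul]
    change D (e y) - T y = dN (H (e y) - T (h y)) - (H (e (dN y)) - T (h (dN y)))
    have hfe : f (e y) = y + (dN (h y) + h (dN y)) := by
      rw [← hh, LinearMap.id_apply, LinearMap.comp_apply, add_sub_cancel]
    rw [hD', hfe, map_add, map_add, map_sub, hdT, hecomm]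
    abel

end HomotopyEquivalence

/-! ### The homotopy inverse of the Hochschild–Kostant–Rosenberg map -/

section Inverse

variable {k : Type*} [Field k] [CharZero k] {g : Type*} [LieRing g] [LieAlgebra k g]
  {ι : Type*} [Fintype ι] [DecidableEq ι] (b : Module.Basis ι k g)

/-- The square of the differential of forms vanishes, because that of the internal differential of chains
does and `Φ` is surjective in every polynomial degree. -/
theorem formsD_formsD (ω : Forms k g ι) : formsD b (formsD b ω) = 0 := by
  refine ext_homog (k := k) fun m => ?_
  rw [homog_formsD, homog_formsD, ← hkrN_hkrInv, formsD_hkrN, map_smul, formsD_hkrN, nD_nD, map_zero,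
    smul_zero, smul_zero, map_zero]

/-- The symmetric tensor of rank `i` of `ω` depends only on the component of `ω` of degree `i`. -/
theorem symTens_homog (i n : ℕ) (ω : Forms k g ι) :
    symTens b i n (homog (k := k) i ω) = symTens b i n ω := by
  induction i generalizing ω with
  | zero =>
    refine congrArg (slot n) ?_
    change MvPowerSeries.coeff 0 (homog (k := k) 0 ω) = MvPowerSeries.coeff 0 ω
    rw [coeff_homog, if_pos (by simp)]
  | succ i ih =>
    rw [symTens_succ, symTens_succ]
    refine Finset.sum_congr rfl fun c _ => ?_
    have h : partialY k g c (homog (k := k) (i + 1) ω) = homog (k := k) i (partialY k g c ω) :=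
      (homog_pdY i c ω).symm
    rw [h, ih]

theorem exists_nB_section (i : ℕ) : ∃ σ : NTens k (Ch k g) i →ₗ[k] NTens k (Ch k g) (i + 1),
    HasDegree (ntensDeg k g i) (ntensDeg k g (i + 1)) 0 σ ∧ ∀ x, nB i (σ (nB i x)) = nB i x :=
  exists_graded_section (isScaling_ntensDeg i) (iSup_ntensDeg (i + 1)) (iSup_ntensDeg i)
    ((scales_nB i).hasDegree (isScaling_ntensDeg _) (isScaling_ntensDeg _))

/-- The Hochschild complex of `Ch(g)` as a perturbation, by the internal differential, of the
Hochschild complex of the underlying graded algebra. -/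
def hkrData : PerturbationData k (fun i => NTens k (Ch k g) i) (Forms k g ι) where
  b := nB
  δ i := (-1 : k) ^ i • nD b i
  φ := hkrN b
  ψ := hkrInv b
  π := homog (k := k)
  d := formsD b
  σ i := (exists_nB_section i).choose
  b_b := nB_nB
  b_δ i x := by
    rw [LinearMap.smul_apply, LinearMap.smul_apply, map_smul, nB_nD, pow_succ, mul_neg_one, neg_smul]
  δ_δ i x := by
    rw [LinearMap.smul_apply, LinearMap.smul_apply, map_smul, nD_nD, smul_zero, smul_zero]
  φ_b := hkrN_nB b
  φ_δ i x := by rw [LinearMap.smul_apply, map_smul, formsD_hkrN]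
  φ_ψ := hkrN_hkrInv b
  π_φ i x := homog_of_isHomog (isHomog_hkrN b i x)
  ψ_π i ω := by rw [hkrInv_apply, hkrInv_apply, symTens_homog]
  b_ψ := nB_hkrInv b
  π_d := homog_formsD b
  b_σ_b i x := (exists_nB_section i).choose_spec.2 x
  exact_zero := nB_exact_zero b
  exact_succ := nB_exact_succ b

theorem hkrData_isGraded : (hkrData b).IsGraded (ntensDeg k g) (formsDeg k g ι) where
  b i := (scales_nB i).hasDegree (isScaling_ntensDeg _) (isScaling_ntensDeg _)
  δ i := ((scales_nD b i).smul _).hasDegree (isScaling_ntensDeg _) (isScaling_ntensDeg _)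
  φ i := (scales_hkrN b i).hasDegree (isScaling_ntensDeg _) isScaling_formsDeg
  ψ i := (scales_hkrInv b i).hasDegree isScaling_formsDeg (isScaling_ntensDeg _)
  σ i := (exists_nB_section i).choose_spec.1

omit [CharZero k] in
theorem mem_chainDeg {m : ℤ} {c : Chains k (Ch k g)} :
    c ∈ chainDeg (chDeg k g) m ↔ ∀ i : ℕ, c i ∈ ntensDeg k g i (m + i) := by
  simp only [chainDeg, Submodule.mem_pi, Set.mem_univ, true_imp_iff]
  rfl

omit [CharZero k] in
theorem mem_formsDeg_of_homog {m : ℤ} {ω : Forms k g ι}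
    (h : ∀ n, homog (k := k) n ω ∈ formsDeg k g ι m) : ω ∈ formsDeg k g ι m := fun n => by
  have h' := h n.degree n
  rwa [coeff_homog, if_pos rfl] at h'

theorem hasDegree_hochD : HasDegree (chainDeg (chDeg k g)) (chainDeg (chDeg k g)) 1 (hochD b) := by
  intro m c hc
  rw [mem_chainDeg] at hc ⊢
  intro i
  have h1 := (hkrData_isGraded b).b i _ _ (hc (i + 1))
  have h2 := (hkrData_isGraded b).δ i _ _ (hc i)
  rw [show m + ((i + 1 : ℕ) : ℤ) + 0 = m + 1 + i by push_cast; ring] at h1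
  rw [show m + (i : ℤ) + 1 = m + 1 + i by ring] at h2
  exact add_mem h1 h2

theorem hasDegree_hkr : HasDegree (chainDeg (chDeg k g)) (formsDeg k g ι) 0 (hkr b) := by
  intro m c hc
  refine mem_formsDeg_of_homog fun n => ?_
  rw [homog_hkr]
  have h := (hkrData_isGraded b).φ n _ _ (mem_chainDeg.1 hc n)
  rwa [show m + (n : ℤ) + -n = m + 0 by ring] at h

theorem hasDegree_formsD : HasDegree (formsDeg k g ι) (formsDeg k g ι) 1 (formsD b) :=
  (scales_formsD b).hasDegree isScaling_formsDeg isScaling_formsDeg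

theorem hasDegree_homotopyH (B : LinearMap.BilinForm k g) (hB : B.Nondegenerate) :
    HasDegree (chainDeg (chDeg k g)) (formsDeg k g ι) (-2) (homotopyH b B hB) := by
  intro m c hc
  refine mem_formsDeg_of_homog fun n => ?_
  rw [homog_homotopyH]
  refine sum_mem fun p _ => ?_
  have h := (scales_homN b B hB p.1 p.2).hasDegree (isScaling_ntensDeg _) isScaling_formsDeg _ _
    (mem_chainDeg.1 hc p.2)
  rwa [show m + (p.2 : ℤ) + (-p.2 - 2) = m + -2 by ring] at h

theorem isChainMap_hkr :
    IsChainMap (chainDeg (chDeg k g)) (hochD b) (formsDeg k g ι) (formsD b) 0 (hkr b) :=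
  isChainMap_zero_iff.2 ⟨hasDegree_hkr b, formsD_hkr b⟩

/-- The homotopy inverse of the Hochschild–Kostant–Rosenberg map, obtained from symmetric tensors by
perturbation. -/
def hkrInverse : Forms k g ι →ₗ[k] Chains k (Ch k g) := LinearMap.pi (hkrData b).incl

theorem hkr_hkrInverse (ω : Forms k g ι) : hkr b (hkrInverse b ω) = ω :=
  ext_homog (k := k) fun m => (homog_hkr b m _).trans ((hkrData b).φ_incl m ω)

theorem isHomotopyInverse_hkrInverse : IsHomotopyInverse (chainDeg (chDeg k g)) (hochD b)
    (formsDeg k g ι) (formsD b) (hkr b) (hkrInverse b) := by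
  have hG := hkrData_isGraded b
  have he : IsChainMap (formsDeg k g ι) (formsD b) (chainDeg (chDeg k g)) (hochD b) 0
      (hkrInverse b) := by
    refine isChainMap_zero_iff.2 ⟨fun m ω hω => mem_chainDeg.2 fun i => ?_, fun ω => funext fun i => ?_⟩
    · rw [add_zero]
      exact hG.incl i hω
    · exact (hkrData b).b_incl i ω
  refine ⟨he, ChainHomotopic.of_apply (h := -LinearMap.pi (hkrData b).htpy)
    (he.comp (isChainMap_hkr b)) isChainMap_id ?_ ?_,
    ChainHomotopic.of_apply (h := 0) ((isChainMap_hkr b).comp he) isChainMap_id ?_ ?_⟩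
  · exact fun m c hc => neg_mem (mem_chainDeg.2 fun i => hG.htpy i (mem_chainDeg.1 hc))
  · intro c
    have h : hochD b (LinearMap.pi (hkrData b).htpy c) + LinearMap.pi (hkrData b).htpy (hochD b c) =
        c - hkrInverse b (hkr b c) := funext fun i =>
      (hkrData b).b_htpy (c := c) (c' := hochD b c) (ω := hkr b c) (fun i => rfl)
        (fun i => homog_hkr b i c) i
    rw [LinearMap.neg_apply, LinearMap.neg_apply, map_neg, ← neg_add, h, neg_sub]
    rfl
  · exact fun m ω _ => zero_mem _
  · intro ω
    rw [LinearMap.comp_apply, hkr_hkrInverse, LinearMap.id_apply, sub_self, LinearMap.zero_apply,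
      LinearMap.zero_apply, map_zero, add_zero]

end Inverse

end

end CEHochschild

open CEHochschild in
theorem mainTheorem1 {k : Type*} [Field k] [CharZero k]
    {g : Type*} [LieRing g] [LieAlgebra k g]
    {ι : Type*} [Fintype ι] [DecidableEq ι] (b : Module.Basis ι k g)
    (B : LinearMap.BilinForm k g) (hB : B.Nondegenerate) (hsymm : B.IsSymm)
    (hinv : ∀ x y z : g, B ⁅x, y⁆ z = B x ⁅y, z⁆) :
    IsQuasiIso (chainDeg (chDeg k g)) (hochD b) (formsDeg k g ι) (formsD b) (hkr b) ∧
    (∃ e : Forms k g ι →ₗ[k] Chains k (Ch k g),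
      IsHomotopyInverse (chainDeg (chDeg k g)) (hochD b) (formsDeg k g ι) (formsD b) (hkr b) e) ∧
    ∀ e : Forms k g ι →ₗ[k] Chains k (Ch k g),
      IsHomotopyInverse (chainDeg (chDeg k g)) (hochD b) (formsDeg k g ι) (formsD b) (hkr b) e →
      ChainHomotopic (formsDeg k g ι) (formsD b) (formsDeg k g ι) (formsD b) (-1)
        (hkr b ∘ₗ hochD0 b B hB ∘ₗ e) (twistedBrylinski b B hB) := by
  have he := isHomotopyInverse_hkrInverse b
  refine ⟨he.isQuasiIso ⟨hasDegree_hochD b, LinearMap.ext (hochD_hochD b)⟩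
    ⟨hasDegree_formsD b, LinearMap.ext (formsD_formsD b)⟩ (isChainMap_hkr b), ⟨_, he⟩,
    fun e he => ?_⟩
  exact he.chainHomotopic (D := hkr b ∘ₗ hochD0 b B hB) (hasDegree_formsD b) (hasDegree_hochD b)
    (hasDegree_hkr b) ((scales_twistedBrylinski b B hB).hasDegree isScaling_formsDeg isScaling_formsDeg)
    (formsD_twistedBrylinski b B hB hsymm hinv) (formsD_formsD b)
    (hasDegree_homotopyH b B hB) (hkr_hochD0_sub b B hB hsymm hinv)
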